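/- **Setting.** Let $V$ be a complete discrete valuation ring of characteristic $0$ with perfect residue field of characteristic $p>0$, $K=\mathrm{Frac}(V)$, and let $F_V$ be an endomorphism of $V$ with $F_V(x)\equiv x^p \bmod pV$. Let $U=\mathrm{Spec}(A)$ be a smooth affine $V$-scheme, $A^\dagger$ the weak completion of $A$, $A_K=K\otimes_V A$, $A_K^\dagger=K\otimes_V A^\dagger$, and let $\sigma\colon A^\dagger\to A^\dagger$ be an $F_V$-linear ring endomorphism with $\sigma(x)\equiv x^p \bmod pA^\dagger$, extended to $A^\dagger_K$. An object of the category $\mathrm{Fil}\text{-}F\text{-}\mathrm{MIC}(U)=\mathrm{Fil}\text{-}F\text{-}\mathrm{MIC}(U,\sigma)$ is a tuple $H=(H_{\mathrm{dR}},H_{\mathrm{rig}},c,\Phi,\nabla,\mathrm{Fil}^\bullet)$, where $H_{\mathrm{dR}}$ is a finitely generated $A_K$-module, $H_{\mathrm{rig}}$ is a finitely generated $A_K^\dagger$-module, $c\colon A_K^\dagger\otimes_{A_K}H_{\mathrm{dR}}\cong H_{\mathrm{rig}}$ is an $A_K^\dagger$-linear isomorphism, $\Phi\colon\sigma^*H_{\mathrm{rig}}\cong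 H_{\mathrm{rig}}$ is an $A_K^\dagger$-linear isomorphism (equivalently a $\sigma$-linear endomorphism of $H_{\mathrm{rig}}$ with bijective linearization), $\nabla\colon H_{\mathrm{dR}}\to\Omega^1_{A_K/K}\otimes H_{\mathrm{dR}}$ is an integrable connection, and $\mathrm{Fil}^\bullet$ is a finite descending filtration of $H_{\mathrm{dR}}$ with locally free graded pieces, such that $\nabla(\mathrm{Fil}^i)\subset\Omega^1_{A_K/K}\otimes\mathrm{Fil}^{i-1}$ and such that $\Phi$ is horizontal for the connection $\nabla_{\mathrm{rig}}$ on $H_{\mathrm{rig}}$ (with values in continuous differentials) induced by $\nabla$ and $c$. Morphisms are pairs of linear maps compatible with all these data. A sequence is exact if the sequences of the $\mathrm{Fil}^iH_{\mathrm{dR}}$ are exact for all $i$. For $m\ge 1$, $\mathrm{Ext}^m(H,H')$ is the group of Yoneda classes of exact sequences $0\to H'\to M_{m-1}\to\cdots\to M_0\to H\to 0$, with the Baer sum. For $n\in\mathbb Z$, the Tate object is $\mathscr O_U(n)=(A_K,A_K^\dagger,c,p^{-n}\sigma,d,\mathrm{Fil}^\bullet)$ with $c$ the canonical isomorphism, $\mathrm{Fil}^{-n}A_K=A_K$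 and $\mathrm{Fil}^{-n+1}A_K=0$. Put $\mathscr O_U=\mathscr O_U(0)$ and $H(n)=H\otimes\mathscr O_U(n)$. For $f\in A^\times$ put $$\log^{(\sigma)}(f)=p^{-1}\log\frac{f^p}{\sigma(f)}=-p^{-1}\sum_{n\ge1}\frac{(1-f^p/\sigma(f))^n}{n}\in A^\dagger .$$ The log object $\mathscr Log(f)$ has $\mathscr Log(f)_{\mathrm{dR}}=A_Ke_{-2}\oplus A_Ke_0$, $\mathscr Log(f)_{\mathrm{rig}}=A_K^\dagger e_{-2}\oplus A_K^\dagger e_0$, the natural $c$, $\Phi(e_{-2})=p^{-1}e_{-2}$, $\Phi(e_0)=e_0-\log^{(\sigma)}(f)e_{-2}$, $\nabla(e_{-2})=0$, $\nabla(e_0)=\frac{df}{f}\otimes e_{-2}$, and $\mathrm{Fil}^i$ is everything for $i\le-1$, $A_Ke_0$ for $i=0$ and $0$ for $i>0$. Let $[f]\in\mathrm{Ext}^1(\mathscr O_U,\mathscr O_U(1))$ be the class of $0\to\mathscr O_U(1)\to\mathscr Log(f)\to\mathscr O_U\to0$, where the maps are given by $1\mapsto e_{-2}$ and by $e_0\mapsto1$,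 $e_{-2}\mapsto 0$. For $h_0,\dots,h_n\in A^\times$, the class $[h_0]\cup\cdots\cup[h_n]\in\mathrm{Ext}^{n+1}(\mathscr O_U,\mathscr O_U(n+1))$ is that of the exact sequence $$0\to\mathscr O_U(n+1)\to\mathscr Log(h_n)(n)\to\cdots\to\mathscr Log(h_1)(1)\to\mathscr Log(h_0)\to\mathscr O_U\to0$$ obtained by splicing the twists $0\to\mathscr O_U(i+1)\to\mathscr Log(h_i)(i)\to\mathscr O_U(i)\to0$. For a commutative ring $R$, $K^M_r(R)$ is the quotient of $(R^\times)^{\otimes r}$ by the subgroup generated by the tensors $a_1\otimes\cdots\otimes b\otimes\cdots\otimes(-b)\otimes\cdots\otimes a_r$ and, when $1-b\in R^\times$, $a_1\otimes\cdots\otimes b\otimes\cdots\otimes(1-b)\otimes\cdots\otimes a_r$; the class of $a_1\otimes\cdots\otimes a_r$ is written $\{a_1,\dots,a_r\}$. **Proposition.** One has $[f]\cup[f]=0$ in $\mathrm{Ext}^2(\mathscr O_U,\mathscr O_U(2))$ for every $f\in A^\times$, and $[f]\cup[1-f]=0$ for every $f\in A^\times$ such that $1-f\in A^\times$. Moreover,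 for every $n\ge0$, there is a well-defined group homomorphism $$K^M_{n+1}(A)\longrightarrow\mathrm{Ext}^{n+1}(\mathscr O_U,\mathscr O_U(n+1)),\qquad \{h_0,\dots,h_n\}\longmapsto[h_0]\cup\cdots\cup[h_n].$$ -/

import Mathlib

open scoped TensorProduct
open CategoryTheory

universe u

noncomputable section

namespace FilteredFIsocrystal

/-! ### Weak completion -/

/-- A power series `∑ a_α T^α` over `V` is overconvergent if the `p`-adic valuation of `a_α` grows
at least linearly in `|α|`: for some constant `c`, one has `p ^ j ∣ a_α` as soon as `|α| > c * j`.
For a complete discrete valuation ring `V` of mixed characteristic `(0, p)` this says exactly that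
`|a_α| r ^ |α| → 0` for some real number `r > 1`. -/
def IsOverconvergent (p : ℕ) {V : Type u} [CommRing V] {m : ℕ}
    (F : MvPowerSeries (Fin m) V) : Prop :=
  ∃ c : ℕ, ∀ (j : ℕ) (α : Fin m →₀ ℕ), c * j < α.degree → (p : V) ^ j ∣ MvPowerSeries.coeff α F

section overconvergent

variable (p : ℕ) {V : Type u} [CommRing V] {m : ℕ}

/-- Growth with defect `s`; auxiliary for powers. -/
theorem growth_mul {c s t : ℕ} {F G : MvPowerSeries (Fin m) V}
    (hF : ∀ (j : ℕ) (α : Fin m →₀ ℕ), c * (j + s) < α.degree →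
      (p : V) ^ j ∣ MvPowerSeries.coeff α F)
    (hG : ∀ (j : ℕ) (α : Fin m →₀ ℕ), c * (j + t) < α.degree →
      (p : V) ^ j ∣ MvPowerSeries.coeff α G) (j : ℕ) (α : Fin m →₀ ℕ)
    (h : c * (j + (s + t + 1)) < α.degree) : (p : V) ^ j ∣ MvPowerSeries.coeff α (F * G) := by
  classical
  rw [MvPowerSeries.coeff_mul]
  refine Finset.dvd_sum fun x hx => ?_
  rw [Finset.HasAntidiagonal.mem_antidiagonal] at hx
  rw [← hx, map_add] at h
  obtain ⟨i, hij, hi, hmax⟩ : ∃ i ≤ j, (p : V) ^ i ∣ MvPowerSeries.coeff x.1 F ∧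
      (i = j ∨ x.1.degree ≤ c * (i + 1 + s)) := by
    by_contra hcon
    push Not at hcon
    have key : ∀ i ≤ j, (p : V) ^ i ∣ MvPowerSeries.coeff x.1 F := by
      intro i
      induction i with
      | zero => intro _; simp
      | succ i ih =>
        intro hi
        have := (hcon i (by omega) (ih (by omega))).2
        exact hF _ _ this
    exact (hcon j le_rfl (key j le_rfl)).1 rfl
  rcases hmax with rfl | hmax
  · exact hi.mul_right _
  · have h2 : (p : V) ^ (j - i) ∣ MvPowerSeries.coeff x.2 G := by
      apply hG
      have e : c * (j + (s + t + 1)) = c * (i + 1 + s) + c * (j - i + t) := by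
        rw [← mul_add]; congr 1; omega
      omega
    have := mul_dvd_mul hi h2
    rwa [← pow_add, Nat.add_sub_cancel' hij] at this

theorem IsOverconvergent.mono {c c' : ℕ} (h : c ≤ c') {F : MvPowerSeries (Fin m) V}
    (hF : ∀ (j : ℕ) (α : Fin m →₀ ℕ), c * j < α.degree → (p : V) ^ j ∣ MvPowerSeries.coeff α F)
    (j : ℕ) (α : Fin m →₀ ℕ) (hj : c' * j < α.degree) : (p : V) ^ j ∣ MvPowerSeries.coeff α F :=
  hF j α ((Nat.mul_le_mul_right j h).trans_lt hj)

theorem growth_pow {c : ℕ} {F : MvPowerSeries (Fin m) V}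
    (hF : ∀ (j : ℕ) (α : Fin m →₀ ℕ), c * j < α.degree → (p : V) ^ j ∣ MvPowerSeries.coeff α F)
    (n : ℕ) (j : ℕ) (α : Fin m →₀ ℕ) (h : c * (j + n) < α.degree) :
    (p : V) ^ j ∣ MvPowerSeries.coeff α (F ^ (n + 1)) := by
  induction n generalizing j α with
  | zero => simpa using hF j α (by simpa using h)
  | succ n ih =>
    rw [pow_succ]
    exact growth_mul p (s := n) (t := 0) ih (by simpa using hF) j α (by simpa using h)

variable (V m) in
/-- The ring `V[T₁, …, T_m]^†` of overconvergent power series. -/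
def overconvergentSeries : Subalgebra V (MvPowerSeries (Fin m) V) where
  carrier := {F | IsOverconvergent p F}
  mul_mem' := by
    rintro F G ⟨c, hF⟩ ⟨c', hG⟩
    refine ⟨2 * max c c', fun j α h => ?_⟩
    rcases Nat.eq_zero_or_pos j with rfl | hj
    · simp
    · refine growth_mul p (c := max c c') (s := 0) (t := 0)
        (by simpa using IsOverconvergent.mono p (le_max_left c c') hF)
        (by simpa using IsOverconvergent.mono p (le_max_right c c') hG) j α ?_
      refine lt_of_le_of_lt ?_ h
      nlinarith [Nat.zero_le (max c c')]
  add_mem' := by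
    rintro F G ⟨c, hF⟩ ⟨c', hG⟩
    refine ⟨max c c', fun j α h => ?_⟩
    rw [map_add]
    exact dvd_add (IsOverconvergent.mono p (le_max_left c c') hF j α h)
      (IsOverconvergent.mono p (le_max_right c c') hG j α h)
  algebraMap_mem' := by
    classical
    intro v
    refine ⟨0, fun j α h => ?_⟩
    have : α ≠ 0 := by rintro rfl; simp at h
    rw [MvPowerSeries.algebraMap_apply, Algebra.algebraMap_self, RingHom.id_apply,
      MvPowerSeries.coeff_C, if_neg this]
    exact dvd_zero _

theorem mem_overconvergentSeries {F : MvPowerSeries (Fin m) V} :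
    F ∈ overconvergentSeries p V m ↔ IsOverconvergent p F := Iff.rfl

theorem isOverconvergent_coe (P : MvPolynomial (Fin m) V) :
    IsOverconvergent p (P : MvPowerSeries (Fin m) V) := by
  refine ⟨P.totalDegree, fun j α h => ?_⟩
  rcases Nat.eq_zero_or_pos j with rfl | hj
  · simp
  · rw [MvPolynomial.coeff_coe, MvPolynomial.coeff_eq_zero_of_totalDegree_lt]
    · exact dvd_zero _
    · have : P.totalDegree ≤ P.totalDegree * j := Nat.le_mul_of_pos_right _ hj
      refine lt_of_le_of_lt this ?_
      rwa [Finsupp.degree_apply] at h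

/-- The inclusion of polynomials in overconvergent power series. -/
def polyToSeries : MvPolynomial (Fin m) V →ₐ[V] overconvergentSeries p V m :=
  (MvPolynomial.coeToMvPowerSeries.algHom V).codRestrict _ fun P => by
    simpa [mem_overconvergentSeries] using isOverconvergent_coe p P

end overconvergent

/-- A presentation `A ≅ V[T₁, …, T_m] / I` of an algebra of finite type. -/
structure AffinePresentation (V A : Type u) [CommRing V] [CommRing A] [Algebra V A] where
  m : ℕ
  φ : MvPolynomial (Fin m) V →ₐ[V] A
  surjective : Function.Surjective φ

section dagger

variable (p : ℕ) {V A : Type u} [CommRing V] [CommRing A] [Algebra V A]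
  (P : AffinePresentation V A)

/-- The ideal of `V[T]^†` generated by the relations `I` of a presentation `V[T] / I` of `A`. -/
def daggerIdeal : Ideal (overconvergentSeries p V P.m) :=
  (RingHom.ker P.φ).map (polyToSeries p)

/-- The weak completion `A^† = V[T]^† / I V[T]^†` of `A = V[T] / I`. -/
def Dagger : Type u := overconvergentSeries p V P.m ⧸ daggerIdeal p P

instance : CommRing (Dagger p P) :=
  inferInstanceAs (CommRing (overconvergentSeries p V P.m ⧸ daggerIdeal p P))

instance : Algebra V (Dagger p P) :=
  inferInstanceAs (Algebra V (overconvergentSeries p V P.m ⧸ daggerIdeal p P))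

/-- The quotient map `V[T]^† → A^†`. -/
def Dagger.mk : overconvergentSeries p V P.m →ₐ[V] Dagger p P :=
  Ideal.Quotient.mkₐ V (daggerIdeal p P)

theorem Dagger.mk_surjective : Function.Surjective (Dagger.mk p P) :=
  Ideal.Quotient.mk_surjective

/-- The canonical map `A → A^†`. -/
def toDagger : A →ₐ[V] Dagger p P :=
  AlgHom.liftOfSurjective P.φ P.surjective ((Dagger.mk p P).comp (polyToSeries p)) (by
    intro x hx
    exact Ideal.Quotient.eq_zero_iff_mem.mpr (Ideal.mem_map_of_mem _ hx))

end dagger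

/-! ### The `p`-adic logarithm on `1 + p V[T]^†` -/

section logarithm

set_option linter.unusedSectionVars false

variable (p : ℕ) [hp : Fact p.Prime] (V : Type u) [CommRing V] [IsDomain V]
  [IsDiscreteValuationRing V] [IsAdicComplete (IsLocalRing.maximalIdeal V) V] [CharZero V]
  [CharP (IsLocalRing.ResidueField V) p]

theorem natCast_mem_maximalIdeal : (p : V) ∈ IsLocalRing.maximalIdeal V := by
  rw [← IsLocalRing.residue_eq_zero_iff, map_natCast, CharP.cast_eq_zero]

theorem exists_logCoeff (n : ℕ) : ∃ c : V, ((n + 1 : ℕ) : V) * c = (p : V) ^ n ∧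
    (p : V) ^ (n / 2) ∣ c := by
  have hp' := hp.out
  obtain ⟨v, a, ha, hn⟩ := Nat.exists_eq_pow_mul_and_not_dvd (Nat.succ_ne_zero n) p hp'.ne_one
  have hu : IsUnit (a : V) := by
    by_contra hcon
    have : (a : V) ∈ IsLocalRing.maximalIdeal V := (IsLocalRing.mem_maximalIdeal _).2 hcon
    rw [← IsLocalRing.residue_eq_zero_iff, map_natCast, CharP.cast_eq_zero_iff _ p] at this
    exact ha this
  obtain ⟨b, hb⟩ := hu.exists_right_inv
  have hv : v + n / 2 ≤ n := by
    have h1 : p ^ v ≤ n + 1 := by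
      rw [← Nat.succ_eq_add_one, hn]
      refine Nat.le_mul_of_pos_right _ (Nat.pos_of_ne_zero ?_)
      rintro rfl; simp at ha
    have h2 : 2 ^ v ≤ p ^ v := Nat.pow_le_pow_left hp'.two_le v
    have h3 : 2 * v ≤ 2 ^ v := by
      rcases v with _ | v
      · simp
      · rw [pow_succ]
        have := Nat.lt_two_pow_self (n := v)
        omega
    omega
  refine ⟨(p : V) ^ (n - v) * b, ?_, ?_⟩
  · rw [← Nat.succ_eq_add_one, hn, Nat.cast_mul, Nat.cast_pow]
    calc (p : V) ^ v * a * (p ^ (n - v) * b) = (p ^ v * p ^ (n - v)) * (a * b) := by ring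
      _ = (p : V) ^ n := by rw [hb, mul_one, ← pow_add]; congr 1; omega
  · exact (pow_dvd_pow _ (by omega)).mul_right _

/-- The element `p ^ n / (n + 1)` of `V`. -/
def logCoeff (n : ℕ) : V := (exists_logCoeff p V n).choose

theorem logCoeff_spec (n : ℕ) : ((n + 1 : ℕ) : V) * logCoeff p V n = (p : V) ^ n :=
  (exists_logCoeff p V n).choose_spec.1

theorem dvd_logCoeff (n : ℕ) : (p : V) ^ (n / 2) ∣ logCoeff p V n :=
  (exists_logCoeff p V n).choose_spec.2

variable {V}

/-- `V` is `p`-adically complete. -/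
theorem exists_padic_limit (f : ℕ → V) (hf : ∀ k l, k ≤ l → (p : V) ^ k ∣ f l - f k) :
    ∃ L : V, ∀ k, (p : V) ^ k ∣ L - f k := by
  have hm := natCast_mem_maximalIdeal p V
  have hp0 : (p : V) ≠ 0 := Nat.cast_ne_zero.2 hp.out.ne_zero
  obtain ⟨e, he⟩ : ∃ e : ℕ, IsLocalRing.maximalIdeal V ^ e = Ideal.span {(p : V)} := by
    obtain ⟨ϖ, hϖ⟩ := IsDiscreteValuationRing.exists_irreducible V
    obtain ⟨e, he⟩ := IsDiscreteValuationRing.ideal_eq_span_pow_irreducible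
      (s := Ideal.span {(p : V)}) (by simpa using hp0) hϖ
    exact ⟨e, by rw [he, hϖ.maximalIdeal_eq, Ideal.span_singleton_pow]⟩
  have hsub : ∀ k, Ideal.span {(p : V) ^ k} ≤ IsLocalRing.maximalIdeal V ^ k := fun k => by
    rw [Ideal.span_singleton_le_iff_mem]; exact Ideal.pow_mem_pow hm k
  obtain ⟨L, hL⟩ := IsPrecomplete.prec' (I := IsLocalRing.maximalIdeal V) (M := V) f (by
    intro k l hkl
    rw [SModEq.sub_mem, smul_eq_mul, Ideal.mul_top, ← neg_mem_iff, neg_sub]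
    exact hsub k (Ideal.mem_span_singleton.2 (hf k l hkl)))
  refine ⟨L, fun k => ?_⟩
  have h1 : (p : V) ^ k ∣ f (k + e * k) - f k := hf _ _ (Nat.le_add_right _ _)
  have h2 := hL (k + e * k)
  rw [SModEq.sub_mem, smul_eq_mul, Ideal.mul_top] at h2
  have h3 : f (k + e * k) - L ∈ Ideal.span {(p : V) ^ k} := by
    rw [← Ideal.span_singleton_pow, ← he, ← pow_mul]
    exact Ideal.pow_le_pow_right (Nat.le_add_left _ _) h2
  rw [Ideal.mem_span_singleton] at h3
  have := dvd_sub h1 h3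
  convert this using 1
  ring

variable {m : ℕ}

/-- The partial sums `∑_{n < N} (p ^ n / (n + 1)) Y ^ (n + 1)` of `- p⁻¹ log (1 - p Y)`. -/
def logPartial (Y : MvPowerSeries (Fin m) V) (N : ℕ) : MvPowerSeries (Fin m) V :=
  ∑ n ∈ Finset.range N, logCoeff p V n • Y ^ (n + 1)

theorem logPartial_congr (Y : MvPowerSeries (Fin m) V) (α : Fin m →₀ ℕ) (k : ℕ) {N M : ℕ}
    (hN : 2 * k ≤ N) (hNM : N ≤ M) :
    (p : V) ^ k ∣ MvPowerSeries.coeff α (logPartial p Y M) -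
      MvPowerSeries.coeff α (logPartial p Y N) := by
  rw [← map_sub, logPartial, logPartial, Finset.sum_range_sub_sum_range hNM, map_sum]
  refine Finset.dvd_sum fun n hn => ?_
  rw [MvPowerSeries.coeff_smul]
  refine Dvd.dvd.mul_right ?_ _
  have hn' := (Finset.mem_filter.1 hn).2
  exact (pow_dvd_pow _ (by omega)).trans (dvd_logCoeff p V n)

theorem exists_logSeries (Y : MvPowerSeries (Fin m) V) : ∃ L : MvPowerSeries (Fin m) V,
    ∀ (k : ℕ) (α : Fin m →₀ ℕ), (p : V) ^ k ∣ MvPowerSeries.coeff α L -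
      MvPowerSeries.coeff α (logPartial p Y (2 * k)) := by
  have := fun α : Fin m →₀ ℕ => exists_padic_limit p
    (fun k => MvPowerSeries.coeff α (logPartial p Y (2 * k)))
    (fun k l h => logPartial_congr p Y α k le_rfl (by omega))
  choose L hL using this
  exact ⟨L, fun k α => hL α k⟩

theorem logPartial_growth {Y : MvPowerSeries (Fin m) V} {c : ℕ}
    (hY : ∀ (j : ℕ) (α : Fin m →₀ ℕ), c * j < α.degree → (p : V) ^ j ∣ MvPowerSeries.coeff α Y)
    (N j : ℕ) (α : Fin m →₀ ℕ) (h : 3 * c * j < α.degree) :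
    (p : V) ^ j ∣ MvPowerSeries.coeff α (logPartial p Y N) := by
  rw [logPartial, map_sum]
  refine Finset.dvd_sum fun n _ => ?_
  rw [MvPowerSeries.coeff_smul]
  by_cases hn : j ≤ n / 2
  · exact Dvd.dvd.mul_right ((pow_dvd_pow _ hn).trans (dvd_logCoeff p V n)) _
  · refine Dvd.dvd.mul_left (growth_pow p hY n j α ?_) _
    refine lt_of_le_of_lt ?_ h
    rw [mul_comm 3 c, mul_assoc]
    exact Nat.mul_le_mul_left c (by omega)

/-- For overconvergent `Y`, the overconvergent power series
`∑_{n ≥ 0} (p ^ n / (n + 1)) Y ^ (n + 1) = - p⁻¹ log (1 - p Y)`: it is the limit of the partial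
sums for the `p`-adic topology (coefficientwise, and uniformly in the coefficients). -/
theorem exists_logSeries_overconvergent (Y : overconvergentSeries p V m) :
    ∃ L : overconvergentSeries p V m, ∀ k : ℕ, ∃ E : overconvergentSeries p V m,
      (L : MvPowerSeries (Fin m) V) = logPartial p (Y : MvPowerSeries (Fin m) V) (2 * k) +
        ((p : V) ^ k • E : overconvergentSeries p V m) := by
  have hp0 : (p : V) ≠ 0 := Nat.cast_ne_zero.2 hp.out.ne_zero
  obtain ⟨c, hc⟩ := Y.2
  obtain ⟨L, hL⟩ := exists_logSeries p (Y : MvPowerSeries (Fin m) V)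
  have hLc : ∀ (j : ℕ) (α : Fin m →₀ ℕ), 3 * c * j < α.degree →
      (p : V) ^ j ∣ MvPowerSeries.coeff α L := fun j α h => by
    have := dvd_add (hL j α) (logPartial_growth p hc (2 * j) j α h)
    simpa using this
  refine ⟨⟨L, 3 * c, hLc⟩, fun k => ?_⟩
  choose E hE using hL k
  have hEo : IsOverconvergent p (m := m) (V := V) E := by
    refine ⟨3 * c * (k + 1), fun j α h => ?_⟩
    rcases Nat.eq_zero_or_pos j with rfl | hj
    · simp
    · have h' : 3 * c * (k + j) < α.degree := by
        refine lt_of_le_of_lt ?_ h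
        rw [mul_assoc (3 * c)]
        refine Nat.mul_le_mul_left _ ?_
        nlinarith
      have h1 := dvd_sub (hLc _ α h') (logPartial_growth p hc (2 * k) _ α h')
      rw [hE α, pow_add] at h1
      exact (mul_dvd_mul_iff_left (pow_ne_zero k hp0)).1 h1
  refine ⟨⟨E, hEo⟩, ?_⟩
  ext α
  have := hE α
  rw [sub_eq_iff_eq_add] at this
  rw [map_add, this, add_comm]
  rfl

/-- `- p⁻¹ log (1 - p Y) = ∑_{n ≥ 0} (p ^ n / (n + 1)) Y ^ (n + 1)` for an overconvergent
series `Y`. -/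
def logSeries (Y : overconvergentSeries p V m) : overconvergentSeries p V m :=
  (exists_logSeries_overconvergent p Y).choose

theorem logSeries_spec (Y : overconvergentSeries p V m) (k : ℕ) :
    ∃ E : overconvergentSeries p V m, logSeries p Y =
      ∑ n ∈ Finset.range (2 * k), logCoeff p V n • Y ^ (n + 1) + (p : V) ^ k • E := by
  obtain ⟨E, hE⟩ := (exists_logSeries_overconvergent p Y).choose_spec k
  refine ⟨E, Subtype.ext ?_⟩
  rw [logSeries, hE, logPartial]
  push_cast
  rfl

end logarithm

/-! ### Differentials and Frobenius -/

/-- The additive group `M` regarded as an `S`-module by restriction of scalars along `σ`. -/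
def Restrict {S : Type u} [CommRing S] (_σ : S →+* S) (M : Type u) : Type u := M

section restrict

variable {K S : Type u} [Field K] [CommRing S] [Algebra K S] (σ : S →+* S)
  (M : Type u) [AddCommGroup M] [Module S M]

instance : AddCommGroup (Restrict σ M) := inferInstanceAs (AddCommGroup M)

instance : Module S (Restrict σ M) := Module.compHom M σ

instance : Module K (Restrict σ M) := Module.compHom (Restrict σ M) (algebraMap K S)

instance : IsScalarTower K S (Restrict σ M) where
  smul_assoc k s x := by
    change σ (k • s) • (show M from x) = σ (algebraMap K S k) • σ s • (show M from x)
    rw [Algebra.smul_def, map_mul, mul_smul]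

/-- The identity map `M → Restrict σ M`. -/
def Restrict.of : M ≃+ Restrict σ M := AddEquiv.refl M

variable {M}

theorem Restrict.smul_of (s : S) (x : M) :
    s • Restrict.of σ M x = Restrict.of σ M (σ s • x) := rfl

theorem Restrict.of_symm_smul (s : S) (x : Restrict σ M) :
    (Restrict.of σ M).symm (s • x) = σ s • (Restrict.of σ M).symm x := rfl

variable {σ} {F : K →+* K} (hF : ∀ k, σ (algebraMap K S k) = algebraMap K S (F k))

/-- The map `Ω¹_{S/K} → Ω¹_{S/K}`, `a db ↦ σ(a) d(σ(b))`, induced by an endomorphism `σ` of `S`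
lying over an endomorphism `F` of `K`. -/
def kaehlerFrobenius : Ω[S⁄K] →ₛₗ[σ] Ω[S⁄K] :=
  let D : Derivation K S (Restrict σ Ω[S⁄K]) :=
    { toFun := fun s => Restrict.of σ _ (KaehlerDifferential.D K S (σ s))
      map_add' := fun a b => by rw [map_add, map_add, map_add]
      map_smul' := fun k s => by
        rw [Algebra.smul_def, map_mul, hF, ← Algebra.smul_def, Derivation.map_smul, RingHom.id_apply,
          ← algebraMap_smul S k, Restrict.smul_of, hF, algebraMap_smul]
      map_one_eq_zero' := by simp
      leibniz' := fun a b => by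
        change Restrict.of σ _ (KaehlerDifferential.D K S (σ (a * b))) =
          a • Restrict.of σ _ (KaehlerDifferential.D K S (σ b)) +
            b • Restrict.of σ _ (KaehlerDifferential.D K S (σ a))
        rw [Restrict.smul_of, Restrict.smul_of, ← map_add]
        simp }
  { toFun := fun ω => (Restrict.of σ _).symm (D.liftKaehlerDifferential ω)
    map_add' := fun a b => by rw [map_add, map_add]
    map_smul' := fun s ω => by rw [map_smul, Restrict.of_symm_smul] }

theorem kaehlerFrobenius_D (s : S) :
    kaehlerFrobenius hF (KaehlerDifferential.D K S s) = KaehlerDifferential.D K S (σ s) := by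
  unfold kaehlerFrobenius
  change (Restrict.of σ _).symm (Derivation.liftKaehlerDifferential _ _) = _
  rw [Derivation.liftKaehlerDifferential_comp_D]
  rfl

end restrict

/-- A `K`-algebra `S` with a Frobenius `σ` lying over `F` on `K` and a submodule `N` of `Ω¹_{S/K}`
stable under `σ`. The module of differentials used is `Ω¹_{S/K} / N`; for the weakly
complete algebra of interest, `N` is the submodule that has to be divided out to obtain the
continuous differentials. -/
structure FrobeniusCalculus (K S : Type u) [Field K] [CommRing S] [Algebra K S] where
  F : K →+* K
  σ : S →+* S
  σ_algebraMap : ∀ k, σ (algebraMap K S k) = algebraMap K S (F k)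
  N : Submodule S Ω[S⁄K]
  N_le : N ≤ N.comap (kaehlerFrobenius σ_algebraMap)

namespace FrobeniusCalculus

variable {K S : Type u} [Field K] [CommRing S] [Algebra K S] (C : FrobeniusCalculus K S)

/-- The module of (continuous) differentials. -/
abbrev Omega : Type u := Ω[S⁄K] ⧸ C.N

/-- The universal (continuous) derivation `d : S → Ω¹_S`. -/
def d (s : S) : C.Omega := C.N.mkQ (KaehlerDifferential.D K S s)

theorem d_add (a b : S) : C.d (a + b) = C.d a + C.d b := by simp only [d, map_add]

theorem d_mul (a b : S) : C.d (a * b) = a • C.d b + b • C.d a := by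
  simp only [d, Derivation.leibniz, map_add, map_smul]

theorem d_algebraMap (k : K) : C.d (algebraMap K S k) = 0 := by simp [d]

theorem d_one : C.d 1 = 0 := by simp [d]

theorem d_zero : C.d 0 = 0 := by simp [d]

/-- The Frobenius `a db ↦ σ(a) d(σ(b))` on differentials. -/
def omegaFrobenius : C.Omega →ₛₗ[C.σ] C.Omega :=
  C.N.mapQ C.N (kaehlerFrobenius C.σ_algebraMap) C.N_le

theorem omegaFrobenius_d (s : S) : C.omegaFrobenius (C.d s) = C.d (C.σ s) := by
  simp only [omegaFrobenius, d, Submodule.mkQ_apply, Submodule.mapQ_apply, kaehlerFrobenius_D]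

/-- The linearization `σ^* H → H` of a `σ`-semilinear map `Φ : H → H`, where
`σ^* H = S ⊗_{σ, S} H`. -/
def linearization (σ : S →+* S) {H : Type u} [AddCommGroup H] [Module S H] (Φ : H →ₛₗ[σ] H) :
    Restrict σ S ⊗[S] H →+ H :=
  TensorProduct.liftAddHom
    { toFun := fun s =>
        { toFun := fun x => (Restrict.of σ S).symm s • Φ x
          map_zero' := by simp
          map_add' := by simp }
      map_zero' := by ext; simp
      map_add' := fun a b => by ext; simp [add_smul] }
    (fun r s x => by
      change (Restrict.of σ S).symm (r • s) • Φ x = (Restrict.of σ S).symm s • Φ (r • x)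
      rw [Restrict.of_symm_smul, LinearMap.map_smulₛₗ, smul_eq_mul, smul_smul, mul_comm])

theorem linearization_tmul (σ : S →+* S) {H : Type u} [AddCommGroup H] [Module S H]
    (Φ : H →ₛₗ[σ] H) (s : S) (x : H) :
    linearization σ Φ (Restrict.of σ S s ⊗ₜ x) = s • Φ x := rfl

end FrobeniusCalculus

/-! ### Connections -/

section connections

variable (K R : Type u) [Field K] [CommRing R] [Algebra K R]

/-- An (algebraic) connection `∇ : M → Ω¹_{R/K} ⊗ M` on an `R`-module `M`. -/
structure Conn (M : Type u) [AddCommGroup M] [Module R M] where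
  toFun : M →+ Ω[R⁄K] ⊗[R] M
  leibniz : ∀ (r : R) (x : M),
    toFun (r • x) = KaehlerDifferential.D K R r ⊗ₜ[R] x + r • toFun x

variable {K R} {M : Type u} [AddCommGroup M] [Module R M]

/-- The covariant derivative `∇_X : M → M` along a derivation `X`. -/
def Conn.cov (n : Conn K R M) (X : Derivation K R R) (x : M) : M :=
  TensorProduct.lid R M (X.liftKaehlerDifferential.rTensor M (n.toFun x))

/-- Integrability: `[∇_X, ∇_Y] = ∇_{[X, Y]}` for all `K`-derivations `X`, `Y` of `R`. -/
def Conn.Integrable (n : Conn K R M) : Prop :=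
  ∀ (X Y : Derivation K R R) (x : M),
    n.cov X (n.cov Y x) - n.cov Y (n.cov X x) = n.cov ⁅X, Y⁆ x

variable {S : Type u} [CommRing S] [Algebra K S] [Algebra R S] [IsScalarTower K R S]
  (C : FrobeniusCalculus K S)

/-- The canonical map `Ω¹_{R/K} ⊗_R M → Ω¹_S ⊗_S (S ⊗_R M)`. -/
def baseChangeForm : Ω[R⁄K] ⊗[R] M →+ C.Omega ⊗[S] (S ⊗[R] M) :=
  TensorProduct.liftAddHom
    { toFun := fun ω =>
        { toFun := fun x => C.N.mkQ (KaehlerDifferential.map K K R S ω) ⊗ₜ[S] ((1 : S) ⊗ₜ[R] x)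
          map_zero' := by simp
          map_add' := fun x y => by rw [TensorProduct.tmul_add, TensorProduct.tmul_add] }
      map_zero' := by ext; simp
      map_add' := fun a b => by ext; simp [TensorProduct.add_tmul] }
    (fun r ω x => by
      change C.N.mkQ (KaehlerDifferential.map K K R S (r • ω)) ⊗ₜ[S] ((1 : S) ⊗ₜ[R] x) =
        C.N.mkQ (KaehlerDifferential.map K K R S ω) ⊗ₜ[S] ((1 : S) ⊗ₜ[R] (r • x))
      rw [map_smul, ← algebraMap_smul S r (KaehlerDifferential.map K K R S ω), map_smul,
        TensorProduct.smul_tmul, TensorProduct.tmul_smul (R := R), algebraMap_smul])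

theorem baseChangeForm_tmul (ω : Ω[R⁄K]) (x : M) :
    baseChangeForm C (ω ⊗ₜ[R] x) =
      C.N.mkQ (KaehlerDifferential.map K K R S ω) ⊗ₜ[S] ((1 : S) ⊗ₜ[R] x) := rfl

theorem baseChangeForm_smul (r : R) (t : Ω[R⁄K] ⊗[R] M) :
    baseChangeForm C (r • t) = algebraMap R S r • baseChangeForm C t := by
  induction t with
  | zero => simp
  | tmul ω x =>
    rw [TensorProduct.smul_tmul', baseChangeForm_tmul, baseChangeForm_tmul, map_smul,
      ← algebraMap_smul S r (KaehlerDifferential.map K K R S ω), map_smul,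
      TensorProduct.smul_tmul']
  | add a b ha hb => rw [smul_add, map_add, ha, hb, map_add, smul_add]

/-- The connection `s ⊗ x ↦ ds ⊗ (1 ⊗ x) + s ∇(x)` on `S ⊗_R M` induced by a connection `∇`
on `M`. -/
def Conn.baseChange (n : Conn K R M) : S ⊗[R] M →+ C.Omega ⊗[S] (S ⊗[R] M) :=
  TensorProduct.liftAddHom
    { toFun := fun s =>
        { toFun := fun x => C.d s ⊗ₜ[S] ((1 : S) ⊗ₜ[R] x) + s • baseChangeForm C (n.toFun x)
          map_zero' := by simp
          map_add' := fun x y => by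
            simp only [TensorProduct.tmul_add, map_add, smul_add]; abel }
      map_zero' := by ext; simp [C.d_zero]
      map_add' := fun a b => by
        ext x
        simp only [C.d_add, TensorProduct.add_tmul, add_smul, AddMonoidHom.coe_mk,
          ZeroHom.coe_mk, AddMonoidHom.add_apply]
        abel }
    (fun r s x => by
      change C.d (r • s) ⊗ₜ[S] ((1 : S) ⊗ₜ[R] x) + (r • s) • baseChangeForm C (n.toFun x) =
        C.d s ⊗ₜ[S] ((1 : S) ⊗ₜ[R] (r • x)) + s • baseChangeForm C (n.toFun (r • x))
      rw [n.leibniz, map_add, baseChangeForm_tmul, KaehlerDifferential.map_D, baseChangeForm_smul,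
        Algebra.smul_def, C.d_mul, TensorProduct.tmul_smul, ← algebraMap_smul S r
          ((1 : S) ⊗ₜ[R] x), TensorProduct.tmul_smul, smul_add, TensorProduct.add_tmul,
        TensorProduct.smul_tmul', TensorProduct.smul_tmul', mul_smul, smul_comm s]
      simp only [FrobeniusCalculus.d]
      abel)

theorem Conn.baseChange_tmul (n : Conn K R M) (s : S) (x : M) :
    n.baseChange C (s ⊗ₜ[R] x) =
      C.d s ⊗ₜ[S] ((1 : S) ⊗ₜ[R] x) + s • baseChangeForm C (n.toFun x) := rfl

theorem Conn.baseChange_smul (n : Conn K R M) (s : S) (t : S ⊗[R] M) :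
    n.baseChange C (s • t) = C.d s ⊗ₜ[S] t + s • n.baseChange C t := by
  induction t with
  | zero => simp
  | tmul a x =>
    rw [TensorProduct.smul_tmul', Conn.baseChange_tmul, Conn.baseChange_tmul, smul_eq_mul, C.d_mul,
      smul_add, TensorProduct.add_tmul, mul_smul]
    have : a ⊗ₜ[R] x = a • ((1 : S) ⊗ₜ[R] x) := by rw [TensorProduct.smul_tmul', smul_eq_mul, mul_one]
    rw [this, TensorProduct.tmul_smul, TensorProduct.smul_tmul', TensorProduct.smul_tmul']
    abel
  | add a b ha hb =>
    rw [smul_add, map_add, ha, hb, map_add, smul_add, TensorProduct.tmul_add]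
    abel

variable {H : Type u} [AddCommGroup H] [Module S H]

/-- The connection `∇_rig : H → Ω¹_S ⊗ H` obtained from a connection on `M` by transport along
an isomorphism `c : S ⊗_R M ≅ H`. -/
def Conn.rig (n : Conn K R M) (c : S ⊗[R] M ≃ₗ[S] H) : H →+ C.Omega ⊗[S] H :=
  ((c.toLinearMap.lTensor C.Omega).toAddMonoidHom.comp (n.baseChange C)).comp
    c.symm.toLinearMap.toAddMonoidHom

theorem Conn.rig_smul (n : Conn K R M) (c : S ⊗[R] M ≃ₗ[S] H) (s : S) (x : H) :
    n.rig C c (s • x) = C.d s ⊗ₜ[S] x + s • n.rig C c x := by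
  change c.toLinearMap.lTensor C.Omega (n.baseChange C (c.symm (s • x))) = _ +
    s • c.toLinearMap.lTensor C.Omega (n.baseChange C (c.symm x))
  rw [map_smul, n.baseChange_smul, map_add, map_smul, LinearMap.lTensor_tmul]
  simp

theorem Conn.rig_apply (n : Conn K R M) (c : S ⊗[R] M ≃ₗ[S] H) (x : M) :
    n.rig C c (c ((1 : S) ⊗ₜ x)) =
      c.toLinearMap.lTensor C.Omega (baseChangeForm C (n.toFun x)) := by
  change c.toLinearMap.lTensor C.Omega (n.baseChange C (c.symm (c ((1 : S) ⊗ₜ x)))) = _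
  rw [c.symm_apply_apply, n.baseChange_tmul, C.d_one, TensorProduct.zero_tmul, zero_add, one_smul]

/-- `Φ` is horizontal: `∇_rig Φ = Φ ∇_rig`, where `Φ` acts on `Ω¹_S ⊗ H` through the Frobenius
of both factors. -/
def Conn.Horizontal (n : Conn K R M) (c : S ⊗[R] M ≃ₗ[S] H) (Φ : H →ₛₗ[C.σ] H) : Prop :=
  ∀ x : H, n.rig C c (Φ x) = TensorProduct.map C.omegaFrobenius Φ (n.rig C c x)

/-- Horizontality may be checked on generators. -/
theorem Conn.horizontal_of_span (n : Conn K R M) (c : S ⊗[R] M ≃ₗ[S] H) (Φ : H →ₛₗ[C.σ] H)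
    (X : Set H) (hX : Submodule.span S X = ⊤)
    (h : ∀ x ∈ X, n.rig C c (Φ x) = TensorProduct.map C.omegaFrobenius Φ (n.rig C c x)) :
    n.Horizontal C c Φ := by
  intro x
  have hx : x ∈ Submodule.span S X := by rw [hX]; trivial
  induction hx using Submodule.span_induction with
  | mem x hx => exact h x hx
  | zero => simp
  | add x y _ _ hx hy => simp only [map_add, hx, hy]
  | smul s x _ hx =>
    rw [LinearMap.map_smulₛₗ, n.rig_smul, n.rig_smul, map_add, TensorProduct.map_tmul,
      C.omegaFrobenius_d, LinearMap.map_smulₛₗ, hx]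

end connections

/-! ### The category of filtered `F`-isocrystals -/

section category

variable {K S : Type u} (R : Type u) [Field K] [CommRing R] [Algebra K R] [CommRing S]
  [Algebra K S] [Algebra R S] [IsScalarTower K R S]

/-- A filtered `F`-isocrystal `(H_dR, H_rig, c, Φ, ∇, Fil)`. -/
structure FilFMIC (C : FrobeniusCalculus K S) where
  dR : Type u
  rig : Type u
  [addCommGroup_dR : AddCommGroup dR]
  [module_dR : Module R dR]
  [addCommGroup_rig : AddCommGroup rig]
  [module_rig : Module S rig]
  finite_dR : Module.Finite R dR
  finite_rig : Module.Finite S rig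
  /-- the comparison isomorphism -/
  c : S ⊗[R] dR ≃ₗ[S] rig
  /-- the Frobenius, as a `σ`-semilinear map -/
  Φ : rig →ₛₗ[C.σ] rig
  Φ_bijective : Function.Bijective (FrobeniusCalculus.linearization C.σ Φ)
  conn : Conn K R dR
  integrable : conn.Integrable
  /-- the descending filtration -/
  Fil : ℤ → Submodule R dR
  antitone_Fil : Antitone Fil
  exists_Fil_eq_top : ∃ i, Fil i = ⊤
  exists_Fil_eq_bot : ∃ i, Fil i = ⊥
  /-- the graded pieces are locally free -/
  projective_gr : ∀ i, Module.Projective R (Fil i ⧸ (Fil (i + 1)).submoduleOf (Fil i))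
  griffiths : ∀ (i : ℤ), ∀ x ∈ Fil i,
    conn.toFun x ∈ LinearMap.range ((Fil (i - 1)).subtype.lTensor Ω[R⁄K])
  horizontal : conn.Horizontal C c Φ

attribute [instance] FilFMIC.addCommGroup_dR FilFMIC.module_dR FilFMIC.addCommGroup_rig
  FilFMIC.module_rig

namespace FilFMIC

variable {R} {C : FrobeniusCalculus K S}

/-- Morphisms of filtered `F`-isocrystals. -/
@[ext]
structure Hom (H H' : FilFMIC R C) where
  dR : H.dR →ₗ[R] H'.dR
  rig : H.rig →ₗ[S] H'.rig
  comm_c : ∀ t, rig (H.c t) = H'.c (dR.baseChange S t)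
  comm_Φ : ∀ x, rig (H.Φ x) = H'.Φ (rig x)
  comm_conn : ∀ x, H'.conn.toFun (dR x) = dR.lTensor Ω[R⁄K] (H.conn.toFun x)
  map_Fil : ∀ i, ∀ x ∈ H.Fil i, dR x ∈ H'.Fil i

instance : Category (FilFMIC R C) where
  Hom := Hom
  id H :=
    { dR := LinearMap.id
      rig := LinearMap.id
      comm_c := by simp
      comm_Φ := by simp
      comm_conn := by simp
      map_Fil := by simp }
  comp f g :=
    { dR := g.dR ∘ₗ f.dR
      rig := g.rig ∘ₗ f.rig
      comm_c := fun t => by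
        rw [LinearMap.comp_apply, f.comm_c, g.comm_c, LinearMap.baseChange_comp,
          LinearMap.comp_apply]
      comm_Φ := fun x => by simp only [LinearMap.comp_apply, f.comm_Φ, g.comm_Φ]
      comm_conn := fun x => by
        rw [LinearMap.comp_apply, g.comm_conn, f.comm_conn, LinearMap.lTensor_comp,
          LinearMap.comp_apply]
      map_Fil := fun i x hx => g.map_Fil i _ (f.map_Fil i x hx) }

instance : Limits.HasZeroMorphisms (FilFMIC R C) where
  zero H H' := ⟨
    { dR := 0
      rig := 0
      comm_c := by simp
      comm_Φ := by simp
      comm_conn := by simp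
      map_Fil := by simp }⟩
  comp_zero f H := Hom.ext rfl rfl
  zero_comp H {_ _} f := Hom.ext (LinearMap.comp_zero f.dR) (LinearMap.comp_zero f.rig)

/-! ### Yoneda extensions -/

/-- For maps `⋯ ⟶ M 1 ⟶ M 0 ⟶ H`, the kernel of the map out of `M i` (on de Rham parts). -/
def cycles {n : ℕ} (M : Fin (n + 1) → FilFMIC R C) (δ : ∀ i : Fin n, M i.succ ⟶ M i.castSucc)
    {H : FilFMIC R C} (π : M 0 ⟶ H) : ∀ i, Submodule R (M i).dR :=
  Fin.cases (LinearMap.ker (Hom.dR π)) (fun k => LinearMap.ker (Hom.dR (δ k)))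

/-- For maps `H' ⟶ M n ⟶ M (n - 1) ⟶ ⋯`, the image of `Fil j` under the map into `M i`. -/
def boundaries {n : ℕ} (M : Fin (n + 1) → FilFMIC R C)
    (δ : ∀ i : Fin n, M i.succ ⟶ M i.castSucc) {H' : FilFMIC R C} (ι : H' ⟶ M (Fin.last n))
    (j : ℤ) : ∀ i, Submodule R (M i).dR :=
  Fin.lastCases ((H'.Fil j).map (Hom.dR ι)) (fun k => ((M k.succ).Fil j).map (Hom.dR (δ k)))

section

variable {n : ℕ} (M : Fin (n + 1) → FilFMIC R C) (δ : ∀ i : Fin n, M i.succ ⟶ M i.castSucc)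
  {H H' : FilFMIC R C} (ι : H' ⟶ M (Fin.last n)) (π : M 0 ⟶ H) (j : ℤ)

theorem cycles_zero : cycles M δ π 0 = LinearMap.ker (Hom.dR π) := rfl

theorem cycles_succ (k : Fin n) : cycles M δ π k.succ = LinearMap.ker (Hom.dR (δ k)) := rfl

theorem boundaries_last : boundaries M δ ι j (Fin.last n) = (H'.Fil j).map (Hom.dR ι) :=
  Fin.lastCases_last

theorem boundaries_castSucc (k : Fin n) :
    boundaries M δ ι j k.castSucc = ((M k.succ).Fil j).map (Hom.dR (δ k)) :=
  Fin.lastCases_castSucc k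

end

/-- An `(n + 1)`-fold extension
`0 ⟶ H' ⟶ M n ⟶ M (n - 1) ⟶ ⋯ ⟶ M 0 ⟶ H ⟶ 0`. Exactness means exactness of all
the sequences of the `Fil j` of the de Rham parts. -/
structure YonedaExtension (H H' : FilFMIC R C) (n : ℕ) where
  M : Fin (n + 1) → FilFMIC R C
  ι : H' ⟶ M (Fin.last n)
  δ : ∀ i : Fin n, M i.succ ⟶ M i.castSucc
  π : M 0 ⟶ H
  injective_ι : Function.Injective (Hom.dR ι)
  exact : ∀ (i : Fin (n + 1)) (j : ℤ), (M i).Fil j ⊓ cycles M δ π i = boundaries M δ ι j i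
  surjective_π : ∀ j : ℤ, ((M 0).Fil j).map (Hom.dR π) = H.Fil j

variable {H H' : FilFMIC R C} {n : ℕ}

/-- There is a morphism of exact sequences from `E` to `E'` which is `b` on the left ends and
`a` on the right ends. -/
def YonedaExtension.HasMap {L L' : FilFMIC R C} (E : YonedaExtension H H' n)
    (E' : YonedaExtension L L' n) (b : H' ⟶ L') (a : H ⟶ L) : Prop :=
  ∃ f : ∀ i, E.M i ⟶ E'.M i,
    E.ι ≫ f (Fin.last n) = b ≫ E'.ι ∧
    (∀ i : Fin n, E.δ i ≫ f i.castSucc = f i.succ ≫ E'.δ i) ∧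
    E.π ≫ a = f 0 ≫ E'.π

variable (H H' n) in
/-- The set `Ext^{n+1}(H, H')`: `(n + 1)`-fold extensions modulo the equivalence relation generated
by morphisms of exact sequences which are the identity on both ends. -/
def Ext : Type (u + 1) :=
  Quot fun E E' : YonedaExtension H H' n => E.HasMap E' (𝟙 H') (𝟙 H)

/-- The class of an extension. -/
def Ext.mk (E : YonedaExtension H H' n) : Ext H H' n := Quot.mk _ E

/-- `z` is the Baer sum of `x` and `y`: for representatives `Ex`, `Ey`, `Ez`, there is an extension
`E` of `H ⊞ H` by `H'` which receives a morphism from `Ex ⊞ Ey` over the codiagonal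
`H' ⊞ H' ⟶ H'` and the identity of `H ⊞ H` (equivalently, morphisms from `Ex` and `Ey` over the two
inclusions `H ⟶ H ⊞ H` and the identity of `H'`), and a morphism from `Ez` over
the identity of `H'` and the diagonal `H ⟶ H ⊞ H`. -/
def Ext.IsBaerSum (x y z : Ext H H' n) : Prop :=
  ∃ (b : Limits.BinaryBicone H H) (Δ : H ⟶ b.pt) (Ex Ey Ez : YonedaExtension H H' n)
    (E : YonedaExtension b.pt H' n),
    Nonempty b.IsBilimit ∧ Δ ≫ b.fst = 𝟙 H ∧ Δ ≫ b.snd = 𝟙 H ∧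
    Ext.mk Ex = x ∧ Ext.mk Ey = y ∧ Ext.mk Ez = z ∧
    Ex.HasMap E (𝟙 H') b.inl ∧ Ey.HasMap E (𝟙 H') b.inr ∧ Ez.HasMap E (𝟙 H') Δ

variable (H H') in
/-- The trivial `2`-fold extension `0 ⟶ H' ⟶ H' ⟶ H ⟶ H ⟶ 0`, with middle map `0`. -/
def trivialExtension : YonedaExtension H H' 1 where
  M := Fin.cons H fun _ => H'
  ι := 𝟙 H'
  δ := fun _ => 0
  π := 𝟙 H
  injective_ι := fun _ _ h => h
  exact := by
    intro i j
    induction i using Fin.cases with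
    | zero =>
      have h := boundaries_castSucc (n := 1) (M := Fin.cons H fun _ => H')
        (fun _ => 0) (𝟙 H') j (0 : Fin 1)
      refine Eq.trans ?_ h.symm
      change H.Fil j ⊓ LinearMap.ker LinearMap.id = (H'.Fil j).map 0
      rw [Submodule.map_zero, LinearMap.ker_id, inf_bot_eq]
    | succ k =>
      obtain rfl : k = 0 := Subsingleton.elim _ _
      have h := boundaries_last (n := 1) (M := Fin.cons H fun _ => H')
        (fun _ => 0) (𝟙 H') j
      refine Eq.trans ?_ h.symm
      change H'.Fil j ⊓ LinearMap.ker (0 : H'.dR →ₗ[R] H.dR) = (H'.Fil j).map LinearMap.id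
      rw [LinearMap.ker_zero, inf_top_eq, Submodule.map_id]
  surjective_π := fun j => Submodule.map_id _

/-! ### Tate objects and Tate twists -/

section tate

theorem linearization_bijective {H : Type u} [AddCommGroup H] [Module S H] {σ : S →+* S}
    (Φ : H →ₛₗ[σ] H) (g : H →+ Restrict σ S ⊗[S] H)
    (h : ∀ x, FrobeniusCalculus.linearization σ Φ (g x) = x)
    (h' : ∀ s x, g (s • Φ x) = Restrict.of σ S s ⊗ₜ[S] x) :
    Function.Bijective (FrobeniusCalculus.linearization σ Φ) := by
  refine ⟨Function.LeftInverse.injective (g := g) fun t => ?_, fun x => ⟨_, h x⟩⟩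
  induction t with
  | zero => simp
  | tmul s x => exact h' ((Restrict.of σ S).symm s) x
  | add a b ha hb => rw [map_add, map_add, ha, hb]

theorem projective_quotient {M M' : Type u} [AddCommGroup M] [Module R M] [AddCommGroup M']
    [Module R M'] [Module.Projective R M'] {P Q : Submodule R M} (g : M →ₗ[R] M')
    (hg : ∀ y, ∃ x ∈ P, g x = y) (hker : ∀ x ∈ P, g x = 0 ↔ x ∈ Q) :
    Module.Projective R (P ⧸ Q.submoduleOf P) := by
  have hk : LinearMap.ker (g.domRestrict P) = Q.submoduleOf P := by
    ext x
    exact hker x.1 x.2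
  have hs : Function.Surjective (g.domRestrict P) := fun y => by
    obtain ⟨x, hx, rfl⟩ := hg y
    exact ⟨⟨x, hx⟩, rfl⟩
  rw [← hk]
  exact Module.Projective.of_equiv ((g.domRestrict P).quotKerEquivOfSurjective hs).symm

variable (C) in
theorem σ_zpow (p : ℕ) (n : ℤ) :
    C.σ (algebraMap K S ((p : K) ^ n)) = algebraMap K S ((p : K) ^ n) := by
  rw [C.σ_algebraMap, map_zpow₀, map_natCast]

variable (K R) in
/-- The trivial connection `d` on `R`. -/
def tateConn : Conn K R R where
  toFun :=
    { toFun := fun r => KaehlerDifferential.D K R r ⊗ₜ[R] (1 : R)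
      map_zero' := by simp
      map_add' := fun a b => by rw [map_add, TensorProduct.add_tmul] }
  leibniz := fun r x => by
    change KaehlerDifferential.D K R (r * x) ⊗ₜ[R] (1 : R) =
      KaehlerDifferential.D K R r ⊗ₜ[R] x + r • (KaehlerDifferential.D K R x ⊗ₜ[R] (1 : R))
    rw [Derivation.leibniz, TensorProduct.add_tmul, TensorProduct.smul_tmul', add_comm]
    congr 1
    rw [TensorProduct.smul_tmul, smul_eq_mul, mul_one]

theorem tateConn_apply (r : R) :
    (tateConn K R).toFun r = KaehlerDifferential.D K R r ⊗ₜ[R] (1 : R) := rfl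

theorem tateConn_rig_one : (tateConn K R).rig C (TensorProduct.AlgebraTensorModule.rid R S S) 1 = 0 := by
  have := (tateConn K R).rig_apply C (TensorProduct.AlgebraTensorModule.rid R S S) 1
  rw [tateConn_apply, Derivation.map_one_eq_zero, TensorProduct.zero_tmul, map_zero, map_zero] at this
  simpa using this

variable (C) in
/-- The Frobenius `p ^ (-n) σ` on `S`. -/
def tateFrobenius (p : ℕ) (n : ℤ) : S →ₛₗ[C.σ] S where
  toFun := fun x => algebraMap K S ((p : K) ^ (-n)) * C.σ x
  map_add' := fun x y => by rw [map_add, mul_add]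
  map_smul' := fun s x => by rw [smul_eq_mul, map_mul, smul_eq_mul]; ring

theorem tateFrobenius_apply (p : ℕ) (n : ℤ) (x : S) :
    tateFrobenius C p n x = algebraMap K S ((p : K) ^ (-n)) * C.σ x := rfl

variable (R) in
/-- The filtration of `R` with `Fil i = R` for `i ≤ -n` and `Fil i = 0` for `i > -n`. -/
def tateFil (n i : ℤ) : Submodule R R := if i ≤ -n then ⊤ else ⊥

variable (R C) in
/-- The Tate object `𝒪(n) = (R, S, c, p ^ (-n) σ, d, Fil)`, with `Fil i = R` for `i ≤ -n` and
`Fil i = 0` for `i > -n`. -/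
def tate (p : ℕ) (hp : (p : K) ≠ 0) (n : ℤ) : FilFMIC R C where
  dR := R
  rig := S
  finite_dR := inferInstance
  finite_rig := inferInstance
  c := TensorProduct.AlgebraTensorModule.rid R S S
  Φ := tateFrobenius C p n
  Φ_bijective := by
    have hq : algebraMap K S ((p : K) ^ n) * algebraMap K S ((p : K) ^ (-n)) = 1 := by
      rw [← map_mul, ← zpow_add₀ hp, add_neg_cancel, zpow_zero, map_one]
    refine linearization_bijective _
      { toFun := fun y => Restrict.of C.σ S (algebraMap K S ((p : K) ^ n) * y) ⊗ₜ[S] (1 : S)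
        map_zero' := by simp
        map_add' := fun x y => by rw [mul_add, map_add, TensorProduct.add_tmul] } ?_ ?_
    · intro x
      change (algebraMap K S ((p : K) ^ n) * x) * (algebraMap K S ((p : K) ^ (-n)) * C.σ 1) = x
      rw [map_one, mul_one, mul_right_comm, hq, one_mul]
    · intro s x
      change Restrict.of C.σ S (algebraMap K S ((p : K) ^ n) *
        (s * (algebraMap K S ((p : K) ^ (-n)) * C.σ x))) ⊗ₜ[S] (1 : S) = _
      have e : algebraMap K S ((p : K) ^ n) * (s * (algebraMap K S ((p : K) ^ (-n)) * C.σ x)) =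
          C.σ x • s := by
        rw [smul_eq_mul]
        linear_combination (s * C.σ x) * hq
      rw [e, ← Restrict.smul_of, TensorProduct.smul_tmul, smul_eq_mul, mul_one]
  conn := tateConn K R
  integrable := by
    intro X Y x
    have h : ∀ (Z : Derivation K R R) (y : R), TensorProduct.lid R R
        (Z.liftKaehlerDifferential.rTensor R (KaehlerDifferential.D K R y ⊗ₜ[R] (1 : R))) = Z y :=
      fun Z y => by simp
    simp only [Conn.cov, tateConn_apply, h, Derivation.commutator_apply]
  Fil := tateFil R n
  antitone_Fil := by
    intro i j hij
    unfold tateFil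
    split_ifs <;> first | exact le_rfl | exact bot_le | exact le_top | omega
  exists_Fil_eq_top := ⟨-n, if_pos le_rfl⟩
  exists_Fil_eq_bot := ⟨-n + 1, if_neg (by omega)⟩
  projective_gr := by
    intro i
    unfold tateFil
    by_cases h : i + 1 ≤ -n
    · rw [if_pos h, if_pos (by omega)]
      exact projective_quotient (0 : R →ₗ[R] PUnit.{u + 1}) (fun y => ⟨0, trivial, rfl⟩)
        fun x _ => ⟨fun _ => trivial, fun _ => rfl⟩
    · by_cases h' : i ≤ -n
      · rw [if_neg h, if_pos h']
        exact projective_quotient (LinearMap.id : R →ₗ[R] R) (fun y => ⟨y, trivial, rfl⟩)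
          fun x _ => Iff.rfl
      · rw [if_neg h, if_neg h']
        exact projective_quotient (0 : R →ₗ[R] PUnit.{u + 1})
          (fun y => ⟨0, Submodule.zero_mem _, rfl⟩) fun x hx => ⟨fun _ => hx, fun _ => rfl⟩
  griffiths := by
    intro i x hx
    unfold tateFil at hx ⊢
    by_cases hi : i ≤ -n
    · rw [if_pos (by omega)]
      exact LinearMap.lTensor_surjective Ω[R⁄K] (g := (⊤ : Submodule R R).subtype)
        (fun y => ⟨⟨y, Submodule.mem_top⟩, rfl⟩) _
    · rw [if_neg hi, Submodule.mem_bot] at hx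
      rw [hx, map_zero]
      exact Submodule.zero_mem _
  horizontal := by
    apply Conn.horizontal_of_span (X := {1})
    · exact Ideal.span_singleton_one
    · rintro x rfl
      rw [tateConn_rig_one, map_zero, tateFrobenius_apply, map_one, ← smul_eq_mul, Conn.rig_smul,
        C.d_algebraMap, TensorProduct.zero_tmul, tateConn_rig_one, smul_zero, add_zero]

variable (C) in
/-- The Frobenius `p ^ (-n) Φ`. -/
def twistFrobenius (p : ℕ) (n : ℤ) {H : Type u} [AddCommGroup H] [Module S H] (Φ : H →ₛₗ[C.σ] H) :
    H →ₛₗ[C.σ] H where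
  toFun := fun x => algebraMap K S ((p : K) ^ (-n)) • Φ x
  map_add' := fun x y => by rw [map_add, smul_add]
  map_smul' := fun s x => by rw [LinearMap.map_smulₛₗ, smul_comm]

theorem twistFrobenius_apply (p : ℕ) (n : ℤ) {H : Type u} [AddCommGroup H] [Module S H]
    (Φ : H →ₛₗ[C.σ] H) (x : H) :
    twistFrobenius C p n Φ x = algebraMap K S ((p : K) ^ (-n)) • Φ x := rfl

/-- The Tate twist `H(n) = H ⊗ 𝒪(n)`: the underlying modules and the connection are those of `H`,
the Frobenius is multiplied by `p ^ (-n)` and the filtration is shifted,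
`Fil i H(n) = Fil (i + n) H`. -/
def twist (p : ℕ) (hp : (p : K) ≠ 0) (H : FilFMIC R C) (n : ℤ) : FilFMIC R C where
  dR := H.dR
  rig := H.rig
  finite_dR := H.finite_dR
  finite_rig := H.finite_rig
  c := H.c
  Φ := twistFrobenius C p n H.Φ
  Φ_bijective := by
    have hq : algebraMap K S ((p : K) ^ n) * algebraMap K S ((p : K) ^ (-n)) = 1 := by
      rw [← map_mul, ← zpow_add₀ hp, add_neg_cancel, zpow_zero, map_one]
    have h : ∀ t, FrobeniusCalculus.linearization C.σ (twistFrobenius C p n H.Φ) t =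
        algebraMap K S ((p : K) ^ (-n)) • FrobeniusCalculus.linearization C.σ H.Φ t := by
      intro t
      induction t with
      | zero => simp
      | tmul s x =>
        change (Restrict.of C.σ S).symm s • algebraMap K S ((p : K) ^ (-n)) • H.Φ x =
          algebraMap K S ((p : K) ^ (-n)) • (Restrict.of C.σ S).symm s • H.Φ x
        rw [smul_comm]
      | add a b ha hb => rw [map_add, map_add, ha, hb, smul_add]
    constructor
    · intro a b hab
      rw [h, h] at hab
      have := congrArg (fun x => algebraMap K S ((p : K) ^ n) • x) hab
      simp only [smul_smul, hq, one_smul] at this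
      exact H.Φ_bijective.1 this
    · intro x
      obtain ⟨t, ht⟩ := H.Φ_bijective.2 (algebraMap K S ((p : K) ^ n) • x)
      refine ⟨t, ?_⟩
      rw [h, ht, smul_smul, mul_comm, hq, one_smul]
  conn := H.conn
  integrable := H.integrable
  Fil := fun i => H.Fil (i + n)
  antitone_Fil := fun i j hij => H.antitone_Fil (by omega)
  exists_Fil_eq_top := by
    obtain ⟨i, hi⟩ := H.exists_Fil_eq_top
    exact ⟨i - n, by rw [sub_add_cancel, hi]⟩
  exists_Fil_eq_bot := by
    obtain ⟨i, hi⟩ := H.exists_Fil_eq_bot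
    exact ⟨i - n, by rw [sub_add_cancel, hi]⟩
  projective_gr := fun i => by
    rw [show i + 1 + n = i + n + 1 by ring]
    exact H.projective_gr (i + n)
  griffiths := fun i x hx => by
    rw [show i - 1 + n = i + n - 1 by ring]
    exact H.griffiths (i + n) x hx
  horizontal := by
    have h : ∀ t, TensorProduct.map C.omegaFrobenius (twistFrobenius C p n H.Φ) t =
        algebraMap K S ((p : K) ^ (-n)) • TensorProduct.map C.omegaFrobenius H.Φ t := by
      intro t
      induction t with
      | zero => simp
      | tmul ω x =>
        rw [TensorProduct.map_tmul, TensorProduct.map_tmul, twistFrobenius_apply,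
          TensorProduct.tmul_smul]
      | add a b ha hb => rw [map_add, map_add, ha, hb, smul_add]
    intro x
    rw [h, twistFrobenius_apply, Conn.rig_smul, C.d_algebraMap, TensorProduct.zero_tmul, zero_add,
      H.horizontal x]

end tate

/-! ### Log objects -/

section log

variable (K) in
/-- The connection with `∇ e₋₂ = 0` and `∇ e₀ = (df / f) e₋₂` on `R e₋₂ ⊕ R e₀`. -/
def logConn (f : Rˣ) : Conn K R (R × R) where
  toFun :=
    { toFun := fun x => KaehlerDifferential.D K R x.1 ⊗ₜ[R] ((1 : R), (0 : R)) +
        KaehlerDifferential.D K R x.2 ⊗ₜ[R] ((0 : R), (1 : R)) +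
        x.2 • ((((f⁻¹ : Rˣ) : R) • KaehlerDifferential.D K R (f : R)) ⊗ₜ[R] ((1 : R), (0 : R)))
      map_zero' := by simp
      map_add' := fun a b => by
        simp only [Prod.fst_add, Prod.snd_add, map_add, TensorProduct.add_tmul, add_smul]
        abel }
  leibniz := fun r x => by
    change KaehlerDifferential.D K R (r * x.1) ⊗ₜ[R] ((1 : R), (0 : R)) +
        KaehlerDifferential.D K R (r * x.2) ⊗ₜ[R] ((0 : R), (1 : R)) +
        (r * x.2) • ((((f⁻¹ : Rˣ) : R) • KaehlerDifferential.D K R (f : R)) ⊗ₜ[R]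
          ((1 : R), (0 : R))) =
      KaehlerDifferential.D K R r ⊗ₜ[R] x +
        r • (KaehlerDifferential.D K R x.1 ⊗ₜ[R] ((1 : R), (0 : R)) +
        KaehlerDifferential.D K R x.2 ⊗ₜ[R] ((0 : R), (1 : R)) +
        x.2 • ((((f⁻¹ : Rˣ) : R) • KaehlerDifferential.D K R (f : R)) ⊗ₜ[R] ((1 : R), (0 : R))))
    have hx : x = x.1 • ((1 : R), (0 : R)) + x.2 • ((0 : R), (1 : R)) := by ext <;> simp
    have e : KaehlerDifferential.D K R r ⊗ₜ[R] x =
        x.1 • (KaehlerDifferential.D K R r ⊗ₜ[R] ((1 : R), (0 : R))) +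
        x.2 • (KaehlerDifferential.D K R r ⊗ₜ[R] ((0 : R), (1 : R))) := by
      conv_lhs => rw [hx]
      rw [TensorProduct.tmul_add, TensorProduct.tmul_smul, TensorProduct.tmul_smul]
    rw [e]
    simp only [Derivation.leibniz, TensorProduct.add_tmul, ← TensorProduct.smul_tmul', smul_add,
      mul_smul]
    abel

theorem logConn_apply (f : Rˣ) (x : R × R) : (logConn K f).toFun x =
    KaehlerDifferential.D K R x.1 ⊗ₜ[R] ((1 : R), (0 : R)) +
      KaehlerDifferential.D K R x.2 ⊗ₜ[R] ((0 : R), (1 : R)) +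
      x.2 • ((((f⁻¹ : Rˣ) : R) • KaehlerDifferential.D K R (f : R)) ⊗ₜ[R] ((1 : R), (0 : R))) :=
  rfl

theorem logConn_integrable (f : Rˣ) : (logConn K f).Integrable := by
  have h : ∀ (X : Derivation K R R) (x : R × R),
      (logConn K f).cov X x = (X x.1 + x.2 * ((f⁻¹ : Rˣ) * X (f : R)), X x.2) := by
    intro X x
    simp only [Conn.cov, logConn_apply, map_add, map_smul, LinearMap.rTensor_tmul,
      TensorProduct.lid_tmul, Derivation.liftKaehlerDifferential_comp_D]
    ext <;> simp
  have hinv : ∀ X : Derivation K R R, X ((f⁻¹ : Rˣ) : R) =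
      - (((f⁻¹ : Rˣ) : R) * ((f⁻¹ : Rˣ) : R)) * X (f : R) := by
    intro X
    have h1 : X (((f⁻¹ : Rˣ) : R) * (f : R)) = 0 := by
      rw [Units.inv_mul, Derivation.map_one_eq_zero]
    rw [Derivation.leibniz, smul_eq_mul, smul_eq_mul] at h1
    have h2 : (f : R) * ((f⁻¹ : Rˣ) : R) = 1 := Units.mul_inv f
    linear_combination ((f⁻¹ : Rˣ) : R) * h1 - X ((f⁻¹ : Rˣ) : R) * h2
  intro X Y x
  simp only [h, Derivation.commutator_apply, map_add, Derivation.leibniz, smul_eq_mul, hinv]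
  ext
  · simp only [Prod.fst_sub]; ring
  · simp

variable (S R) in
/-- The natural isomorphism `S ⊗ (R e₋₂ ⊕ R e₀) ≅ S e₋₂ ⊕ S e₀`. -/
def logComparison : S ⊗[R] (R × R) ≃ₗ[S] S × S :=
  (TensorProduct.prodRight R S S R R).trans
    ((TensorProduct.AlgebraTensorModule.rid R S S).prodCongr
      (TensorProduct.AlgebraTensorModule.rid R S S))

theorem logComparison_tmul (s : S) (x : R × R) :
    logComparison S R (s ⊗ₜ x) = (x.1 • s, x.2 • s) := by
  simp [logComparison]

variable (C) in
/-- The Frobenius with `Φ(e₋₂) = p⁻¹ e₋₂` and `Φ(e₀) = e₀ - ℓ e₋₂` on `S e₋₂ ⊕ S e₀`. -/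
def logFrobenius (p : ℕ) (ℓ : S) : S × S →ₛₗ[C.σ] S × S where
  toFun := fun x => (algebraMap K S ((p : K)⁻¹) * C.σ x.1 - C.σ x.2 * ℓ, C.σ x.2)
  map_add' := fun x y => by
    ext
    · simp only [Prod.fst_add, Prod.snd_add, map_add]; ring
    · simp only [Prod.snd_add, map_add]
  map_smul' := fun s x => by
    ext
    · simp only [Prod.smul_fst, Prod.smul_snd, smul_eq_mul, map_mul]; ring
    · simp only [Prod.smul_snd, smul_eq_mul, map_mul]

theorem logFrobenius_apply (p : ℕ) (ℓ : S) (x : S × S) : logFrobenius C p ℓ x =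
    (algebraMap K S ((p : K)⁻¹) * C.σ x.1 - C.σ x.2 * ℓ, C.σ x.2) := rfl

variable (R) in
/-- The filtration of `R e₋₂ ⊕ R e₀`: everything for `i ≤ -1`, `R e₀` for `i = 0`, zero for
`i > 0`. -/
def logFil (i : ℤ) : Submodule R (R × R) :=
  if i ≤ -1 then ⊤ else if i = 0 then LinearMap.range (LinearMap.inr R R R) else ⊥

/-- `Log(f)`, where `ℓ` is to be `log^(σ)(f) = p⁻¹ log (f ^ p / σ(f))`; its differential is
`df / f - p⁻¹ dσ(f) / σ(f)`. -/
def logObject (p : ℕ) (hp : (p : K) ≠ 0) (f : Rˣ) (ℓ : S)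
    (hℓ : C.d ℓ = algebraMap R S ((f⁻¹ : Rˣ) : R) • C.d (algebraMap R S (f : R)) -
      algebraMap K S ((p : K)⁻¹) • C.σ (algebraMap R S ((f⁻¹ : Rˣ) : R)) •
        C.d (C.σ (algebraMap R S (f : R)))) : FilFMIC R C where
  dR := R × R
  rig := S × S
  finite_dR := inferInstance
  finite_rig := inferInstance
  c := logComparison S R
  Φ := logFrobenius C p ℓ
  Φ_bijective := by
    have hq : algebraMap K S (p : K) * algebraMap K S ((p : K)⁻¹) = 1 := by
      rw [← map_mul, mul_inv_cancel₀ hp, map_one]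
    refine linearization_bijective _
      { toFun := fun y => Restrict.of C.σ S (algebraMap K S (p : K) * (y.1 + y.2 * ℓ)) ⊗ₜ[S]
          ((1 : S), (0 : S)) + Restrict.of C.σ S y.2 ⊗ₜ[S] ((0 : S), (1 : S))
        map_zero' := by simp
        map_add' := fun x y => by
          simp only [Prod.fst_add, Prod.snd_add, add_mul, mul_add, map_add, TensorProduct.add_tmul]
          abel } ?_ ?_
    · intro x
      simp only [AddMonoidHom.coe_mk, ZeroHom.coe_mk, map_add,
        FrobeniusCalculus.linearization_tmul, logFrobenius_apply, map_one, map_zero]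
      ext
      · simp only [Prod.smul_mk, smul_eq_mul, Prod.mk_add_mk]
        linear_combination (x.1 + x.2 * ℓ) * hq
      · simp
    · intro s x
      have hx : x = x.1 • ((1 : S), (0 : S)) + x.2 • ((0 : S), (1 : S)) := by ext <;> simp
      conv_rhs => rw [hx]
      rw [TensorProduct.tmul_add, ← TensorProduct.smul_tmul, ← TensorProduct.smul_tmul,
        Restrict.smul_of, Restrict.smul_of]
      have e1 : algebraMap K S (p : K) * ((s • logFrobenius C p ℓ x).1 +
          (s • logFrobenius C p ℓ x).2 * ℓ) = C.σ x.1 • s := by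
        simp only [logFrobenius_apply, Prod.smul_mk, smul_eq_mul]
        linear_combination (s * C.σ x.1) * hq
      have e2 : (s • logFrobenius C p ℓ x).2 = C.σ x.2 • s := by
        simp only [logFrobenius_apply, Prod.smul_mk, smul_eq_mul]
        ring
      rw [← e1, ← e2]
      rfl
  conn := logConn K f
  integrable := logConn_integrable f
  Fil := logFil R
  antitone_Fil := by
    intro i j hij
    unfold logFil
    split_ifs <;> first | exact le_rfl | exact bot_le | exact le_top | omega
  exists_Fil_eq_top := ⟨-1, if_pos le_rfl⟩
  exists_Fil_eq_bot := ⟨1, by simp [logFil]⟩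
  projective_gr := by
    intro i
    unfold logFil
    rcases lt_trichotomy i (-1) with h | rfl | h
    · rw [if_pos (by omega), if_pos (by omega)]
      exact projective_quotient (0 : R × R →ₗ[R] PUnit.{u + 1}) (fun y => ⟨0, trivial, rfl⟩)
        fun x _ => ⟨fun _ => trivial, fun _ => rfl⟩
    · rw [if_pos (by omega), if_neg (by omega), if_pos (by omega)]
      refine projective_quotient (LinearMap.fst R R R) (fun y => ⟨(y, 0), trivial, rfl⟩)
        fun x _ => ⟨fun h => ⟨x.2, ?_⟩, ?_⟩
      · ext
        · exact h.symm
        · rfl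
      · rintro ⟨y, rfl⟩
        rfl
    · rcases eq_or_lt_of_le (show 0 ≤ i by omega) with rfl | h'
      · rw [if_neg (show ¬ (0 + 1 : ℤ) ≤ -1 by omega), if_neg (show ¬ (0 + 1 : ℤ) = 0 by omega),
          if_neg (show ¬ (0 : ℤ) ≤ -1 by omega), if_pos rfl]
        refine projective_quotient (LinearMap.snd R R R) (fun y => ⟨(0, y), ⟨y, rfl⟩, rfl⟩) ?_
        rintro _ ⟨y, rfl⟩
        simp
      · rw [if_neg (by omega), if_neg (by omega), if_neg (by omega), if_neg (by omega)]
        exact projective_quotient (0 : R × R →ₗ[R] PUnit.{u + 1})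
          (fun y => ⟨0, Submodule.zero_mem _, rfl⟩) fun x hx => ⟨fun _ => hx, fun _ => rfl⟩
  griffiths := by
    intro i x hx
    by_cases hi : i ≤ 0
    · have : logFil R (i - 1) = ⊤ := if_pos (by omega)
      rw [this]
      exact LinearMap.lTensor_surjective Ω[R⁄K] (g := (⊤ : Submodule R (R × R)).subtype)
        (fun y => ⟨⟨y, Submodule.mem_top⟩, rfl⟩) _
    · rw [logFil, if_neg (by omega), if_neg (by omega), Submodule.mem_bot] at hx
      rw [hx, map_zero]
      exact Submodule.zero_mem _
  horizontal := by
    have h1 : (logConn K f).rig C (logComparison S R) ((1 : S), (0 : S)) = 0 := by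
      have := (logConn K f).rig_apply C (logComparison S R) ((1 : R), (0 : R))
      simpa [logConn_apply, logComparison_tmul] using this
    have h2 : (logConn K f).rig C (logComparison S R) ((0 : S), (1 : S)) =
        (algebraMap R S ((f⁻¹ : Rˣ) : R) • C.d (algebraMap R S (f : R))) ⊗ₜ[S]
          ((1 : S), (0 : S)) := by
      have := (logConn K f).rig_apply C (logComparison S R) ((0 : R), (1 : R))
      rw [logConn_apply] at this
      simp only [map_zero, Derivation.map_one_eq_zero, TensorProduct.zero_tmul, zero_add, one_smul,
        baseChangeForm_tmul, LinearMap.lTensor_tmul, LinearEquiv.coe_coe, logComparison_tmul,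
        zero_smul] at this
      rw [this, map_smul, KaehlerDifferential.map_D, ← algebraMap_smul S ((f⁻¹ : Rˣ) : R)
        (KaehlerDifferential.D K S _), map_smul]
      rfl
    apply Conn.horizontal_of_span (X := {((1 : S), (0 : S)), ((0 : S), (1 : S))})
    · rw [eq_top_iff]
      rintro x -
      rw [Submodule.mem_span_pair]
      exact ⟨x.1, x.2, by ext <;> simp⟩
    · rintro x (rfl | rfl)
      · have e : logFrobenius C p ℓ ((1 : S), (0 : S)) =
            algebraMap K S ((p : K)⁻¹) • ((1 : S), (0 : S)) := by
          rw [logFrobenius_apply, map_one, map_zero, Prod.smul_mk, smul_eq_mul, smul_zero,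
            zero_mul, sub_zero]
        rw [e, Conn.rig_smul, h1, C.d_algebraMap]
        simp
      · have e : logFrobenius C p ℓ ((0 : S), (1 : S)) =
            ((0 : S), (1 : S)) + (-ℓ) • ((1 : S), (0 : S)) := by
          rw [logFrobenius_apply, map_one, map_zero]
          ext
          · simp only [Prod.fst_add, Prod.smul_fst, smul_eq_mul]; ring
          · simp only [Prod.snd_add, Prod.smul_snd, smul_eq_mul]; ring
        have e' : logFrobenius C p ℓ ((1 : S), (0 : S)) =
            algebraMap K S ((p : K)⁻¹) • ((1 : S), (0 : S)) := by
          rw [logFrobenius_apply, map_one, map_zero, Prod.smul_mk, smul_eq_mul, smul_zero,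
            zero_mul, sub_zero]
        have hneg : C.d (-ℓ) = - C.d ℓ := by simp [FrobeniusCalculus.d]
        rw [e, map_add, Conn.rig_smul, h1, h2, TensorProduct.map_tmul, e', smul_zero, add_zero,
          LinearMap.map_smulₛₗ, C.omegaFrobenius_d, hneg, hℓ, TensorProduct.tmul_smul,
          TensorProduct.smul_tmul', ← TensorProduct.add_tmul]
        congr 1
        abel

variable (p : ℕ) (hp : (p : K) ≠ 0) (f : Rˣ) (ℓ : S)
    (hℓ : C.d ℓ = algebraMap R S ((f⁻¹ : Rˣ) : R) • C.d (algebraMap R S (f : R)) -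
      algebraMap K S ((p : K)⁻¹) • C.σ (algebraMap R S ((f⁻¹ : Rˣ) : R)) •
        C.d (C.σ (algebraMap R S (f : R))))

theorem logFil_snd (m j : ℤ) :
    (logFil R (j + m)).map (LinearMap.snd R R R) = tateFil R m j := by
  unfold logFil tateFil
  by_cases h : j ≤ -m
  · rw [if_pos h, eq_top_iff]
    rintro x -
    refine ⟨(0, x), ?_, rfl⟩
    split_ifs
    · trivial
    · exact ⟨x, rfl⟩
    · omega
  · rw [if_neg h, if_neg (by omega), if_neg (by omega), Submodule.map_bot]

theorem logFil_inl (m k j : ℤ) (hk : k = m + 1) :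
    logFil R (j + m) ⊓ LinearMap.ker (LinearMap.snd R R R) =
      (tateFil R k j).map (LinearMap.inl R R R) := by
  unfold logFil tateFil
  by_cases h : j ≤ -k
  · rw [if_pos h, if_pos (by omega), top_inf_eq, Submodule.map_top, LinearMap.range_inl]
  · rw [if_neg h, if_neg (by omega), Submodule.map_bot]
    split_ifs
    · rw [eq_bot_iff]
      rintro _ ⟨⟨x, rfl⟩, hx⟩
      have : x = 0 := hx
      simp [this]
    · rw [bot_inf_eq]

theorem inl_comparison (t : S ⊗[R] R) :
    LinearMap.inl S S S (TensorProduct.AlgebraTensorModule.rid R S S t) =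
      logComparison S R ((LinearMap.inl R R R).baseChange S t) := by
  induction t with
  | zero => simp
  | tmul s r => simp [logComparison_tmul]
  | add a b ha hb => simp only [map_add, ha, hb]

theorem snd_comparison (t : S ⊗[R] (R × R)) :
    LinearMap.snd S S S (logComparison S R t) =
      TensorProduct.AlgebraTensorModule.rid R S S ((LinearMap.snd R R R).baseChange S t) := by
  induction t with
  | zero => simp
  | tmul s r => simp [logComparison_tmul]
  | add a b ha hb => simp only [map_add, ha, hb]

/-- The inclusion `𝒪(m + 1) ⟶ Log(f)(m)`, `1 ↦ e₋₂`. -/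
def logInl (m k : ℤ) (hk : k = m + 1) : tate R C p hp k ⟶ twist p hp (logObject p hp f ℓ hℓ) m where
  dR := LinearMap.inl R R R
  rig := LinearMap.inl S S S
  comm_c := inl_comparison (R := R) (S := S)
  comm_Φ := fun x => by
    change ((algebraMap K S ((p : K) ^ (-k)) * C.σ x, 0) : S × S) =
      algebraMap K S ((p : K) ^ (-m)) • logFrobenius C p ℓ (x, 0)
    rw [logFrobenius_apply, map_zero, zero_mul, sub_zero, Prod.smul_mk, smul_zero, smul_eq_mul,
      ← mul_assoc, ← map_mul, ← zpow_sub_one₀ hp, hk, neg_add']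
  comm_conn := fun (x : R) => by
    change (logConn K f).toFun (x, 0) =
      (LinearMap.inl R R R).lTensor Ω[R⁄K] ((tateConn K R).toFun x)
    rw [logConn_apply, tateConn_apply]
    simp
  map_Fil := fun i x hx => 
    ((logFil_inl (R := R) m k i hk).symm.le ⟨x, hx, rfl⟩).1

/-- The projection `Log(f)(m) ⟶ 𝒪(m)`, `e₀ ↦ 1`, `e₋₂ ↦ 0`. -/
def logSnd (m k : ℤ) (hk : k = m) : twist p hp (logObject p hp f ℓ hℓ) m ⟶ tate R C p hp k where
  dR := LinearMap.snd R R R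
  rig := LinearMap.snd S S S
  comm_c := snd_comparison (R := R) (S := S)
  comm_Φ := fun x => by
    subst hk
    rfl
  comm_conn := fun (x : R × R) => by
    change (tateConn K R).toFun (x.2 : R) =
      (LinearMap.snd R R R).lTensor Ω[R⁄K] ((logConn K f).toFun x)
    rw [logConn_apply, tateConn_apply]
    simp
  map_Fil := fun i (x : R × R) hx => by
    subst hk
    have h : x.2 ∈ (logFil R (i + k)).map (LinearMap.snd R R R) := ⟨x, hx, rfl⟩
    rw [logFil_snd] at h
    exact h

section cup

variable {n : ℕ} (h : Fin (n + 1) → Rˣ) (ℓ : Fin (n + 1) → S)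
  (hℓ : ∀ i, C.d (ℓ i) =
    algebraMap R S (((h i)⁻¹ : Rˣ) : R) • C.d (algebraMap R S (h i : R)) -
      algebraMap K S ((p : K)⁻¹) • C.σ (algebraMap R S (((h i)⁻¹ : Rˣ) : R)) •
        C.d (C.σ (algebraMap R S (h i : R))))

/-- The objects `Log(hᵢ)(i)`. -/
def cupM (i : Fin (n + 1)) : FilFMIC R C := twist p hp (logObject p hp (h i) (ℓ i) (hℓ i)) (i : ℕ)

/-- The composite maps `Log(h_{i+1})(i + 1) ⟶ 𝒪(i + 1) ⟶ Log(hᵢ)(i)`. -/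
def cupδ (i : Fin n) : cupM p hp h ℓ hℓ i.succ ⟶ cupM p hp h ℓ hℓ i.castSucc :=
  logSnd p hp _ _ _ _ (i.succ : ℕ) rfl ≫ logInl p hp _ _ _ _ _ (by simp)

/-- The map `𝒪(n + 1) ⟶ Log(hₙ)(n)`. -/
def cupι : tate R C p hp (n + 1) ⟶ cupM p hp h ℓ hℓ (Fin.last n) :=
  logInl p hp _ _ _ _ _ (by simp)

/-- The map `Log(h₀) ⟶ 𝒪`. -/
def cupπ : cupM p hp h ℓ hℓ 0 ⟶ tate R C p hp 0 :=
  logSnd p hp _ _ _ _ _ (by simp)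

theorem cup_cycles (i : Fin (n + 1)) :
    cycles (cupM p hp h ℓ hℓ) (cupδ p hp h ℓ hℓ) (cupπ p hp h ℓ hℓ) i =
      (LinearMap.ker (LinearMap.snd R R R) : Submodule R (R × R)) := by
  induction i using Fin.cases with
  | zero => rfl
  | succ k =>
    change LinearMap.ker (LinearMap.inl R R R ∘ₗ LinearMap.snd R R R) = _
    rw [LinearMap.ker_comp, LinearMap.ker_eq_bot.2 LinearMap.inl_injective]
    rfl

theorem cup_boundaries (i : Fin (n + 1)) (j : ℤ) :
    boundaries (cupM p hp h ℓ hℓ) (cupδ p hp h ℓ hℓ) (cupι p hp h ℓ hℓ) j i =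
      (tateFil R ((i : ℕ) + 1) j).map (LinearMap.inl R R R) := by
  induction i using Fin.lastCases with
  | last => exact boundaries_last (cupM p hp h ℓ hℓ) (cupδ p hp h ℓ hℓ) (cupι p hp h ℓ hℓ) j
  | cast k =>
    refine (boundaries_castSucc (cupM p hp h ℓ hℓ) (cupδ p hp h ℓ hℓ) (cupι p hp h ℓ hℓ) j k).trans
      ?_
    change (logFil R (j + (k.succ : ℕ))).map (LinearMap.inl R R R ∘ₗ LinearMap.snd R R R) = _
    rw [Submodule.map_comp, logFil_snd]
    simp

/-- The extension
`0 ⟶ 𝒪(n + 1) ⟶ Log(hₙ)(n) ⟶ ⋯ ⟶ Log(h₁)(1) ⟶ Log(h₀) ⟶ 𝒪 ⟶ 0`,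
spliced from the twists `0 ⟶ 𝒪(i + 1) ⟶ Log(hᵢ)(i) ⟶ 𝒪(i) ⟶ 0`; the element `ℓ i`
is to be `log^(σ)(hᵢ)`. It represents `[h₀] ∪ ⋯ ∪ [hₙ]`. -/
def cupExtension : YonedaExtension (tate R C p hp 0) (tate R C p hp (n + 1)) n where
  M := cupM p hp h ℓ hℓ
  ι := cupι p hp h ℓ hℓ
  δ := cupδ p hp h ℓ hℓ
  π := cupπ p hp h ℓ hℓ
  injective_ι := fun _ _ hxy => congrArg (Prod.fst : R × R → R) hxy
  exact := fun i j =>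
    ((congrArg _ (cup_cycles p hp h ℓ hℓ i)).trans (logFil_inl (R := R) _ _ j rfl)).trans
      (cup_boundaries p hp h ℓ hℓ i j).symm
  surjective_π := fun j => logFil_snd (R := R) 0 j

end cup

end log

end FilFMIC

end category

/-! ### The filtered `F`-isocrystals on a smooth affine scheme -/

theorem natCast_ne_zero_of_isFractionRing (p : ℕ) [hp : Fact p.Prime] (V : Type u) [CommRing V]
    [CharZero V] (K : Type u) [Field K] [Algebra V K] [IsFractionRing V K] : (p : K) ≠ 0 := by
  have h : (p : V) ≠ 0 := Nat.cast_ne_zero.2 hp.out.ne_zero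
  rw [← map_natCast (algebraMap V K)]
  exact (map_ne_zero_iff _ (IsFractionRing.injective V K)).2 h

/-- A ring endomorphism of `V` is injective. -/
theorem frobenius_injective (p : ℕ) [hp : Fact p.Prime] {V : Type u} [CommRing V] [IsDomain V]
    [IsDiscreteValuationRing V] [IsAdicComplete (IsLocalRing.maximalIdeal V) V] [CharZero V]
    [CharP (IsLocalRing.ResidueField V) p] (FV : V →+* V) : Function.Injective FV := by
  rw [RingHom.injective_iff_ker_eq_bot]
  by_contra hne
  have hprime : (RingHom.ker FV).IsPrime := RingHom.ker_isPrime FV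
  have hmax := IsLocalRing.eq_maximalIdeal (hprime.isMaximal hne)
  have hmem := natCast_mem_maximalIdeal p V
  rw [← hmax, RingHom.mem_ker, map_natCast] at hmem
  exact Nat.cast_ne_zero.2 hp.out.ne_zero hmem

section concrete

set_option linter.unusedSectionVars false

variable (p : ℕ) [hp : Fact p.Prime] {V : Type u} [CommRing V] [IsDomain V]
  [IsDiscreteValuationRing V] [IsAdicComplete (IsLocalRing.maximalIdeal V) V] [CharZero V]
  [CharP (IsLocalRing.ResidueField V) p] (K : Type u) [Field K] [Algebra V K] [IsFractionRing V K]
  {A : Type u} [CommRing A] [Algebra V A] (P : AffinePresentation V A)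

/-- The `K`-algebra `A^†_K = K ⊗ A^†`. -/
def DaggerK : Type u := K ⊗[V] Dagger p P

instance : CommRing (DaggerK p K P) := inferInstanceAs (CommRing (K ⊗[V] Dagger p P))

instance : Algebra K (DaggerK p K P) := inferInstanceAs (Algebra K (K ⊗[V] Dagger p P))

/-- The canonical map `A_K → A^†_K`. -/
def toDaggerK : K ⊗[V] A →ₐ[K] DaggerK p K P :=
  Algebra.TensorProduct.map (AlgHom.id K K) (toDagger p P)

instance : Algebra (K ⊗[V] A) (DaggerK p K P) := (toDaggerK p K P).toRingHom.toAlgebra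

instance : IsScalarTower K (K ⊗[V] A) (DaggerK p K P) :=
  IsScalarTower.of_algebraMap_eq fun k => ((toDaggerK p K P).commutes k).symm

/-- The canonical map `A^† → A^†_K`. -/
def daggerToK : Dagger p P →+* DaggerK p K P :=
  (Algebra.TensorProduct.includeRight : Dagger p P →ₐ[V] K ⊗[V] Dagger p P).toRingHom

theorem daggerToK_algebraMap (v : V) : daggerToK p K P (algebraMap V (Dagger p P) v) =
    algebraMap K (DaggerK p K P) (algebraMap V K v) := by
  change (Algebra.TensorProduct.includeRight : Dagger p P →ₐ[V] K ⊗[V] Dagger p P)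
    (algebraMap V (Dagger p P) v) = algebraMap K (K ⊗[V] Dagger p P) (algebraMap V K v)
  rw [AlgHom.commutes, ← IsScalarTower.algebraMap_apply]

/-- The extension of an endomorphism of `V` to `K = Frac V`. -/
def fracFrobenius (FV : V →+* V) : K →+* K :=
  IsFractionRing.map (frobenius_injective p FV)

theorem fracFrobenius_algebraMap (FV : V →+* V) (v : V) :
    fracFrobenius p K FV (algebraMap V K v) = algebraMap V K (FV v) := by
  unfold fracFrobenius IsFractionRing.map
  exact IsLocalization.map_eq (S := K) (Q := K) (M := nonZeroDivisors V)
    (T := nonZeroDivisors V) _ v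

/-- A `p`-th Frobenius on `A^†` compatible with the endomorphism `FV` of `V`: a ring endomorphism
`σ`, linear over `FV`, with `σ(x) ≡ x ^ p` modulo `p`. -/
structure FrobeniusLift (FV : V →+* V) where
  σ : Dagger p P →+* Dagger p P
  σ_algebraMap : ∀ v, σ (algebraMap V _ v) = algebraMap V _ (FV v)
  dvd_sub : ∀ x, (p : Dagger p P) ∣ σ x - x ^ p

variable {P} {FV : V →+* V} (σ : FrobeniusLift p P FV)

/-- The endomorphism `k ⊗ x ↦ F(k) ⊗ σ(x)` of `A^†_K`. -/
def FrobeniusLift.σK : DaggerK p K P →+* DaggerK p K P :=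
  let f : K →ₛₗ[FV] K :=
    { toFun := fracFrobenius p K FV
      map_add' := map_add _
      map_smul' := fun v k => by
        rw [Algebra.smul_def, map_mul, fracFrobenius_algebraMap, ← Algebra.smul_def] }
  let g : Dagger p P →ₛₗ[FV] Dagger p P :=
    { toFun := σ.σ
      map_add' := map_add _
      map_smul' := fun v x => by
        rw [Algebra.smul_def, map_mul, σ.σ_algebraMap, ← Algebra.smul_def] }
  let h : K ⊗[V] Dagger p P →ₛₗ[FV] K ⊗[V] Dagger p P := TensorProduct.map f g
  have hmul : ∀ x y : K ⊗[V] Dagger p P, h (x * y) = h x * h y := fun x y => by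
    induction x using TensorProduct.induction_on with
    | zero => rw [map_zero, zero_mul, map_zero, zero_mul]
    | add a b ha hb => rw [map_add, add_mul, map_add, ha, hb, add_mul]
    | tmul k a =>
      induction y using TensorProduct.induction_on with
      | zero => rw [map_zero, mul_zero, map_zero, mul_zero]
      | add c d hc hd => rw [map_add, mul_add, map_add, hc, hd, mul_add]
      | tmul l b =>
        rw [Algebra.TensorProduct.tmul_mul_tmul]
        change fracFrobenius p K FV (k * l) ⊗ₜ[V] σ.σ (a * b) =
          (fracFrobenius p K FV k ⊗ₜ[V] σ.σ a) * (fracFrobenius p K FV l ⊗ₜ[V] σ.σ b)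
        rw [map_mul, map_mul, Algebra.TensorProduct.tmul_mul_tmul]
  have hone : h 1 = 1 := by
    change fracFrobenius p K FV 1 ⊗ₜ[V] σ.σ 1 = (1 : K) ⊗ₜ[V] (1 : Dagger p P)
    rw [map_one, map_one]
  { toFun := h
    map_zero' := map_zero h
    map_add' := map_add h
    map_one' := hone
    map_mul' := hmul }

theorem FrobeniusLift.σK_algebraMap (k : K) :
    σ.σK p K (algebraMap K _ k) = algebraMap K _ (fracFrobenius p K FV k) := by
  change fracFrobenius p K FV k ⊗ₜ[V] σ.σ 1 = fracFrobenius p K FV k ⊗ₜ[V] 1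
  rw [map_one]

theorem FrobeniusLift.σK_daggerToK (x : Dagger p P) :
    σ.σK p K (daggerToK p K P x) = daggerToK p K P (σ.σ x) := by
  change fracFrobenius p K FV 1 ⊗ₜ[V] σ.σ x = (1 : K) ⊗ₜ[V] σ.σ x
  rw [map_one]

variable (P) in
/-- The image of `Ω¹_{A^†/V}` in `Ω¹_{A^†_K/K}`. -/
def integralForms : AddSubgroup Ω[DaggerK p K P⁄K] :=
  AddSubgroup.closure {ω | ∃ a b : Dagger p P,
    ω = daggerToK p K P a • KaehlerDifferential.D K _ (daggerToK p K P b)}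

variable (P) in
/-- The submodule spanned by the differentials which lie in `p ^ k` times the integral ones for
all `k`. The quotient of `Ω¹_{A^†_K/K}` by it is the module of continuous differentials. -/
def divisibleForms : Submodule (DaggerK p K P) Ω[DaggerK p K P⁄K] :=
  Submodule.span _ {ω | ∀ k : ℕ, ∃ η ∈ integralForms p K P, ω = (p : DaggerK p K P) ^ k • η}

/-- `A^†_K` with its Frobenius and its continuous differentials. -/
def FrobeniusLift.calculus : FrobeniusCalculus K (DaggerK p K P) where
  F := fracFrobenius p K FV
  σ := σ.σK p K
  σ_algebraMap := σ.σK_algebraMap p K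
  N := divisibleForms p K P
  N_le := by
    unfold divisibleForms
    rw [Submodule.span_le]
    intro ω hω
    refine Submodule.subset_span fun k => ?_
    obtain ⟨η, hη, rfl⟩ := hω k
    clear hω
    refine ⟨kaehlerFrobenius (σ.σK_algebraMap p K) η, ?_, ?_⟩
    · have hle : integralForms p K P ≤ (integralForms p K P).comap
          (kaehlerFrobenius (σ.σK_algebraMap p K)).toAddMonoidHom := by
        refine (AddSubgroup.closure_le _).2 ?_
        rintro _ ⟨a, b, rfl⟩
        refine AddSubgroup.subset_closure ⟨σ.σ a, σ.σ b, ?_⟩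
        rw [← σ.σK_daggerToK p K, ← σ.σK_daggerToK p K]
        exact (LinearMap.map_smulₛₗ (kaehlerFrobenius (σ.σK_algebraMap p K)) _ _).trans
          (congrArg _ (kaehlerFrobenius_D (σ.σK_algebraMap p K) _))
      exact hle hη
    · rw [LinearMap.map_smulₛₗ, map_pow, map_natCast]

/-- The category of filtered `F`-isocrystals on `Spec A` (with respect to `σ`). -/
abbrev FilteredIsocrystal : Type (u + 1) := FilFMIC (K ⊗[V] A) (σ.calculus p K)

/-- The Tate object `𝒪(n)`. -/
abbrev tateObject (n : ℤ) : FilteredIsocrystal p K σ :=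
  FilFMIC.tate _ _ p (natCast_ne_zero_of_isFractionRing p V K) n

/-! ### The function `log^(σ)` -/

theorem exists_frobeniusQuotient (f : Aˣ) : ∃ Y : overconvergentSeries p V P.m,
    σ.σ (toDagger p P f) * (1 - (p : Dagger p P) * Dagger.mk p P Y) = toDagger p P f ^ p := by
  obtain ⟨z, hz⟩ := σ.dvd_sub (toDagger p P f)
  obtain ⟨Y, hY⟩ := Dagger.mk_surjective p P (σ.σ (toDagger p P ((f⁻¹ : Aˣ) : A)) * z)
  refine ⟨Y, ?_⟩
  have h : σ.σ (toDagger p P (f : A)) * σ.σ (toDagger p P ((f⁻¹ : Aˣ) : A)) = 1 := by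
    rw [← map_mul, ← map_mul, Units.mul_inv, map_one, map_one]
  rw [hY]
  linear_combination hz - (p : Dagger p P) * z * h

/-- An overconvergent series `Y` with `f ^ p / σ(f) = 1 - p Y` in `A^†`. -/
def frobeniusQuotient (f : Aˣ) : overconvergentSeries p V P.m :=
  (exists_frobeniusQuotient p σ f).choose

theorem frobeniusQuotient_spec (f : Aˣ) :
    σ.σ (toDagger p P f) * (1 - (p : Dagger p P) * Dagger.mk p P (frobeniusQuotient p σ f)) =
      toDagger p P f ^ p :=
  (exists_frobeniusQuotient p σ f).choose_spec

/-- `log^(σ)(f) = p⁻¹ log (f ^ p / σ(f)) = - p⁻¹ ∑_{n ≥ 1} (1 - f ^ p / σ(f)) ^ n / n`, the image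
in `A^†_K` of an element of `A^†`. -/
def frobeniusLog (f : Aˣ) : DaggerK p K P :=
  - daggerToK p K P (Dagger.mk p P (logSeries p (frobeniusQuotient p σ f)))

theorem d_logSeries (Y : overconvergentSeries p V P.m) :
    (1 - (p : DaggerK p K P) * daggerToK p K P (Dagger.mk p P Y)) •
      (σ.calculus p K).d (daggerToK p K P (Dagger.mk p P (logSeries p Y))) =
    (σ.calculus p K).d (daggerToK p K P (Dagger.mk p P Y)) := by
  rw [← sub_eq_zero]
  simp only [FrobeniusCalculus.d]
  rw [← map_smul, ← map_sub, Submodule.mkQ_apply, Submodule.Quotient.mk_eq_zero]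
  change _ ∈ divisibleForms p K P
  refine Submodule.subset_span fun k => ?_
  obtain ⟨E, hE⟩ := logSeries_spec p Y k
  set y := daggerToK p K P (Dagger.mk p P Y) with hy
  set D := KaehlerDifferential.D K (DaggerK p K P)
  have hc : ∀ (v : V) (x : overconvergentSeries p V P.m),
      daggerToK p K P (Dagger.mk p P (v • x)) =
        algebraMap V K v • daggerToK p K P (Dagger.mk p P x) := by
    intro v x
    rw [map_smul, Algebra.smul_def, map_mul, daggerToK_algebraMap, ← Algebra.smul_def]
  have hterm : ∀ n, D (algebraMap V K (logCoeff p V n) • y ^ (n + 1)) =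
      ((p : DaggerK p K P) * y) ^ n • D y := by
    intro n
    have h1 : (((n + 1 : ℕ) : K)) * algebraMap V K (logCoeff p V n) = (p : K) ^ n := by
      rw [← map_natCast (algebraMap V K), ← map_mul, logCoeff_spec, map_pow, map_natCast]
    rw [Derivation.map_smul, Derivation.leibniz_pow, Nat.add_sub_cancel,
      ← algebraMap_smul (DaggerK p K P) (algebraMap V K (logCoeff p V n)),
      ← Nat.cast_smul_eq_nsmul (DaggerK p K P), smul_smul, smul_smul]
    congr 1
    rw [mul_pow, ← map_natCast (algebraMap K (DaggerK p K P)) (n + 1), ← map_mul,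
      mul_comm (algebraMap V K _), h1, map_pow, map_natCast]
  have hL : D (daggerToK p K P (Dagger.mk p P (logSeries p Y))) =
      (∑ n ∈ Finset.range (2 * k), ((p : DaggerK p K P) * y) ^ n) • D y +
        (p : DaggerK p K P) ^ k • D (daggerToK p K P (Dagger.mk p P E)) := by
    rw [hE, map_add, map_add, map_add, hc, map_sum, map_sum, map_sum, Finset.sum_smul]
    congr 1
    · refine Finset.sum_congr rfl fun n _ => ?_
      rw [hc, map_pow, map_pow, hterm]
    · rw [Derivation.map_smul, map_pow, map_natCast, ← algebraMap_smul (DaggerK p K P) ((p : K) ^ k),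
        map_pow, map_natCast]
  refine ⟨(1 - (p : DaggerK p K P) * y) • D (daggerToK p K P (Dagger.mk p P E)) -
    ((p : DaggerK p K P) ^ k * y ^ (2 * k)) • D y, ?_, ?_⟩
  · refine sub_mem (AddSubgroup.subset_closure ⟨1 - (p : Dagger p P) * Dagger.mk p P Y, Dagger.mk p P E, ?_⟩)
      (AddSubgroup.subset_closure ⟨(p : Dagger p P) ^ k * Dagger.mk p P Y ^ (2 * k), Dagger.mk p P Y, ?_⟩)
    · simp [hy, D]
    · simp [hy, D]
  · have hg : (1 - (p : DaggerK p K P) * y) *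
        ∑ n ∈ Finset.range (2 * k), ((p : DaggerK p K P) * y) ^ n =
          1 - ((p : DaggerK p K P) * y) ^ (2 * k) := mul_neg_geom_sum _ _
    rw [hL, smul_add, smul_smul, hg, smul_sub, smul_smul, smul_smul, sub_smul, one_smul, smul_smul,
      mul_comm ((p : DaggerK p K P) ^ k) (1 - _), mul_pow,
      show ((p : DaggerK p K P)) ^ (2 * k) * y ^ (2 * k) =
        (p : DaggerK p K P) ^ k * ((p : DaggerK p K P) ^ k * y ^ (2 * k)) by ring]
    abel

/-- The image in `A_K` of a unit of `A`. -/
def unitK (f : Aˣ) : (K ⊗[V] A)ˣ :=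
  Units.map (Algebra.TensorProduct.includeRight : A →ₐ[V] K ⊗[V] A).toRingHom.toMonoidHom f

theorem algebraMap_unitK (f : Aˣ) : algebraMap (K ⊗[V] A) (DaggerK p K P) ((unitK K f : (K ⊗[V] A)ˣ) : K ⊗[V] A) =
    daggerToK p K P (toDagger p P f) := by
  change Algebra.TensorProduct.map (AlgHom.id K K) (toDagger p P) ((1 : K) ⊗ₜ[V] (f : A)) =
    (1 : K) ⊗ₜ[V] toDagger p P f
  rw [Algebra.TensorProduct.map_tmul, map_one]

/-- `d log^(σ)(f) = df / f - p⁻¹ dσ(f) / σ(f)`. -/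
theorem d_frobeniusLog (f : Aˣ) : (σ.calculus p K).d (frobeniusLog p K σ f) =
    algebraMap (K ⊗[V] A) (DaggerK p K P) (((unitK K f)⁻¹ : (K ⊗[V] A)ˣ) : K ⊗[V] A) •
        (σ.calculus p K).d (algebraMap (K ⊗[V] A) (DaggerK p K P) ((unitK K f : (K ⊗[V] A)ˣ) : K ⊗[V] A)) -
      algebraMap K (DaggerK p K P) ((p : K)⁻¹) •
        (σ.calculus p K).σ (algebraMap (K ⊗[V] A) (DaggerK p K P)
          (((unitK K f)⁻¹ : (K ⊗[V] A)ˣ) : K ⊗[V] A)) •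
        (σ.calculus p K).d ((σ.calculus p K).σ
          (algebraMap (K ⊗[V] A) (DaggerK p K P) ((unitK K f : (K ⊗[V] A)ˣ) : K ⊗[V] A))) := by
  have hp0 : (p : K) ≠ 0 := natCast_ne_zero_of_isFractionRing p V K
  set w := 1 - (p : DaggerK p K P) * daggerToK p K P (Dagger.mk p P (frobeniusQuotient p σ f))
    with hw
  set a := algebraMap (K ⊗[V] A) (DaggerK p K P) ((unitK K f : (K ⊗[V] A)ˣ) : K ⊗[V] A) with ha
  set b := algebraMap (K ⊗[V] A) (DaggerK p K P) (((unitK K f)⁻¹ : (K ⊗[V] A)ˣ) : K ⊗[V] A)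
  have hab : a * b = 1 := by rw [← map_mul, Units.mul_inv, map_one]
  have hσ : (σ.calculus p K).σ a * (σ.calculus p K).σ b = 1 := by rw [← map_mul, hab, map_one]
  have hrel : (σ.calculus p K).σ a * w = a ^ p := by
    have := congrArg (daggerToK p K P) (frobeniusQuotient_spec p σ f)
    rw [map_mul, map_sub, map_one, map_mul, map_natCast, map_pow, ← algebraMap_unitK,
      ← σ.σK_daggerToK p K, ← algebraMap_unitK] at this
    exact this
  have hL := d_logSeries p K σ (frobeniusQuotient p σ f)
  rw [← hw] at hL
  set C := σ.calculus p K
  set y := daggerToK p K P (Dagger.mk p P (frobeniusQuotient p σ f))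
  set ℓ := daggerToK p K P (Dagger.mk p P (logSeries p (frobeniusQuotient p σ f)))
  set q := algebraMap K (DaggerK p K P) ((p : K)⁻¹)
  have hq : q * (p : DaggerK p K P) = 1 := by
    rw [← map_natCast (algebraMap K (DaggerK p K P)), ← map_mul, inv_mul_cancel₀ hp0, map_one]
  have e1 : C.d (frobeniusLog p K σ f) = - C.d ℓ := by
    rw [frobeniusLog]; simp only [FrobeniusCalculus.d, map_neg]; rfl
  have e2 : C.d w = - ((p : DaggerK p K P) • C.d y) := by
    have h0 : C.d (w + (p : DaggerK p K P) * y) = 0 := by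
      rw [hw, sub_add_cancel, C.d_one]
    have hdp : C.d (p : DaggerK p K P) = 0 := by
      rw [← map_natCast (algebraMap K (DaggerK p K P)), C.d_algebraMap]
    rw [C.d_add, C.d_mul, hdp, smul_zero, add_zero] at h0
    exact eq_neg_of_add_eq_zero_left h0
  have e3 : C.σ a • C.d w + w • C.d (C.σ a) = ((p : DaggerK p K P) * a ^ (p - 1)) • C.d a := by
    have := congrArg C.d hrel
    rw [C.d_mul] at this
    rw [this]
    simp only [FrobeniusCalculus.d, Derivation.leibniz_pow, map_smul,
      ← Nat.cast_smul_eq_nsmul (DaggerK p K P), smul_smul]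
  have hp1 : a ^ (p - 1) * a = a ^ p := pow_sub_one_mul hp.out.ne_zero a
  rw [e2, ← hL] at e3
  rw [e1, smul_smul]
  have hwi : w * (C.σ a * b ^ p) = 1 := by
    rw [← mul_assoc, mul_comm w, hrel, ← mul_pow, hab, one_pow]
  have e4 := congrArg (fun t => (q * C.σ b * (C.σ a * b ^ p)) • t) e3
  simp only [smul_add, smul_neg, smul_smul] at e4
  have c1 : q * C.σ b * (C.σ a * b ^ p) * (C.σ a * ((p : DaggerK p K P) * w)) = 1 := by
    linear_combination (C.σ b * (C.σ a * b ^ p) * w * C.σ a) * hq +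
      (w * (C.σ a * b ^ p)) * hσ + hwi
  have c2 : q * C.σ b * (C.σ a * b ^ p) * w = q * C.σ b := by
    linear_combination (q * C.σ b) * hwi
  have hpb : a ^ (p - 1) * b ^ p = b := by
    have : ∀ m : ℕ, m ≠ 0 → a ^ (m - 1) * b ^ m = b := by
      rintro (_ | r) hr
      · exact absurd rfl hr
      · rw [Nat.add_sub_cancel, pow_succ, ← mul_assoc, ← mul_pow, hab, one_pow, one_mul]
    exact this p hp.out.ne_zero
  have c3 : q * C.σ b * (C.σ a * b ^ p) * ((p : DaggerK p K P) * a ^ (p - 1)) = b := by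
    linear_combination (C.σ b * C.σ a * b ^ p * a ^ (p - 1)) * hq +
      (b ^ p * a ^ (p - 1)) * hσ + hpb
  rw [c1, c2, c3, one_smul] at e4
  rw [← e4]
  abel

end concrete

/-! ### Milnor `K`-groups and cup products -/

section milnor

variable (R : Type u) [CommRing R] (r : ℕ)

/-- The tensors `a₁ ⊗ ⋯ ⊗ b ⊗ ⋯ ⊗ (-b) ⊗ ⋯ ⊗ a_r` and `a₁ ⊗ ⋯ ⊗ b ⊗ ⋯ ⊗ (1 - b) ⊗ ⋯ ⊗ a_r`
in `(Rˣ)^{⊗ r}`. -/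
def milnorRelations : Set (PiTensorProduct ℤ fun _ : Fin r => Additive Rˣ) :=
  {t | ∃ a : Fin r → Rˣ,
    (∃ i j, i < j ∧ ((a j : R) = -(a i : R) ∨ (a j : R) = 1 - (a i : R))) ∧
    t = PiTensorProduct.tprod ℤ fun k => Additive.ofMul (a k)}

/-- The Milnor `K`-group `K^M_r(R)`, written additively. -/
abbrev MilnorK : Type u :=
  (PiTensorProduct ℤ fun _ : Fin r => Additive Rˣ) ⧸ Submodule.span ℤ (milnorRelations R r)

variable {R r}

/-- The symbol `{h₁, …, h_r}`. -/
def MilnorK.symbol (h : Fin r → Rˣ) : MilnorK R r :=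
  Submodule.Quotient.mk (PiTensorProduct.tprod ℤ fun k => Additive.ofMul (h k))

end milnor

section cup

variable (p : ℕ) [hp : Fact p.Prime] {V : Type u} [CommRing V] [IsDomain V]
  [IsDiscreteValuationRing V] [IsAdicComplete (IsLocalRing.maximalIdeal V) V] [CharZero V]
  [CharP (IsLocalRing.ResidueField V) p] (K : Type u) [Field K] [Algebra V K] [IsFractionRing V K]
  {A : Type u} [CommRing A] [Algebra V A] {P : AffinePresentation V A} {FV : V →+* V}
  (σ : FrobeniusLift p P FV)

/-- The class `[h₀] ∪ ⋯ ∪ [hₙ] ∈ Ext^{n+1}(𝒪, 𝒪(n + 1))` of the extension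
`0 ⟶ 𝒪(n + 1) ⟶ Log(hₙ)(n) ⟶ ⋯ ⟶ Log(h₁)(1) ⟶ Log(h₀) ⟶ 𝒪 ⟶ 0`. -/
def cup {n : ℕ} (h : Fin (n + 1) → Aˣ) :
    FilFMIC.Ext (tateObject p K σ 0) (tateObject p K σ (n + 1)) n :=
  FilFMIC.Ext.mk (FilFMIC.cupExtension p (natCast_ne_zero_of_isFractionRing p V K)
    (fun i => unitK K (h i)) (fun i => frobeniusLog p K σ (h i))
    (fun i => d_frobeniusLog p K σ (h i)))

end cup

end FilteredFIsocrystal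

end

open FilteredFIsocrystal

noncomputable section

/-! ### Yoneda extensions in an additive category with a class of short exact sequences -/

namespace YonedaExact

universe v w

/-! A log object is governed by two invariants of the unit: the form dlog f and the function
log^(σ)(f), whose differential is dlog f - p⁻¹ dlog σ(f). Both turn products into sums, so f ↦ [f]
is a homomorphism and the symbols [h₀] ∪ ⋯ ∪ [hₙ] are multilinear (`exists_logSES_sum`,
`frobeniusLog_mul`). It remains to kill [f] ∪ [g] for g = f, -f and 1 - f.

An extension splits after pullback to its own middle term. Hence [f] ∪ [g] = 0 as soon as the
extension Log(f) of 𝒪 by 𝒪(1) lifts to an extension of 𝒪 by Log(g)(1) (`splice_mk_eq_zero`). Such a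
lift has a basis e₀, e₋₂, e₋₄ with ∇e₀ = dlog f ⊗ e₋₂ and Φ(e₀) = e₀ - log^(σ)(f) e₋₂ + θ e₋₄. Its
connection is integrable because df ∧ dg = 0, and Φ is horizontal exactly if dθ = log^(σ)(f) dlog g
- p⁻¹ log^(σ)(g) dlog σ(f) (`exists_dominating`). For g = f one takes θ = log^(σ)(f)² / 2; the same
θ serves for g = -f.

For g = 1 - f the function θ is a p-adic dilogarithm, and the point is that it is overconvergent.
Put L(Y) = -p⁻¹ log(1 - pY), t = -f / (1 - f), and f^p / σ(f) = 1 - ps. The Frobenius quotient of f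
/ (1 - f) is then 1 - pQ for a universal polynomial Q in t and s, and the required form is ((1 - t)
L(s) - L(Q)) dt / (t (1 - t)) - (L(Q) - L(s)) ds / (1 - ps). This is a closed form in two variables
without poles at t = 0 and t = 1. It is integrated term by term in t. The denominators grow
logarithmically with the degree, while the coefficients of L gain powers of p linearly, so the sum
of the integrals is overconvergent (`exists_steinbergPrimitive`, `exists_padicSum`). The same
integration technique proves the functional equation of L (`logSeries_add`).

The formal part makes Ext a group. Because the graded pieces are projective, short exact sequences
have filtered linear splittings (`exists_splitting`), so pushouts and pullbacks exist. Yoneda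
classes are compared with classes of spliced short exact sequences (`Ext.equiv`), for which the Baer
sum is built from pushouts and pullbacks. Finally, a multilinear map which vanishes on adjacent
equal arguments is alternating, so the Milnor relations reduce to adjacent arguments
(`MilnorK.lift`). -/

/-- An additive category with a class of short exact sequences which is stable under direct sums
and under pushouts and pullbacks at the ends, and contains the split sequences. -/
class ExactCat (𝒞 : Type w) [Category.{v} 𝒞] [Preadditive 𝒞] where
  sum : 𝒞 → 𝒞 → 𝒞
  inl : ∀ X Y : 𝒞, X ⟶ sum X Y
  inr : ∀ X Y : 𝒞, Y ⟶ sum X Y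
  fst : ∀ X Y : 𝒞, sum X Y ⟶ X
  snd : ∀ X Y : 𝒞, sum X Y ⟶ Y
  inl_fst : ∀ X Y : 𝒞, inl X Y ≫ fst X Y = 𝟙 X
  inl_snd : ∀ X Y : 𝒞, inl X Y ≫ snd X Y = 0
  inr_fst : ∀ X Y : 𝒞, inr X Y ≫ fst X Y = 0
  inr_snd : ∀ X Y : 𝒞, inr X Y ≫ snd X Y = 𝟙 Y
  total : ∀ X Y : 𝒞, fst X Y ≫ inl X Y + snd X Y ≫ inr X Y = 𝟙 (sum X Y)
  /-- the class of short exact sequences -/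
  Conf : ∀ {A B C : 𝒞}, (A ⟶ B) → (B ⟶ C) → Prop
  conf_split : ∀ X Y : 𝒞, Conf (inl X Y) (snd X Y)
  conf_sum : ∀ {A B C A' B' C' : 𝒞} {i : A ⟶ B} {q : B ⟶ C} {i' : A' ⟶ B'} {q' : B' ⟶ C'},
    Conf i q → Conf i' q' →
      Conf (fst A A' ≫ i ≫ inl B B' + snd A A' ≫ i' ≫ inr B B')
        (fst B B' ≫ q ≫ inl C C' + snd B B' ≫ q' ≫ inr C C')
  conf_comp : ∀ {A B C : 𝒞} {i : A ⟶ B} {q : B ⟶ C}, Conf i q → i ≫ q = 0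
  exists_push : ∀ {A B C A' : 𝒞} {i : A ⟶ B} {q : B ⟶ C}, Conf i q → ∀ b : A ⟶ A',
    ∃ (B' : 𝒞) (i' : A' ⟶ B') (q' : B' ⟶ C) (f : B ⟶ B'),
      Conf i' q' ∧ IsPushout i b f i' ∧ f ≫ q' = q
  exists_pull : ∀ {A B C C' : 𝒞} {i : A ⟶ B} {q : B ⟶ C}, Conf i q → ∀ a : C' ⟶ C,
    ∃ (B' : 𝒞) (i' : A ⟶ B') (q' : B' ⟶ C') (f : B' ⟶ B),
      Conf i' q' ∧ IsPullback f q' q a ∧ i' ≫ f = i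

attribute [simp] ExactCat.inl_fst ExactCat.inl_snd ExactCat.inr_fst ExactCat.inr_snd

variable {𝒞 : Type w} [Category.{v} 𝒞] [Preadditive 𝒞] [ExactCat 𝒞]

open ExactCat

/-! ### Morphisms between finite direct sums. -/

section sums

variable {X Y Z X' Y' Z' W : 𝒞}

@[simp] theorem inl_fst_assoc (h : X ⟶ W) : inl X Y ≫ fst X Y ≫ h = h := by
  rw [← Category.assoc, inl_fst, Category.id_comp]

@[simp] theorem inl_snd_assoc (h : Y ⟶ W) : inl X Y ≫ snd X Y ≫ h = 0 := by
  rw [← Category.assoc, inl_snd, Limits.zero_comp]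

@[simp] theorem inr_fst_assoc (h : X ⟶ W) : inr X Y ≫ fst X Y ≫ h = 0 := by
  rw [← Category.assoc, inr_fst, Limits.zero_comp]

@[simp] theorem inr_snd_assoc (h : Y ⟶ W) : inr X Y ≫ snd X Y ≫ h = h := by
  rw [← Category.assoc, inr_snd, Category.id_comp]

theorem sum_hom_ext {f g : sum X Y ⟶ W} (h₁ : inl X Y ≫ f = inl X Y ≫ g)
    (h₂ : inr X Y ≫ f = inr X Y ≫ g) : f = g := by
  rw [← Category.id_comp f, ← Category.id_comp g, ← total, Preadditive.add_comp,
    Preadditive.add_comp, Category.assoc, Category.assoc, Category.assoc, Category.assoc, h₁, h₂]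

/-- The direct sum of two morphisms. -/
def sumMap (f : X ⟶ X') (g : Y ⟶ Y') : sum X Y ⟶ sum X' Y' :=
  fst X Y ≫ f ≫ inl X' Y' + snd X Y ≫ g ≫ inr X' Y'

/-- The diagonal. -/
def diag (X : 𝒞) : X ⟶ sum X X := inl X X + inr X X

/-- The codiagonal. -/
def codiag (X : 𝒞) : sum X X ⟶ X := fst X X + snd X X

/-- The exchange of summands. -/
def swap (X Y : 𝒞) : sum X Y ⟶ sum Y X := fst X Y ≫ inr Y X + snd X Y ≫ inl Y X

/-- The associativity isomorphism. -/
def assocHom (X Y Z : 𝒞) : sum (sum X Y) Z ⟶ sum X (sum Y Z) :=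
  fst _ _ ≫ (fst _ _ ≫ inl _ _ + snd _ _ ≫ inl _ _ ≫ inr _ _) + snd _ _ ≫ inr _ _ ≫ inr _ _

variable (f : X ⟶ X') (g : Y ⟶ Y')

@[simp] theorem inl_sumMap : inl X Y ≫ sumMap f g = f ≫ inl X' Y' := by simp [sumMap]
@[simp] theorem inr_sumMap : inr X Y ≫ sumMap f g = g ≫ inr X' Y' := by simp [sumMap]
@[simp] theorem inl_codiag : inl X X ≫ codiag X = 𝟙 X := by simp [codiag]
@[simp] theorem inr_codiag : inr X X ≫ codiag X = 𝟙 X := by simp [codiag]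
@[simp] theorem inl_swap : inl X Y ≫ swap X Y = inr Y X := by simp [swap]
@[simp] theorem inr_swap : inr X Y ≫ swap X Y = inl Y X := by simp [swap]
@[simp] theorem inl_assocHom : inl (sum X Y) Z ≫ assocHom X Y Z =
    fst _ _ ≫ inl _ _ + snd _ _ ≫ inl _ _ ≫ inr _ _ := by simp [assocHom]
@[simp] theorem inr_assocHom : inr (sum X Y) Z ≫ assocHom X Y Z = inr _ _ ≫ inr _ _ := by
  simp [assocHom]

@[simp] theorem inl_sumMap_assoc (h : sum X' Y' ⟶ W) :
    inl X Y ≫ sumMap f g ≫ h = f ≫ inl X' Y' ≫ h := by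
  rw [← Category.assoc, inl_sumMap, Category.assoc]
@[simp] theorem inr_sumMap_assoc (h : sum X' Y' ⟶ W) :
    inr X Y ≫ sumMap f g ≫ h = g ≫ inr X' Y' ≫ h := by
  rw [← Category.assoc, inr_sumMap, Category.assoc]
@[simp] theorem inl_codiag_assoc (h : X ⟶ W) : inl X X ≫ codiag X ≫ h = h := by
  rw [← Category.assoc, inl_codiag, Category.id_comp]
@[simp] theorem inr_codiag_assoc (h : X ⟶ W) : inr X X ≫ codiag X ≫ h = h := by
  rw [← Category.assoc, inr_codiag, Category.id_comp]
@[simp] theorem inl_swap_assoc (h : sum Y X ⟶ W) : inl X Y ≫ swap X Y ≫ h = inr Y X ≫ h := by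
  rw [← Category.assoc, inl_swap]
@[simp] theorem inr_swap_assoc (h : sum Y X ⟶ W) : inr X Y ≫ swap X Y ≫ h = inl Y X ≫ h := by
  rw [← Category.assoc, inr_swap]
@[simp] theorem inl_assocHom_assoc (h : sum X (sum Y Z) ⟶ W) :
    inl (sum X Y) Z ≫ assocHom X Y Z ≫ h =
      fst _ _ ≫ inl _ _ ≫ h + snd _ _ ≫ inl _ _ ≫ inr _ _ ≫ h := by
  rw [← Category.assoc, inl_assocHom]; simp
@[simp] theorem inr_assocHom_assoc (h : sum X (sum Y Z) ⟶ W) :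
    inr (sum X Y) Z ≫ assocHom X Y Z ≫ h = inr _ _ ≫ inr _ _ ≫ h := by
  rw [← Category.assoc, inr_assocHom]; simp

/-- Commutativity and associativity of the Baer sum reduce to this identity and the next three,
which treat the left and the right ends of the sequences separately. -/
theorem swap_codiag : swap X X ≫ codiag X = codiag X := by
  apply sum_hom_ext <;> simp

theorem diag_swap : diag X ≫ swap X X = diag X := by
  simp [diag, add_comm]

theorem assocHom_codiag : assocHom X X X ≫ sumMap (𝟙 X) (codiag X) ≫ codiag X =
    sumMap (codiag X) (𝟙 X) ≫ codiag X := by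
  apply sum_hom_ext
  · apply sum_hom_ext <;> simp
  · simp

theorem diag_assocHom : (diag X ≫ sumMap (diag X) (𝟙 X)) ≫ assocHom X X X =
    diag X ≫ sumMap (𝟙 X) (diag X) := by
  simp [diag, add_assoc]

theorem diag_natural : f ≫ diag X' = diag X ≫ sumMap f f := by simp [diag]

theorem codiag_natural : codiag X ≫ f = sumMap f f ≫ codiag X' := by
  apply sum_hom_ext <;> simp

theorem diag_sumMap_codiag (f g : X ⟶ X') : diag X ≫ sumMap f g ≫ codiag X' = f + g := by
  simp [diag]

end sums

/-! ### Short exact sequences and their morphisms -/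

/-- A short exact sequence `0 ⟶ H' ⟶ M ⟶ H ⟶ 0`. -/
structure SES (H H' : 𝒞) where
  M : 𝒞
  ι : H' ⟶ M
  π : M ⟶ H
  conf : Conf ι π

variable {H H' L L' N N' Z Z' Y Y' : 𝒞}

namespace SES

/-- There is a morphism of short exact sequences with given ends. -/
def HasMap (E : SES H H') (F : SES L L') (b : H' ⟶ L') (a : H ⟶ L) : Prop :=
  ∃ f : E.M ⟶ F.M, E.ι ≫ f = b ≫ F.ι ∧ E.π ≫ a = f ≫ F.π

theorem HasMap.id (E : SES H H') : E.HasMap E (𝟙 H') (𝟙 H) := ⟨𝟙 _, by simp, by simp⟩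

theorem HasMap.comp {E : SES H H'} {F : SES L L'} {G : SES N N'} {b : H' ⟶ L'} {a : H ⟶ L}
    {b' : L' ⟶ N'} {a' : L ⟶ N} (h : E.HasMap F b a) (h' : F.HasMap G b' a') :
    E.HasMap G (b ≫ b') (a ≫ a') := by
  obtain ⟨f, h1, h2⟩ := h
  obtain ⟨f', h1', h2'⟩ := h'
  refine ⟨f ≫ f', ?_, ?_⟩
  · rw [← Category.assoc, h1, Category.assoc, h1', Category.assoc]
  · rw [← Category.assoc, h2, Category.assoc, h2', Category.assoc]

theorem HasMap.zero (E : SES H H') (F : SES L L') : E.HasMap F 0 0 := ⟨0, by simp, by simp⟩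

/-- The direct sum of short exact sequences. -/
def sum (E : SES H H') (F : SES L L') : SES (ExactCat.sum H L) (ExactCat.sum H' L') :=
  ⟨ExactCat.sum E.M F.M, sumMap E.ι F.ι, sumMap E.π F.π, conf_sum E.conf F.conf⟩

theorem HasMap.sum {E : SES H H'} {F : SES L L'} {E' : SES Z Z'} {F' : SES Y Y'} {b : H' ⟶ Z'}
    {a : H ⟶ Z} {b' : L' ⟶ Y'} {a' : L ⟶ Y} (h : E.HasMap E' b a) (h' : F.HasMap F' b' a') :
    (E.sum F).HasMap (E'.sum F') (sumMap b b') (sumMap a a') := by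
  obtain ⟨f, h1, h2⟩ := h
  obtain ⟨f', h1', h2'⟩ := h'
  refine ⟨sumMap f f', ?_, ?_⟩ <;> apply sum_hom_ext <;> simp only [SES.sum, inl_sumMap_assoc,
    inr_sumMap_assoc, inl_sumMap, inr_sumMap]
  · rw [← Category.assoc, h1, Category.assoc]
  · rw [← Category.assoc, h1', Category.assoc]
  · rw [← Category.assoc, h2, Category.assoc]
  · rw [← Category.assoc, h2', Category.assoc]

theorem HasMap.diag (E : SES H H') :
    E.HasMap (E.sum E) (YonedaExact.diag H') (YonedaExact.diag H) :=
  ⟨YonedaExact.diag E.M, diag_natural _, diag_natural _⟩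

theorem HasMap.codiag (E : SES H H') :
    (E.sum E).HasMap E (YonedaExact.codiag H') (YonedaExact.codiag H) :=
  ⟨YonedaExact.codiag E.M, (codiag_natural _).symm, (codiag_natural _).symm⟩

theorem HasMap.swap (E : SES H H') (F : SES L L') :
    (E.sum F).HasMap (F.sum E) (YonedaExact.swap H' L') (YonedaExact.swap H L) := by
  refine ⟨YonedaExact.swap E.M F.M, ?_, ?_⟩ <;> apply sum_hom_ext <;> simp [SES.sum]

theorem HasMap.assocHom (E : SES H H') (F : SES L L') (G : SES N N') :
    ((E.sum F).sum G).HasMap (E.sum (F.sum G)) (YonedaExact.assocHom H' L' N')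
      (YonedaExact.assocHom H L N) := by
  refine ⟨YonedaExact.assocHom E.M F.M G.M, ?_, ?_⟩ <;> apply sum_hom_ext
  · apply sum_hom_ext <;> simp [SES.sum]
  · simp [SES.sum]
  · apply sum_hom_ext <;> simp [SES.sum]
  · simp [SES.sum]

/-- The split sequence. -/
def split (H H' : 𝒞) : SES H H' := ⟨ExactCat.sum H' H, inl _ _, snd _ _, conf_split _ _⟩

/-- It exhibits a split sequence as the pullback of a split sequence along zero, so that its class
vanishes. -/
theorem HasMap.split_zero (H H' L : 𝒞) : (split H H').HasMap (split L H') (𝟙 H') 0 :=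
  ⟨sumMap (𝟙 H') 0, by simp [split], by apply sum_hom_ext <;> simp [split]⟩

theorem ι_π (E : SES H H') : E.ι ≫ E.π = 0 := conf_comp E.conf

/-- The pullback of a sequence along its own projection splits, the identity of the middle term
being a section. All vanishing results for products come from this. -/
theorem HasMap.split_π (E : SES H H') : (split E.M H').HasMap E (𝟙 H') E.π :=
  ⟨fst _ _ ≫ E.ι + snd _ _, by simp [split], by
    apply sum_hom_ext <;> simp [split, E.ι_π]⟩

/-- The universal property is needed for maps of whole sequences with an arbitrary right end. It
follows from that of the pushout square, because the projection of the new sequence is determined by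
its restrictions to `B` and to `L'`. -/
theorem exists_push (E : SES H H') (b : H' ⟶ L') : ∃ F : SES H L', E.HasMap F b (𝟙 H) ∧
    ∀ {N N' : 𝒞} (G : SES N N') (b' : L' ⟶ N') (a : H ⟶ N), E.HasMap G (b ≫ b') a →
      F.HasMap G b' a := by
  obtain ⟨B, i, q, f, hc, hp, h⟩ := ExactCat.exists_push E.conf b
  refine ⟨⟨B, i, q, hc⟩, ⟨f, hp.w, by rw [Category.comp_id, h]⟩, fun {N N'} G b' a hG => ?_⟩
  obtain ⟨g, h1, h2⟩ := hG
  refine ⟨hp.desc g (b' ≫ G.ι) (by rw [h1, Category.assoc]), hp.inr_desc _ _ _,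
    hp.hom_ext ?_ ?_⟩
  · rw [← Category.assoc, ← Category.assoc, h, hp.inl_desc, h2]
  · rw [← Category.assoc, conf_comp hc, ← Category.assoc, hp.inr_desc, Category.assoc, G.ι_π,
      Limits.zero_comp, Limits.comp_zero]

theorem exists_pull (E : SES H H') (a : L ⟶ H) : ∃ F : SES L H', F.HasMap E (𝟙 H') a ∧
    ∀ {N N' : 𝒞} (G : SES N N') (b : N' ⟶ H') (a' : N ⟶ L), G.HasMap E b (a' ≫ a) →
      G.HasMap F b a' := by
  obtain ⟨B, i, q, f, hc, hp, h⟩ := ExactCat.exists_pull E.conf a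
  refine ⟨⟨B, i, q, hc⟩, ⟨f, by rw [Category.id_comp, h], hp.w.symm⟩, fun {N N'} G b a' hG => ?_⟩
  obtain ⟨g, h1, h2⟩ := hG
  have hw : g ≫ E.π = (G.π ≫ a') ≫ a := by rw [← h2, Category.assoc]
  refine ⟨hp.lift g (G.π ≫ a') hw, hp.hom_ext ?_ ?_, (hp.lift_snd _ _ _).symm⟩
  · rw [Category.assoc (G.ι), hp.lift_fst, h1, Category.assoc, h]
  · rw [Category.assoc (G.ι), hp.lift_snd, ← Category.assoc, G.ι_π, Category.assoc,
      conf_comp hc, Limits.zero_comp, Limits.comp_zero]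

/-- The pushout of a short exact sequence. -/
def push (b : H' ⟶ L') (E : SES H H') : SES H L' := (E.exists_push b).choose

theorem hasMap_push (b : H' ⟶ L') (E : SES H H') : E.HasMap (push b E) b (𝟙 H) :=
  (E.exists_push b).choose_spec.1

theorem HasMap.of_push {b : H' ⟶ L'} {E : SES H H'} {G : SES N N'} {b' : L' ⟶ N'} {a : H ⟶ N}
    (h : E.HasMap G (b ≫ b') a) : (push b E).HasMap G b' a :=
  (E.exists_push b).choose_spec.2 G b' a h

/-- The pullback of a short exact sequence. -/
def pull (a : L ⟶ H) (E : SES H H') : SES L H' := (E.exists_pull a).choose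

theorem hasMap_pull (a : L ⟶ H) (E : SES H H') : (pull a E).HasMap E (𝟙 H') a :=
  (E.exists_pull a).choose_spec.1

theorem HasMap.to_pull {a : L ⟶ H} {E : SES H H'} {G : SES N N'} {b : N' ⟶ H'} {a' : N ⟶ L}
    (h : G.HasMap E b (a' ≫ a)) : G.HasMap (pull a E) b a' :=
  (E.exists_pull a).choose_spec.2 G b a' h

end SES

/-! ### Spliced sequences -/

/-- `(n + 1)`-fold extensions of `H` by `H'`, as spliced short exact sequences. -/
def YE : ℕ → 𝒞 → 𝒞 → Type (max v w)
  | 0, H, H' => SES H H'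
  | n + 1, H, H' => Σ Z : 𝒞, YE n Z H' × SES H Z

namespace YE

/-- There is a morphism of spliced sequences with given ends. -/
def HasMap : ∀ {n : ℕ} {H H' L L' : 𝒞}, YE n H H' → YE n L L' → (H' ⟶ L') → (H ⟶ L) → Prop
  | 0, _, _, _, _ => fun E F b a => SES.HasMap E F b a
  | _ + 1, _, _, _, _ => fun E F b a =>
      ∃ z : E.1 ⟶ F.1, HasMap E.2.1 F.2.1 b z ∧ E.2.2.HasMap F.2.2 z a

/-- The splice of an extension with a short exact sequence. -/
def splice {n : ℕ} (E : YE n Z H') (S : SES H Z) : YE (n + 1) H H' := ⟨Z, E, S⟩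

variable {n : ℕ}

theorem HasMap.splice {E : YE n Z H'} {F : YE n Y L'} {S : SES H Z} {T : SES L Y} {b : H' ⟶ L'}
    {z : Z ⟶ Y} {a : H ⟶ L} (h : E.HasMap F b z) (h' : S.HasMap T z a) :
    (E.splice S).HasMap (F.splice T) b a := ⟨z, h, h'⟩

theorem HasMap.id : ∀ {n : ℕ} {H H' : 𝒞} (E : YE n H H'), E.HasMap E (𝟙 H') (𝟙 H)
  | 0, _, _, E => SES.HasMap.id E
  | _ + 1, _, _, E => ⟨𝟙 _, HasMap.id E.2.1, SES.HasMap.id E.2.2⟩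

theorem HasMap.comp : ∀ {n : ℕ} {H H' L L' N N' : 𝒞} {E : YE n H H'} {F : YE n L L'}
    {G : YE n N N'} {b : H' ⟶ L'} {a : H ⟶ L} {b' : L' ⟶ N'} {a' : L ⟶ N},
    E.HasMap F b a → F.HasMap G b' a' → E.HasMap G (b ≫ b') (a ≫ a')
  | 0, _, _, _, _, _, _, _, _, _, _, _, _, _, h, h' => SES.HasMap.comp h h'
  | _ + 1, _, _, _, _, _, _, _, _, _, _, _, _, _, ⟨z, h1, h2⟩, ⟨z', h1', h2'⟩ =>
    ⟨z ≫ z', HasMap.comp h1 h1', SES.HasMap.comp h2 h2'⟩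

theorem HasMap.zero : ∀ {n : ℕ} {H H' L L' : 𝒞} (E : YE n H H') (F : YE n L L'), E.HasMap F 0 0
  | 0, _, _, _, _, E, F => SES.HasMap.zero E F
  | _ + 1, _, _, _, _, E, F => ⟨0, HasMap.zero E.2.1 F.2.1, SES.HasMap.zero E.2.2 F.2.2⟩

/-- The direct sum of spliced sequences. -/
def sum : ∀ {n : ℕ} {H H' L L' : 𝒞}, YE n H H' → YE n L L' →
    YE n (ExactCat.sum H L) (ExactCat.sum H' L')
  | 0, _, _, _, _ => fun E F => SES.sum E F
  | _ + 1, _, _, _, _ => fun E F => ⟨_, sum E.2.1 F.2.1, E.2.2.sum F.2.2⟩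

theorem HasMap.sum : ∀ {n : ℕ} {H H' L L' Z Z' Y Y' : 𝒞} {E : YE n H H'} {F : YE n L L'}
    {E' : YE n Z Z'} {F' : YE n Y Y'} {b : H' ⟶ Z'} {a : H ⟶ Z} {b' : L' ⟶ Y'} {a' : L ⟶ Y},
    E.HasMap E' b a → F.HasMap F' b' a' → (E.sum F).HasMap (E'.sum F') (sumMap b b') (sumMap a a')
  | 0, _, _, _, _, _, _, _, _, _, _, _, _, _, _, _, _, h, h' => SES.HasMap.sum h h'
  | _ + 1, _, _, _, _, _, _, _, _, _, _, _, _, _, _, _, _, ⟨z, h1, h2⟩, ⟨z', h1', h2'⟩ =>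
    ⟨sumMap z z', HasMap.sum h1 h1', SES.HasMap.sum h2 h2'⟩

theorem HasMap.codiag : ∀ {n : ℕ} {H H' : 𝒞} (E : YE n H H'),
    (E.sum E).HasMap E (YonedaExact.codiag H') (YonedaExact.codiag H)
  | 0, _, _, E => SES.HasMap.codiag E
  | _ + 1, _, _, E => ⟨_, HasMap.codiag E.2.1, SES.HasMap.codiag E.2.2⟩

theorem HasMap.swap : ∀ {n : ℕ} {H H' L L' : 𝒞} (E : YE n H H') (F : YE n L L'),
    (E.sum F).HasMap (F.sum E) (YonedaExact.swap H' L') (YonedaExact.swap H L)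
  | 0, _, _, _, _, E, F => SES.HasMap.swap E F
  | _ + 1, _, _, _, _, E, F => ⟨_, HasMap.swap E.2.1 F.2.1, SES.HasMap.swap E.2.2 F.2.2⟩

theorem HasMap.assocHom : ∀ {n : ℕ} {H H' L L' N N' : 𝒞} (E : YE n H H') (F : YE n L L')
    (G : YE n N N'), ((E.sum F).sum G).HasMap (E.sum (F.sum G)) (YonedaExact.assocHom H' L' N')
      (YonedaExact.assocHom H L N)
  | 0, _, _, _, _, _, _, E, F, G => SES.HasMap.assocHom E F G
  | _ + 1, _, _, _, _, _, _, E, F, G =>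
    ⟨_, HasMap.assocHom E.2.1 F.2.1 G.2.1, SES.HasMap.assocHom E.2.2 F.2.2 G.2.2⟩

/-- The pushout of an extension. -/
def push : ∀ {n : ℕ} {H H' L' : 𝒞}, (H' ⟶ L') → YE n H H' → YE n H L'
  | 0, _, _, _ => fun b E => SES.push b E
  | _ + 1, _, _, _ => fun b E => ⟨E.1, push b E.2.1, E.2.2⟩

theorem hasMap_push : ∀ {n : ℕ} {H H' L' : 𝒞} (b : H' ⟶ L') (E : YE n H H'),
    E.HasMap (push b E) b (𝟙 H)
  | 0, _, _, _, b, E => SES.hasMap_push b E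
  | _ + 1, _, _, _, b, E => ⟨𝟙 _, hasMap_push b E.2.1, SES.HasMap.id _⟩

theorem HasMap.of_push : ∀ {n : ℕ} {H H' L' N N' : 𝒞} {b : H' ⟶ L'} {E : YE n H H'}
    {G : YE n N N'} {b' : L' ⟶ N'} {a : H ⟶ N}, E.HasMap G (b ≫ b') a → (push b E).HasMap G b' a
  | 0, _, _, _, _, _, _, _, _, _, _, h => SES.HasMap.of_push h
  | _ + 1, _, _, _, _, _, _, _, _, _, _, ⟨z, h1, h2⟩ => ⟨z, HasMap.of_push h1, h2⟩

/-- The pullback of an extension. -/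
def pull : ∀ {n : ℕ} {H H' L : 𝒞}, (L ⟶ H) → YE n H H' → YE n L H'
  | 0, _, _, _ => fun a E => SES.pull a E
  | _ + 1, _, _, _ => fun a E => ⟨E.1, E.2.1, E.2.2.pull a⟩

theorem hasMap_pull : ∀ {n : ℕ} {H H' L : 𝒞} (a : L ⟶ H) (E : YE n H H'),
    (pull a E).HasMap E (𝟙 H') a
  | 0, _, _, _, a, E => SES.hasMap_pull a E
  | _ + 1, _, _, _, a, E => ⟨𝟙 _, HasMap.id _, SES.hasMap_pull a E.2.2⟩

theorem HasMap.to_pull : ∀ {n : ℕ} {H H' L N N' : 𝒞} {a : L ⟶ H} {E : YE n H H'}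
    {G : YE n N N'} {b : N' ⟶ H'} {a' : N ⟶ L}, G.HasMap E b (a' ≫ a) → G.HasMap (pull a E) b a'
  | 0, _, _, _, _, _, _, _, _, _, _, h => SES.HasMap.to_pull h
  | _ + 1, _, _, _, _, _, _, _, _, _, _, ⟨z, h1, h2⟩ => ⟨z, h1, SES.HasMap.to_pull h2⟩

/-- Some extension has to exist in each degree, because the zero class is defined as the pullback of
one along zero. -/
theorem nonempty : ∀ (n : ℕ) (H H' : 𝒞), Nonempty (YE n H H')
  | 0, H, H' => ⟨SES.split H H'⟩
  | n + 1, H, H' => by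
    obtain ⟨E⟩ := nonempty n H' H'
    exact ⟨E.splice (SES.split H H')⟩

end YE

/-! ### The group of classes of extensions -/

/-- Classes of `(n + 1)`-fold extensions of `H` by `H'`. -/
def YExt (n : ℕ) (H H' : 𝒞) : Type (max v w) :=
  Quot fun E F : YE n H H' => E.HasMap F (𝟙 H') (𝟙 H)

namespace YExt

variable {n : ℕ}

/-- The class of a spliced sequence. -/
def mk (E : YE n H H') : YExt n H H' := Quot.mk _ E

theorem mk_surjective (x : YExt n H H') : ∃ E, mk E = x := Quot.exists_rep x

theorem mk_eq {E F : YE n H H'} (h : E.HasMap F (𝟙 H') (𝟙 H)) : mk E = mk F := Quot.sound h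

/-- Functoriality in the second argument. -/
def push (b : H' ⟶ L') : YExt n H H' → YExt n H L' :=
  Quot.map (YE.push b) fun E F h => YE.HasMap.of_push (by
    rw [Category.comp_id]
    simpa using h.comp (YE.hasMap_push b F))

/-- Functoriality in the first argument. -/
def pull (a : L ⟶ H) : YExt n H H' → YExt n L H' :=
  Quot.map (YE.pull a) fun E F h => YE.HasMap.to_pull (by
    rw [Category.id_comp]
    simpa using (YE.hasMap_pull a E).comp h)

/-- The source of nearly all identities below: a morphism of extensions factors through the pushout
of its source and the pullback of its target, so every natural map of sequences becomes an equation
of classes. -/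
theorem push_mk_eq {E : YE n H H'} {F : YE n L L'} {b : H' ⟶ L'} {a : H ⟶ L}
    (h : E.HasMap F b a) : push b (mk E) = pull a (mk F) :=
  mk_eq (YE.HasMap.to_pull (YE.HasMap.of_push (by simpa using h)))

theorem pull_id (x : YExt n H H') : pull (𝟙 H) x = x := by
  obtain ⟨E, rfl⟩ := mk_surjective x
  exact mk_eq (YE.hasMap_pull _ E)

theorem push_id (x : YExt n H H') : push (𝟙 H') x = x := by
  obtain ⟨E, rfl⟩ := mk_surjective x
  exact (mk_eq (YE.hasMap_push _ E)).symm

theorem pull_eq_of_hasMap {E : YE n H H'} {F : YE n L H'} {a : H ⟶ L} (h : E.HasMap F (𝟙 H') a) :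
    pull a (mk F) = mk E := by
  rw [← push_mk_eq h, push_id]

theorem push_eq_of_hasMap {E : YE n H H'} {F : YE n H L'} {b : H' ⟶ L'} (h : E.HasMap F b (𝟙 H)) :
    push b (mk E) = mk F := by
  rw [push_mk_eq h, pull_id]

theorem pull_pull (a : L ⟶ H) (a' : N ⟶ L) (x : YExt n H H') :
    pull a' (pull a x) = pull (a' ≫ a) x := by
  obtain ⟨E, rfl⟩ := mk_surjective x
  refine (pull_eq_of_hasMap ?_).symm
  simpa using (YE.hasMap_pull a' (YE.pull a E)).comp (YE.hasMap_pull a E)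

theorem push_push (b : H' ⟶ L') (b' : L' ⟶ N') (x : YExt n H H') :
    push b' (push b x) = push (b ≫ b') x := by
  obtain ⟨E, rfl⟩ := mk_surjective x
  refine (push_eq_of_hasMap ?_).symm
  simpa using (YE.hasMap_push b E).comp (YE.hasMap_push b' (YE.push b E))

theorem push_pull (b : H' ⟶ L') (a : L ⟶ H) (x : YExt n H H') :
    push b (pull a x) = pull a (push b x) := by
  obtain ⟨E, rfl⟩ := mk_surjective x
  refine push_mk_eq (E := YE.pull a E) (F := YE.push b E) ?_
  simpa using (YE.hasMap_pull a E).comp (YE.hasMap_push b E)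

/-- The external direct sum of classes. -/
def sum (x : YExt n H H') (y : YExt n L L') : YExt n (ExactCat.sum H L) (ExactCat.sum H' L') :=
  Quot.map₂ YE.sum
    (fun E F F' h => by
      have := (YE.HasMap.id E).sum h
      rwa [show sumMap (𝟙 H') (𝟙 L') = 𝟙 _ by apply sum_hom_ext <;> simp,
        show sumMap (𝟙 H) (𝟙 L) = 𝟙 _ by apply sum_hom_ext <;> simp] at this)
    (fun E E' F h => by
      have := h.sum (YE.HasMap.id F)
      rwa [show sumMap (𝟙 H') (𝟙 L') = 𝟙 _ by apply sum_hom_ext <;> simp,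
        show sumMap (𝟙 H) (𝟙 L) = 𝟙 _ by apply sum_hom_ext <;> simp] at this) x y

theorem push_sum (b : H' ⟶ Z') (b' : L' ⟶ Y') (x : YExt n H H') (y : YExt n L L') :
    push (sumMap b b') (sum x y) = sum (push b x) (push b' y) := by
  obtain ⟨E, rfl⟩ := mk_surjective x
  obtain ⟨F, rfl⟩ := mk_surjective y
  refine push_eq_of_hasMap (E := E.sum F) (F := (YE.push b E).sum (YE.push b' F)) ?_
  have := (YE.hasMap_push b E).sum (YE.hasMap_push b' F)
  rwa [show sumMap (𝟙 H) (𝟙 L) = 𝟙 _ by apply sum_hom_ext <;> simp] at this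

theorem pull_sum (a : Z ⟶ H) (a' : Y ⟶ L) (x : YExt n H H') (y : YExt n L L') :
    pull (sumMap a a') (sum x y) = sum (pull a x) (pull a' y) := by
  obtain ⟨E, rfl⟩ := mk_surjective x
  obtain ⟨F, rfl⟩ := mk_surjective y
  refine pull_eq_of_hasMap (E := (YE.pull a E).sum (YE.pull a' F)) (F := E.sum F) ?_
  have := (YE.hasMap_pull a E).sum (YE.hasMap_pull a' F)
  rwa [show sumMap (𝟙 H') (𝟙 L') = 𝟙 _ by apply sum_hom_ext <;> simp] at this

theorem push_codiag (x : YExt n H H') : push (codiag H') (sum x x) = pull (codiag H) x := by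
  obtain ⟨E, rfl⟩ := mk_surjective x
  exact push_mk_eq (YE.HasMap.codiag E)

theorem push_swap (x : YExt n H H') (y : YExt n L L') :
    push (swap H' L') (sum x y) = pull (swap H L) (sum y x) := by
  obtain ⟨E, rfl⟩ := mk_surjective x
  obtain ⟨F, rfl⟩ := mk_surjective y
  exact push_mk_eq (YE.HasMap.swap E F)

theorem push_assocHom (x : YExt n H H') (y : YExt n L L') (z : YExt n N N') :
    push (assocHom H' L' N') (sum (sum x y) z) = pull (assocHom H L N) (sum x (sum y z)) := by
  obtain ⟨E, rfl⟩ := mk_surjective x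
  obtain ⟨F, rfl⟩ := mk_surjective y
  obtain ⟨G, rfl⟩ := mk_surjective z
  exact push_mk_eq (YE.HasMap.assocHom E F G)

/-- The zero maps form a morphism between any two extensions; hence the class obtained does not
depend on the extension. -/
theorem push_zero (x : YExt n H H') (y : YExt n L L') :
    push (0 : H' ⟶ L') x = pull (0 : H ⟶ L) y := by
  obtain ⟨E, rfl⟩ := mk_surjective x
  obtain ⟨F, rfl⟩ := mk_surjective y
  exact push_mk_eq (YE.HasMap.zero E F)

instance : Add (YExt n H H') := ⟨fun x y => push (codiag H') (pull (diag H) (sum x y))⟩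

theorem add_def (x y : YExt n H H') : x + y = push (codiag H') (pull (diag H) (sum x y)) := rfl

/-- The extension that is pulled back is arbitrary; `pull_zero_eq` shows that the choice is
immaterial. -/
instance : Zero (YExt n H H') := ⟨pull 0 (mk (YE.nonempty n H H').some)⟩

instance : Neg (YExt n H H') := ⟨pull (-𝟙 H)⟩

theorem push_zero_eq (x : YExt n H H') : push (0 : H' ⟶ L') x = 0 := push_zero _ _

theorem pull_zero_eq (x : YExt n H H') : pull (0 : L ⟶ H) x = 0 :=
  (push_zero (mk (YE.nonempty n L H').some) x).symm.trans (push_zero_eq _)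

/-- The sum `a + a'` is the diagonal, followed by `a ⊕ a'` and the codiagonal, and a codiagonal may
be moved from the right end of `x ⊕ x` to its left end. With `a` and `a'` taken from 0, 1 and -1
this gives the group axioms for zero and for inverses. -/
theorem add_pull (a a' : L ⟶ H) (x : YExt n H H') : pull (a + a') x = pull a x + pull a' x := by
  rw [← diag_sumMap_codiag, ← pull_pull, ← pull_pull, ← push_codiag, ← push_pull, ← push_pull,
    pull_sum, add_def]

theorem pull_add (a : L ⟶ H) (x y : YExt n H H') : pull a (x + y) = pull a x + pull a y := by
  rw [add_def, add_def, ← push_pull, pull_pull, diag_natural, ← pull_pull, pull_sum]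

protected theorem add_comm (x y : YExt n H H') : x + y = y + x := by
  rw [add_def, ← swap_codiag, ← push_push, push_pull, push_swap, pull_pull, diag_swap, add_def]

protected theorem add_assoc (x y z : YExt n H H') : x + y + z = x + (y + z) := by
  -- Both bracketings are written as one pushout of one pullback of a threefold direct sum;
  -- `assocHom` then compares the two sums.
  have h1 : x + y + z = push (sumMap (codiag H') (𝟙 H') ≫ codiag H')
      (pull (diag H ≫ sumMap (diag H) (𝟙 H)) (sum (sum x y) z)) := by
    have e : sum (push (codiag H') (pull (diag H) (sum x y))) z =
        push (sumMap (codiag H') (𝟙 H')) (pull (sumMap (diag H) (𝟙 H)) (sum (sum x y) z)) := by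
      rw [pull_sum, push_sum, pull_id, push_id]
    rw [add_def (x + y), add_def x y, e, ← push_pull, pull_pull, push_push]
  have h2 : x + (y + z) = push (sumMap (𝟙 H') (codiag H') ≫ codiag H')
      (pull (diag H ≫ sumMap (𝟙 H) (diag H)) (sum x (sum y z))) := by
    have e : sum x (push (codiag H') (pull (diag H) (sum y z))) =
        push (sumMap (𝟙 H') (codiag H')) (pull (sumMap (𝟙 H) (diag H)) (sum x (sum y z))) := by
      rw [pull_sum, push_sum, pull_id, push_id]
    rw [add_def x, add_def y, e, ← push_pull, pull_pull, push_push]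
  rw [h1, h2, ← assocHom_codiag, ← push_push, push_pull (assocHom _ _ _), push_assocHom, pull_pull,
    diag_assocHom]

instance : AddCommGroup (YExt n H H') where
  add_assoc := YExt.add_assoc
  add_comm := YExt.add_comm
  zero_add x := by
    have := add_pull 0 (𝟙 H) x
    rw [zero_add, pull_zero_eq, pull_id] at this
    exact this.symm
  add_zero x := by
    have := add_pull (𝟙 H) 0 x
    rw [add_zero, pull_zero_eq, pull_id] at this
    exact this.symm
  neg_add_cancel x := by
    have := add_pull (-𝟙 H) (𝟙 H) x
    rw [neg_add_cancel, pull_zero_eq, pull_id] at this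
    exact this.symm
  nsmul := nsmulRec
  zsmul := zsmulRec

/-- The splice of a class with a short exact sequence. -/
def splice (x : YExt n Z H') (S : SES H Z) : YExt (n + 1) H H' :=
  Quot.map (fun E => YE.splice E S) (fun _ _ h => h.splice (SES.HasMap.id S)) x

theorem push_splice (b : H' ⟶ L') (x : YExt n Z H') (S : SES H Z) :
    push b (splice x S) = splice (push b x) S := by
  obtain ⟨E, rfl⟩ := mk_surjective x
  exact push_eq_of_hasMap ((YE.hasMap_push b E).splice (SES.HasMap.id S))

/-- A map of the intermediate objects can be moved from one factor of a splice to the other. This is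
the relation that makes the product of classes bilinear over morphisms. -/
theorem splice_pull {S : SES H Z} {T : SES L Y} {z : Z ⟶ Y} {a : H ⟶ L} (h : S.HasMap T z a)
    (x : YExt n Y H') : splice (pull z x) S = pull a (splice x T) := by
  obtain ⟨E, rfl⟩ := mk_surjective x
  exact (pull_eq_of_hasMap ((YE.hasMap_pull z E).splice h)).symm

theorem splice_sum (x : YExt n Z H') (S : SES H Z) (y : YExt n Y L') (T : SES L Y) :
    splice (sum x y) (S.sum T) = sum (splice x S) (splice y T) := by
  obtain ⟨E, rfl⟩ := mk_surjective x
  obtain ⟨F, rfl⟩ := mk_surjective y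
  rfl

theorem add_splice (x y : YExt n Z H') (S : SES H Z) :
    splice (x + y) S = splice x S + splice y S := by
  rw [add_def, add_def, ← push_splice, splice_pull (SES.HasMap.diag S), splice_sum]

/-- The splice is additive in the short exact sequence. -/
theorem splice_add {S T W : SES H Z} {U : SES H (ExactCat.sum Z Z)}
    (h : U.HasMap (S.sum T) (𝟙 _) (diag H)) (h' : U.HasMap W (codiag Z) (𝟙 H))
    (x : YExt n Z H') : splice x W = splice x S + splice x T := by
  -- `U` lies over both sides: along the codiagonal it computes the splice with `W`, along the
  -- diagonal the splice with `S ⊕ T`.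
  have h1 := splice_pull h' x
  have h2 := splice_pull h (sum x x)
  rw [pull_id] at h1 h2
  rw [← h1, ← push_codiag, ← push_splice, h2, splice_sum, add_def]

/-- The degree one analogue of `splice_add`: `W` is the pushout of `U` along the codiagonal and `U`
is the pullback of `S ⊕ T` along the diagonal, which is how the Baer sum is formed. -/
theorem mk_add {S T W : SES H Z} {U : SES H (ExactCat.sum Z Z)}
    (h : U.HasMap (S.sum T) (𝟙 _) (diag H)) (h' : U.HasMap W (codiag Z) (𝟙 H)) :
    (mk (n := 0) W : YExt 0 H Z) = mk (n := 0) S + mk (n := 0) T := by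
  rw [add_def, ← push_eq_of_hasMap (n := 0) h', ← pull_eq_of_hasMap (n := 0) h]
  rfl

theorem zero_splice (S : SES H Z) : splice (0 : YExt n Z H') S = 0 := by
  have := add_splice (0 : YExt n Z H') 0 S
  rw [add_zero] at this
  exact left_eq_add.1 this

theorem mk_split (H H' : 𝒞) : (mk (n := 0) (SES.split H H') : YExt 0 H H') = 0 := by
  rw [← pull_eq_of_hasMap (n := 0) (SES.HasMap.split_zero H H' H), pull_zero_eq]

theorem splice_split (x : YExt n H' L') (H : 𝒞) : splice x (SES.split H H') = 0 := by
  have := splice_pull (SES.HasMap.split_zero H H' H) x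
  rwa [pull_id, pull_zero_eq] at this

theorem pull_π_mk (S : SES H H') : pull S.π (mk (n := 0) S) = 0 := by
  rw [pull_eq_of_hasMap (n := 0) (SES.HasMap.split_π S), mk_split]

theorem pull_π_splice (x : YExt n H' L') (S : SES H H') : pull S.π (splice x S) = 0 := by
  rw [← splice_pull (SES.HasMap.split_π S), splice_split]

/-- The product of two short exact sequences vanishes if they are the graded pieces of a
two-step filtration. -/
theorem splice_mk_eq_zero {S : SES Z H'} {T : SES H Z} {U : SES H S.M} (h : U.HasMap T S.π (𝟙 H)) :
    splice (mk (n := 0) S) T = 0 := by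
  -- Since `T` is the image of `U` under `S.π`, the product equals the splice of `U` with the
  -- pullback of `S` to its own middle term, and that pullback is split.
  have := splice_pull h (mk (n := 0) S)
  rwa [pull_id, pull_π_mk, zero_splice, eq_comm] at this

theorem splice_splice_eq_zero {S : SES Z H'} {T : SES H Z} {U : SES H S.M}
    (h : U.HasMap T S.π (𝟙 H)) (x : YExt n H' L') : splice (splice x S) T = 0 := by
  have := splice_pull h (splice x S)
  rwa [pull_id, pull_π_splice, zero_splice, eq_comm] at this

end YExt

end YonedaExact

namespace FilteredFIsocrystal

/-! ### Functoriality of connections and linearizations -/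

section natural

variable {K R S : Type u} [Field K] [CommRing R] [Algebra K R] [CommRing S]
  [Algebra K S] [Algebra R S] [IsScalarTower K R S] {C : FrobeniusCalculus K S}
  {M N : Type u} [AddCommGroup M] [Module R M] [AddCommGroup N] [Module R N]
  {H H' : Type u} [AddCommGroup H] [Module S H] [AddCommGroup H'] [Module S H']

/-- A linear map is horizontal for connections on source and target. -/
def Conn.Compat (n : Conn K R M) (n' : Conn K R N) (f : M →ₗ[R] N) : Prop :=
  ∀ x, n'.toFun (f x) = f.lTensor Ω[R⁄K] (n.toFun x)

theorem Conn.cov_add (n : Conn K R M) (X : Derivation K R R) (x y : M) :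
    n.cov X (x + y) = n.cov X x + n.cov X y := by
  simp only [cov, map_add]

theorem Conn.Compat.cov {n : Conn K R M} {n' : Conn K R N} {f : M →ₗ[R] N} (h : n.Compat n' f)
    (X : Derivation K R R) (x : M) : n'.cov X (f x) = f (n.cov X x) := by
  have key : ∀ t : Ω[R⁄K] ⊗[R] M, TensorProduct.lid R N
      (X.liftKaehlerDifferential.rTensor N (f.lTensor Ω[R⁄K] t)) =
      f (TensorProduct.lid R M (X.liftKaehlerDifferential.rTensor M t)) := by
    intro t
    induction t with
    | zero => simp
    | tmul ω x => simp
    | add a b ha hb => simp only [map_add, ha, hb]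
  simp only [Conn.cov]
  rw [h x, key]

theorem Conn.Integrable.of_injective {n : Conn K R M} {n' : Conn K R N} {f : M →ₗ[R] N}
    (h : n.Compat n' f) (hf : Function.Injective f) (hn : n'.Integrable) : n.Integrable := by
  intro X Y x
  apply hf
  rw [map_sub, ← h.cov, ← h.cov, ← h.cov, ← h.cov, ← h.cov]
  exact hn X Y (f x)

theorem Conn.Integrable.of_surjective {n : Conn K R M} {n' : Conn K R N} {f : M →ₗ[R] N}
    (h : n.Compat n' f) (hf : Function.Surjective f) (hn : n.Integrable) : n'.Integrable := by
  intro X Y y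
  obtain ⟨x, rfl⟩ := hf y
  rw [h.cov, h.cov, h.cov, h.cov, h.cov, ← map_sub, hn X Y x]

theorem baseChangeForm_natural (f : M →ₗ[R] N) (t : Ω[R⁄K] ⊗[R] M) :
    baseChangeForm C (f.lTensor Ω[R⁄K] t) =
      (f.baseChange S).lTensor C.Omega (baseChangeForm C t) := by
  induction t with
  | zero => simp
  | tmul ω x => rw [LinearMap.lTensor_tmul, baseChangeForm_tmul, baseChangeForm_tmul,
      LinearMap.lTensor_tmul, LinearMap.baseChange_tmul]
  | add a b ha hb => simp only [map_add, ha, hb]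

theorem Conn.Compat.baseChange {n : Conn K R M} {n' : Conn K R N} {f : M →ₗ[R] N}
    (h : n.Compat n' f) (t : S ⊗[R] M) :
    n'.baseChange C (f.baseChange S t) = (f.baseChange S).lTensor C.Omega (n.baseChange C t) := by
  induction t with
  | zero => simp
  | tmul s x =>
    rw [LinearMap.baseChange_tmul, Conn.baseChange_tmul, Conn.baseChange_tmul, h x,
      baseChangeForm_natural, map_add, map_smul, LinearMap.lTensor_tmul,
      LinearMap.baseChange_tmul]
  | add a b ha hb => simp only [map_add, ha, hb]

theorem Conn.Compat.rig {n : Conn K R M} {n' : Conn K R N} {f : M →ₗ[R] N}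
    (h : n.Compat n' f) (c : S ⊗[R] M ≃ₗ[S] H) (c' : S ⊗[R] N ≃ₗ[S] H') {v : H →ₗ[S] H'}
    (hv : ∀ t, v (c t) = c' (f.baseChange S t)) (x : H) :
    n'.rig C c' (v x) = v.lTensor C.Omega (n.rig C c x) := by
  obtain ⟨t, rfl⟩ := c.surjective x
  have hv' : v ∘ₗ c.toLinearMap = c'.toLinearMap ∘ₗ f.baseChange S := LinearMap.ext hv
  rw [hv]
  change c'.toLinearMap.lTensor C.Omega (n'.baseChange C (c'.symm (c' _))) =
    v.lTensor C.Omega (c.toLinearMap.lTensor C.Omega (n.baseChange C (c.symm (c t))))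
  rw [c'.symm_apply_apply, c.symm_apply_apply, h.baseChange, ← LinearMap.lTensor_comp_apply,
    ← LinearMap.lTensor_comp_apply, hv']

theorem map_frobenius_natural {Φ : H →ₛₗ[C.σ] H} {Φ' : H' →ₛₗ[C.σ] H'} {v : H →ₗ[S] H'}
    (h : ∀ x, v (Φ x) = Φ' (v x)) (t : C.Omega ⊗[S] H) :
    TensorProduct.map C.omegaFrobenius Φ' (v.lTensor C.Omega t) =
      v.lTensor C.Omega (TensorProduct.map C.omegaFrobenius Φ t) := by
  induction t with
  | zero => simp
  | tmul ω x => simp only [LinearMap.lTensor_tmul, TensorProduct.map_tmul, h]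
  | add a b ha hb => simp only [map_add, ha, hb]

/-- It serves to transport bijectivity of linearized Frobenius maps to direct sums, kernels and
cokernels. -/
theorem linearization_natural {σ : S →+* S} {Φ : H →ₛₗ[σ] H} {Φ' : H' →ₛₗ[σ] H'}
    {v : H →ₗ[S] H'} (h : ∀ x, v (Φ x) = Φ' (v x)) (t : Restrict σ S ⊗[S] H) :
    FrobeniusCalculus.linearization σ Φ' (v.lTensor (Restrict σ S) t) =
      v (FrobeniusCalculus.linearization σ Φ t) := by
  induction t with
  | zero => simp
  | tmul s x =>
    obtain ⟨s, rfl⟩ := (Restrict.of σ S).surjective s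
    rw [LinearMap.lTensor_tmul, FrobeniusCalculus.linearization_tmul,
      FrobeniusCalculus.linearization_tmul, map_smul, h]
  | add a b ha hb => simp only [map_add, ha, hb]

end natural

namespace FilFMIC

variable {K R S : Type u} [Field K] [CommRing R] [Algebra K R] [CommRing S]
  [Algebra K S] [Algebra R S] [IsScalarTower K R S] {C : FrobeniusCalculus K S}
  {H H' L L' : FilFMIC R C}

/-! ### The additive structure on morphisms -/

/-- The rigid part of a morphism is forced by the comparison isomorphisms, so equalities of
morphisms need only be checked on de Rham parts. -/
theorem Hom.rig_eq (f : Hom H L) (x : H.rig) :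
    f.rig x = L.c (f.dR.baseChange S (H.c.symm x)) := by
  conv_lhs => rw [← H.c.apply_symm_apply x]
  rw [f.comm_c]

theorem hom_ext {f g : H ⟶ L} (h : Hom.dR f = Hom.dR g) : f = g :=
  Hom.ext h (LinearMap.ext fun x => by rw [Hom.rig_eq f, Hom.rig_eq g, h])

/-- The map on rigid parts induced by a linear map of de Rham parts. -/
def rigMap (f : H.dR →ₗ[R] L.dR) : H.rig →ₗ[S] L.rig :=
  L.c.toLinearMap ∘ₗ f.baseChange S ∘ₗ H.c.symm.toLinearMap

theorem rigMap_c (f : H.dR →ₗ[R] L.dR) (t : S ⊗[R] H.dR) :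
    rigMap f (H.c t) = L.c (f.baseChange S t) := by
  simp [rigMap]

theorem Hom.rig_eq_rigMap (f : Hom H L) : f.rig = rigMap f.dR := LinearMap.ext f.rig_eq

theorem rigMap_id : rigMap (LinearMap.id : H.dR →ₗ[R] H.dR) = LinearMap.id := by
  ext; simp [rigMap]

theorem rigMap_comp (g : L.dR →ₗ[R] L'.dR) (f : H.dR →ₗ[R] L.dR) :
    rigMap (g ∘ₗ f) = rigMap g ∘ₗ rigMap f := by
  ext; simp [rigMap, LinearMap.baseChange_comp]

theorem rigMap_zero : rigMap (0 : H.dR →ₗ[R] L.dR) = 0 := by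
  ext; simp [rigMap]

/-- A morphism given by its de Rham part. -/
def homOfdR (f : H.dR →ₗ[R] L.dR) (hΦ : ∀ x, rigMap f (H.Φ x) = L.Φ (rigMap f x))
    (hconn : H.conn.Compat L.conn f) (hFil : ∀ i, ∀ x ∈ H.Fil i, f x ∈ L.Fil i) : H ⟶ L where
  dR := f
  rig := rigMap f
  comm_c := rigMap_c f
  comm_Φ := hΦ
  comm_conn := hconn
  map_Fil := hFil

@[simp] theorem homOfdR_dR (f : H.dR →ₗ[R] L.dR) (hΦ hconn hFil) :
    Hom.dR (homOfdR (L := L) f hΦ hconn hFil) = f := rfl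

@[simp] theorem comp_dR (f : H ⟶ L) (g : L ⟶ L') :
    Hom.dR (f ≫ g) = (Hom.dR g) ∘ₗ (Hom.dR f) := rfl

@[simp] theorem id_dR : Hom.dR (𝟙 H) = LinearMap.id := rfl

@[simp] theorem zero_dR : Hom.dR (0 : H ⟶ L) = 0 := rfl

instance : Add (H ⟶ L) := ⟨fun f g =>
  { dR := Hom.dR f + Hom.dR g
    rig := Hom.rig f + Hom.rig g
    comm_c := fun t => by
      simp only [LinearMap.add_apply, Hom.comm_c, LinearMap.baseChange_add, map_add]
    comm_Φ := fun x => by simp only [LinearMap.add_apply, Hom.comm_Φ, map_add]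
    comm_conn := fun x => by
      simp only [LinearMap.add_apply, Hom.comm_conn, LinearMap.lTensor_add, map_add]
    map_Fil := fun i x hx => add_mem (Hom.map_Fil f i x hx) (Hom.map_Fil g i x hx) }⟩

instance : Neg (H ⟶ L) := ⟨fun f =>
  { dR := - Hom.dR f
    rig := - Hom.rig f
    comm_c := fun t => by
      simp only [LinearMap.neg_apply, Hom.comm_c, LinearMap.baseChange_neg, map_neg]
    comm_Φ := fun x => by simp only [LinearMap.neg_apply, Hom.comm_Φ, map_neg]
    comm_conn := fun x => by
      simp only [LinearMap.neg_apply, Hom.comm_conn, LinearMap.lTensor_neg, map_neg]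
    map_Fil := fun i x hx => neg_mem (Hom.map_Fil f i x hx) }⟩

@[simp] theorem add_dR (f g : H ⟶ L) : Hom.dR (f + g) = Hom.dR f + Hom.dR g := rfl

@[simp] theorem neg_dR (f : H ⟶ L) : Hom.dR (-f) = - Hom.dR f := rfl

instance : Preadditive (FilFMIC R C) where
  homGroup H L :=
    { add_assoc := fun f g h => hom_ext (add_assoc _ _ _)
      zero_add := fun f => hom_ext (zero_add _)
      add_zero := fun f => hom_ext (add_zero _)
      neg_add_cancel := fun f => hom_ext (neg_add_cancel _)
      add_comm := fun f g => hom_ext (add_comm _ _)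
      nsmul := nsmulRec
      zsmul := zsmulRec }
  add_comp _ _ _ f f' g := hom_ext (LinearMap.comp_add _ _ _)
  comp_add _ _ _ f g g' := hom_ext (LinearMap.add_comp _ _ _)

@[simp] theorem sub_dR (f g : H ⟶ L) : Hom.dR (f - g) = Hom.dR f - Hom.dR g := by
  rw [sub_eq_add_neg, add_dR, neg_dR, sub_eq_add_neg]

theorem hom_comm_conn (f : H ⟶ L) : H.conn.Compat L.conn (Hom.dR f) := Hom.comm_conn f

theorem hom_comm_Φ (f : H ⟶ L) (x : H.rig) :
    rigMap (Hom.dR f) (H.Φ x) = L.Φ (rigMap (Hom.dR f) x) := by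
  rw [← Hom.rig_eq_rigMap]
  exact Hom.comm_Φ f x

/-! ### Filtrations -/

/-- A filtered retract has graded pieces which are direct summands of the given projective ones. -/
theorem projective_gr_of_retract {M N : Type u} [AddCommGroup M] [Module R M] [AddCommGroup N]
    [Module R N] {P Q : Submodule R M} {P' Q' : Submodule R N}
    [Module.Projective R (P ⧸ Q.submoduleOf P)] (i : N →ₗ[R] M) (q : M →ₗ[R] N)
    (hqi : ∀ x ∈ P', q (i x) = x)
    (hiP : ∀ x ∈ P', i x ∈ P) (hiQ : ∀ x ∈ Q', i x ∈ Q) (hqP : ∀ x ∈ P, q x ∈ P')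
    (hqQ : ∀ x ∈ Q, q x ∈ Q') : Module.Projective R (P' ⧸ Q'.submoduleOf P') := by
  refine Module.Projective.of_split
    ((Q'.submoduleOf P').mapQ (Q.submoduleOf P) (i.restrict hiP) fun x hx => hiQ _ hx)
    ((Q.submoduleOf P).mapQ (Q'.submoduleOf P') (q.restrict hqP) fun x hx => hqQ _ hx) ?_
  ext x
  exact congrArg (Submodule.Quotient.mk (p := Q'.submoduleOf P')) (Subtype.ext (hqi _ x.2))

/-- A strict epimorphism has a filtered linear section. -/
theorem exists_filtered_section (H : FilFMIC R C) {M : Type u} [AddCommGroup M] [Module R M]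
    (Fil : ℤ → Submodule R M) (hFil : Antitone Fil) (f : M →ₗ[R] H.dR)
    (hf : ∀ j, (Fil j).map f = H.Fil j) : ∃ s : H.dR →ₗ[R] M,
      (∀ x, f (s x) = x) ∧ ∀ j, ∀ x ∈ H.Fil j, s x ∈ Fil j := by
  obtain ⟨a, ha⟩ := H.exists_Fil_eq_top
  obtain ⟨b, hb⟩ := H.exists_Fil_eq_bot
  -- Descending induction on `j`, starting where the filtration vanishes; the section on `Fil j` has
  -- to respect all deeper steps of the filtration as well.
  have key : ∀ j, j ≤ b → ∃ s : H.Fil j →ₗ[R] M, (∀ x, f (s x) = x) ∧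
      ∀ k, j ≤ k → ∀ x : H.Fil j, (x : H.dR) ∈ H.Fil k → s x ∈ Fil k := by
    intro j hj
    induction j, hj using Int.leInductionDown with
    | base =>
      refine ⟨0, fun x => ?_, fun k _ x _ => Submodule.zero_mem _⟩
      have := (Submodule.mem_bot R).1 (hb ▸ x.2 : (x : H.dR) ∈ (⊥ : Submodule R H.dR))
      rw [this, LinearMap.zero_apply, map_zero]
    | pred j hj ih =>
      obtain ⟨i, rfl⟩ : ∃ i, j = i + 1 := ⟨j - 1, by omega⟩
      rw [add_sub_cancel_right]
      obtain ⟨s, hs, hsF⟩ := ih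
      have hproj := H.projective_gr i
      set Q := (H.Fil (i + 1)).submoduleOf (H.Fil i)
      -- By projectivity of the graded piece, `τ` splits the projection of `Fil i` onto it and `l`
      -- lifts `τ` to the filtration of the source. An element of `Fil i` is the sum of `τ` of its
      -- class, which `l` handles, and of a remainder in `Fil (i + 1)`, which the section `s`
      -- already handles.
      obtain ⟨τ, hτ⟩ := Module.projective_lifting_property Q.mkQ LinearMap.id Q.mkQ_surjective
      have hf' : ∀ x ∈ Fil i, f x ∈ H.Fil i := fun x hx => by
        rw [← hf i]; exact ⟨x, hx, rfl⟩
      obtain ⟨l, hl⟩ := Module.projective_lifting_property (f.restrict hf') τ (by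
        rintro ⟨x, hx⟩
        rw [← hf i] at hx
        obtain ⟨y, hy, rfl⟩ := hx
        exact ⟨⟨y, hy⟩, rfl⟩)
      have hτ' : ∀ z, Q.mkQ (τ z) = z := fun z => LinearMap.congr_fun hτ z
      have hl' : ∀ z, f (l z) = τ z := fun z => congrArg Subtype.val (LinearMap.congr_fun hl z)
      let e : H.Fil i →ₗ[R] H.Fil i := LinearMap.id - τ ∘ₗ Q.mkQ
      have he : ∀ x, ((e x : H.Fil i) : H.dR) ∈ H.Fil (i + 1) := fun x => by
        have : Q.mkQ (e x) = 0 := by simp only [e, LinearMap.sub_apply, map_sub,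
          LinearMap.id_apply, LinearMap.comp_apply, hτ', sub_self]
        rw [Submodule.mkQ_apply, Submodule.Quotient.mk_eq_zero] at this
        exact this
      let e' : H.Fil i →ₗ[R] H.Fil (i + 1) := ((H.Fil i).subtype ∘ₗ e).codRestrict _ he
      have he' : ∀ x, ((e' x : H.Fil (i + 1)) : H.dR) = x - τ (Q.mkQ x) := fun x => rfl
      refine ⟨s ∘ₗ e' + (Fil i).subtype ∘ₗ l ∘ₗ Q.mkQ, fun x => ?_, fun k hk x hx => ?_⟩
      · simp only [LinearMap.add_apply, LinearMap.comp_apply, map_add, hs, Submodule.subtype_apply,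
          hl', he', sub_add_cancel]
      · rcases eq_or_lt_of_le hk with rfl | hk'
        · exact add_mem (hFil (by omega) (hsF (i + 1) le_rfl _ (e' x).2)) (l _).2
        · have h0 : Q.mkQ x = 0 := by
            rw [Submodule.mkQ_apply, Submodule.Quotient.mk_eq_zero]
            exact H.antitone_Fil (show i + 1 ≤ k by omega) hx
          simp only [LinearMap.add_apply, LinearMap.comp_apply, h0, map_zero, add_zero]
          refine hsF k (by omega) _ ?_
          have : ((e' x : H.Fil (i + 1)) : H.dR) = x := by
            rw [he', h0, map_zero, ZeroMemClass.coe_zero, sub_zero]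
          rw [this]
          exact hx
  -- The index must be at most `b` to be reached by the induction and at most `a` for `Fil` to be
  -- everything there.
  obtain ⟨s, hs, hsF⟩ := key (min a b) (min_le_right _ _)
  have htop : ∀ j, j ≤ a → H.Fil j = ⊤ := fun j hj => top_le_iff.1 (ha ▸ H.antitone_Fil hj)
  refine ⟨s ∘ₗ LinearMap.codRestrict _ LinearMap.id
    (fun x => by rw [htop _ (min_le_left _ _)]; trivial), fun x => hs _, fun j x hx => ?_⟩
  rcases le_total (min a b) j with h | h
  · exact hsF j h _ hx
  · exact hFil h (hsF _ le_rfl _ (Subtype.property _))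

end FilFMIC

namespace FilFMIC

variable {K R S : Type u} [Field K] [CommRing R] [Algebra K R] [CommRing S]
  [Algebra K S] [Algebra R S] [IsScalarTower K R S] {C : FrobeniusCalculus K S}

/-! ### Direct sums -/

section prod

variable {M N : Type u} [AddCommGroup M] [Module R M] [AddCommGroup N] [Module R N]

/-- The direct sum of two connections. -/
def prodConn (n : Conn K R M) (n' : Conn K R N) : Conn K R (M × N) where
  toFun := ((LinearMap.inl R M N).lTensor Ω[R⁄K]).toAddMonoidHom.comp
      (n.toFun.comp (AddMonoidHom.fst M N)) +
    ((LinearMap.inr R M N).lTensor Ω[R⁄K]).toAddMonoidHom.comp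
      (n'.toFun.comp (AddMonoidHom.snd M N))
  leibniz r x := by
    have hx : x = LinearMap.inl R M N x.1 + LinearMap.inr R M N x.2 := by ext <;> simp
    change (LinearMap.inl R M N).lTensor Ω[R⁄K] (n.toFun (r • x.1)) +
        (LinearMap.inr R M N).lTensor Ω[R⁄K] (n'.toFun (r • x.2)) =
      KaehlerDifferential.D K R r ⊗ₜ[R] x + r • ((LinearMap.inl R M N).lTensor Ω[R⁄K] (n.toFun x.1) +
        (LinearMap.inr R M N).lTensor Ω[R⁄K] (n'.toFun x.2))
    conv_rhs => rw [hx]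
    rw [n.leibniz, n'.leibniz, map_add, map_add, map_smul, map_smul, LinearMap.lTensor_tmul,
      LinearMap.lTensor_tmul, TensorProduct.tmul_add, smul_add]
    simp only [Prod.fst_add, Prod.snd_add, LinearMap.inl_apply, LinearMap.inr_apply, add_zero,
      zero_add]
    abel

variable (n : Conn K R M) (n' : Conn K R N)

theorem prodConn_apply (x : M × N) : (prodConn n n').toFun x =
    (LinearMap.inl R M N).lTensor Ω[R⁄K] (n.toFun x.1) +
      (LinearMap.inr R M N).lTensor Ω[R⁄K] (n'.toFun x.2) := rfl

theorem prodConn_inl : n.Compat (prodConn n n') (LinearMap.inl R M N) := fun x => by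
  rw [prodConn_apply]; simp

theorem prodConn_inr : n'.Compat (prodConn n n') (LinearMap.inr R M N) := fun x => by
  rw [prodConn_apply]; simp

theorem prodConn_fst : (prodConn n n').Compat n (LinearMap.fst R M N) := fun x => by
  rw [prodConn_apply, map_add, ← LinearMap.lTensor_comp_apply, ← LinearMap.lTensor_comp_apply,
    LinearMap.fst_comp_inl, LinearMap.fst_comp_inr]
  simp

theorem prodConn_snd : (prodConn n n').Compat n' (LinearMap.snd R M N) := fun x => by
  rw [prodConn_apply, map_add, ← LinearMap.lTensor_comp_apply, ← LinearMap.lTensor_comp_apply,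
    LinearMap.snd_comp_inl, LinearMap.snd_comp_inr]
  simp

theorem prodConn_integrable (h : n.Integrable) (h' : n'.Integrable) :
    (prodConn n n').Integrable := by
  have h1 : ∀ (X : Derivation K R R) y, ((prodConn n n').cov X y).1 = n.cov X y.1 :=
    fun X y => ((prodConn_fst n n').cov X y).symm
  have h2 : ∀ (X : Derivation K R R) y, ((prodConn n n').cov X y).2 = n'.cov X y.2 :=
    fun X y => ((prodConn_snd n n').cov X y).symm
  intro X Y x
  refine Prod.ext ?_ ?_
  · simp only [Prod.fst_sub, h1]
    exact h X Y _
  · simp only [Prod.snd_sub, h2]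
    exact h' X Y _

/-- It carries Griffiths transversality along filtered linear maps. -/
theorem mem_range_lTensor {M N : Type u} [AddCommGroup M] [Module R M] [AddCommGroup N]
    [Module R N] {P : Submodule R M} {Q : Submodule R N} (f : M →ₗ[R] N) (hf : ∀ x ∈ P, f x ∈ Q)
    {t : Ω[R⁄K] ⊗[R] M} (ht : t ∈ LinearMap.range (P.subtype.lTensor Ω[R⁄K])) :
    f.lTensor Ω[R⁄K] t ∈ LinearMap.range (Q.subtype.lTensor Ω[R⁄K]) := by
  obtain ⟨t, rfl⟩ := ht
  refine ⟨(f.restrict hf).lTensor Ω[R⁄K] t, ?_⟩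
  rw [← LinearMap.lTensor_comp_apply, ← LinearMap.lTensor_comp_apply]
  rfl

variable (H L : FilFMIC R C)

variable (S M N) in
/-- The base change of a direct sum. -/
def prodComparison {M' N' : Type u} [AddCommGroup M'] [Module S M'] [AddCommGroup N'] [Module S N']
    (c : S ⊗[R] M ≃ₗ[S] M') (c' : S ⊗[R] N ≃ₗ[S] N') : S ⊗[R] (M × N) ≃ₗ[S] M' × N' :=
  (TensorProduct.prodRight R S S M N).trans (c.prodCongr c')

theorem prodComparison_inl {M' N' : Type u} [AddCommGroup M'] [Module S M'] [AddCommGroup N']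
    [Module S N'] (c : S ⊗[R] M ≃ₗ[S] M') (c' : S ⊗[R] N ≃ₗ[S] N') (t : S ⊗[R] M) :
    LinearMap.inl S M' N' (c t) =
      prodComparison S M N c c' ((LinearMap.inl R M N).baseChange S t) := by
  induction t with
  | zero => simp
  | tmul s x => simp [prodComparison]
  | add a b ha hb => simp only [map_add, ha, hb]

theorem prodComparison_inr {M' N' : Type u} [AddCommGroup M'] [Module S M'] [AddCommGroup N']
    [Module S N'] (c : S ⊗[R] M ≃ₗ[S] M') (c' : S ⊗[R] N ≃ₗ[S] N') (t : S ⊗[R] N) :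
    LinearMap.inr S M' N' (c' t) =
      prodComparison S M N c c' ((LinearMap.inr R M N).baseChange S t) := by
  induction t with
  | zero => simp
  | tmul s x => simp [prodComparison]
  | add a b ha hb => simp only [map_add, ha, hb]

theorem prodComparison_fst {M' N' : Type u} [AddCommGroup M'] [Module S M'] [AddCommGroup N']
    [Module S N'] (c : S ⊗[R] M ≃ₗ[S] M') (c' : S ⊗[R] N ≃ₗ[S] N') (t : S ⊗[R] (M × N)) :
    LinearMap.fst S M' N' (prodComparison S M N c c' t) =
      c ((LinearMap.fst R M N).baseChange S t) := by
  induction t with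
  | zero => simp
  | tmul s x => simp [prodComparison]
  | add a b ha hb => simp only [map_add, ha, hb]

theorem prodComparison_snd {M' N' : Type u} [AddCommGroup M'] [Module S M'] [AddCommGroup N']
    [Module S N'] (c : S ⊗[R] M ≃ₗ[S] M') (c' : S ⊗[R] N ≃ₗ[S] N') (t : S ⊗[R] (M × N)) :
    LinearMap.snd S M' N' (prodComparison S M N c c' t) =
      c' ((LinearMap.snd R M N).baseChange S t) := by
  induction t with
  | zero => simp
  | tmul s x => simp [prodComparison]
  | add a b ha hb => simp only [map_add, ha, hb]

/-- The direct sum of two semilinear maps. -/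
def prodFrobenius {M N : Type u} [AddCommGroup M] [Module S M] [AddCommGroup N] [Module S N]
    (Φ : M →ₛₗ[C.σ] M) (Φ' : N →ₛₗ[C.σ] N) : M × N →ₛₗ[C.σ] M × N where
  toFun x := (Φ x.1, Φ' x.2)
  map_add' x y := by simp
  map_smul' s x := by simp [LinearMap.map_smulₛₗ]

/-- Linearization is natural for the two inclusions and the two projections, so the statement splits
into components. -/
theorem prodFrobenius_bijective {M N : Type u} [AddCommGroup M] [Module S M] [AddCommGroup N]
    [Module S N] (Φ : M →ₛₗ[C.σ] M) (Φ' : N →ₛₗ[C.σ] N)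
    (h : Function.Bijective (FrobeniusCalculus.linearization C.σ Φ))
    (h' : Function.Bijective (FrobeniusCalculus.linearization C.σ Φ')) :
    Function.Bijective (FrobeniusCalculus.linearization C.σ (prodFrobenius Φ Φ')) := by
  have hl := linearization_natural (Φ := Φ) (Φ' := prodFrobenius Φ Φ') (v := LinearMap.inl S M N)
    fun x => Prod.ext rfl (map_zero Φ').symm
  have hr := linearization_natural (Φ := Φ') (Φ' := prodFrobenius Φ Φ') (v := LinearMap.inr S M N)
    fun x => Prod.ext (map_zero Φ).symm rfl
  have hf := linearization_natural (Φ := prodFrobenius Φ Φ') (Φ' := Φ) (v := LinearMap.fst S M N)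
    fun x => rfl
  have hs := linearization_natural (Φ := prodFrobenius Φ Φ') (Φ' := Φ') (v := LinearMap.snd S M N)
    fun x => rfl
  constructor
  · rw [injective_iff_map_eq_zero]
    intro t ht
    have h1 : (LinearMap.fst S M N).lTensor (Restrict C.σ S) t = 0 :=
      (injective_iff_map_eq_zero _).1 h.1 _ (by rw [hf, ht, map_zero])
    have h2 : (LinearMap.snd S M N).lTensor (Restrict C.σ S) t = 0 :=
      (injective_iff_map_eq_zero _).1 h'.1 _ (by rw [hs, ht, map_zero])
    have e : (LinearMap.inl S M N ∘ₗ LinearMap.fst S M N + LinearMap.inr S M N ∘ₗ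
        LinearMap.snd S M N) = LinearMap.id := by ext <;> simp
    have := LinearMap.lTensor_id_apply (Restrict C.σ S) (M × N) t
    rw [← e, LinearMap.lTensor_add, LinearMap.add_apply, LinearMap.lTensor_comp_apply,
      LinearMap.lTensor_comp_apply, h1, h2, map_zero, map_zero, add_zero] at this
    exact this.symm
  · rintro ⟨x, y⟩
    obtain ⟨t, rfl⟩ := h.2 x
    obtain ⟨t', rfl⟩ := h'.2 y
    refine ⟨(LinearMap.inl S M N).lTensor _ t + (LinearMap.inr S M N).lTensor _ t', ?_⟩
    rw [map_add, hl, hr]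
    simp

/-- The direct sum of two filtered `F`-isocrystals. -/
def prod : FilFMIC R C where
  dR := H.dR × L.dR
  rig := H.rig × L.rig
  finite_dR := by
    have := H.finite_dR; have := L.finite_dR; infer_instance
  finite_rig := by
    have := H.finite_rig; have := L.finite_rig; infer_instance
  c := prodComparison S H.dR L.dR H.c L.c
  Φ := prodFrobenius H.Φ L.Φ
  Φ_bijective := prodFrobenius_bijective _ _ H.Φ_bijective L.Φ_bijective
  conn := prodConn H.conn L.conn
  integrable := prodConn_integrable _ _ H.integrable L.integrable
  Fil i := (H.Fil i).prod (L.Fil i)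
  antitone_Fil i j h := Submodule.prod_mono (H.antitone_Fil h) (L.antitone_Fil h)
  exists_Fil_eq_top := by
    obtain ⟨i, hi⟩ := H.exists_Fil_eq_top
    obtain ⟨j, hj⟩ := L.exists_Fil_eq_top
    refine ⟨min i j, ?_⟩
    rw [top_le_iff.1 (hi.symm.le.trans (H.antitone_Fil (min_le_left i j))),
      top_le_iff.1 (hj.symm.le.trans (L.antitone_Fil (min_le_right i j))), Submodule.prod_top]
  exists_Fil_eq_bot := by
    obtain ⟨i, hi⟩ := H.exists_Fil_eq_bot
    obtain ⟨j, hj⟩ := L.exists_Fil_eq_bot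
    refine ⟨max i j, ?_⟩
    rw [le_bot_iff.1 ((H.antitone_Fil (le_max_left i j)).trans hi.le),
      le_bot_iff.1 ((L.antitone_Fil (le_max_right i j)).trans hj.le), Submodule.prod_bot]
  projective_gr i := by
    have := H.projective_gr i
    have := L.projective_gr i
    let P := (H.Fil i).prod (L.Fil i)
    let g : P →ₗ[R] (H.Fil i ⧸ (H.Fil (i + 1)).submoduleOf (H.Fil i)) ×
        (L.Fil i ⧸ (L.Fil (i + 1)).submoduleOf (L.Fil i)) :=
      (Submodule.mkQ _ ∘ₗ (LinearMap.fst R H.dR L.dR).restrict (p := P) fun x hx => hx.1).prod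
        (Submodule.mkQ _ ∘ₗ (LinearMap.snd R H.dR L.dR).restrict (p := P) fun x hx => hx.2)
    have hg : Function.Surjective g := by
      rintro ⟨x, y⟩
      obtain ⟨x, rfl⟩ := Submodule.mkQ_surjective _ x
      obtain ⟨y, rfl⟩ := Submodule.mkQ_surjective _ y
      exact ⟨⟨(x, y), x.2, y.2⟩, rfl⟩
    have hk : LinearMap.ker g = ((H.Fil (i + 1)).prod (L.Fil (i + 1))).submoduleOf P := by
      rw [LinearMap.ker_prod, LinearMap.ker_comp, LinearMap.ker_comp, Submodule.ker_mkQ,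
        Submodule.ker_mkQ]
      rfl
    rw [← hk]
    exact Module.Projective.of_equiv (g.quotKerEquivOfSurjective hg).symm
  griffiths i x hx := by
    rw [prodConn_apply]
    exact add_mem
      (mem_range_lTensor (Q := (H.Fil (i - 1)).prod (L.Fil (i - 1))) _
        (fun y hy => ⟨hy, Submodule.zero_mem _⟩) (H.griffiths i _ hx.1))
      (mem_range_lTensor (Q := (H.Fil (i - 1)).prod (L.Fil (i - 1))) _
        (fun y hy => ⟨Submodule.zero_mem _, hy⟩) (L.griffiths i _ hx.2))
  horizontal x := by
    have hx : x = LinearMap.inl S _ _ x.1 + LinearMap.inr S _ _ x.2 := by ext <;> simp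
    have hl : ∀ y, LinearMap.inl S _ _ (H.Φ y) = prodFrobenius H.Φ L.Φ (LinearMap.inl S _ _ y) :=
      fun x => Prod.ext rfl (map_zero L.Φ).symm
    have hr : ∀ y, LinearMap.inr S _ _ (L.Φ y) = prodFrobenius H.Φ L.Φ (LinearMap.inr S _ _ y) :=
      fun x => Prod.ext (map_zero H.Φ).symm rfl
    have h1 := (prodConn_inl H.conn L.conn).rig (C := C) H.c (prodComparison S _ _ H.c L.c)
      (prodComparison_inl H.c L.c)
    have h2 := (prodConn_inr H.conn L.conn).rig (C := C) L.c (prodComparison S _ _ H.c L.c)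
      (prodComparison_inr H.c L.c)
    rw [hx]
    simp only [map_add]
    rw [← hl, ← hr, h1, h1, h2, h2, H.horizontal, L.horizontal, map_frobenius_natural hl,
      map_frobenius_natural hr]

/-- The inclusion of the first summand. -/
def prodInl : H ⟶ prod H L where
  dR := LinearMap.inl R H.dR L.dR
  rig := LinearMap.inl S H.rig L.rig
  comm_c := prodComparison_inl H.c L.c
  comm_Φ _ := Prod.ext rfl (map_zero L.Φ).symm
  comm_conn := prodConn_inl _ _
  map_Fil _ _ hx := ⟨hx, Submodule.zero_mem _⟩

/-- The inclusion of the second summand. -/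
def prodInr : L ⟶ prod H L where
  dR := LinearMap.inr R H.dR L.dR
  rig := LinearMap.inr S H.rig L.rig
  comm_c := prodComparison_inr H.c L.c
  comm_Φ _ := Prod.ext (map_zero H.Φ).symm rfl
  comm_conn := prodConn_inr _ _
  map_Fil _ _ hx := ⟨Submodule.zero_mem _, hx⟩

/-- The projection to the first summand. -/
def prodFst : prod H L ⟶ H where
  dR := LinearMap.fst R H.dR L.dR
  rig := LinearMap.fst S H.rig L.rig
  comm_c := prodComparison_fst H.c L.c
  comm_Φ _ := rfl
  comm_conn := prodConn_fst _ _
  map_Fil _ _ hx := hx.1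

/-- The projection to the second summand. -/
def prodSnd : prod H L ⟶ L where
  dR := LinearMap.snd R H.dR L.dR
  rig := LinearMap.snd S H.rig L.rig
  comm_c := prodComparison_snd H.c L.c
  comm_Φ _ := rfl
  comm_conn := prodConn_snd _ _
  map_Fil _ _ hx := hx.2

end prod

/-! ### Complements -/

section compl

variable (M Y : FilFMIC R C) (g : M.dR →ₗ[R] Y.dR) (s : Y.dR →ₗ[R] M.dR)
  (hgs : ∀ y, g (s y) = y)

/-- The projection to the kernel of a split epimorphism. -/
def complProj : M.dR →ₗ[R] LinearMap.ker g :=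
  (LinearMap.id - s ∘ₗ g).codRestrict _ fun x => by
    simp [hgs]

theorem coe_complProj (x : M.dR) : (complProj M Y g s hgs x : M.dR) = x - s (g x) := rfl

theorem complProj_coe (x : LinearMap.ker g) : complProj M Y g s hgs x = x := by
  refine Subtype.ext ?_
  rw [coe_complProj, show g x = 0 from x.2, map_zero, sub_zero]

theorem complProj_section (y : Y.dR) : complProj M Y g s hgs (s y) = 0 := by
  refine Subtype.ext ?_
  rw [coe_complProj, hgs, sub_self, ZeroMemClass.coe_zero]

/-- The connection on the kernel of a split epimorphism. -/
def complConn : Conn K R (LinearMap.ker g) where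
  toFun := ((complProj M Y g s hgs).lTensor Ω[R⁄K]).toAddMonoidHom.comp
    (M.conn.toFun.comp (LinearMap.ker g).subtype.toAddMonoidHom)
  leibniz r x := by
    change (complProj M Y g s hgs).lTensor Ω[R⁄K] (M.conn.toFun (r • (x : M.dR))) =
      KaehlerDifferential.D K R r ⊗ₜ[R] x +
        r • (complProj M Y g s hgs).lTensor Ω[R⁄K] (M.conn.toFun x)
    rw [M.conn.leibniz, map_add, map_smul, LinearMap.lTensor_tmul, complProj_coe]

theorem complConn_apply (x : LinearMap.ker g) : (complConn M Y g s hgs).toFun x =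
    (complProj M Y g s hgs).lTensor Ω[R⁄K] (M.conn.toFun x) := rfl

/-- The inclusion on rigid parts. -/
def complRigIncl : S ⊗[R] LinearMap.ker g →ₗ[S] M.rig :=
  M.c.toLinearMap ∘ₗ (LinearMap.ker g).subtype.baseChange S

/-- The projection on rigid parts. -/
def complRigProj : M.rig →ₗ[S] S ⊗[R] LinearMap.ker g :=
  (complProj M Y g s hgs).baseChange S ∘ₗ M.c.symm.toLinearMap

theorem complRigProj_incl (t : S ⊗[R] LinearMap.ker g) :
    complRigProj M Y g s hgs (complRigIncl M Y g t) = t := by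
  have : complProj M Y g s hgs ∘ₗ (LinearMap.ker g).subtype = LinearMap.id :=
    LinearMap.ext (complProj_coe M Y g s hgs)
  simp only [complRigProj, complRigIncl, LinearMap.comp_apply, LinearEquiv.coe_coe,
    LinearEquiv.symm_apply_apply]
  rw [← LinearMap.comp_apply, ← LinearMap.baseChange_comp, this, LinearMap.baseChange_id,
    LinearMap.id_apply]

theorem complRigIncl_proj (x : M.rig) :
    complRigIncl M Y g (complRigProj M Y g s hgs x) =
      x - rigMap (H := Y) (L := M) s (rigMap (H := M) (L := Y) g x) := by
  have : (LinearMap.ker g).subtype ∘ₗ complProj M Y g s hgs = LinearMap.id - s ∘ₗ g := rfl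
  simp only [complRigProj, complRigIncl, LinearMap.comp_apply, LinearEquiv.coe_coe, rigMap,
    LinearEquiv.symm_apply_apply]
  rw [← LinearMap.comp_apply, ← LinearMap.baseChange_comp, this, LinearMap.baseChange_sub,
    LinearMap.baseChange_comp, LinearMap.sub_apply, map_sub, LinearMap.baseChange_id,
    LinearMap.id_apply, LinearEquiv.apply_symm_apply]
  rfl

theorem rigMap_complRigIncl (t : S ⊗[R] LinearMap.ker g) :
    rigMap (H := M) (L := Y) g (complRigIncl M Y g t) = 0 := by
  have : g ∘ₗ (LinearMap.ker g).subtype = 0 := LinearMap.ext fun x => x.2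
  simp only [complRigIncl, LinearMap.comp_apply, LinearEquiv.coe_coe, rigMap,
    LinearEquiv.symm_apply_apply]
  rw [← LinearMap.comp_apply, ← LinearMap.baseChange_comp, this, LinearMap.baseChange_zero,
    LinearMap.zero_apply, map_zero]

theorem complRigProj_rigMap (y : Y.rig) :
    complRigProj M Y g s hgs (rigMap (H := Y) (L := M) s y) = 0 := by
  have : complProj M Y g s hgs ∘ₗ s = 0 := LinearMap.ext (complProj_section M Y g s hgs)
  simp only [complRigProj, LinearMap.comp_apply, LinearEquiv.coe_coe, rigMap,
    LinearEquiv.symm_apply_apply]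
  rw [← LinearMap.comp_apply, ← LinearMap.baseChange_comp, this, LinearMap.baseChange_zero,
    LinearMap.zero_apply]

/-- The Frobenius on the kernel of a split epimorphism. -/
def complFrobenius : S ⊗[R] LinearMap.ker g →ₛₗ[C.σ] S ⊗[R] LinearMap.ker g where
  toFun t := complRigProj M Y g s hgs (M.Φ (complRigIncl M Y g t))
  map_add' x y := by simp only [map_add]
  map_smul' a x := by rw [map_smul, LinearMap.map_smulₛₗ, map_smul]

/-- The pair `(g, s)` splits a strict epimorphism or a strict monomorphism. -/
def IsSplitting : Prop := (∃ f : M ⟶ Y, Hom.dR f = g) ∨ ∃ f : Y ⟶ M, Hom.dR f = s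

variable {M Y g s}

/-- If `g` is a morphism, `∇` maps its kernel to forms with values in the kernel, so the projection
in the definition of `complConn` changes nothing. -/
theorem complConn_incl (h : ∃ f : M ⟶ Y, Hom.dR f = g) :
    (complConn M Y g s hgs).Compat M.conn (LinearMap.ker g).subtype := by
  obtain ⟨f, rfl⟩ := h
  intro x
  have hx : Hom.dR f x = 0 := x.2
  have h0 := hom_comm_conn f x
  rw [hx, map_zero] at h0
  have : (LinearMap.ker (Hom.dR f)).subtype ∘ₗ complProj M Y (Hom.dR f) s hgs =
    LinearMap.id - s ∘ₗ Hom.dR f := rfl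
  rw [complConn_apply, ← LinearMap.lTensor_comp_apply, this, LinearMap.lTensor_sub,
    LinearMap.sub_apply, LinearMap.lTensor_comp_apply, ← h0, map_zero, sub_zero,
    LinearMap.lTensor_id_apply]
  rfl

/-- If `s` is a morphism, `∇` preserves its image; the kernel of `g` then stands for the quotient by
this image and carries the quotient connection. -/
theorem complConn_proj (h : ∃ f : Y ⟶ M, Hom.dR f = s) :
    M.conn.Compat (complConn M Y g s hgs) (complProj M Y g s hgs) := by
  obtain ⟨f, rfl⟩ := h
  intro x
  rw [complConn_apply, coe_complProj, map_sub, map_sub, hom_comm_conn f,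
    ← LinearMap.lTensor_comp_apply, show complProj M Y g (Hom.dR f) hgs ∘ₗ Hom.dR f = 0 from
      LinearMap.ext (complProj_section M Y g _ hgs), LinearMap.lTensor_zero, LinearMap.zero_apply,
    sub_zero]

theorem complFrobenius_incl (h : ∃ f : M ⟶ Y, Hom.dR f = g) (t : S ⊗[R] LinearMap.ker g) :
    complRigIncl M Y g (complFrobenius M Y g s hgs t) = M.Φ (complRigIncl M Y g t) := by
  obtain ⟨f, rfl⟩ := h
  change complRigIncl M Y _ (complRigProj M Y _ s hgs (M.Φ _)) = _
  rw [complRigIncl_proj, hom_comm_Φ, rigMap_complRigIncl, map_zero, map_zero, sub_zero]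

theorem complFrobenius_proj (h : ∃ f : Y ⟶ M, Hom.dR f = s) (x : M.rig) :
    complRigProj M Y g s hgs (M.Φ x) =
      complFrobenius M Y g s hgs (complRigProj M Y g s hgs x) := by
  obtain ⟨f, rfl⟩ := h
  change _ = complRigProj M Y g _ hgs (M.Φ (complRigIncl M Y g _))
  rw [complRigIncl_proj, map_sub, map_sub, ← hom_comm_Φ, complRigProj_rigMap, sub_zero]

theorem lTensor_incl_proj (t : Restrict C.σ S ⊗[S] M.rig) :
    (complRigIncl M Y g).lTensor (Restrict C.σ S)
      ((complRigProj M Y g s hgs).lTensor (Restrict C.σ S) t) =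
    t - (rigMap (H := Y) (L := M) s).lTensor (Restrict C.σ S)
      ((rigMap (H := M) (L := Y) g).lTensor (Restrict C.σ S) t) := by
  have : complRigIncl M Y g ∘ₗ complRigProj M Y g s hgs = LinearMap.id -
      rigMap (H := Y) (L := M) s ∘ₗ rigMap (H := M) (L := Y) g :=
    LinearMap.ext (complRigIncl_proj M Y g s hgs)
  rw [← LinearMap.lTensor_comp_apply, this, LinearMap.lTensor_sub, LinearMap.sub_apply,
    LinearMap.lTensor_comp_apply, LinearMap.lTensor_id_apply]

theorem lTensor_proj_incl (P : Type u) [AddCommGroup P] [Module S P]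
    (t : P ⊗[S] (S ⊗[R] LinearMap.ker g)) :
    (complRigProj M Y g s hgs).lTensor P ((complRigIncl M Y g).lTensor P t) = t := by
  have : complRigProj M Y g s hgs ∘ₗ complRigIncl M Y g = LinearMap.id :=
    LinearMap.ext (complRigProj_incl M Y g s hgs)
  rw [← LinearMap.lTensor_comp_apply, this, LinearMap.lTensor_id_apply]

/-- The linear splitting survives the twist by `σ`, so no exactness of the twist is needed. In the
kernel case injectivity is inherited from `M`, while surjectivity also uses injectivity for `Y`. In
the cokernel case surjectivity is inherited, while injectivity also uses surjectivity for `Y`. -/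
theorem complFrobenius_bijective (h : IsSplitting M Y g s) : Function.Bijective
    (FrobeniusCalculus.linearization C.σ (complFrobenius M Y g s hgs)) := by
  rcases h with h | h
  · have hi := linearization_natural (complFrobenius_incl hgs h)
    constructor
    · rw [injective_iff_map_eq_zero]
      intro t ht
      have := (injective_iff_map_eq_zero _).1 M.Φ_bijective.1 _
        ((hi t).trans (by rw [ht, map_zero]))
      rw [← lTensor_proj_incl hgs _ t, this, map_zero]
    · intro y
      obtain ⟨t, ht⟩ := M.Φ_bijective.2 (complRigIncl M Y g y)
      refine ⟨(complRigProj M Y g s hgs).lTensor _ t, ?_⟩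
      apply Function.LeftInverse.injective (complRigProj_incl M Y g s hgs)
      obtain ⟨f, rfl⟩ := h
      have h0 : (rigMap (H := M) (L := Y) (Hom.dR f)).lTensor (Restrict C.σ S) t = 0 := by
        refine (injective_iff_map_eq_zero _).1 Y.Φ_bijective.1 _ ?_
        rw [linearization_natural (hom_comm_Φ f), ht, rigMap_complRigIncl]
      rw [← hi, lTensor_incl_proj, h0, map_zero, sub_zero, ht]
  · have hq := linearization_natural (complFrobenius_proj hgs h)
    constructor
    · rw [injective_iff_map_eq_zero]
      intro t ht
      obtain ⟨f, rfl⟩ := h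
      set u := (complRigIncl M Y g).lTensor (Restrict C.σ S) t with hu
      have hut : (complRigProj M Y g (Hom.dR f) hgs).lTensor _ u = t := lTensor_proj_incl hgs _ t
      obtain ⟨a, ha⟩ := Y.Φ_bijective.2 (rigMap (H := M) (L := Y) g
        (FrobeniusCalculus.linearization C.σ M.Φ u))
      have h1 := complRigIncl_proj M Y g (Hom.dR f) hgs
        (FrobeniusCalculus.linearization C.σ M.Φ u)
      rw [← hq, hut, ht, map_zero, ← ha, ← linearization_natural (hom_comm_Φ f), eq_comm,
        sub_eq_zero] at h1
      rw [← hut, M.Φ_bijective.1 h1, ← LinearMap.lTensor_comp_apply,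
        show complRigProj M Y g (Hom.dR f) hgs ∘ₗ rigMap (H := Y) (L := M) (Hom.dR f) = 0 from
          LinearMap.ext (complRigProj_rigMap M Y g _ hgs), LinearMap.lTensor_zero,
        LinearMap.zero_apply]
    · intro y
      obtain ⟨t, ht⟩ := M.Φ_bijective.2 (complRigIncl M Y g y)
      exact ⟨(complRigProj M Y g s hgs).lTensor _ t, by rw [hq, ht, complRigProj_incl]⟩

theorem complConn_horizontal (h : IsSplitting M Y g s) :
    (complConn M Y g s hgs).Horizontal C (LinearEquiv.refl S (S ⊗[R] LinearMap.ker g))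
      (complFrobenius M Y g s hgs) := by
  intro x
  rcases h with h | h
  · have hr := (complConn_incl hgs h).rig (C := C) (LinearEquiv.refl S _) M.c
      (v := complRigIncl M Y g) fun t => rfl
    apply Function.LeftInverse.injective (lTensor_proj_incl hgs C.Omega)
    rw [← hr, complFrobenius_incl hgs h, M.horizontal, hr,
      map_frobenius_natural (complFrobenius_incl hgs h)]
  · have hr := (complConn_proj hgs h).rig (C := C) M.c (LinearEquiv.refl S _)
      (v := complRigProj M Y g s hgs) fun t => by simp [complRigProj]
    rw [← complRigProj_incl M Y g s hgs x, ← complFrobenius_proj hgs h, hr, hr, M.horizontal,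
      map_frobenius_natural (complFrobenius_proj hgs h)]

theorem complProj_mem (hg : ∀ i, ∀ x ∈ M.Fil i, g x ∈ Y.Fil i)
    (hs : ∀ i, ∀ x ∈ Y.Fil i, s x ∈ M.Fil i) {i : ℤ} {x : M.dR} (hx : x ∈ M.Fil i) :
    complProj M Y g s hgs x ∈ (M.Fil i).comap (LinearMap.ker g).subtype :=
  sub_mem hx (hs i _ (hg i _ hx))

variable (hg : ∀ i, ∀ x ∈ M.Fil i, g x ∈ Y.Fil i) (hs : ∀ i, ∀ x ∈ Y.Fil i, s x ∈ M.Fil i)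
  (h : IsSplitting M Y g s)

/-- The kernel of a split filtered epimorphism `g`, if either `g` or its splitting is a morphism of
filtered `F`-isocrystals. -/
def compl : FilFMIC R C where
  dR := LinearMap.ker g
  rig := S ⊗[R] LinearMap.ker g
  finite_dR := by
    have := M.finite_dR
    exact Module.Finite.of_surjective (complProj M Y g s hgs)
      fun x => ⟨x, complProj_coe M Y g s hgs x⟩
  finite_rig := by
    have := M.finite_rig
    exact Module.Finite.of_surjective (complRigProj M Y g s hgs)
      fun x => ⟨_, complRigProj_incl M Y g s hgs x⟩
  c := LinearEquiv.refl S _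
  Φ := complFrobenius M Y g s hgs
  Φ_bijective := complFrobenius_bijective hgs h
  conn := complConn M Y g s hgs
  integrable := by
    rcases h with h | h
    · exact .of_injective (complConn_incl hgs h) Subtype.val_injective M.integrable
    · exact .of_surjective (complConn_proj hgs h) (fun x => ⟨x, complProj_coe M Y g s hgs x⟩)
        M.integrable
  Fil i := (M.Fil i).comap (LinearMap.ker g).subtype
  antitone_Fil i j hij := Submodule.comap_mono (M.antitone_Fil hij)
  exists_Fil_eq_top := by
    obtain ⟨i, hi⟩ := M.exists_Fil_eq_top
    exact ⟨i, by rw [hi, Submodule.comap_top]⟩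
  exists_Fil_eq_bot := by
    obtain ⟨i, hi⟩ := M.exists_Fil_eq_bot
    exact ⟨i, by rw [hi, Submodule.comap_bot, Submodule.ker_subtype]⟩
  projective_gr i := by
    have := M.projective_gr i
    exact projective_gr_of_retract (LinearMap.ker g).subtype (complProj M Y g s hgs)
      (fun x _ => complProj_coe M Y g s hgs x) (fun _ hx => hx) (fun _ hx => hx)
      (fun _ hx => complProj_mem hgs hg hs hx) (fun _ hx => complProj_mem hgs hg hs hx)
  griffiths i x hx := mem_range_lTensor (Q := (M.Fil (i - 1)).comap (LinearMap.ker g).subtype)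
    (complProj M Y g s hgs) (fun _ hy => complProj_mem hgs hg hs hy) (M.griffiths i x hx)
  horizontal := complConn_horizontal hgs h

/-- The inclusion of the kernel of a morphism. -/
def complIncl (h' : ∃ f : M ⟶ Y, Hom.dR f = g) : compl hgs hg hs h ⟶ M where
  dR := (LinearMap.ker g).subtype
  rig := complRigIncl M Y g
  comm_c _ := rfl
  comm_Φ := complFrobenius_incl hgs h'
  comm_conn := complConn_incl hgs h'
  map_Fil _ _ hx := hx

/-- The projection to the cokernel of a morphism. -/
def complQuot (h' : ∃ f : Y ⟶ M, Hom.dR f = s) : M ⟶ compl hgs hg hs h where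
  dR := complProj M Y g s hgs
  rig := complRigProj M Y g s hgs
  comm_c t := by
    change (complProj M Y g s hgs).baseChange S (M.c.symm (M.c t)) = _
    rw [M.c.symm_apply_apply]
    rfl
  comm_Φ := complFrobenius_proj hgs h'
  comm_conn := complConn_proj hgs h'
  map_Fil _ _ hx := complProj_mem hgs hg hs hx

end compl

end FilFMIC

namespace FilFMIC

variable {K R S : Type u} [Field K] [CommRing R] [Algebra K R] [CommRing S]
  [Algebra K S] [Algebra R S] [IsScalarTower K R S] {C : FrobeniusCalculus K S}

/-! ### Universal properties of kernels and cokernels. -/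

section compl

variable {M Y X : FilFMIC R C} {g : M.dR →ₗ[R] Y.dR} {s : Y.dR →ₗ[R] M.dR}
  (hgs : ∀ y, g (s y) = y)
  (hg : ∀ i, ∀ x ∈ M.Fil i, g x ∈ Y.Fil i) (hs : ∀ i, ∀ x ∈ Y.Fil i, s x ∈ M.Fil i)
  (h : IsSplitting M Y g s)

/-- The morphism out of a cokernel induced by a morphism. -/
def complDesc (φ : M ⟶ X) (hφ : ∀ y, Hom.dR φ (s y) = 0) : compl hgs hg hs h ⟶ X where
  dR := Hom.dR φ ∘ₗ (LinearMap.ker g).subtype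
  rig := Hom.rig φ ∘ₗ complRigIncl M Y g
  comm_c t := (Hom.comm_c φ ((LinearMap.ker g).subtype.baseChange S t)).trans
    (congrArg X.c (LinearMap.congr_fun (LinearMap.baseChange_comp (A := S)
      (LinearMap.ker g).subtype (Hom.dR φ)) t).symm)
  comm_Φ t := by
    change Hom.rig φ (complRigIncl M Y g (complRigProj M Y g s hgs (M.Φ _))) = _
    have h0 : rigMap (H := M) (L := X) (Hom.dR φ) ∘ₗ rigMap (H := Y) (L := M) s = 0 := by
      rw [← rigMap_comp, show Hom.dR φ ∘ₗ s = 0 from LinearMap.ext hφ, rigMap_zero]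
    rw [complRigIncl_proj, map_sub, Hom.comm_Φ]
    conv_lhs => rw [Hom.rig_eq_rigMap φ, ← LinearMap.comp_apply (rigMap (Hom.dR φ)) (rigMap s), h0]
    rw [LinearMap.zero_apply, sub_zero, ← Hom.rig_eq_rigMap]
    rfl
  comm_conn (x : LinearMap.ker g) := by
    -- Because `φ` kills the image of `s`, it does not see the correction term by which the
    -- projection to the kernel of `g` differs from the identity.
    have h0 : (Hom.dR φ ∘ₗ (LinearMap.ker g).subtype) ∘ₗ complProj M Y g s hgs =
        Hom.dR φ := by
      ext y
      change Hom.dR φ (y - s (g y)) = _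
      rw [map_sub, hφ, sub_zero]
    exact (hom_comm_conn φ (x : M.dR)).trans ((congrArg (fun k : M.dR →ₗ[R] X.dR =>
      k.lTensor Ω[R⁄K] (M.conn.toFun (x : M.dR))) h0.symm).trans
      (LinearMap.lTensor_comp_apply Ω[R⁄K] (Hom.dR φ ∘ₗ (LinearMap.ker g).subtype)
        (complProj M Y g s hgs) (M.conn.toFun (x : M.dR))))
  map_Fil i _ hx := Hom.map_Fil φ i _ hx

theorem complQuot_desc (h' : ∃ f : Y ⟶ M, Hom.dR f = s) (φ : M ⟶ X)
    (hφ : ∀ y, Hom.dR φ (s y) = 0) :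
    complQuot hgs hg hs h h' ≫ complDesc hgs hg hs h φ hφ = φ := by
  refine hom_ext (LinearMap.ext fun y => ?_)
  change Hom.dR φ (y - s (g y)) = _
  rw [map_sub, hφ, sub_zero]

theorem complQuot_hom_ext (h' : ∃ f : Y ⟶ M, Hom.dR f = s) {φ ψ : compl hgs hg hs h ⟶ X}
    (hφ : complQuot hgs hg hs h h' ≫ φ = complQuot hgs hg hs h h' ≫ ψ) : φ = ψ := by
  refine hom_ext (LinearMap.ext fun (y : LinearMap.ker g) => ?_)
  have := LinearMap.congr_fun (congrArg Hom.dR hφ) (y : M.dR)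
  change Hom.dR φ (complProj M Y g s hgs (y : M.dR)) =
    Hom.dR ψ (complProj M Y g s hgs (y : M.dR)) at this
  rwa [complProj_coe] at this

/-- The morphism into a kernel induced by a morphism. -/
def complLift (φ : X ⟶ M) (hφ : ∀ y, g (Hom.dR φ y) = 0) : X ⟶ compl hgs hg hs h where
  dR := complProj M Y g s hgs ∘ₗ Hom.dR φ
  rig := complRigProj M Y g s hgs ∘ₗ Hom.rig φ
  comm_c t := by
    change (complProj M Y g s hgs).baseChange S (M.c.symm (Hom.rig φ (X.c t))) =
      (complProj M Y g s hgs ∘ₗ Hom.dR φ).baseChange S t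
    rw [Hom.comm_c, M.c.symm_apply_apply, LinearMap.baseChange_comp, LinearMap.comp_apply]
  comm_Φ x := by
    have h0 : rigMap (H := M) (L := Y) g ∘ₗ rigMap (H := X) (L := M) (Hom.dR φ) = 0 := by
      rw [← rigMap_comp, show g ∘ₗ Hom.dR φ = 0 from LinearMap.ext hφ, rigMap_zero]
    change complRigProj M Y g s hgs (Hom.rig φ (X.Φ x)) =
      complRigProj M Y g s hgs (M.Φ (complRigIncl M Y g
        (complRigProj M Y g s hgs (Hom.rig φ x))))
    rw [complRigIncl_proj]
    conv_rhs => rw [Hom.rig_eq_rigMap φ, ← LinearMap.comp_apply (rigMap g) (rigMap (Hom.dR φ)), h0]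
    rw [LinearMap.zero_apply, map_zero, sub_zero, ← Hom.rig_eq_rigMap, Hom.comm_Φ]
  comm_conn x := by
    change (complProj M Y g s hgs).lTensor Ω[R⁄K]
      (M.conn.toFun (Hom.dR φ x - s (g (Hom.dR φ x)))) = _
    rw [hφ, map_zero, sub_zero, hom_comm_conn φ x, ← LinearMap.lTensor_comp_apply]
    rfl
  map_Fil i _ hx := complProj_mem hgs hg hs (Hom.map_Fil φ i _ hx)

theorem complLift_incl (h' : ∃ f : M ⟶ Y, Hom.dR f = g) (φ : X ⟶ M)
    (hφ : ∀ y, g (Hom.dR φ y) = 0) :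
    complLift hgs hg hs h φ hφ ≫ complIncl hgs hg hs h h' = φ := by
  refine hom_ext (LinearMap.ext fun y => ?_)
  change Hom.dR φ y - s (g (Hom.dR φ y)) = _
  rw [hφ, map_zero, sub_zero]

theorem complIncl_hom_ext (h' : ∃ f : M ⟶ Y, Hom.dR f = g) {φ ψ : X ⟶ compl hgs hg hs h}
    (hφ : φ ≫ complIncl hgs hg hs h h' = ψ ≫ complIncl hgs hg hs h h') : φ = ψ :=
  hom_ext (LinearMap.ext fun y => Subtype.ext (LinearMap.congr_fun (congrArg Hom.dR hφ) y))

end compl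

/-! ### The exact structure -/

/-- Exactness of `0 ⟶ A ⟶ B ⟶ D ⟶ 0`: the sequences of the `Fil j` are exact. -/
structure IsShortExact {A B D : FilFMIC R C} (i : A ⟶ B) (q : B ⟶ D) : Prop where
  injective : Function.Injective (Hom.dR i)
  exact : ∀ j, B.Fil j ⊓ LinearMap.ker (Hom.dR q) = (A.Fil j).map (Hom.dR i)
  surjective : ∀ j, (B.Fil j).map (Hom.dR q) = D.Fil j

namespace IsShortExact

variable {A B D : FilFMIC R C} {i : A ⟶ B} {q : B ⟶ D} (h : IsShortExact i q)

theorem comp_apply (h : IsShortExact i q) (x : A.dR) : Hom.dR q (Hom.dR i x) = 0 := by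
  -- Exactness is only assumed for each step of the filtration; an index where the filtration is
  -- everything gives it for all elements.
  obtain ⟨a, ha⟩ := A.exists_Fil_eq_top
  have : Hom.dR i x ∈ (A.Fil a).map (Hom.dR i) := ⟨x, by rw [ha]; trivial, rfl⟩
  rw [← h.exact] at this
  exact this.2

theorem mem_of_map_eq_zero (h : IsShortExact i q) {j : ℤ} {x : B.dR} (hx : x ∈ B.Fil j)
    (h0 : Hom.dR q x = 0) : ∃ y ∈ A.Fil j, Hom.dR i y = x := by
  have : x ∈ B.Fil j ⊓ LinearMap.ker (Hom.dR q) := ⟨hx, h0⟩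
  rwa [h.exact] at this

/-- Short exact sequences have filtered linear splittings. -/
theorem exists_splitting (h : IsShortExact i q) :
    ∃ (s : D.dR →ₗ[R] B.dR) (r : B.dR →ₗ[R] A.dR),
      (∀ x, Hom.dR q (s x) = x) ∧ (∀ x, r (Hom.dR i x) = x) ∧
      (∀ x, Hom.dR i (r x) = x - s (Hom.dR q x)) ∧ (∀ x, r (s x) = 0) ∧
      (∀ j, ∀ x ∈ D.Fil j, s x ∈ B.Fil j) ∧ ∀ j, ∀ x ∈ B.Fil j, r x ∈ A.Fil j := by
  obtain ⟨s, hs, hsF⟩ := D.exists_filtered_section B.Fil B.antitone_Fil (Hom.dR q) h.surjective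
  obtain ⟨b, hb⟩ := B.exists_Fil_eq_top
  have hmem : ∀ x, ((LinearMap.id : B.dR →ₗ[R] B.dR) - s ∘ₗ Hom.dR q) x ∈ LinearMap.range (Hom.dR i) := fun x => by
    obtain ⟨y, -, hy⟩ := h.mem_of_map_eq_zero (j := b) (x := x - s (Hom.dR q x))
      (by rw [hb]; trivial) (by rw [map_sub, hs, sub_self])
    exact ⟨y, hy⟩
  -- The retraction is read off from the section: `x - s (q x)` lies in the image of `i`, and `r x`
  -- is its preimage. Exactness on each filtration step makes `r` filtered.
  let e := LinearEquiv.ofInjective (Hom.dR i) h.injective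
  let r : B.dR →ₗ[R] A.dR := e.symm.toLinearMap ∘ₗ LinearMap.codRestrict _ _ hmem
  have hr : ∀ x, Hom.dR i (r x) = x - s (Hom.dR q x) := fun x =>
    congrArg Subtype.val (e.apply_symm_apply (LinearMap.codRestrict _ _ hmem x))
  refine ⟨s, r, hs, fun x => h.injective ?_, hr, fun x => h.injective ?_, hsF, fun j x hx => ?_⟩
  · rw [hr, h.comp_apply, map_zero, sub_zero]
  · rw [hr, hs, sub_self, map_zero]
  · obtain ⟨y, hy, hyx⟩ := h.mem_of_map_eq_zero (j := j) (x := x - s (Hom.dR q x))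
      (sub_mem hx (hsF j _ (Hom.map_Fil q j _ hx))) (by rw [map_sub, hs, sub_self])
    rwa [← h.injective (hyx.trans (hr x).symm)]

/-- The pushout is the cokernel of `(i, -b) : A ⟶ B ⊕ A'`. A retraction `r` of `i` provides a linear
retraction of this map, and the cokernel is realized on the kernel of that retraction. -/
theorem exists_push (h : IsShortExact i q) {A' : FilFMIC R C} (b : A ⟶ A') :
    ∃ (B' : FilFMIC R C) (i' : A' ⟶ B') (q' : B' ⟶ D) (f : B ⟶ B'),
      IsShortExact i' q' ∧ IsPushout i b f i' ∧ f ≫ q' = q := by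
  obtain ⟨s, r, hs, hri, hir, hrs, hsF, hrF⟩ := h.exists_splitting
  let κ : A ⟶ prod B A' := i ≫ prodInl B A' - b ≫ prodInr B A'
  have hκ : ∀ x, Hom.dR κ x = (Hom.dR i x, - Hom.dR b x) := fun x => by
    refine (LinearMap.congr_fun (sub_dR _ _) x).trans ?_
    exact Prod.ext (sub_zero _) (zero_sub _)
  let g : (prod B A').dR →ₗ[R] A.dR := r ∘ₗ LinearMap.fst R B.dR A'.dR
  have hgs : ∀ y, g (Hom.dR κ y) = y := fun y => by rw [hκ]; exact hri y
  have hg : ∀ j, ∀ x ∈ (prod B A').Fil j, g x ∈ A.Fil j := fun j x hx => hrF j _ hx.1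
  have hk : ∃ f : A ⟶ prod B A', Hom.dR f = Hom.dR κ := ⟨κ, rfl⟩
  let N := compl hgs hg (fun j => Hom.map_Fil κ j) (Or.inr hk)
  let Q : prod B A' ⟶ N := complQuot hgs hg _ _ hk
  have hw : i ≫ prodInl B A' ≫ Q = b ≫ prodInr B A' ≫ Q := by
    refine hom_ext (LinearMap.ext fun x => ?_)
    change complProj (prod B A') A g (Hom.dR κ) hgs (Hom.dR i x, 0) =
      complProj (prod B A') A g (Hom.dR κ) hgs (0, Hom.dR b x)
    have e : ((Hom.dR i x, 0) : B.dR × A'.dR) =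
        ((0, Hom.dR b x) : B.dR × A'.dR) + (show B.dR × A'.dR from Hom.dR κ x) := by
      rw [hκ]
      exact Prod.ext (zero_add _).symm (add_neg_cancel _).symm
    exact (congrArg _ e).trans ((map_add _ _ _).trans
      ((congrArg _ (complProj_section (prod B A') A g (Hom.dR κ) hgs x)).trans (add_zero _)))
  let q' : N ⟶ D := complDesc hgs hg _ _ (prodFst B A' ≫ q) fun y => by
    rw [hκ]; exact h.comp_apply y
  have hQq : Q ≫ q' = prodFst B A' ≫ q := complQuot_desc hgs hg _ _ hk _ _
  let val : N.dR → B.dR × A'.dR := fun x : LinearMap.ker g => x.1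
  -- The retraction vanishes on the summand `A'`, so elements of `A'` already lie in the kernel that
  -- represents the cokernel.
  have hi' : ∀ l, val (Hom.dR (prodInr B A' ≫ Q) l) = (0, l) := fun l => by
    change ((0, l) : B.dR × A'.dR) - (show B.dR × A'.dR from Hom.dR κ (r 0)) = _
    rw [map_zero, map_zero]
    exact sub_zero _
  refine ⟨N, prodInr B A' ≫ Q, q', prodInl B A' ≫ Q, ⟨?_, ?_, ?_⟩, ⟨⟨hw⟩,
    ⟨Limits.PushoutCocone.IsColimit.mk hw
      (fun t => complDesc hgs hg _ _ (prodFst B A' ≫ t.inl + prodSnd B A' ≫ t.inr) fun y => ?_)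
      ?_ ?_ ?_⟩⟩, ?_⟩
  · intro x y hxy
    have := congrArg val hxy
    rw [hi', hi'] at this
    exact congrArg Prod.snd this
  · intro j
    apply le_antisymm
    · rintro ⟨⟨m, l⟩, hm⟩ ⟨hF, h0⟩
      refine ⟨l, hF.2, Subtype.ext ((hi' l).trans (Prod.ext ?_ rfl))⟩
      have h0' : Hom.dR q m = 0 := h0
      have hm' : r m = 0 := hm
      have := hir m
      rw [h0', hm', map_zero, map_zero, sub_zero] at this
      exact this
    · rintro _ ⟨l, hl, rfl⟩
      constructor
      · change val (Hom.dR (prodInr B A' ≫ Q) l) ∈ (prod B A').Fil j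
        rw [hi']
        exact ⟨Submodule.zero_mem _, hl⟩
      · change Hom.dR q (val (Hom.dR (prodInr B A' ≫ Q) l)).1 = 0
        rw [hi', map_zero]
  · intro j
    rw [← h.surjective j]
    apply le_antisymm
    · rintro _ ⟨⟨⟨m, l⟩, hm⟩, hF, rfl⟩
      exact ⟨m, hF.1, rfl⟩
    · rintro _ ⟨m, hm, rfl⟩
      -- The element `m` need not be killed by `r`, but `s (q m)` is, lies in the same step of the
      -- filtration and has the same image in `D`.
      exact ⟨⟨(s (Hom.dR q m), 0), hrs _⟩, ⟨hsF j _ (Hom.map_Fil q j _ hm), Submodule.zero_mem _⟩,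
        hs _⟩
  · rw [hκ]
    have := LinearMap.congr_fun (congrArg Hom.dR t.condition) y
    change Hom.dR t.inl (Hom.dR i y) = Hom.dR t.inr (Hom.dR b y) at this
    change Hom.dR t.inl (Hom.dR i y) + Hom.dR t.inr (- Hom.dR b y) = 0
    rw [this, map_neg, add_neg_cancel]
  · intro t
    rw [Category.assoc]
    refine (congrArg (prodInl B A' ≫ ·) (complQuot_desc hgs hg _ _ hk _ _)).trans ?_
    refine hom_ext (LinearMap.ext fun x => ?_)
    change Hom.dR t.inl x + Hom.dR t.inr 0 = _
    rw [map_zero, add_zero]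
  · intro t
    rw [Category.assoc]
    refine (congrArg (prodInr B A' ≫ ·) (complQuot_desc hgs hg _ _ hk _ _)).trans ?_
    refine hom_ext (LinearMap.ext fun x => ?_)
    change Hom.dR t.inl 0 + Hom.dR t.inr x = _
    rw [map_zero, zero_add]
  · intro t φ h1 h2
    refine complQuot_hom_ext hgs hg _ _ hk (Eq.trans ?_ (complQuot_desc hgs hg _ _ hk _ _).symm)
    refine hom_ext (LinearMap.ext fun (x : B.dR × A'.dR) => ?_)
    have h1' := LinearMap.congr_fun (congrArg Hom.dR h1) x.1
    have h2' := LinearMap.congr_fun (congrArg Hom.dR h2) x.2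
    change Hom.dR φ (Hom.dR Q x) = Hom.dR t.inl x.1 + Hom.dR t.inr x.2
    rw [← h1', ← h2']
    change _ = Hom.dR φ (Hom.dR Q (x.1, 0)) + Hom.dR φ (Hom.dR Q (0, x.2))
    refine Eq.trans ?_ (map_add (Hom.dR φ ∘ₗ Hom.dR Q) _ _)
    exact congrArg (fun z => Hom.dR φ (Hom.dR Q z))
      (Prod.ext (add_zero _).symm (zero_add _).symm)
  · rw [Category.assoc, hQq]
    exact hom_ext (LinearMap.ext fun x => rfl)

/-- The pullback is the kernel of `q - a` on `B ⊕ D'`, and a filtered section `s` of `q` yields a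
filtered section of this difference. -/
theorem exists_pull (h : IsShortExact i q) {D' : FilFMIC R C} (a : D' ⟶ D) :
    ∃ (B' : FilFMIC R C) (i' : A ⟶ B') (q' : B' ⟶ D') (f : B' ⟶ B),
      IsShortExact i' q' ∧ IsPullback f q' q a ∧ i' ≫ f = i := by
  obtain ⟨s, r, hs, hri, hir, hrs, hsF, hrF⟩ := h.exists_splitting
  let p : prod B D' ⟶ D := prodFst B D' ≫ q - prodSnd B D' ≫ a
  have hp : ∀ x : B.dR × D'.dR, Hom.dR p x = Hom.dR q x.1 - Hom.dR a x.2 := fun x =>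
    LinearMap.congr_fun (sub_dR (prodFst B D' ≫ q) (prodSnd B D' ≫ a)) x
  let t : D.dR →ₗ[R] (prod B D').dR := LinearMap.inl R B.dR D'.dR ∘ₗ s
  have hgs : ∀ y, Hom.dR p (t y) = y := fun y => by
    refine (hp _).trans ?_
    change Hom.dR q (s y) - Hom.dR a 0 = y
    rw [hs, map_zero, sub_zero]
  have ht : ∀ j, ∀ x ∈ D.Fil j, t x ∈ (prod B D').Fil j :=
    fun j x hx => ⟨hsF j x hx, Submodule.zero_mem _⟩
  have hk : ∃ f : prod B D' ⟶ D, Hom.dR f = Hom.dR p := ⟨p, rfl⟩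
  let N := compl hgs (fun j => Hom.map_Fil p j) ht (Or.inl hk)
  let I : N ⟶ prod B D' := complIncl hgs _ ht _ hk
  have hi0 : ∀ y, Hom.dR p (Hom.dR (i ≫ prodInl B D') y) = 0 := fun y => by
    refine (hp _).trans ?_
    change Hom.dR q (Hom.dR i y) - Hom.dR a 0 = 0
    rw [h.comp_apply, map_zero, sub_zero]
  let i' : A ⟶ N := complLift hgs _ ht _ (i ≫ prodInl B D') hi0
  have hiI : i' ≫ I = i ≫ prodInl B D' := complLift_incl hgs _ ht _ hk _ hi0
  let val : N.dR → B.dR × D'.dR := fun x : LinearMap.ker (Hom.dR p) => x.1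
  have hi' : ∀ x, val (Hom.dR i' x) = (Hom.dR i x, 0) :=
    fun x => LinearMap.congr_fun (congrArg Hom.dR hiI) x
  have hmem : ∀ x : N.dR, Hom.dR q (val x).1 = Hom.dR a (val x).2 :=
    fun (x : LinearMap.ker (Hom.dR p)) => sub_eq_zero.1 ((hp _).symm.trans x.2)
  have hw : (I ≫ prodFst B D') ≫ q = (I ≫ prodSnd B D') ≫ a :=
    hom_ext (LinearMap.ext fun x => hmem x)
  refine ⟨N, i', I ≫ prodSnd B D', I ≫ prodFst B D', ⟨?_, ?_, ?_⟩, ⟨⟨hw⟩,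
    ⟨Limits.PullbackCone.IsLimit.mk hw
      (fun c => complLift hgs _ ht _ (c.fst ≫ prodInl B D' + c.snd ≫ prodInr B D') fun y => ?_)
      ?_ ?_ ?_⟩⟩, ?_⟩
  · intro x y hxy
    have := congrArg val hxy
    rw [hi', hi'] at this
    exact h.injective (congrArg Prod.fst this)
  · intro j
    apply le_antisymm
    · rintro ⟨⟨m, l⟩, hm⟩ ⟨hF, h0⟩
      have h0' : l = 0 := h0
      subst h0'
      have hq : Hom.dR q m = 0 := (hmem ⟨(m, 0), hm⟩).trans (map_zero _)
      obtain ⟨y, hy, rfl⟩ := h.mem_of_map_eq_zero hF.1 hq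
      exact ⟨y, hy, Subtype.ext (hi' y)⟩
    · rintro _ ⟨x, hx, rfl⟩
      constructor
      · change val (Hom.dR i' x) ∈ (prod B D').Fil j
        rw [hi']
        exact ⟨Hom.map_Fil i j _ hx, Submodule.zero_mem _⟩
      · change (val (Hom.dR i' x)).2 = 0
        rw [hi']
  · intro j
    apply le_antisymm
    · rintro _ ⟨⟨⟨m, l⟩, hm⟩, hF, rfl⟩
      exact hF.2
    · intro l hl
      refine ⟨⟨(s (Hom.dR a l), l), ?_⟩, ⟨hsF j _ (Hom.map_Fil a j _ hl), hl⟩, rfl⟩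
      refine (hp _).trans ?_
      change Hom.dR q (s (Hom.dR a l)) - Hom.dR a l = 0
      rw [hs, sub_self]
  · have := LinearMap.congr_fun (congrArg Hom.dR c.condition) y
    change Hom.dR q (Hom.dR c.fst y) = Hom.dR a (Hom.dR c.snd y) at this
    have e : Hom.dR (c.fst ≫ prodInl B D' + c.snd ≫ prodInr B D') y =
      (Hom.dR c.fst y, Hom.dR c.snd y) := Prod.ext (add_zero _) (zero_add _)
    rw [e]
    exact (hp _).trans (sub_eq_zero.2 this)
  · intro c
    rw [← Category.assoc]
    exact (congrArg (· ≫ prodFst B D') (complLift_incl hgs _ ht _ hk _ _)).trans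
      (hom_ext (LinearMap.ext fun x => add_zero _))
  · intro c
    rw [← Category.assoc]
    exact (congrArg (· ≫ prodSnd B D') (complLift_incl hgs _ ht _ hk _ _)).trans
      (hom_ext (LinearMap.ext fun x => zero_add _))
  · intro c φ h1 h2
    refine complIncl_hom_ext hgs _ ht _ hk (Eq.trans ?_ (complLift_incl hgs _ ht _ hk _ _).symm)
    refine hom_ext (LinearMap.ext fun x => Prod.ext ?_ ?_)
    · exact (LinearMap.congr_fun (congrArg Hom.dR h1) x).trans (add_zero _).symm
    · exact (LinearMap.congr_fun (congrArg Hom.dR h2) x).trans (zero_add _).symm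
  · rw [← Category.assoc, hiI]
    exact hom_ext (LinearMap.ext fun x => rfl)

end IsShortExact

instance : YonedaExact.ExactCat (FilFMIC R C) where
  sum := prod
  inl := prodInl
  inr := prodInr
  fst := prodFst
  snd := prodSnd
  inl_fst _ _ := hom_ext rfl
  inl_snd _ _ := hom_ext rfl
  inr_fst _ _ := hom_ext rfl
  inr_snd _ _ := hom_ext rfl
  total _ _ := hom_ext (LinearMap.ext fun x => Prod.ext (add_zero _) (zero_add _))
  Conf := IsShortExact
  conf_split X Y :=
    { injective := LinearMap.inl_injective
      exact := fun j => by
        ext ⟨x, y⟩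
        constructor
        · rintro ⟨hx, hy⟩
          exact ⟨x, hx.1, Prod.ext rfl (Eq.symm hy)⟩
        · rintro ⟨z, hz, hzx⟩
          obtain ⟨rfl, rfl⟩ := Prod.mk.inj hzx
          exact ⟨⟨hz, Submodule.zero_mem _⟩, rfl⟩
      surjective := fun j => by
        ext y
        constructor
        · rintro ⟨x, hx, rfl⟩
          exact hx.2
        · exact fun hy => ⟨(0, y), ⟨Submodule.zero_mem _, hy⟩, rfl⟩ }
  conf_sum {A B D A' B' D' i q i' q'} h h' := by
    have e1 : ∀ x : A.dR × A'.dR, Hom.dR (prodFst A A' ≫ i ≫ prodInl B B' +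
        prodSnd A A' ≫ i' ≫ prodInr B B') x = (Hom.dR i x.1, Hom.dR i' x.2) :=
      fun x => Prod.ext (add_zero _) (zero_add _)
    have e2 : ∀ x : B.dR × B'.dR, Hom.dR (prodFst B B' ≫ q ≫ prodInl D D' +
        prodSnd B B' ≫ q' ≫ prodInr D D') x = (Hom.dR q x.1, Hom.dR q' x.2) :=
      fun x => Prod.ext (add_zero _) (zero_add _)
    constructor
    · intro x y hxy
      obtain ⟨h1, h2⟩ := Prod.mk.inj ((e1 x).symm.trans (hxy.trans (e1 y)))
      exact Prod.ext (h.injective h1) (h'.injective h2)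
    · intro j
      ext ⟨x, y⟩
      constructor
      · rintro ⟨hx, hy⟩
        obtain ⟨h1, h2⟩ := Prod.mk.inj ((e2 (x, y)).symm.trans hy)
        obtain ⟨x', hx', rfl⟩ := h.mem_of_map_eq_zero hx.1 h1
        obtain ⟨y', hy', rfl⟩ := h'.mem_of_map_eq_zero hx.2 h2
        exact ⟨(x', y'), ⟨hx', hy'⟩, e1 _⟩
      · rintro ⟨z, hz, hzx⟩
        obtain ⟨rfl, rfl⟩ := Prod.mk.inj ((e1 z).symm.trans hzx)
        exact ⟨⟨Hom.map_Fil i j _ hz.1, Hom.map_Fil i' j _ hz.2⟩,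
          (e2 _).trans (Prod.ext (h.comp_apply _) (h'.comp_apply _))⟩
    · intro j
      ext ⟨x, y⟩
      constructor
      · rintro ⟨z, hz, hzx⟩
        obtain ⟨rfl, rfl⟩ := Prod.mk.inj ((e2 z).symm.trans hzx)
        exact ⟨Hom.map_Fil q j _ hz.1, Hom.map_Fil q' j _ hz.2⟩
      · rintro ⟨hx, hy⟩
        rw [← h.surjective] at hx
        rw [← h'.surjective] at hy
        obtain ⟨x', hx', rfl⟩ := hx
        obtain ⟨y', hy', rfl⟩ := hy
        exact ⟨(x', y'), ⟨hx', hy'⟩, e2 _⟩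
  conf_comp h := hom_ext (LinearMap.ext h.comp_apply)
  exists_push h b := h.exists_push b
  exists_pull h a := h.exists_pull a

end FilFMIC

namespace FilFMIC

open YonedaExact

variable {K R S : Type u} [Field K] [CommRing R] [Algebra K R] [CommRing S]
  [Algebra K S] [Algebra R S] [IsScalarTower K R S] {C : FrobeniusCalculus K S}

/-! ### The first map of a short exact sequence as a kernel. -/

namespace IsShortExact

variable {A B D X : FilFMIC R C} {i : A ⟶ B} {q : B ⟶ D}

theorem hom_ext_right (h : IsShortExact i q) {φ ψ : X ⟶ A} (hφ : φ ≫ i = ψ ≫ i) : φ = ψ :=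
  hom_ext (LinearMap.ext fun x => h.injective (LinearMap.congr_fun (congrArg Hom.dR hφ) x))

/-- The retraction `r` need not be a morphism, but `r ∘ φ` is one: its composite with `i` is the
morphism `φ`, and `i` remains split injective after base change to `S` and after tensoring with
differentials. -/
theorem exists_lift (h : IsShortExact i q) (φ : X ⟶ B) (hφ : φ ≫ q = 0) :
    ∃ ψ : X ⟶ A, ψ ≫ i = φ := by
  obtain ⟨s, r, hs, hri, hir, hrs, hsF, hrF⟩ := h.exists_splitting
  have hq : ∀ x, Hom.dR q (Hom.dR φ x) = 0 := LinearMap.congr_fun (congrArg Hom.dR hφ)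
  have h1 : Hom.dR i ∘ₗ (r ∘ₗ Hom.dR φ) = Hom.dR φ := LinearMap.ext fun x => by
    change Hom.dR i (r (Hom.dR φ x)) = _
    rw [hir, hq, map_zero, sub_zero]
  have h2 : ∀ x, rigMap (H := B) (L := A) r (rigMap (Hom.dR i) x) = x := fun x => by
    rw [← LinearMap.comp_apply, ← rigMap_comp, show r ∘ₗ Hom.dR i = LinearMap.id from
      LinearMap.ext hri, rigMap_id, LinearMap.id_apply]
  have h3 : ∀ x, rigMap (Hom.dR i) (rigMap (H := X) (L := A) (r ∘ₗ Hom.dR φ) x) =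
      rigMap (Hom.dR φ) x := fun x => by
    rw [← LinearMap.comp_apply, ← rigMap_comp, h1]
  refine ⟨homOfdR (r ∘ₗ Hom.dR φ) (fun x => ?_) (fun x => ?_)
    (fun j x hx => hrF j _ (Hom.map_Fil φ j x hx)), hom_ext h1⟩
  · rw [← h2 (rigMap _ (X.Φ x)), h3, hom_comm_Φ, ← h3, ← hom_comm_Φ, h2]
  · have hi : Function.Injective ((Hom.dR i).lTensor Ω[R⁄K]) :=
      Function.LeftInverse.injective (g := r.lTensor Ω[R⁄K]) fun t => by
        rw [← LinearMap.lTensor_comp_apply, show r ∘ₗ Hom.dR i = LinearMap.id from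
          LinearMap.ext hri, LinearMap.lTensor_id_apply]
    apply hi
    rw [← LinearMap.lTensor_comp_apply, h1, ← hom_comm_conn i, ← hom_comm_conn φ]
    exact congrArg B.conn.toFun (LinearMap.congr_fun h1 x)

end IsShortExact

/-! ### Spliced sequences and Yoneda extensions -/

namespace YonedaExtension

variable {H H' L L' N N' Z Z' : FilFMIC R C} {n : ℕ}

theorem HasMap.comp {E : YonedaExtension H H' n} {F : YonedaExtension L L' n}
    {G : YonedaExtension N N' n} {b : H' ⟶ L'} {a : H ⟶ L} {b' : L' ⟶ N'} {a' : L ⟶ N}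
    (h : E.HasMap F b a) (h' : F.HasMap G b' a') : E.HasMap G (b ≫ b') (a ≫ a') := by
  obtain ⟨f, h1, h2, h3⟩ := h
  obtain ⟨f', h1', h2', h3'⟩ := h'
  refine ⟨fun i => f i ≫ f' i, ?_, fun i => ?_, ?_⟩
  · rw [← Category.assoc, h1, Category.assoc, h1', Category.assoc]
  · rw [← Category.assoc, h2, Category.assoc, h2', Category.assoc]
  · rw [← Category.assoc, h3, Category.assoc, h3', Category.assoc]

theorem boundaries_succ (M : Fin (n + 1 + 1) → FilFMIC R C)
    (δ : ∀ i : Fin (n + 1), M i.succ ⟶ M i.castSucc) (ι : H' ⟶ M (Fin.last (n + 1))) (j : ℤ)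
    (i : Fin (n + 1)) : boundaries M δ ι j i.succ =
      boundaries (H' := H') (fun i => M i.succ) (fun i => δ i.succ) ι j i := by
  induction i using Fin.lastCases with
  | last =>
    exact (boundaries_last M δ ι j).trans
      (boundaries_last (H' := H') (fun i => M i.succ) (fun i => δ i.succ) ι j).symm
  | cast k =>
    exact (boundaries_castSucc M δ ι j k.succ).trans
      (boundaries_castSucc (H' := H') (fun i => M i.succ) (fun i => δ i.succ) ι j k).symm

/-- A short exact sequence as a Yoneda extension. -/
def ofSES (T : SES H H') : YonedaExtension H H' 0 where
  M _ := T.M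
  ι := T.ι
  δ := fun i => i.elim0
  π := T.π
  injective_ι := (T.conf : IsShortExact T.ι T.π).injective
  exact i j := by
    obtain rfl : i = Fin.last 0 := Fin.ext (by omega)
    exact ((T.conf : IsShortExact T.ι T.π).exact j).trans
      (boundaries_last (n := 0) (fun _ => T.M) (fun i => i.elim0) T.ι j).symm
  surjective_π := (T.conf : IsShortExact T.ι T.π).surjective

/-- The splice of a Yoneda extension with a short exact sequence. -/
def cons (Y : YonedaExtension Z H' n) (T : SES H Z) : YonedaExtension H H' (n + 1) where
  M := Fin.cons T.M Y.M
  ι := Y.ι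
  δ := Fin.cases (Y.π ≫ T.ι) Y.δ
  π := T.π
  injective_ι := Y.injective_ι
  exact i j := by
    let δ : ∀ i : Fin (n + 1), (Fin.cons T.M Y.M : Fin (n + 2) → FilFMIC R C) i.succ ⟶
        (Fin.cons T.M Y.M : Fin (n + 2) → FilFMIC R C) i.castSucc := Fin.cases (Y.π ≫ T.ι) Y.δ
    have hT : IsShortExact T.ι T.π := T.conf
    induction i using Fin.cases with
    | zero =>
      refine Eq.trans ?_ (boundaries_castSucc (n := n + 1) (Fin.cons T.M Y.M) δ Y.ι j 0).symm
      change T.M.Fil j ⊓ LinearMap.ker (Hom.dR T.π) =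
        ((Y.M 0).Fil j).map (Hom.dR T.ι ∘ₗ Hom.dR Y.π)
      -- Strictness of `Y.π` enters here: it maps each `Fil j` onto `Fil j` of the intermediate
      -- object.
      rw [Submodule.map_comp, Y.surjective_π, hT.exact]
    | succ i =>
      refine Eq.trans (Eq.trans ?_ (Y.exact i j)) (boundaries_succ (Fin.cons T.M Y.M) δ Y.ι j i).symm
      induction i using Fin.cases with
      | zero =>
        -- Composing with the injective map `T.ι` does not change the kernel of `Y.π`.
        change (Y.M 0).Fil j ⊓ LinearMap.ker (Hom.dR T.ι ∘ₗ Hom.dR Y.π) =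
          (Y.M 0).Fil j ⊓ LinearMap.ker (Hom.dR Y.π)
        rw [LinearMap.ker_comp, LinearMap.ker_eq_bot.2 hT.injective]
        rfl
      | succ k => rfl
  surjective_π := (T.conf : IsShortExact T.ι T.π).surjective

theorem HasMap.cons {E : YonedaExtension Z H' n} {F : YonedaExtension Z' L' n} {T : SES H Z}
    {T' : SES L Z'} {b : H' ⟶ L'} {z : Z ⟶ Z'} {a : H ⟶ L} (h : E.HasMap F b z)
    (h' : T.HasMap T' z a) : (E.cons T).HasMap (F.cons T') b a := by
  obtain ⟨f, h1, h2, h3⟩ := h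
  obtain ⟨g, h1', h2'⟩ := h'
  let φ : ∀ i, (E.cons T).M i ⟶ (F.cons T').M i := Fin.cases g f
  refine ⟨φ, h1, fun i => ?_, h2'⟩
  induction i using Fin.cases with
  | succ k => exact h2 k
  | zero => ?_
  change (E.π ≫ T.ι) ≫ g = f 0 ≫ F.π ≫ T'.ι
  rw [Category.assoc, h1', ← Category.assoc, h3, Category.assoc]

/-- A morphism of Yoneda extensions does not contain a map of the intermediate objects. It is
recovered because `T'.ι` is a kernel of `T'.π`. -/
theorem HasMap.of_cons {E : YonedaExtension Z H' n} {F : YonedaExtension Z' L' n} {T : SES H Z}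
    {T' : SES L Z'} {b : H' ⟶ L'} {a : H ⟶ L} (h : (E.cons T).HasMap (F.cons T') b a) :
    ∃ z : Z ⟶ Z', E.HasMap F b z ∧ T.HasMap T' z a := by
  obtain ⟨f, h1, h2, h3⟩ := h
  have hT' : IsShortExact T'.ι T'.π := T'.conf
  let f0 : T.M ⟶ T'.M := f 0
  let f' : ∀ i, E.M i ⟶ F.M i := fun i => f i.succ
  have h3' : T.π ≫ a = f0 ≫ T'.π := h3
  obtain ⟨z, hz⟩ := hT'.exists_lift (T.ι ≫ f0) (by
    rw [Category.assoc, ← h3', ← Category.assoc, T.ι_π, Limits.zero_comp])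
  have h0 : (E.π ≫ T.ι) ≫ f0 = f' 0 ≫ F.π ≫ T'.ι := h2 0
  refine ⟨z, ⟨f', h1, fun i => h2 i.succ, hT'.hom_ext_right ?_⟩, f0, hz.symm, h3'⟩
  rw [Category.assoc, hz, ← Category.assoc, h0, Category.assoc]

end YonedaExtension

/-! ### Comparison of Yoneda classes with classes of spliced sequences, and the group law. -/

namespace Ext

variable {H H' L L' N N' Z Z' : FilFMIC R C} {n : ℕ}

/-- The Yoneda extension defined by a spliced sequence. -/
def toYoneda : ∀ {n : ℕ} {H H' : FilFMIC R C}, YE n H H' → YonedaExtension H H' n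
  | 0, _, _ => fun T => .ofSES T
  | _ + 1, _, _ => fun E => (toYoneda E.2.1).cons E.2.2

theorem toYoneda_hasMap : ∀ {n : ℕ} {H H' L L' : FilFMIC R C} {E : YE n H H'} {F : YE n L L'}
    {b : H' ⟶ L'} {a : H ⟶ L}, (toYoneda E).HasMap (toYoneda F) b a ↔ E.HasMap F b a
  | 0, _, _, _, _, _, _, _, _ =>
    ⟨fun ⟨f, h1, _, h3⟩ => ⟨f 0, h1, h3⟩, fun ⟨f, h1, h3⟩ => ⟨fun _ => f, h1, fun i => i.elim0, h3⟩⟩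
  | _ + 1, _, _, _, _, E, F, b, a => by
    constructor
    · intro h
      obtain ⟨z, h1, h2⟩ := YonedaExtension.HasMap.of_cons (E := toYoneda E.2.1)
        (F := toYoneda F.2.1) h
      exact ⟨z, toYoneda_hasMap.1 h1, h2⟩
    · rintro ⟨z, h1, h2⟩
      exact YonedaExtension.HasMap.cons (toYoneda_hasMap.2 h1) h2

/-- The intermediate object is the kernel of `Y.π`, which exists because a strict epimorphism has a
filtered section. Both comparison maps are the identity on every term. -/
theorem exists_cons (Y : YonedaExtension H H' (n + 1)) :
    ∃ (Z : FilFMIC R C) (Y' : YonedaExtension Z H' n) (T : SES H Z),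
      (Y'.cons T).HasMap Y (𝟙 H') (𝟙 H) ∧ Y.HasMap (Y'.cons T) (𝟙 H') (𝟙 H) := by
  obtain ⟨s, hs, hsF⟩ := H.exists_filtered_section (Y.M 0).Fil (Y.M 0).antitone_Fil
    (Hom.dR Y.π) Y.surjective_π
  have hk : ∃ f : Y.M 0 ⟶ H, Hom.dR f = Hom.dR Y.π := ⟨Y.π, rfl⟩
  let Z := compl hs (fun j => Hom.map_Fil Y.π j) hsF (Or.inl hk)
  let I : Z ⟶ Y.M 0 := complIncl hs _ hsF _ hk
  have hI : IsShortExact I Y.π :=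
    { injective := Subtype.val_injective
      exact := fun j => by
        ext x
        exact ⟨fun hx => ⟨⟨x, hx.2⟩, hx.1, rfl⟩, by rintro ⟨y, hy, rfl⟩; exact ⟨hy, y.2⟩⟩
      surjective := Y.surjective_π }
  let δ0 : Y.M (Fin.succ 0) ⟶ Y.M 0 := Y.δ 0
  have h0 : ∀ j, (Y.M 0).Fil j ⊓ LinearMap.ker (Hom.dR Y.π) =
      ((Y.M (Fin.succ 0)).Fil j).map (Hom.dR δ0) := fun j =>
    (Y.exact 0 j).trans (boundaries_castSucc Y.M Y.δ Y.ι j 0)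
  have hδ : ∀ x, Hom.dR Y.π (Hom.dR δ0 x) = 0 := fun x => by
    obtain ⟨a, ha⟩ := (Y.M (Fin.succ 0)).exists_Fil_eq_top
    exact ((h0 a).ge ⟨x, by rw [ha]; trivial, rfl⟩).2
  let ρ : Y.M (Fin.succ 0) ⟶ Z := complLift hs _ hsF _ δ0 hδ
  have hρ : ρ ≫ I = δ0 := complLift_incl hs _ hsF _ hk δ0 hδ
  have hρx : ∀ x, Hom.dR I (Hom.dR ρ x) = Hom.dR δ0 x :=
    LinearMap.congr_fun (congrArg Hom.dR hρ)
  let Y' : YonedaExtension Z H' n :=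
    { M := fun i => Y.M i.succ
      ι := Y.ι
      δ := fun i => Y.δ i.succ
      π := ρ
      injective_ι := Y.injective_ι
      exact := fun i j => by
        refine Eq.trans ?_ ((Y.exact i.succ j).trans
          (YonedaExtension.boundaries_succ Y.M Y.δ Y.ι j i))
        induction i using Fin.cases with
        | zero =>
          change (Y.M (Fin.succ 0)).Fil j ⊓ LinearMap.ker (Hom.dR ρ) =
            (Y.M (Fin.succ 0)).Fil j ⊓ LinearMap.ker (Hom.dR δ0)
          rw [← hρ, comp_dR, LinearMap.ker_comp, LinearMap.ker_eq_bot.2 hI.injective]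
          rfl
        | succ k => rfl
      surjective_π := fun j => by
        ext x
        constructor
        · rintro ⟨y, hy, rfl⟩
          exact Hom.map_Fil ρ j y hy
        · intro hx
          have : Hom.dR I x ∈ (Y.M 0).Fil j ⊓ LinearMap.ker (Hom.dR Y.π) :=
            ⟨hx, hI.comp_apply x⟩
          rw [h0] at this
          obtain ⟨y, hy, hyx⟩ := this
          exact ⟨y, hy, hI.injective ((hρx y).trans hyx)⟩ }
  refine ⟨Z, Y', ⟨Y.M 0, I, Y.π, hI⟩, ?_, ?_⟩
  · refine ⟨Fin.cases (𝟙 (Y.M 0)) fun i => 𝟙 (Y.M i.succ), ?_, Fin.cases ?_ fun i => ?_, ?_⟩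
    · exact (Category.comp_id _).trans (Category.id_comp _).symm
    · exact (Category.comp_id _).trans (Category.id_comp _).symm
    · exact (Category.comp_id _).trans (hρ.trans (Category.id_comp _).symm)
    · exact (Category.comp_id _).trans (Category.id_comp _).symm
  · refine ⟨Fin.cases (𝟙 (Y.M 0)) fun i => 𝟙 (Y.M i.succ), ?_, Fin.cases ?_ fun i => ?_, ?_⟩
    · exact (Category.comp_id _).trans (Category.id_comp _).symm
    · exact (Category.comp_id _).trans (Category.id_comp _).symm
    · exact (Category.comp_id _).trans (hρ.symm.trans (Category.id_comp _).symm)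
    · exact (Category.comp_id _).trans (Category.id_comp _).symm

theorem exists_toYoneda : ∀ {n : ℕ} {H H' : FilFMIC R C} (Y : YonedaExtension H H' n),
    ∃ E : YE n H H', (toYoneda E).HasMap Y (𝟙 H') (𝟙 H) ∧ Y.HasMap (toYoneda E) (𝟙 H') (𝟙 H)
  | 0, H, H', Y => by
    let T : SES H H' := ⟨Y.M 0, Y.ι, Y.π, Y.injective_ι, fun j => (Y.exact 0 j).trans
      (boundaries_last (n := 0) Y.M Y.δ Y.ι j), Y.surjective_π⟩
    refine ⟨T, ⟨Fin.cases (𝟙 (Y.M 0)) (fun i => i.elim0), ?_, fun i => i.elim0, ?_⟩,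
      ⟨Fin.cases (𝟙 (Y.M 0)) (fun i => i.elim0), ?_, fun i => i.elim0, ?_⟩⟩ <;>
      exact (Category.comp_id _).trans (Category.id_comp _).symm
  | _ + 1, H, H', Y => by
    obtain ⟨Z, Y', T, h1, h2⟩ := exists_cons Y
    obtain ⟨E, h1', h2'⟩ := exists_toYoneda Y'
    refine ⟨E.splice T, ?_, ?_⟩
    · have := (h1'.cons (SES.HasMap.id T)).comp h1
      rw [Category.comp_id, Category.comp_id] at this
      exact this
    · have := h2.comp (h2'.cons (SES.HasMap.id T))
      rw [Category.comp_id, Category.comp_id] at this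
      exact this

/-- A spliced sequence which represents a Yoneda extension. -/
def ofYoneda (Y : YonedaExtension H H' n) : YE n H H' := (exists_toYoneda Y).choose

theorem ofYoneda_hasMap {Y : YonedaExtension H H' n} {Y' : YonedaExtension L L' n} {b : H' ⟶ L'}
    {a : H ⟶ L} (h : Y.HasMap Y' b a) : (ofYoneda Y).HasMap (ofYoneda Y') b a := by
  rw [← toYoneda_hasMap]
  have := ((exists_toYoneda Y).choose_spec.1.comp h).comp (exists_toYoneda Y').choose_spec.2
  rw [Category.id_comp, Category.id_comp, Category.comp_id, Category.comp_id] at this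
  exact this

theorem ofYoneda_toYoneda (E : YE n H H') :
    (ofYoneda (toYoneda E)).HasMap E (𝟙 H') (𝟙 H) :=
  toYoneda_hasMap.1 (exists_toYoneda (toYoneda E)).choose_spec.1

variable (H H' n) in
/-- Classes of Yoneda extensions are classes of spliced sequences. -/
def equiv : Ext H H' n ≃ YExt n H H' where
  toFun := Quot.map ofYoneda fun _ _ h => ofYoneda_hasMap h
  invFun := Quot.map toYoneda fun _ _ h => toYoneda_hasMap.2 h
  left_inv x := by
    induction x using Quot.ind with
    | mk Y => exact Quot.sound (exists_toYoneda Y).choose_spec.1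
  right_inv x := by
    induction x using Quot.ind with
    | mk E => exact Quot.sound (ofYoneda_toYoneda E)

theorem equiv_mk (Y : YonedaExtension H H' n) : equiv H H' n (mk Y) = .mk (ofYoneda Y) := rfl

theorem equiv_toYoneda (E : YE n H H') : equiv H H' n (mk (toYoneda E)) = .mk E :=
  YExt.mk_eq (ofYoneda_toYoneda E)

instance : AddCommGroup (Ext H H' n) := (equiv H H' n).addCommGroup

theorem equiv_add (x y : Ext H H' n) : equiv H H' n (x + y) = equiv H H' n x + equiv H H' n y :=
  (equiv H H' n).apply_symm_apply _

theorem equiv_zero : equiv H H' n 0 = 0 := (equiv H H' n).apply_symm_apply 0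

/-- If `E` witnesses a Baer sum, the three classes are the pullbacks of `E` along the two inclusions
and along the diagonal. The diagonal is the sum of the inclusions and pullback is additive in the
morphism. Conversely, a representative of the sum of the pullbacks of `x` and `y` along the two
projections is such a witness. -/
theorem isBaerSum_iff (x y z : Ext H H' n) : IsBaerSum x y z ↔ x + y = z := by
  rw [← (equiv H H' n).apply_eq_iff_eq, equiv_add]
  constructor
  · rintro ⟨b, Δ, Ex, Ey, Ez, E, ⟨hb⟩, h1, h2, rfl, rfl, rfl, hx, hy, hz⟩
    rw [equiv_mk, equiv_mk, equiv_mk, ← YExt.pull_eq_of_hasMap (ofYoneda_hasMap hx),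
      ← YExt.pull_eq_of_hasMap (ofYoneda_hasMap hy), ← YExt.pull_eq_of_hasMap (ofYoneda_hasMap hz)]
    have e : Δ = b.inl + b.inr := by
      refine Limits.BinaryFan.IsLimit.hom_ext hb.isLimit ?_ ?_
      · change Δ ≫ b.fst = (b.inl + b.inr) ≫ b.fst
        rw [h1, Preadditive.add_comp, b.inl_fst]
        exact (add_zero _).symm.trans (congrArg (𝟙 H + ·) b.inr_fst.symm)
      · change Δ ≫ b.snd = (b.inl + b.inr) ≫ b.snd
        rw [h2, Preadditive.add_comp, b.inr_snd]
        exact (zero_add _).symm.trans (congrArg (· + 𝟙 H) b.inl_snd.symm)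
    rw [e, YExt.add_pull]
  · intro h
    obtain ⟨E, hE⟩ := YExt.mk_surjective (YExt.pull (ExactCat.fst H H) (equiv H H' n x) +
      YExt.pull (ExactCat.snd H H) (equiv H H' n y))
    let b : Limits.BinaryBicone H H :=
      { pt := ExactCat.sum H H
        fst := ExactCat.fst H H
        snd := ExactCat.snd H H
        inl := ExactCat.inl H H
        inr := ExactCat.inr H H
        inl_fst := ExactCat.inl_fst H H
        inl_snd := ExactCat.inl_snd H H
        inr_fst := ExactCat.inr_fst H H
        inr_snd := ExactCat.inr_snd H H }
    have key : ∀ (a : H ⟶ ExactCat.sum H H) (w : Ext H H' n), YExt.pull a (.mk E) = equiv H H' n w →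
        mk (toYoneda (E.pull a)) = w := fun a w hw =>
      (equiv H H' n).injective ((equiv_toYoneda _).trans hw)
    refine ⟨b, diag H, toYoneda (E.pull b.inl), toYoneda (E.pull b.inr),
      toYoneda (E.pull (diag H)), toYoneda E, ⟨Limits.isBinaryBilimitOfTotal b (ExactCat.total H H)⟩,
      ?_, ?_, key _ _ ?_, key _ _ ?_, key _ _ ?_, toYoneda_hasMap.2 (YE.hasMap_pull _ E),
      toYoneda_hasMap.2 (YE.hasMap_pull _ E), toYoneda_hasMap.2 (YE.hasMap_pull _ E)⟩
    · change diag H ≫ ExactCat.fst H H = _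
      simp [diag]
    · change diag H ≫ ExactCat.snd H H = _
      simp [diag]
    · rw [hE, YExt.pull_add, YExt.pull_pull, YExt.pull_pull]
      change YExt.pull (ExactCat.inl H H ≫ _) _ + YExt.pull (ExactCat.inl H H ≫ _) _ = _
      rw [ExactCat.inl_fst, ExactCat.inl_snd, YExt.pull_id, YExt.pull_zero_eq, add_zero]
    · rw [hE, YExt.pull_add, YExt.pull_pull, YExt.pull_pull]
      change YExt.pull (ExactCat.inr H H ≫ _) _ + YExt.pull (ExactCat.inr H H ≫ _) _ = _
      rw [ExactCat.inr_fst, ExactCat.inr_snd, YExt.pull_id, YExt.pull_zero_eq, zero_add]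
    · rw [hE, YExt.pull_add, YExt.pull_pull, YExt.pull_pull, ← h]
      simp [diag, YExt.pull_id]

/-- The trivial extension has an endomorphism which is the identity on the left end and zero on the
right end, so it is its own pullback along zero. -/
theorem mk_trivialExtension : mk (trivialExtension H H') = 0 := by
  apply (equiv H H' 1).injective
  rw [equiv_zero, equiv_mk]
  have h : (trivialExtension H H').HasMap (trivialExtension H H') (𝟙 H') 0 := by
    refine ⟨Fin.cases 0 fun _ => 𝟙 H', ?_, fun i => ?_, ?_⟩
    · exact (Category.comp_id _).trans (Category.id_comp _).symm
    · obtain rfl : i = 0 := Fin.ext (by omega)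
      change (0 : H' ⟶ H) ≫ (0 : H ⟶ H) = 𝟙 H' ≫ (0 : H' ⟶ H)
      rw [Limits.comp_zero, Limits.comp_zero]
    · change 𝟙 H ≫ (0 : H ⟶ H) = (0 : H ⟶ H) ≫ 𝟙 H
      rw [Limits.comp_zero, Limits.zero_comp]
  rw [← YExt.pull_eq_of_hasMap (ofYoneda_hasMap h), YExt.pull_zero_eq]

end Ext

end FilFMIC

namespace FilFMIC

open YonedaExact

variable {K R S : Type u} [Field K] [CommRing R] [Algebra K R] [CommRing S]
  [Algebra K S] [Algebra R S] [IsScalarTower K R S] {C : FrobeniusCalculus K S}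

/-! ### Extensions of Tate objects -/

section extension

variable {M : Type u} [AddCommGroup M] [Module R M] {H : Type u} [AddCommGroup H] [Module S H]

/-- The connection on `M ⊕ R e` which extends a connection on `M` and satisfies `∇ e = ν`. -/
def extConn (n : Conn K R M) (ν : Ω[R⁄K] ⊗[R] M) : Conn K R (M × R) where
  toFun := (prodConn n (tateConn K R)).toFun +
    { toFun := fun x => x.2 • (LinearMap.inl R M R).lTensor Ω[R⁄K] ν
      map_zero' := by simp
      map_add' := fun x y => by rw [Prod.snd_add, add_smul] }
  leibniz r x := by
    change (prodConn n (tateConn K R)).toFun (r • x) + (r * x.2) • _ =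
      _ + r • ((prodConn n (tateConn K R)).toFun x + x.2 • _)
    rw [(prodConn n (tateConn K R)).leibniz, smul_add, mul_smul, add_assoc]

theorem extConn_apply (n : Conn K R M) (ν : Ω[R⁄K] ⊗[R] M) (x : M × R) :
    (extConn n ν).toFun x = (LinearMap.inl R M R).lTensor Ω[R⁄K] (n.toFun x.1) +
      KaehlerDifferential.D K R x.2 ⊗ₜ[R] ((0 : M), (1 : R)) +
      x.2 • (LinearMap.inl R M R).lTensor Ω[R⁄K] ν := by
  change (prodConn n (tateConn K R)).toFun x + x.2 • _ = _
  rw [prodConn_apply, tateConn_apply, LinearMap.lTensor_tmul]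
  rfl

theorem extConn_inl (n : Conn K R M) (ν : Ω[R⁄K] ⊗[R] M) :
    n.Compat (extConn n ν) (LinearMap.inl R M R) := fun x => by
  rw [extConn_apply]; simp

theorem extConn_snd (n : Conn K R M) (ν : Ω[R⁄K] ⊗[R] M) :
    (extConn n ν).Compat (tateConn K R) (LinearMap.snd R M R) := fun x => by
  rw [extConn_apply, map_add, map_add, map_smul, ← LinearMap.lTensor_comp_apply,
    ← LinearMap.lTensor_comp_apply, LinearMap.snd_comp_inl, tateConn_apply]
  simp

/-- The contraction of a vector valued form with a vector field. -/
def contract (X : Derivation K R R) (ν : Ω[R⁄K] ⊗[R] M) : M :=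
  TensorProduct.lid R M (X.liftKaehlerDifferential.rTensor M ν)

theorem extConn_cov (n : Conn K R M) (ν : Ω[R⁄K] ⊗[R] M) (X : Derivation K R R) (x : M × R) :
    (extConn n ν).cov X x = (n.cov X x.1 + x.2 • contract X ν, X x.2) := by
  have key : ∀ t : Ω[R⁄K] ⊗[R] M, TensorProduct.lid R (M × R)
      (X.liftKaehlerDifferential.rTensor (M × R) ((LinearMap.inl R M R).lTensor Ω[R⁄K] t)) =
      (contract X t, 0) := by
    intro t
    induction t with
    | zero => simp [contract]; rfl
    | tmul ω x => simp [contract]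
    | add a b ha hb =>
      rw [map_add, map_add, map_add, ha, hb, contract, contract, contract, map_add, map_add]
      simp
  rw [Conn.cov, extConn_apply, map_add, map_add, map_add, map_add, map_smul, map_smul, key, key]
  ext <;> simp [Conn.cov, contract]

/-- The curvature of the new connection on the new basis vector is the covariant derivative of `ν`;
the hypothesis says that it vanishes on pairs of vector fields. -/
theorem extConn_integrable (n : Conn K R M) (ν : Ω[R⁄K] ⊗[R] M) (hn : n.Integrable)
    (hν : ∀ X Y : Derivation K R R, n.cov X (contract Y ν) - n.cov Y (contract X ν) =
      contract ⁅X, Y⁆ ν) : (extConn n ν).Integrable := by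
  have hcov : ∀ (X : Derivation K R R) (r : R) (y : M), n.cov X (r • y) = X r • y + r • n.cov X y := by
    intro X r y
    simp [Conn.cov, n.leibniz]
  intro X Y x
  simp only [extConn_cov, Conn.cov_add, hcov, ← hν, ← hn X Y x.1, Derivation.commutator_apply]
  ext
  · simp only [Prod.fst_sub, smul_sub]
    abel
  · simp

/-- The Frobenius on `H ⊕ S e` which extends a Frobenius on `H` and maps `e` to
`η + p ^ (-m) e`. -/
def extFrobenius (p : ℕ) (m : ℤ) (Φ : H →ₛₗ[C.σ] H) (η : H) : H × S →ₛₗ[C.σ] H × S where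
  toFun x := (Φ x.1 + C.σ x.2 • η, tateFrobenius C p m x.2)
  map_add' x y := by
    simp only [Prod.fst_add, Prod.snd_add, map_add, add_smul, Prod.mk_add_mk]
    congr 1
    abel
  map_smul' s x := by
    simp only [Prod.smul_fst, Prod.smul_snd, smul_eq_mul, map_mul, LinearMap.map_smulₛₗ,
      Prod.smul_mk, smul_add, mul_smul]
    rw [← smul_eq_mul, LinearMap.map_smulₛₗ, smul_eq_mul]

/-- The Frobenius is the diagonal one followed by a unipotent automorphism `1 + w` with `w² = 0`. -/
theorem extFrobenius_bijective (p : ℕ) (hp : (p : K) ≠ 0) (m : ℤ) (Φ : H →ₛₗ[C.σ] H) (η : H)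
    (h : Function.Bijective (FrobeniusCalculus.linearization C.σ (prodFrobenius Φ
      (tateFrobenius C p m)))) :
    Function.Bijective (FrobeniusCalculus.linearization C.σ (extFrobenius p m Φ η)) := by
  have hq : algebraMap K S ((p : K) ^ m) * algebraMap K S ((p : K) ^ (-m)) = 1 := by
    rw [← map_mul, ← zpow_add₀ hp, add_neg_cancel, zpow_zero, map_one]
  -- The factor `p ^ m` compensates the `p ^ (-m)` in the Frobenius of the Tate object.
  let w : H × S →ₗ[S] H × S := LinearMap.inl S H S ∘ₗ
    (LinearMap.toSpanSingleton S H (algebraMap K S ((p : K) ^ m) • η)) ∘ₗ LinearMap.snd S H S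
  have hw : ∀ x, w (w x) = 0 := fun x => by simp [w]
  let e : (H × S) ≃ₗ[S] (H × S) := LinearEquiv.ofLinearMap (LinearMap.id + w) (LinearMap.id - w)
    (LinearMap.ext fun x => by simp [hw]) (LinearMap.ext fun x => by simp [hw])
  have he : ∀ x, e (prodFrobenius Φ (tateFrobenius C p m) x) = extFrobenius p m Φ η x := by
    intro x
    change (Φ x.1, tateFrobenius C p m x.2) + ((tateFrobenius C p m x.2) •
      algebraMap K S ((p : K) ^ m) • η, (0 : S)) = (Φ x.1 + C.σ x.2 • η, tateFrobenius C p m x.2)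
    rw [Prod.mk_add_mk, add_zero, smul_smul, tateFrobenius_apply]
    congr 3
    linear_combination C.σ x.2 * hq
  have hl : ∀ t, FrobeniusCalculus.linearization C.σ (extFrobenius p m Φ η) t =
      e (FrobeniusCalculus.linearization C.σ (prodFrobenius Φ (tateFrobenius C p m)) t) := by
    intro t
    induction t with
    | zero => simp
    | tmul s x =>
      obtain ⟨s, rfl⟩ := (Restrict.of C.σ S).surjective s
      rw [FrobeniusCalculus.linearization_tmul, FrobeniusCalculus.linearization_tmul, map_smul, he]
    | add a b ha hb => simp only [map_add, ha, hb]
  have : ⇑(FrobeniusCalculus.linearization C.σ (extFrobenius p m Φ η)) =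
      e ∘ FrobeniusCalculus.linearization C.σ (prodFrobenius Φ (tateFrobenius C p m)) :=
    funext hl
  rw [this]
  exact e.bijective.comp h

variable (S) in
/-- The form on `H ≅ S ⊗ M` defined by a form on `M`. -/
def rigForm (C : FrobeniusCalculus K S) (c : S ⊗[R] M ≃ₗ[S] H) :
    Ω[R⁄K] ⊗[R] M →+ C.Omega ⊗[S] H :=
  (c.toLinearMap.lTensor C.Omega).toAddMonoidHom.comp (baseChangeForm C)

theorem rigForm_tmul (c : S ⊗[R] M ≃ₗ[S] H) (ω : Ω[R⁄K]) (x : M) :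
    rigForm S C c (ω ⊗ₜ x) = C.N.mkQ (KaehlerDifferential.map K K R S ω) ⊗ₜ[S] c (1 ⊗ₜ x) := rfl

/-- On the subobject horizontality is given. The hypothesis `hη` compares `∇ Φ` with `Φ ∇` on the
new basis vector, whose Frobenius is `η + p ^ (-m) e` and whose derivative is `ν`. -/
theorem extConn_horizontal (p : ℕ) (m : ℤ) (n : Conn K R M) (ν : Ω[R⁄K] ⊗[R] M)
    (c : S ⊗[R] M ≃ₗ[S] H) (Φ : H →ₛₗ[C.σ] H) (η : H) (hn : n.Horizontal C c Φ)
    (hη : n.rig C c η + algebraMap K S ((p : K) ^ (-m)) • rigForm S C c ν =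
      TensorProduct.map C.omegaFrobenius Φ (rigForm S C c ν)) :
    (extConn n ν).Horizontal C
      (prodComparison S M R c (TensorProduct.AlgebraTensorModule.rid R S S))
      (extFrobenius p m Φ η) := by
  set c' := prodComparison S M R c (TensorProduct.AlgebraTensorModule.rid R S S)
  have hc := prodComparison_inl c (TensorProduct.AlgebraTensorModule.rid R S S)
  have h1 := (extConn_inl n ν).rig (C := C) c c' hc
  have hl : ∀ y, LinearMap.inl S H S (Φ y) = extFrobenius p m Φ η (LinearMap.inl S H S y) := by
    intro y
    refine Prod.ext ?_ ?_
    · change Φ y = Φ y + C.σ 0 • η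
      rw [map_zero, zero_smul, add_zero]
    · exact (map_zero (tateFrobenius C p m)).symm
  have hν : ∀ t : Ω[R⁄K] ⊗[R] M, c'.toLinearMap.lTensor C.Omega
      (baseChangeForm C ((LinearMap.inl R M R).lTensor Ω[R⁄K] t)) =
      (LinearMap.inl S H S).lTensor C.Omega (rigForm S C c t) := by
    intro t
    rw [baseChangeForm_natural, ← LinearMap.lTensor_comp_apply]
    change _ = (LinearMap.inl S H S).lTensor C.Omega (c.toLinearMap.lTensor C.Omega _)
    rw [← LinearMap.lTensor_comp_apply]
    congr 2
    exact (LinearMap.ext hc).symm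
  have h2 : (extConn n ν).rig C c' ((0 : H), (1 : S)) =
      (LinearMap.inl S H S).lTensor C.Omega (rigForm S C c ν) := by
    have hc2 : c' ((1 : S) ⊗ₜ ((0 : M), (1 : R))) = ((0 : H), (1 : S)) := by
      simp [c', prodComparison]
    rw [← hc2, Conn.rig_apply, extConn_apply]
    simp only [map_zero, Derivation.map_one_eq_zero, TensorProduct.zero_tmul, zero_add, one_smul]
    exact hν ν
  apply Conn.horizontal_of_span (X := insert ((0 : H), (1 : S)) (Set.range (LinearMap.inl S H S)))
  · rw [eq_top_iff]
    rintro ⟨y, s⟩ -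
    have e : ((y, s) : H × S) = LinearMap.inl S H S y + s • ((0 : H), (1 : S)) := by
      ext <;> simp
    rw [e]
    exact add_mem (Submodule.subset_span (Or.inr ⟨y, rfl⟩))
      (Submodule.smul_mem _ _ (Submodule.subset_span (Or.inl rfl)))
  · rintro x (rfl | ⟨y, rfl⟩)
    · have e : extFrobenius p m Φ η ((0 : H), (1 : S)) = LinearMap.inl S H S η +
          algebraMap K S ((p : K) ^ (-m)) • ((0 : H), (1 : S)) := by
        refine Prod.ext ?_ ?_
        · change Φ 0 + C.σ 1 • η = η + _ • (0 : H)
          rw [map_zero, map_one, one_smul, zero_add, smul_zero, add_zero]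
        · change algebraMap K S ((p : K) ^ (-m)) * C.σ 1 = 0 + algebraMap K S ((p : K) ^ (-m)) * 1
          rw [map_one, zero_add]
      rw [e, map_add, h1, Conn.rig_smul, h2, C.d_algebraMap, TensorProduct.zero_tmul, zero_add,
        map_frobenius_natural hl, ← hη, map_add, map_smul]
    · rw [← hl, h1, h1, hn, map_frobenius_natural hl]

theorem extConn_coprod {N : Type u} [AddCommGroup N] [Module R N] {n : Conn K R M}
    {n' : Conn K R N} {ν : Ω[R⁄K] ⊗[R] M} {f : M →ₗ[R] N} (h : n.Compat n' f) (e : N)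
    (he : n'.toFun e = f.lTensor Ω[R⁄K] ν) :
    (extConn n ν).Compat n' (f.coprod (LinearMap.toSpanSingleton R N e)) := by
  intro x
  rw [extConn_apply, map_add, map_add, map_smul, ← LinearMap.lTensor_comp_apply,
    ← LinearMap.lTensor_comp_apply, LinearMap.coprod_inl, LinearMap.lTensor_tmul]
  change n'.toFun (f x.1 + x.2 • e) = _
  rw [n'.toFun.map_add, n'.leibniz, he, h]
  simp [add_assoc]

theorem prodComparison_coprod {N H' : Type u} [AddCommGroup N] [Module R N] [AddCommGroup H']
    [Module S H'] (c : S ⊗[R] M ≃ₗ[S] H) (c' : S ⊗[R] N ≃ₗ[S] H') (f : M →ₗ[R] N) (v : H →ₗ[S] H')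
    (hv : ∀ t, v (c t) = c' (f.baseChange S t)) (e : N) (t : S ⊗[R] (M × R)) :
    v.coprod (LinearMap.toSpanSingleton S H' (c' (1 ⊗ₜ e)))
      (prodComparison S M R c (TensorProduct.AlgebraTensorModule.rid R S S) t) =
      c' ((f.coprod (LinearMap.toSpanSingleton R N e)).baseChange S t) := by
  induction t with
  | zero => simp
  | add a b ha hb => rw [map_add, map_add, ha, hb, map_add, map_add]
  | tmul s x =>
    change v (c (s ⊗ₜ[R] x.1)) +
      (TensorProduct.AlgebraTensorModule.rid R S S (s ⊗ₜ[R] x.2)) • c' (1 ⊗ₜ e) =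
      c' (s ⊗ₜ[R] (f x.1 + x.2 • e))
    rw [hv, LinearMap.baseChange_tmul, ← map_smul, ← map_add, TensorProduct.tmul_add,
      TensorProduct.AlgebraTensorModule.rid_tmul, TensorProduct.tmul_smul,
      TensorProduct.smul_tmul', TensorProduct.smul_tmul', smul_eq_mul, mul_one]

theorem extFrobenius_coprod {p : ℕ} {m : ℤ} {H' : Type u} [AddCommGroup H'] [Module S H']
    {Φ : H →ₛₗ[C.σ] H} {Φ' : H' →ₛₗ[C.σ] H'} {v : H →ₗ[S] H'} (hv : ∀ x, v (Φ x) = Φ' (v x)) {η : H}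
    {e : H'} (he : Φ' e = algebraMap K S ((p : K) ^ (-m)) • e + v η) (x : H × S) :
    v.coprod (LinearMap.toSpanSingleton S H' e) (extFrobenius p m Φ η x) =
      Φ' (v.coprod (LinearMap.toSpanSingleton S H' e) x) := by
  change v (Φ x.1 + C.σ x.2 • η) + (algebraMap K S ((p : K) ^ (-m)) * C.σ x.2) • e =
    Φ' (v x.1 + x.2 • e)
  rw [map_add, map_add, map_smul, hv, LinearMap.map_smulₛₗ, he, smul_add, smul_smul, mul_comm]
  abel

/-- The defect of horizontality maps to zero in the larger object, and `v` stays injective after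
tensoring with differentials because it has a linear retraction. -/
theorem horizontal_of_retract {N H' : Type u} [AddCommGroup N] [Module R N] [AddCommGroup H']
    [Module S H'] {n : Conn K R M} {n' : Conn K R N} {f : M →ₗ[R] N} (h : n.Compat n' f)
    {c : S ⊗[R] M ≃ₗ[S] H} {c' : S ⊗[R] N ≃ₗ[S] H'} {v : H →ₗ[S] H'}
    (hv : ∀ t, v (c t) = c' (f.baseChange S t)) {r : H' →ₗ[S] H} (hr : ∀ x, r (v x) = x)
    {Φ : H →ₛₗ[C.σ] H} {Φ' : H' →ₛₗ[C.σ] H'} (hΦ : ∀ x, v (Φ x) = Φ' (v x))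
    (hn : n'.Horizontal C c' Φ') : n.Horizontal C c Φ := by
  intro x
  have hinj : Function.Injective (v.lTensor C.Omega) :=
    Function.LeftInverse.injective (g := r.lTensor C.Omega) fun t => by
      rw [← LinearMap.lTensor_comp_apply, show r ∘ₗ v = LinearMap.id from LinearMap.ext hr,
        LinearMap.lTensor_id_apply]
  apply hinj
  rw [← h.rig c c' hv, ← map_frobenius_natural hΦ, ← h.rig c c' hv, hΦ, hn]

end extension

variable (p : ℕ) (hp : (p : K) ≠ 0) (N : FilFMIC R C) (m : ℤ) (ν : Ω[R⁄K] ⊗[R] N.dR) (η : N.rig)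

/-- The extension of `𝒪(m)` by `N` with `∇ e = ν` and `Φ(e) = p ^ (-m) e + η`. -/
def extObject (hi : (extConn N.conn ν).Integrable)
    (hν : ν ∈ LinearMap.range ((N.Fil (-m - 1)).subtype.lTensor Ω[R⁄K]))
    (hh : (extConn N.conn ν).Horizontal C
      (prodComparison S N.dR R N.c (TensorProduct.AlgebraTensorModule.rid R S S))
      (extFrobenius p m N.Φ η)) : FilFMIC R C :=
  { prod N (tate R C p hp m) with
    Φ := extFrobenius p m N.Φ η
    Φ_bijective := extFrobenius_bijective p hp m N.Φ η (prod N (tate R C p hp m)).Φ_bijective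
    conn := extConn N.conn ν
    integrable := hi
    griffiths := fun i x hx => by
      refine add_mem ((prod N (tate R C p hp m)).griffiths i x hx) ?_
      have hx2 : x.2 ∈ tateFil R m i := hx.2
      -- The coefficient of `e` can be nonzero only for `i ≤ -m`, and then `Fil (-m - 1)` is
      -- contained in `Fil (i - 1)`.
      by_cases h : i ≤ -m
      · refine Submodule.smul_mem _ _ (mem_range_lTensor
          (Q := (prod N (tate R C p hp m)).Fil (i - 1)) (LinearMap.inl R N.dR R)
          (fun y hy => ⟨?_, Submodule.zero_mem _⟩) hν)
        exact N.antitone_Fil (by omega) hy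
      · rw [tateFil, if_neg h] at hx2
        have h0 : x.2 = (0 : R) := hx2
        exact (show ∀ r : R, r = 0 → r • (LinearMap.inl R N.dR R).lTensor Ω[R⁄K] ν ∈ _ from
          fun r hr => by rw [hr, zero_smul]; exact Submodule.zero_mem _) _ h0
    horizontal := hh }

/-! ### The short exact sequence of an extension of a Tate object, and maps out of it. -/

section extObject

variable (hi : (extConn N.conn ν).Integrable)
    (hν : ν ∈ LinearMap.range ((N.Fil (-m - 1)).subtype.lTensor Ω[R⁄K]))
    (hh : (extConn N.conn ν).Horizontal C
      (prodComparison S N.dR R N.c (TensorProduct.AlgebraTensorModule.rid R S S))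
      (extFrobenius p m N.Φ η))

/-- The inclusion of `N`. -/
def extIncl : N ⟶ extObject p hp N m ν η hi hν hh where
  dR := LinearMap.inl R N.dR R
  rig := LinearMap.inl S N.rig S
  comm_c := prodComparison_inl N.c _
  comm_Φ y := by
    refine Prod.ext ?_ ?_
    · change N.Φ y = N.Φ y + C.σ 0 • η
      rw [map_zero, zero_smul, add_zero]
    · exact (map_zero (tateFrobenius C p m)).symm
  comm_conn := extConn_inl N.conn ν
  map_Fil _ _ hx := ⟨hx, Submodule.zero_mem _⟩

/-- The projection to `𝒪(m)`. -/
def extProj : extObject p hp N m ν η hi hν hh ⟶ tate R C p hp m where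
  dR := LinearMap.snd R N.dR R
  rig := LinearMap.snd S N.rig S
  comm_c := prodComparison_snd N.c _
  comm_Φ _ := rfl
  comm_conn := extConn_snd N.conn ν
  map_Fil _ _ hx := hx.2

/-- The extension of `𝒪(m)` by `N`, as a short exact sequence. -/
def extSES : SES (tate R C p hp m) N where
  M := extObject p hp N m ν η hi hν hh
  ι := extIncl p hp N m ν η hi hν hh
  π := extProj p hp N m ν η hi hν hh
  conf :=
    { injective := LinearMap.inl_injective
      exact := (ExactCat.conf_split N (tate R C p hp m) : IsShortExact _ _).exact
      surjective := (ExactCat.conf_split N (tate R C p hp m) : IsShortExact _ _).surjective }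

variable {X : FilFMIC R C} (ψ : N ⟶ X) (e : X.dR)

/-- A morphism out of an extension of `𝒪(m)`. -/
def extDesc (he : e ∈ X.Fil (-m)) (hconn : X.conn.toFun e = (Hom.dR ψ).lTensor Ω[R⁄K] ν)
    (hΦ : X.Φ (X.c (1 ⊗ₜ e)) = algebraMap K S ((p : K) ^ (-m)) • X.c (1 ⊗ₜ e) + Hom.rig ψ η) :
    extObject p hp N m ν η hi hν hh ⟶ X where
  dR := (Hom.dR ψ).coprod (LinearMap.toSpanSingleton R X.dR e)
  rig := (Hom.rig ψ).coprod (LinearMap.toSpanSingleton S X.rig (X.c (1 ⊗ₜ e)))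
  comm_c := prodComparison_coprod N.c X.c (Hom.dR ψ) (Hom.rig ψ) (Hom.comm_c ψ) e
  comm_Φ := extFrobenius_coprod (Hom.comm_Φ ψ) hΦ
  comm_conn := extConn_coprod (hom_comm_conn ψ) e hconn
  map_Fil i (x : N.dR × R) hx := by
    refine add_mem (Hom.map_Fil ψ i _ hx.1) ?_
    have hx2 : x.2 ∈ tateFil R m i := hx.2
    change x.2 • e ∈ X.Fil i
    by_cases h : i ≤ -m
    · exact Submodule.smul_mem _ _ (X.antitone_Fil h he)
    · rw [tateFil, if_neg h, Submodule.mem_bot] at hx2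
      rw [hx2, zero_smul]
      exact Submodule.zero_mem _

theorem extIncl_desc (he hconn hΦ) : extIncl p hp N m ν η hi hν hh ≫
    extDesc p hp N m ν η hi hν hh ψ e he hconn hΦ = ψ :=
  hom_ext (LinearMap.ext fun (x : N.dR) => by
    change Hom.dR ψ x + (0 : R) • e = _
    rw [zero_smul, add_zero])

end extObject

end FilFMIC

namespace FilFMIC

open YonedaExact

variable {K R S : Type u} [Field K] [CommRing R] [Algebra K R] [CommRing S]
  [Algebra K S] [Algebra R S] [IsScalarTower K R S] {C : FrobeniusCalculus K S}

/-! ### Log objects as extensions -/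

variable (R C) in
/-- A unit `f` with an element which has the differential of `log^(σ)(f)`. -/
@[ext]
structure LogDatum (p : ℕ) where
  unit : Rˣ
  log : S
  d_log : C.d log = algebraMap R S ((unit⁻¹ : Rˣ) : R) • C.d (algebraMap R S (unit : R)) -
      algebraMap K S ((p : K)⁻¹) • C.σ (algebraMap R S ((unit⁻¹ : Rˣ) : R)) •
        C.d (C.σ (algebraMap R S (unit : R)))

namespace LogDatum

variable {p : ℕ}

theorem dlog_mul {a a' b b' : S} (h : a * b = 1) (h' : a' * b' = 1) :
    (b * b') • C.d (a * a') = b • C.d a + b' • C.d a' := by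
  rw [C.d_mul, smul_add, smul_smul, smul_smul, add_comm]
  congr 2
  · linear_combination b * h'
  · linear_combination b' * h

/-- Both terms in the formula for the differential are logarithmic derivatives, so products of units
go with sums of logarithms. -/
instance : Mul (LogDatum R C p) where
  mul d d' :=
    { unit := d.unit * d'.unit
      log := d.log + d'.log
      d_log := by
        have h1 : ∀ f : Rˣ, algebraMap R S (f : R) * algebraMap R S ((f⁻¹ : Rˣ) : R) = 1 :=
          fun f => by rw [← map_mul, Units.mul_inv, map_one]
        have h2 : ∀ f : Rˣ, C.σ (algebraMap R S (f : R)) *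
            C.σ (algebraMap R S ((f⁻¹ : Rˣ) : R)) = 1 :=
          fun f => by rw [← map_mul, h1, map_one]
        rw [C.d_add, d.d_log, d'.d_log, mul_inv, Units.val_mul, Units.val_mul, map_mul, map_mul,
          map_mul, map_mul, dlog_mul (h1 d.unit) (h1 d'.unit),
          dlog_mul (h2 d.unit) (h2 d'.unit), smul_add]
        abel }

end LogDatum

variable {p : ℕ} (hp : (p : K) ≠ 0)

/-- The object `Log(f)(m)`. -/
abbrev logTwist (d : LogDatum R C p) (m : ℤ) : FilFMIC R C :=
  twist p hp (logObject p hp d.unit d.log d.d_log) m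

/-- The extension `0 ⟶ 𝒪(m + 1) ⟶ Log(f)(m) ⟶ 𝒪(m) ⟶ 0`. -/
def logSES (d : LogDatum R C p) (m k l : ℤ) (hk : k = m + 1) (hl : l = m) :
    SES (tate R C p hp l) (tate R C p hp k) where
  M := logTwist hp d m
  ι := logInl p hp d.unit d.log d.d_log m k hk
  π := logSnd p hp d.unit d.log d.d_log m l hl
  conf :=
    { injective := LinearMap.inl_injective (R := R) (M := R) (M₂ := R)
      exact := fun j => logFil_inl (R := R) m k j hk
      surjective := fun j => by
        subst hl
        exact logFil_snd (R := R) l j }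

theorem logConn_generator (f : Rˣ) : (logConn K f).toFun ((0 : R), (1 : R)) =
    (((f⁻¹ : Rˣ) : R) • KaehlerDifferential.D K R (f : R)) ⊗ₜ[R] ((1 : R), (0 : R)) := by
  rw [logConn_apply]; simp

theorem logTwist_Φ_generator (d : LogDatum R C p) (m : ℤ) :
    (logTwist hp d m).Φ ((0 : S), (1 : S)) =
      (algebraMap K S ((p : K) ^ (-m)) • (-d.log, 1) : S × S) := by
  change algebraMap K S ((p : K) ^ (-m)) • logFrobenius C p d.log (0, 1) = _
  rw [logFrobenius_apply, map_zero, map_one, mul_zero, one_mul, zero_sub]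

theorem logTwist_c (d : LogDatum R C p) (m : ℤ) (s : S) (x : R × R) :
    (logTwist hp d m).c (s ⊗ₜ[R] x) = (x.1 • s, x.2 • s) := logComparison_tmul s x

theorem tmul_mem_range {M : Type u} [AddCommGroup M] [Module R M] {P : Submodule R M}
    (ω : Ω[R⁄K]) {x : M} (hx : x ∈ P) : ω ⊗ₜ[R] x ∈ LinearMap.range (P.subtype.lTensor Ω[R⁄K]) :=
  ⟨ω ⊗ₜ ⟨x, hx⟩, rfl⟩

/-- The extension of `𝒪(m)` by `𝒪(m + 1) ⊕ 𝒪(m + 1)` which exhibits `Log(fg)` as the Baer sum of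
`Log(f)` and `Log(g)`. -/
theorem exists_logSES_sum (d d' : LogDatum R C p) (m k l : ℤ) (hk : k = m + 1) (hl : l = m) :
    ∃ U : SES (tate R C p hp l) (ExactCat.sum (tate R C p hp k) (tate R C p hp k)),
      U.HasMap ((logSES hp d m k l hk hl).sum (logSES hp d' m k l hk hl)) (𝟙 _) (diag _) ∧
      U.HasMap (logSES hp (d * d') m k l hk hl) (codiag _) (𝟙 _) := by
  subst hl
  let N : FilFMIC R C := ExactCat.sum (tate R C p hp k) (tate R C p hp k)
  let X : FilFMIC R C := ExactCat.sum (logTwist hp d l) (logTwist hp d' l)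
  let W : FilFMIC R C := logTwist hp (d * d') l
  let ω : Ω[R⁄K] := ((d.unit⁻¹ : Rˣ) : R) • KaehlerDifferential.D K R (d.unit : R)
  let ω' : Ω[R⁄K] := ((d'.unit⁻¹ : Rˣ) : R) • KaehlerDifferential.D K R (d'.unit : R)
  let q := algebraMap K S ((p : K) ^ (-l))
  -- The new basis vector stands for the diagonal `(e₀, e₀)` in the direct sum of the two log
  -- objects; `ν` and `η` record its derivative and its Frobenius there.
  let ν : Ω[R⁄K] ⊗[R] (R × R) := ω ⊗ₜ ((1 : R), (0 : R)) + ω' ⊗ₜ ((0 : R), (1 : R))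
  let η : S × S := q • (-d.log, -d'.log)
  let ψ : N ⟶ X := sumMap (logSES hp d l k l hk rfl).ι (logSES hp d' l k l hk rfl).ι
  let f : R × R →ₗ[R] (R × R) × (R × R) := LinearMap.prodMap (LinearMap.inl R R R)
    (LinearMap.inl R R R)
  let v : S × S →ₗ[S] (S × S) × (S × S) := LinearMap.prodMap (LinearMap.inl S S S)
    (LinearMap.inl S S S)
  have hf : Hom.dR ψ = f := LinearMap.ext fun (x : R × R) => Prod.ext (add_zero _) (zero_add _)
  have hv : Hom.rig ψ = v := LinearMap.ext fun (x : S × S) => Prod.ext (add_zero _) (zero_add _)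
  let e : (R × R) × (R × R) := ((0, 1), (0, 1))
  let e' : (S × S) × (S × S) := ((0, 1), (0, 1))
  let eX : X.dR := e
  let eX' : X.rig := e'
  let eW : W.dR := ((0 : R), (1 : R))
  have hce : X.c (1 ⊗ₜ[R] eX) = e' := by
    refine Prod.ext ?_ ?_
    · exact (logTwist_c hp d l 1 (0, 1)).trans (by rw [zero_smul, one_smul])
    · exact (logTwist_c hp d' l 1 (0, 1)).trans (by rw [zero_smul, one_smul])
  have hconn : X.conn.toFun eX = (Hom.dR ψ).lTensor Ω[R⁄K] ν := by
    rw [hf]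
    change (prodConn (logConn K d.unit) (logConn K d'.unit)).toFun e = f.lTensor Ω[R⁄K] ν
    rw [prodConn_apply, logConn_generator, logConn_generator, map_add]
    simp only [LinearMap.lTensor_tmul]
    rfl
  have hΦ : X.Φ e' = algebraMap K S ((p : K) ^ (-l)) • eX' + Hom.rig ψ η := by
    rw [hv]
    refine Prod.ext ?_ ?_
    · refine (logTwist_Φ_generator hp d l).trans ?_
      change (q * (-d.log), q * 1) = (q * 0 + q * (-d.log), q * 1 + 0)
      rw [mul_zero, zero_add, add_zero]
    · refine (logTwist_Φ_generator hp d' l).trans ?_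
      change (q * (-d'.log), q * 1) = (q * 0 + q * (-d'.log), q * 1 + 0)
      rw [mul_zero, zero_add, add_zero]
  have hcomp := extConn_coprod (hom_comm_conn ψ) eX hconn
  have hfe' : ∀ z : (R × R) × R, f.coprod (LinearMap.toSpanSingleton R ((R × R) × (R × R)) e) z =
      ((z.1.1, z.2), (z.1.2, z.2)) := fun z => by simp [f, e]
  have hfe : ∀ z : (R × R) × R, (Hom.dR ψ).coprod (LinearMap.toSpanSingleton R X.dR eX) z =
      (((z.1.1, z.2), (z.1.2, z.2)) : (R × R) × (R × R)) := fun z => by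
    rw [hf]
    exact hfe' z
  have hinj : Function.Injective ((Hom.dR ψ).coprod (LinearMap.toSpanSingleton R X.dR eX)) := by
    intro x y hxy
    have h2 := (hfe x).symm.trans (hxy.trans (hfe y))
    have h3 : ∀ x y : (R × R) × R, (((x.1.1, x.2), (x.1.2, x.2)) : (R × R) × (R × R)) =
        ((y.1.1, y.2), (y.1.2, y.2)) → x = y := fun x y h => by
      simp only [Prod.mk.injEq] at h
      exact Prod.ext (Prod.ext h.1.1 h.2.1) h.1.2
    exact h3 x y h2
  -- The extension is the pullback of the direct sum of the log objects along the diagonal and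
  -- embeds in it; integrability and horizontality are inherited through this embedding.
  have hi : (extConn N.conn ν).Integrable := .of_injective hcomp hinj X.integrable
  let r : (S × S) × (S × S) →ₗ[S] (S × S) × S :=
    ((LinearMap.fst S S S ∘ₗ LinearMap.fst S _ _).prod
      (LinearMap.fst S S S ∘ₗ LinearMap.snd S _ _)).prod
      (LinearMap.snd S S S ∘ₗ LinearMap.fst S _ _)
  have hΦ' : X.Φ (X.c (1 ⊗ₜ[R] eX)) =
      algebraMap K S ((p : K) ^ (-l)) • X.c (1 ⊗ₜ[R] eX) + Hom.rig ψ η := by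
    rw [hce]
    exact hΦ
  have hh : (extConn N.conn ν).Horizontal C
      (prodComparison S N.dR R N.c (TensorProduct.AlgebraTensorModule.rid R S S))
      (extFrobenius p l N.Φ η) := by
    refine horizontal_of_retract hcomp
      (prodComparison_coprod N.c X.c (Hom.dR ψ) (Hom.rig ψ) (Hom.comm_c ψ) eX)
      (r := r) ?_ (extFrobenius_coprod (Hom.comm_Φ ψ) hΦ') X.horizontal
    intro x
    rw [hce, hv]
    have h1 : ∀ z : (S × S) × S, r (v.coprod (LinearMap.toSpanSingleton S _ e') z) = z :=
      fun z => by simp [r, v, e']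
    exact h1 x
  have hN : ∀ x : R × R, x ∈ N.Fil (-l - 1) := fun x => by
    have : ∀ y : R, y ∈ tateFil R k (-l - 1) := fun y => by
      rw [tateFil, if_pos (by omega)]; trivial
    exact ⟨this _, this _⟩
  have hν : ν ∈ LinearMap.range ((N.Fil (-l - 1)).subtype.lTensor Ω[R⁄K]) :=
    add_mem (tmul_mem_range ω (hN _)) (tmul_mem_range ω' (hN _))
  have hFil : ∀ d : LogDatum R C p, ((0 : R), (1 : R)) ∈ (logTwist hp d l).Fil (-l) := fun d => by
    change _ ∈ logFil R (-l + l)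
    rw [neg_add_cancel, logFil, if_neg (by omega), if_pos rfl]
    exact ⟨1, rfl⟩
  -- Along the codiagonal the two forms and the two logarithms are added, which produces the data of
  -- `d * d'`.
  let ψ' : N ⟶ W := codiag _ ≫ (logSES hp (d * d') l k l hk rfl).ι
  let f' : R × R →ₗ[R] R × R := LinearMap.inl R R R ∘ₗ (LinearMap.fst R R R + LinearMap.snd R R R)
  have hf' : Hom.dR ψ' = f' := rfl
  have hv' : ∀ x : S × S, Hom.rig ψ' x = (x.1 + x.2, (0 : S)) := fun _ => rfl
  have hcw : W.c (1 ⊗ₜ[R] eW) = ((0 : S), (1 : S)) :=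
    (logTwist_c hp (d * d') l 1 (0, 1)).trans (by rw [zero_smul, one_smul])
  have hconnW : W.conn.toFun eW =
      (Hom.dR ψ').lTensor Ω[R⁄K] ν := by
    refine (logConn_generator (d.unit * d'.unit)).trans ?_
    have e1 : ((((d.unit * d'.unit)⁻¹ : Rˣ) : R)) •
        KaehlerDifferential.D K R ((d.unit * d'.unit : Rˣ) : R) = ω + ω' := by
      rw [mul_inv, Units.val_mul, Units.val_mul, Derivation.leibniz, smul_add, smul_smul,
        smul_smul, add_comm]
      congr 2
      · linear_combination ((d.unit⁻¹ : Rˣ) : R) * (d'.unit).mul_inv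
      · linear_combination ((d'.unit⁻¹ : Rˣ) : R) * (d.unit).mul_inv
    rw [hf', e1]
    change _ = f'.lTensor Ω[R⁄K] ν
    rw [map_add, LinearMap.lTensor_tmul, LinearMap.lTensor_tmul, TensorProduct.add_tmul]
    simp [f']
  have hΦW : W.Φ (W.c (1 ⊗ₜ[R] eW)) =
      algebraMap K S ((p : K) ^ (-l)) • W.c (1 ⊗ₜ[R] eW) +
        Hom.rig ψ' η := by
    rw [hcw]
    refine Eq.trans ?_ (congrArg (_ + ·) (hv' η).symm)
    refine (logTwist_Φ_generator hp (d * d') l).trans ?_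
    change (q * (-(d.log + d'.log)), q * 1) =
      (q * 0 + (q * (-d.log) + q * (-d'.log)), q * 1 + 0)
    rw [mul_zero, zero_add, add_zero, neg_add, mul_add]
  refine ⟨extSES p hp N l ν η hi hν hh, ?_, ?_⟩
  · refine ⟨extDesc p hp N l ν η hi hν hh ψ eX ⟨hFil d, hFil d'⟩ hconn hΦ', ?_, ?_⟩
    · exact (extIncl_desc p hp N l ν η hi hν hh ψ _ _ hconn hΦ').trans (Category.id_comp ψ).symm
    · refine hom_ext (LinearMap.ext fun (x : (R × R) × R) => ?_)
      have h1 : x.2 = ((Hom.dR ψ).coprod (LinearMap.toSpanSingleton R X.dR eX) x :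
          (R × R) × (R × R)).1.2 := by rw [hfe]
      have h2 : x.2 = ((Hom.dR ψ).coprod (LinearMap.toSpanSingleton R X.dR eX) x :
          (R × R) × (R × R)).2.2 := by rw [hfe]
      exact Prod.ext (congrArg (· + (0 : R)) h1) (congrArg ((0 : R) + ·) h2)
  · refine ⟨extDesc p hp N l ν η hi hν hh ψ' _ (hFil (d * d')) hconnW hΦW, ?_, ?_⟩
    · exact extIncl_desc p hp N l ν η hi hν hh ψ' _ _ hconnW hΦW
    · refine hom_ext (LinearMap.ext fun (x : (R × R) × R) => ?_)
      change x.2 = (0 : R) + x.2 * 1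
      rw [zero_add, mul_one]

end FilFMIC

namespace FilFMIC

open YonedaExact

variable {K R S : Type u} [Field K] [CommRing R] [Algebra K R] [CommRing S]
  [Algebra K S] [Algebra R S] [IsScalarTower K R S] {C : FrobeniusCalculus K S}

/-! ### Cup products of logarithmic classes -/

variable {p : ℕ} (hp : (p : K) ≠ 0)

/-- The spliced sequence `[d₀] ∪ ⋯ ∪ [dₙ]`, twisted by `m`. -/
def cupSplice : ∀ (n : ℕ) (m l k : ℤ) (_ : k = m + (n : ℤ) + 1) (_ : l = m)
    (_ : Fin (n + 1) → LogDatum R C p), YE n (tate R C p hp l) (tate R C p hp k)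
  | 0, m, l, k, hk, hl, d => logSES hp (d 0) m k l (by simpa using hk) hl
  -- The ends are given by integers `l` and `k` with equations, so the recursion, which shifts `m`,
  -- needs no transport between equal twists.
  | n + 1, m, l, k, hk, hl, d =>
    (cupSplice n (m + 1) (m + 1) k (by push_cast at hk; omega) rfl (Fin.tail d)).splice
      (logSES hp (d 0) m (m + 1) l rfl hl)

/-- The class of `cupSplice`. -/
def cupClass (n : ℕ) (m l k : ℤ) (hk : k = m + (n : ℤ) + 1) (hl : l = m)
    (d : Fin (n + 1) → LogDatum R C p) : YExt n (tate R C p hp l) (tate R C p hp k) :=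
  .mk (cupSplice hp n m l k hk hl d)

theorem cupClass_succ (n : ℕ) (m l k : ℤ) (hk : k = m + ((n + 1 : ℕ) : ℤ) + 1) (hl : l = m)
    (d : Fin (n + 1 + 1) → LogDatum R C p) : cupClass hp (n + 1) m l k hk hl d =
      YExt.splice (cupClass hp n (m + 1) (m + 1) k (by push_cast at hk; omega) rfl (Fin.tail d))
        (logSES hp (d 0) m (m + 1) l rfl hl) := rfl

/-- The class is additive in every argument. -/
theorem cupClass_update_mul : ∀ (n : ℕ) (m l k : ℤ) (hk : k = m + (n : ℤ) + 1) (hl : l = m)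
    (d : Fin (n + 1) → LogDatum R C p) (i : Fin (n + 1)) (x y : LogDatum R C p),
    cupClass hp n m l k hk hl (Function.update d i (x * y)) =
      cupClass hp n m l k hk hl (Function.update d i x) +
        cupClass hp n m l k hk hl (Function.update d i y)
  | 0, m, l, k, hk, hl, d, i, x, y => by
    obtain rfl : i = 0 := Fin.ext (by omega)
    obtain ⟨U, h, h'⟩ := exists_logSES_sum hp x y m k l (by simpa using hk) hl
    have e : ∀ z, cupClass hp 0 m l k hk hl (Function.update d 0 z) =
        .mk (n := 0) (logSES hp z m k l (by simpa using hk) hl) := fun z => by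
      change YExt.mk (n := 0) (logSES hp (Function.update d 0 z 0) m k l _ hl) = _
      rw [Function.update_self]
    rw [e, e, e]
    exact YExt.mk_add h h'
  | n + 1, m, l, k, hk, hl, d, i, x, y => by
    rw [cupClass_succ, cupClass_succ, cupClass_succ]
    induction i using Fin.cases with
    | zero =>
      obtain ⟨U, h, h'⟩ := exists_logSES_sum hp x y m (m + 1) l rfl hl
      rw [Fin.tail_update_zero, Fin.tail_update_zero, Fin.tail_update_zero, Function.update_self,
        Function.update_self, Function.update_self]
      exact YExt.splice_add h h' _
    | succ i =>
      rw [Fin.tail_update_succ, Fin.tail_update_succ, Fin.tail_update_succ,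
        Function.update_of_ne (Fin.succ_ne_zero i).symm,
        Function.update_of_ne (Fin.succ_ne_zero i).symm,
        Function.update_of_ne (Fin.succ_ne_zero i).symm, cupClass_update_mul, YExt.add_splice]

/-- The identification of `H(a)` with `H(b)` for `a = b`. -/
def twistCongr (H : FilFMIC R C) {a b : ℤ} (h : a = b) : twist p hp H a ⟶ twist p hp H b where
  dR := LinearMap.id
  rig := LinearMap.id
  comm_c := fun x => by
    change H.c x = H.c (LinearMap.baseChange S LinearMap.id x)
    rw [LinearMap.baseChange_id]
    rfl
  comm_Φ := fun x => by subst h; rfl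
  comm_conn := fun x => by
    change H.conn.toFun x = LinearMap.lTensor Ω[R⁄K] LinearMap.id (H.conn.toFun x)
    rw [LinearMap.lTensor_id]
    rfl
  map_Fil := fun i x hx => by subst h; exact hx

/-- The recursion and the closed formula of `cupExtension` produce twists which are equal integers
but different expressions. The twists `a i` are therefore free parameters subject to equations, and
`twistCongr` passes between equal ones. -/
theorem exists_map_cupSplice : ∀ (n : ℕ) (m l k : ℤ) (hk : k = m + (n : ℤ) + 1) (hl : l = m)
    (d : Fin (n + 1) → LogDatum R C p) (a : Fin (n + 1) → ℤ) (ha : ∀ i, a i = m + (i : ℕ)),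
    ∃ f : ∀ i, (Ext.toYoneda (cupSplice hp n m l k hk hl d)).M i ⟶ logTwist hp (d i) (a i),
      (Ext.toYoneda (cupSplice hp n m l k hk hl d)).ι ≫ f (Fin.last n) =
        logInl p hp _ _ _ (a (Fin.last n)) k (by rw [ha, hk, Fin.val_last]) ∧
      (∀ i : Fin n, (Ext.toYoneda (cupSplice hp n m l k hk hl d)).δ i ≫ f i.castSucc =
        f i.succ ≫ logSnd p hp _ _ _ (a i.succ) (a i.succ) rfl ≫
          logInl p hp _ _ _ (a i.castSucc) (a i.succ) (by simp [ha, add_assoc])) ∧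
      (Ext.toYoneda (cupSplice hp n m l k hk hl d)).π = f 0 ≫ logSnd p hp _ _ _ (a 0) l
        (by rw [ha, hl]; simp)
  | 0, m, l, k, hk, hl, d, a, ha => by
    have h0 : m = a 0 := by simp [ha]
    refine ⟨Fin.cases (twistCongr hp _ h0) fun i => i.elim0, ?_, fun i => i.elim0, ?_⟩
    · exact hom_ext rfl
    · exact hom_ext rfl
  | n + 1, m, l, k, hk, hl, d, a, ha => by
    have h0 : m = a 0 := by simp [ha]
    obtain ⟨f, h1, h2, h3⟩ := exists_map_cupSplice n (m + 1) (m + 1) k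
      (by push_cast at hk; omega) rfl (Fin.tail d) (Fin.tail a) (fun i => by
        change a i.succ = _
        rw [ha]
        simp only [Fin.val_succ, Nat.cast_add, Nat.cast_one]
        ring)
    let φ : ∀ i, (Ext.toYoneda (cupSplice hp (n + 1) m l k hk hl d)).M i ⟶
      logTwist hp (d i) (a i) := Fin.cases (twistCongr hp _ h0) f
    refine ⟨φ, h1, fun i => ?_, hom_ext rfl⟩
    induction i using Fin.cases with
    | succ i => exact h2 i
    | zero =>
      have h4 := congrArg (fun φ => φ ≫ logInl p hp (d 0).unit (d 0).log (d 0).d_log (a 0) (m + 1)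
        (by rw [← h0])) h3
      refine Eq.trans (hom_ext rfl) (h4.trans (hom_ext rfl))

theorem equiv_cupExtension (n : ℕ)
    (d : Fin (n + 1) → LogDatum R C p) :
    Ext.equiv _ _ n (Ext.mk (cupExtension p hp (fun i => (d i).unit) (fun i => (d i).log)
      (fun i => (d i).d_log))) = cupClass hp n 0 0 (n + 1) (by omega) rfl d := by
  obtain ⟨f, h1, h2, h3⟩ := exists_map_cupSplice hp n 0 0 (n + 1) (by omega) rfl d
    (fun i => ((i : ℕ) : ℤ)) (fun i => by simp)
  have h : (Ext.toYoneda (cupSplice hp n 0 0 (n + 1) (by omega) rfl d)).HasMap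
      (cupExtension p hp (fun i => (d i).unit) (fun i => (d i).log) (fun i => (d i).d_log))
      (𝟙 _) (𝟙 _) :=
    ⟨f, h1.trans (Category.id_comp _).symm, h2, (Category.comp_id _).trans h3⟩
  refine Eq.trans (congrArg _ ?_) (Ext.equiv_toYoneda (cupSplice hp n 0 0 (n + 1) (by omega) rfl d))
  exact (Quot.sound h).symm

/-! ### Vanishing of products -/

theorem logConn_rig_inl (f : Rˣ) :
    (logConn K f).rig C (logComparison S R) ((1 : S), (0 : S)) = 0 := by
  have := (logConn K f).rig_apply C (logComparison S R) ((1 : R), (0 : R))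
  simpa [logConn_apply, logComparison_tmul] using this

theorem logConn_rig_inr (f : Rˣ) : (logConn K f).rig C (logComparison S R) ((0 : S), (1 : S)) =
    (algebraMap R S ((f⁻¹ : Rˣ) : R) • C.d (algebraMap R S (f : R))) ⊗ₜ[S]
      ((1 : S), (0 : S)) := by
  have := (logConn K f).rig_apply C (logComparison S R) ((0 : R), (1 : R))
  rw [logConn_apply] at this
  simp only [map_zero, Derivation.map_one_eq_zero, TensorProduct.zero_tmul, zero_add, one_smul,
    baseChangeForm_tmul, LinearMap.lTensor_tmul, LinearEquiv.coe_coe, logComparison_tmul,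
    zero_smul] at this
  rw [this, map_smul, KaehlerDifferential.map_D, ← algebraMap_smul S ((f⁻¹ : Rˣ) : R)
    (KaehlerDifferential.D K S _), map_smul]
  rfl

theorem logConn_cov (f : Rˣ) (X : Derivation K R R) (x : R × R) :
    (logConn K f).cov X x = (X x.1 + x.2 * ((f⁻¹ : Rˣ) * X (f : R)), X x.2) := by
  simp only [Conn.cov, logConn_apply, map_add, map_smul, LinearMap.rTensor_tmul,
    TensorProduct.lid_tmul, Derivation.liftKaehlerDifferential_comp_D]
  ext <;> simp

theorem derivation_unit_inv (X : Derivation K R R) (f : Rˣ) : X ((f⁻¹ : Rˣ) : R) =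
    - (((f⁻¹ : Rˣ) : R) * ((f⁻¹ : Rˣ) : R)) * X (f : R) := by
  have h1 : X (((f⁻¹ : Rˣ) : R) * (f : R)) = 0 := by
    rw [Units.inv_mul, Derivation.map_one_eq_zero]
  rw [Derivation.leibniz, smul_eq_mul, smul_eq_mul] at h1
  have h2 : (f : R) * ((f⁻¹ : Rˣ) : R) = 1 := Units.mul_inv f
  linear_combination ((f⁻¹ : Rˣ) : R) * h1 - X ((f⁻¹ : Rˣ) : R) * h2

/-- If the class `dlog f ∧ dlog g` vanishes together with its syntomic refinement, there is an
extension of `Log(f)(m)` which makes `[f] ∪ [g]` vanish. -/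
theorem exists_dominating (d d' : LogDatum R C p) (θ : S)
    (hθ : C.d θ = d.log • algebraMap R S ((d'.unit⁻¹ : Rˣ) : R) •
        C.d (algebraMap R S (d'.unit : R)) -
      (algebraMap K S ((p : K)⁻¹) * d'.log) • C.σ (algebraMap R S ((d.unit⁻¹ : Rˣ) : R)) •
        C.d (C.σ (algebraMap R S (d.unit : R))))
    (hd : ∀ X Y : Derivation K R R, X (d.unit : R) * Y (d'.unit : R) =
      Y (d.unit : R) * X (d'.unit : R)) (m k l : ℤ) (hk : k = m + 1 + 1) (hl : l = m) :
    ∃ U : SES (tate R C p hp l) (logSES hp d' (m + 1) k (m + 1) hk rfl).M,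
      U.HasMap (logSES hp d m (m + 1) l rfl hl) (logSES hp d' (m + 1) k (m + 1) hk rfl).π
        (𝟙 _) := by
  subst hl
  let N : FilFMIC R C := logTwist hp d' (l + 1)
  let X : FilFMIC R C := logTwist hp d l
  let ω : Ω[R⁄K] := ((d.unit⁻¹ : Rˣ) : R) • KaehlerDifferential.D K R (d.unit : R)
  -- In `Log(g)(l + 1)` the vector `(1, 0)` is `e₋₄` and `(0, 1)` is `e₋₂`. Thus `∇ e₀ = dlog f ⊗
  -- e₋₂`, while `Φ(e₀)` has the extra terms `θ e₋₄` and `-log^(σ)(f) e₋₂`, all scaled by the twist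
  -- `q`.
  let q := algebraMap K S ((p : K) ^ (-l))
  let ν : Ω[R⁄K] ⊗[R] (R × R) := ω ⊗ₜ ((0 : R), (1 : R))
  let η : S × S := (q * θ, q * (-d.log))
  have hcontract : ∀ Y : Derivation K R R,
      contract Y ν = (0, ((d.unit⁻¹ : Rˣ) : R) * Y (d.unit : R)) := fun Y => by
    simp [contract, ν, ω]
  have hi : (extConn N.conn ν).Integrable := by
    -- The component along `e₋₄` of the curvature is dlog f ∧ dlog g, which `hd` kills; the
    -- component along `e₋₂` is the differential of dlog f.
    refine extConn_integrable (logConn K d'.unit) ν (logConn_integrable d'.unit) fun Y Z => ?_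
    rw [hcontract, hcontract, hcontract, logConn_cov, logConn_cov]
    ext
    · simp only [Prod.fst_sub, map_zero]
      linear_combination ((d.unit⁻¹ : Rˣ) : R) * ((d'.unit⁻¹ : Rˣ) : R) * hd Z Y
    · simp only [Prod.snd_sub, Derivation.leibniz, smul_eq_mul, derivation_unit_inv,
        Derivation.commutator_apply]
      ring
  have hq : q * algebraMap K S ((p : K)⁻¹) = algebraMap K S ((p : K) ^ (-(l + 1))) := by
    rw [← map_mul, ← zpow_sub_one₀ hp, neg_add']
  have hω : C.N.mkQ (KaehlerDifferential.map K K R S ω) =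
      algebraMap R S ((d.unit⁻¹ : Rˣ) : R) • C.d (algebraMap R S (d.unit : R)) := by
    rw [map_smul, KaehlerDifferential.map_D, ← algebraMap_smul S ((d.unit⁻¹ : Rˣ) : R)
      (KaehlerDifferential.D K S _), map_smul]
    rfl
  let Φ : S × S →ₛₗ[C.σ] S × S := twistFrobenius C p (l + 1) (logFrobenius C p d'.log)
  have hh : (extConn (logConn K d'.unit) ν).Horizontal C
      (prodComparison S (R × R) R (logComparison S R)
        (TensorProduct.AlgebraTensorModule.rid R S S)) (extFrobenius p l Φ η) := by
    refine extConn_horizontal p l (logConn K d'.unit) ν (logComparison S R) Φ η N.horizontal ?_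
    have hd0 : ∀ s : S, C.d (q * s) = q • C.d s := fun s => by
      rw [C.d_mul, C.d_algebraMap, smul_zero, add_zero]
    have hneg : C.d (-d.log) = - C.d d.log := by simp [FrobeniusCalculus.d]
    have hdl := d.d_log
    set τ := algebraMap R S ((d.unit⁻¹ : Rˣ) : R) • C.d (algebraMap R S (d.unit : R))
    set τ' := algebraMap R S ((d'.unit⁻¹ : Rˣ) : R) • C.d (algebraMap R S (d'.unit : R))
    set ρ := C.σ (algebraMap R S ((d.unit⁻¹ : Rˣ) : R)) • C.d (C.σ (algebraMap R S (d.unit : R)))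
      with hρ
    have h2 : (logConn K d'.unit).rig C (logComparison S R) η =
        C.d (q * θ) ⊗ₜ[S] ((1 : S), (0 : S)) + (C.d (q * (-d.log)) ⊗ₜ[S] ((0 : S), (1 : S)) +
        (q * (-d.log)) • (τ' ⊗ₜ[S] ((1 : S), (0 : S)))) := by
      have : η = (q * θ) • ((1 : S), (0 : S)) + (q * (-d.log)) • ((0 : S), (1 : S)) := by
        ext <;> simp [η]
      rw [this, map_add, Conn.rig_smul, Conn.rig_smul, logConn_rig_inl, logConn_rig_inr, smul_zero,
        add_zero]
    have h3 : TensorProduct.map C.omegaFrobenius Φ (τ ⊗ₜ[S] ((0 : S), (1 : S))) =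
        ρ ⊗ₜ[S] (algebraMap K S ((p : K) ^ (-(l + 1))) • (-d'.log, 1) : S × S) := by
      rw [TensorProduct.map_tmul, LinearMap.map_smulₛₗ, C.omegaFrobenius_d]
      exact congrArg _ (logTwist_Φ_generator hp d' (l + 1))
    have e : ((-d'.log, 1) : S × S) = (-d'.log) • ((1 : S), (0 : S)) + ((0 : S), (1 : S)) := by
      ext <;> simp
    -- With `τ`, `τ'` and `ρ` the logarithmic differentials of f, g and σ(f), the coefficient of
    -- `e₋₄` in the horizontality is the equation imposed on `θ`. The coefficient of `e₋₂` is the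
    -- formula for the differential of log^(σ)(f).
    have hα : C.d (q * θ) + (q * (-d.log)) • τ' =
        (q * algebraMap K S ((p : K)⁻¹) * (-d'.log)) • ρ := by
      rw [hd0, hθ]
      module
    have hβ : C.d (q * (-d.log)) + algebraMap K S ((p : K) ^ (-l)) • τ = (q * algebraMap K S ((p : K)⁻¹)) • ρ := by
      rw [hd0, hneg, hdl]
      change q • _ + q • _ = _
      module
    rw [rigForm_tmul, hω, logComparison_tmul, zero_smul, one_smul, h2, h3, e, ← hq, smul_add,
      smul_smul, TensorProduct.tmul_add, TensorProduct.tmul_smul, TensorProduct.tmul_smul]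
    simp only [TensorProduct.smul_tmul']
    rw [← hα, ← hβ, TensorProduct.add_tmul, TensorProduct.add_tmul]
    abel
  have hFil : ∀ (d : LogDatum R C p) (m j : ℤ), j = -m →
      ((0 : R), (1 : R)) ∈ (logTwist hp d m).Fil j := fun d m j hj => by
    change _ ∈ logFil R (j + m)
    rw [hj, neg_add_cancel, logFil, if_neg (by omega), if_pos rfl]
    exact ⟨1, rfl⟩
  have hν : ν ∈ LinearMap.range ((N.Fil (-l - 1)).subtype.lTensor Ω[R⁄K]) :=
    tmul_mem_range ω (hFil d' (l + 1) (-l - 1) (by omega))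
  -- Dividing out `e₋₄` leaves `Log(f)(l)`, so this composite extends to the required map of short
  -- exact sequences.
  let ψ : N ⟶ X := (logSES hp d' (l + 1) k (l + 1) hk rfl).π ≫ (logSES hp d l (l + 1) l rfl rfl).ι
  let f : R × R →ₗ[R] R × R := LinearMap.inl R R R ∘ₗ LinearMap.snd R R R
  have hf : Hom.dR ψ = f := rfl
  have hv : Hom.rig ψ η = ((q * (-d.log), 0) : S × S) := rfl
  let eX : X.dR := ((0 : R), (1 : R))
  have hc : X.c (1 ⊗ₜ[R] eX) = ((0 : S), (1 : S)) :=
    (logTwist_c hp d l 1 (0, 1)).trans (by rw [zero_smul, one_smul])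
  have hconn : X.conn.toFun eX = (Hom.dR ψ).lTensor Ω[R⁄K] ν := by
    refine (logConn_generator d.unit).trans ?_
    rw [hf]
    change ω ⊗ₜ[R] ((1 : R), (0 : R)) = f.lTensor Ω[R⁄K] ν
    rw [LinearMap.lTensor_tmul]
    rfl
  have hΦ : X.Φ (X.c (1 ⊗ₜ[R] eX)) =
      algebraMap K S ((p : K) ^ (-l)) • X.c (1 ⊗ₜ[R] eX) + Hom.rig ψ η := by
    rw [hc, hv]
    refine (logTwist_Φ_generator hp d l).trans ?_
    change (q * (-d.log), q * 1) = (q * 0 + q * (-d.log), q * 1 + 0)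
    rw [mul_zero, zero_add, add_zero]
  refine ⟨extSES p hp N l ν η hi hν hh, extDesc p hp N l ν η hi hν hh ψ eX (hFil d l (-l) rfl)
    hconn hΦ, extIncl_desc p hp N l ν η hi hν hh ψ _ _ hconn hΦ, ?_⟩
  refine hom_ext (LinearMap.ext fun (x : (R × R) × R) => ?_)
  change x.2 = (0 : R) + x.2 * 1
  rw [zero_add, mul_one]

/-- Two logarithmic data with vanishing product. -/
def LogDatum.Orthogonal (d d' : LogDatum R C p) : Prop :=
  (∀ X Y : Derivation K R R, X (d.unit : R) * Y (d'.unit : R) =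
      Y (d.unit : R) * X (d'.unit : R)) ∧
  ∃ θ : S, C.d θ = d.log • algebraMap R S ((d'.unit⁻¹ : Rˣ) : R) •
        C.d (algebraMap R S (d'.unit : R)) -
      (algebraMap K S ((p : K)⁻¹) * d'.log) • C.σ (algebraMap R S ((d.unit⁻¹ : Rˣ) : R)) •
        C.d (C.σ (algebraMap R S (d.unit : R)))

set_option linter.unusedSectionVars false in
-- For equal data the prescribed form is `ℓ dℓ` with `ℓ` the logarithm, and `ℓ² / 2` is a primitive.
theorem LogDatum.orthogonal_of_eq (h2 : (2 : K) ≠ 0) {d d' : LogDatum R C p}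
    (hu : d'.unit = d.unit) (hl : d'.log = d.log) : d.Orthogonal d' := by
  refine ⟨fun X Y => by rw [hu, mul_comm], algebraMap K S (2 : K)⁻¹ * (d.log * d.log), ?_⟩
  have h : algebraMap K S (2 : K)⁻¹ * 2 = 1 := by
    rw [← map_ofNat (algebraMap K S) 2, ← map_mul, inv_mul_cancel₀ h2, map_one]
  rw [hu, hl, C.d_mul, C.d_algebraMap, smul_zero, add_zero, C.d_mul, ← two_smul S, smul_smul, h,
    one_smul, d.d_log, smul_sub, mul_comm, mul_smul]

/-- The class vanishes if two consecutive arguments are orthogonal. -/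
theorem cupClass_eq_zero : ∀ (n : ℕ) (m l k : ℤ) (hk : k = m + ((n + 1 : ℕ) : ℤ) + 1) (hl : l = m)
    (d : Fin (n + 1 + 1) → LogDatum R C p) (i : Fin (n + 1))
    (_ : (d i.castSucc).Orthogonal (d i.succ)), cupClass hp (n + 1) m l k hk hl d = 0
  | 0, m, l, k, hk, hl, d, i, h => by
    obtain rfl : i = 0 := Fin.ext (by omega)
    obtain ⟨hd, θ, hθ⟩ := h
    obtain ⟨U, hU⟩ := exists_dominating hp (d 0) (d 1) θ hθ hd m k l
      (by push_cast at hk; omega) hl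
    exact YExt.splice_mk_eq_zero hU
  | n + 1, m, l, k, hk, hl, d, i, h => by
    rw [cupClass_succ]
    induction i using Fin.cases with
    | zero =>
      obtain ⟨hd, θ, hθ⟩ := h
      obtain ⟨U, hU⟩ := exists_dominating hp (d 0) (d 1) θ hθ hd m (m + 1 + 1) l rfl hl
      rw [cupClass_succ]
      exact YExt.splice_splice_eq_zero hU _
    | succ i =>
      rw [cupClass_eq_zero n _ _ _ _ _ (Fin.tail d) i h, YExt.zero_splice]

end FilFMIC

/-! ### Convergent sums of polynomials in overconvergent series -/

section padicSum

set_option linter.unusedSectionVars false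

variable (p : ℕ) [hp : Fact p.Prime] {V : Type u} [CommRing V] [IsDomain V]
  [IsDiscreteValuationRing V] [IsAdicComplete (IsLocalRing.maximalIdeal V) V] [CharZero V]
  [CharP (IsLocalRing.ResidueField V) p] {m : ℕ}

theorem eq_zero_of_forall_pow_dvd (x : V) (h : ∀ k, (p : V) ^ k ∣ x) : x = 0 := by
  refine IsHausdorff.haus (I := IsLocalRing.maximalIdeal V) inferInstance x fun n => ?_
  rw [SModEq.sub_mem, sub_zero, smul_eq_mul, Ideal.mul_top]
  exact Ideal.mem_of_dvd _ (h n) (Ideal.pow_mem_pow (natCast_mem_maximalIdeal p V) n)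

theorem coeff_natCast_pow_mul (k : ℕ) (F : overconvergentSeries p V m) (α : Fin m →₀ ℕ) :
    MvPowerSeries.coeff α (((p : overconvergentSeries p V m) ^ k * F :
      overconvergentSeries p V m) : MvPowerSeries (Fin m) V) =
      (p : V) ^ k * MvPowerSeries.coeff α (F : MvPowerSeries (Fin m) V) := by
  have : (p : overconvergentSeries p V m) ^ k * F = (p : V) ^ k • F := by
    rw [Algebra.smul_def, map_pow, map_natCast]
  rw [this]
  exact MvPowerSeries.coeff_smul ..

theorem eq_of_forall_pow_dvd_sub {F G : overconvergentSeries p V m}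
    (h : ∀ k, (p : overconvergentSeries p V m) ^ k ∣ F - G) : F = G := by
  rw [← sub_eq_zero]
  ext α
  refine eq_zero_of_forall_pow_dvd p _ fun k => ?_
  obtain ⟨E, hE⟩ := h k
  rw [hE, coeff_natCast_pow_mul]
  exact dvd_mul_right _ _

/-- The coefficientwise quotients are again overconvergent: if `c` serves for `F`, then `c * (k +
1)` serves for them, because `c * (k + j) ≤ c * (k + 1) * j` for `j ≥ 1`. -/
theorem pow_dvd_of_coeff {F : overconvergentSeries p V m} {k : ℕ}
    (h : ∀ α, (p : V) ^ k ∣ MvPowerSeries.coeff α (F : MvPowerSeries (Fin m) V)) :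
    (p : overconvergentSeries p V m) ^ k ∣ F := by
  have hp0 : (p : V) ≠ 0 := Nat.cast_ne_zero.2 hp.out.ne_zero
  choose E hE using h
  obtain ⟨c, hc⟩ := F.2
  have hEo : IsOverconvergent p (m := m) (V := V) E := by
    refine ⟨c * (k + 1), fun j α h => ?_⟩
    rcases Nat.eq_zero_or_pos j with rfl | hj
    · simp
    · have h1 := hc (k + j) α (by
        refine lt_of_le_of_lt ?_ h
        rw [mul_assoc]
        refine Nat.mul_le_mul_left _ ?_
        nlinarith)
      rw [hE α, pow_add] at h1
      exact (mul_dvd_mul_iff_left (pow_ne_zero k hp0)).1 h1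
  refine ⟨⟨E, hEo⟩, Subtype.ext (MvPowerSeries.ext fun α => ?_)⟩
  rw [coeff_natCast_pow_mul, hE]
  rfl

theorem growth_pow_zero {c : ℕ} {F : MvPowerSeries (Fin m) V}
    (hF : ∀ (j : ℕ) (α : Fin m →₀ ℕ), c * j < α.degree → (p : V) ^ j ∣ MvPowerSeries.coeff α F)
    (n j : ℕ) (α : Fin m →₀ ℕ) (h : c * (j + n) < α.degree) :
    (p : V) ^ j ∣ MvPowerSeries.coeff α (F ^ n) := by
  classical
  rcases n with _ | n
  · have : α ≠ 0 := by rintro rfl; simp at h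
    rw [pow_zero, MvPowerSeries.coeff_one, if_neg this]
    exact dvd_zero _
  · exact growth_pow p hF n j α ((Nat.mul_le_mul_left c (by omega)).trans_lt h)

/-- The exponents in a monomial add up to at most `d`, and multiplying the two powers costs one
more; hence the defect `d + 1`. -/
theorem growth_aeval {c d : ℕ} (x : Fin 2 → overconvergentSeries p V m)
    (hx : ∀ (i : Fin 2) (j : ℕ) (α : Fin m →₀ ℕ), c * j < α.degree →
      (p : V) ^ j ∣ MvPowerSeries.coeff α (x i : MvPowerSeries (Fin m) V))
    (P : MvPolynomial (Fin 2) V) (hP : P.totalDegree ≤ d) (j : ℕ) (α : Fin m →₀ ℕ)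
    (h : c * (j + (d + 1)) < α.degree) :
    (p : V) ^ j ∣ MvPowerSeries.coeff α
      (MvPolynomial.aeval x P : overconvergentSeries p V m).1 := by
  have e : (MvPolynomial.aeval x P : overconvergentSeries p V m).1 =
      ∑ s ∈ P.support, P.coeff s • ((x 0).1 ^ s 0 * (x 1).1 ^ s 1) := by
    rw [MvPolynomial.aeval_def, MvPolynomial.eval₂_eq', AddSubmonoidClass.coe_finsetSum]
    refine Finset.sum_congr rfl fun s _ => ?_
    rw [Fin.prod_univ_two, ← Algebra.smul_def]
    rfl
  rw [e, map_sum]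
  refine Finset.dvd_sum fun s hs => ?_
  rw [MvPowerSeries.coeff_smul]
  refine Dvd.dvd.mul_left (growth_mul p (c := c) (s := s 0) (t := s 1)
    (growth_pow_zero p (hx 0) (s 0)) (growth_pow_zero p (hx 1) (s 1)) j α ?_) _
  refine lt_of_le_of_lt (Nat.mul_le_mul_left c ?_) h
  have h1 := (MvPolynomial.le_totalDegree hs).trans hP
  rw [Finsupp.sum_fintype _ _ (fun _ => rfl), Fin.sum_univ_two] at h1
  omega

theorem aeval_pow_dvd {k : ℕ} {P : MvPolynomial (Fin 2) V}
    (h : (p : MvPolynomial (Fin 2) V) ^ k ∣ P) (x : Fin 2 → overconvergentSeries p V m) :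
    (p : overconvergentSeries p V m) ^ k ∣ MvPolynomial.aeval x P := by
  have := map_dvd (MvPolynomial.aeval (R := V) x) h
  rwa [map_pow, map_natCast] at this

/-- A sum of polynomials in overconvergent series, whose coefficients tend `p`-adically to zero
linearly while their degrees grow linearly, is an overconvergent series. -/
theorem exists_padicSum (P : ℕ → MvPolynomial (Fin 2) V) (d : ℕ)
    (hdeg : ∀ n, (P n).totalDegree ≤ d * (n + 1))
    (hP : ∀ n, (p : MvPolynomial (Fin 2) V) ^ (n / 4) ∣ P n)
    (x : Fin 2 → overconvergentSeries p V m) : ∃ B : overconvergentSeries p V m, ∀ k,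
      (p : overconvergentSeries p V m) ^ k ∣
        B - ∑ n ∈ Finset.range (4 * k), MvPolynomial.aeval x (P n) := by
  obtain ⟨c, hc⟩ : ∃ c, ∀ (i : Fin 2) (j : ℕ) (α : Fin m →₀ ℕ), c * j < α.degree →
      (p : V) ^ j ∣ MvPowerSeries.coeff α (x i : MvPowerSeries (Fin m) V) := by
    obtain ⟨c0, h0⟩ := (x 0).2
    obtain ⟨c1, h1⟩ := (x 1).2
    refine ⟨max c0 c1, fun i => ?_⟩
    fin_cases i
    · exact IsOverconvergent.mono p (le_max_left c0 c1) h0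
    · exact IsOverconvergent.mono p (le_max_right c0 c1) h1
  let T : ℕ → overconvergentSeries p V m := fun n => MvPolynomial.aeval x (P n)
  have hT : ∀ n α, (p : V) ^ (n / 4) ∣ MvPowerSeries.coeff α (T n).1 := fun n α => by
    obtain ⟨E, hE⟩ := aeval_pow_dvd p (hP n) x
    change _ ∣ MvPowerSeries.coeff α (MvPolynomial.aeval x (P n) : overconvergentSeries p V m).1
    rw [hE, coeff_natCast_pow_mul]
    exact dvd_mul_right _ _
  -- Uniform overconvergence of all terms. If `j ≤ n / 4`, the term is divisible by `p ^ j` anyway.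
  -- Otherwise its degree is bounded linearly in `j`, and the growth of polynomials applies; the
  -- constant `8 * d + 2` is generous.
  have hgrow : ∀ n j α, c * (8 * d + 2) * j < α.degree →
      (p : V) ^ j ∣ MvPowerSeries.coeff α (T n).1 := fun n j α h => by
    rcases Nat.eq_zero_or_pos j with rfl | hj
    · simp
    rcases le_or_gt j (n / 4) with hn | hn
    · exact (pow_dvd_pow _ hn).trans (hT n α)
    · refine growth_aeval p x hc (P n) (hdeg n) j α (lt_of_le_of_lt ?_ h)
      rw [mul_assoc]
      refine Nat.mul_le_mul_left c ?_
      have h1 : n + 1 ≤ 8 * j := by omega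
      have h2 : d * (n + 1) ≤ d * (8 * j) := Nat.mul_le_mul_left d h1
      nlinarith
  let f : (Fin m →₀ ℕ) → ℕ → V := fun α k =>
    ∑ n ∈ Finset.range (4 * k), MvPowerSeries.coeff α (T n).1
  -- Terms with index at least `4 * k` are divisible by `p ^ k`.
  have hf : ∀ α k l, k ≤ l → (p : V) ^ k ∣ f α l - f α k := fun α k l hkl => by
    change _ ∣ ∑ n ∈ Finset.range (4 * l), _ - ∑ n ∈ Finset.range (4 * k), _
    rw [Finset.sum_range_sub_sum_range (by omega)]
    refine Finset.dvd_sum fun n hn => ?_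
    have hn' := (Finset.mem_filter.1 hn).2
    exact (pow_dvd_pow _ (by omega)).trans (hT n α)
  choose L hL using fun α => exists_padic_limit p (f α) (hf α)
  refine ⟨⟨L, c * (8 * d + 2), fun j α h => ?_⟩, fun k => pow_dvd_of_coeff p fun α => ?_⟩
  · have := dvd_add (hL α j) (Finset.dvd_sum (s := Finset.range (4 * j)) fun n _ => hgrow n j α h)
    rw [sub_add_cancel] at this
    exact this
  · have : (∑ n ∈ Finset.range (4 * k), T n).1 = ∑ n ∈ Finset.range (4 * k), (T n).1 :=
      AddSubmonoidClass.coe_finsetSum ..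
    change _ ∣ MvPowerSeries.coeff α ((show MvPowerSeries (Fin m) V from L) - (∑ n ∈ Finset.range (4 * k), T n).1)
    rw [this, map_sub, map_sum]
    exact hL α k

theorem pow_dvd_logSeries_sub (Y : overconvergentSeries p V m) (k : ℕ) :
    (p : overconvergentSeries p V m) ^ k ∣ logSeries p Y -
      ∑ n ∈ Finset.range (2 * k), logCoeff p V n • Y ^ (n + 1) := by
  obtain ⟨E, hE⟩ := logSeries_spec p Y k
  refine ⟨E, ?_⟩
  rw [hE, add_sub_cancel_left, Algebra.smul_def, map_pow, map_natCast]

end padicSum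

section logSum

set_option linter.unusedSectionVars false

variable (p : ℕ) [hp : Fact p.Prime] {V : Type u} [CommRing V] [IsDomain V]
  [IsDiscreteValuationRing V] [IsAdicComplete (IsLocalRing.maximalIdeal V) V] [CharZero V]
  [CharP (IsLocalRing.ResidueField V) p] {m : ℕ}

/-! ### Division by integers -/

/-- The prime-to-p part of `i` is a unit of `V`, and the size of `i` bounds its p-adic valuation by
`v`. -/
theorem exists_natCast_mul_eq_pow {i v : ℕ} (hi : i ≠ 0) (hiv : i < p ^ (v + 1)) :
    ∃ u : V, (i : V) * u = (p : V) ^ v := by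
  have hp' := hp.out
  obtain ⟨a, b, hb, rfl⟩ := Nat.exists_eq_pow_mul_and_not_dvd hi p hp'.ne_one
  have hu : IsUnit (b : V) := by
    by_contra hcon
    have : (b : V) ∈ IsLocalRing.maximalIdeal V := (IsLocalRing.mem_maximalIdeal _).2 hcon
    rw [← IsLocalRing.residue_eq_zero_iff, map_natCast, CharP.cast_eq_zero_iff _ p] at this
    exact hb this
  obtain ⟨w, hw⟩ := hu.exists_right_inv
  have hav : a ≤ v := by
    by_contra hcon
    have h1 : p ^ (v + 1) ≤ p ^ a := Nat.pow_le_pow_right hp'.pos (by omega)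
    have h2 : p ^ a ≤ p ^ a * b := Nat.le_mul_of_pos_right _ (Nat.pos_of_ne_zero (by
      rintro rfl; simp at hb))
    omega
  refine ⟨(p : V) ^ (v - a) * w, ?_⟩
  push_cast
  calc (p : V) ^ a * b * (p ^ (v - a) * w) = p ^ a * p ^ (v - a) * (b * w) := by ring
    _ = p ^ v := by rw [hw, mul_one, ← pow_add, Nat.add_sub_cancel' hav]

theorem pow_dvd_of_natCast_mul {i v M : ℕ} (hi : i ≠ 0) (hiv : i < p ^ (v + 1)) {x : V}
    (h : (p : V) ^ (M + v) ∣ (i : V) * x) : (p : V) ^ M ∣ x := by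
  have hp0 : (p : V) ≠ 0 := Nat.cast_ne_zero.2 hp.out.ne_zero
  obtain ⟨u, hu⟩ := exists_natCast_mul_eq_pow p (V := V) hi hiv
  refine (mul_dvd_mul_iff_left (pow_ne_zero v hp0)).1 ?_
  rw [← pow_add, add_comm v, ← hu]
  exact h.trans ⟨u, by ring⟩

/-- Integers of size linear in `n` have valuation at most `r + n / 4`. The rate 1/4 is half the rate
at which `logCoeff` gains powers of `p`, so half of these powers can pay for denominators and the
other half gives convergence. -/
theorem exists_linear_lt_pow (d : ℕ) : ∃ r : ℕ, ∀ n, d * (n + 1) < p ^ (r + n / 4 + 1) := by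
  refine ⟨d + 2, fun n => ?_⟩
  have h1 : 2 ^ (d + 2 + n / 4 + 1) ≤ p ^ (d + 2 + n / 4 + 1) :=
    Nat.pow_le_pow_left hp.out.two_le _
  have h2 : d < 2 ^ d := Nat.lt_two_pow_self
  have h3 : n / 4 < 2 ^ (n / 4) := Nat.lt_two_pow_self
  have h4 : n + 1 ≤ 4 * 2 ^ (n / 4) := by omega
  have e : 2 ^ (d + 2 + n / 4 + 1) = 2 ^ d * (4 * 2 ^ (n / 4)) * 2 := by ring
  have h5 : d * (n + 1) ≤ 2 ^ d * (4 * 2 ^ (n / 4)) := Nat.mul_le_mul h2.le h4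
  have h6 : 0 < 2 ^ d * (4 * 2 ^ (n / 4)) := by positivity
  omega

/-! ### Integration of polynomials -/

theorem natCast_pow_dvd_iff (k : ℕ) (F : MvPolynomial (Fin 2) V) :
    (p : MvPolynomial (Fin 2) V) ^ k ∣ F ↔ ∀ s, (p : V) ^ k ∣ F.coeff s := by
  rw [← MvPolynomial.C_dvd_iff_dvd_coeff, map_pow, map_natCast]

theorem coeff_X_mul_pderiv (i : Fin 2) (F : MvPolynomial (Fin 2) V) (s : Fin 2 →₀ ℕ) :
    (MvPolynomial.X i * MvPolynomial.pderiv i F).coeff s = (s i : V) * F.coeff s := by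
  classical
  induction F using MvPolynomial.induction_on' with
  | monomial t a =>
    rw [MvPolynomial.X_mul_pderiv_monomial, nsmul_eq_mul, ← map_natCast MvPolynomial.C,
      MvPolynomial.coeff_C_mul, MvPolynomial.coeff_monomial]
    split_ifs with h
    · rw [h]
    · rw [mul_zero, mul_zero]
  | add F G hF hG => rw [map_add, mul_add, MvPolynomial.coeff_add, hF, hG, MvPolynomial.coeff_add,
      mul_add]

theorem coeff_eq_zero_of_X_dvd {i : Fin 2} {F : MvPolynomial (Fin 2) V}
    (h : MvPolynomial.X i ∣ F) {s : Fin 2 →₀ ℕ} (hs : s i = 0) : F.coeff s = 0 := by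
  obtain ⟨G, rfl⟩ := h
  rw [MvPolynomial.coeff_X_mul', if_neg]
  simpa using hs

/-- The operator multiplies each coefficient by the exponent of the first variable. That exponent is
nonzero by `hX` and, by the degree bound, absorbs at most `p ^ v`. -/
theorem pow_dvd_of_X_mul_pderiv {F : MvPolynomial (Fin 2) V} {M v : ℕ}
    (hX : MvPolynomial.X 0 ∣ F) (hdeg : F.totalDegree < p ^ (v + 1))
    (h : (p : MvPolynomial (Fin 2) V) ^ (M + v) ∣ MvPolynomial.X 0 * MvPolynomial.pderiv 0 F) :
    (p : MvPolynomial (Fin 2) V) ^ M ∣ F := by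
  rw [natCast_pow_dvd_iff] at h ⊢
  intro s
  by_cases hs : F.coeff s = 0
  · rw [hs]; exact dvd_zero _
  have hs0 : s 0 ≠ 0 := fun h0 => hs (coeff_eq_zero_of_X_dvd hX h0)
  refine pow_dvd_of_natCast_mul p hs0 (lt_of_le_of_lt ?_ hdeg) (coeff_X_mul_pderiv 0 F s ▸ h s)
  refine le_trans ?_ (MvPolynomial.le_totalDegree (MvPolynomial.mem_support_iff.2 hs))
  rw [Finsupp.sum_fintype _ _ (fun _ => rfl), Fin.sum_univ_two]
  omega

/-- Termwise integration in the first variable without constant term; the factor `p ^ v` clears the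
denominators `s 0 + 1`. -/
theorem exists_integral (W : MvPolynomial (Fin 2) V) {v : ℕ} (h : W.totalDegree + 1 < p ^ (v + 1)) :
    ∃ B : MvPolynomial (Fin 2) V, MvPolynomial.pderiv 0 B = (p : MvPolynomial (Fin 2) V) ^ v * W ∧
      MvPolynomial.X 0 ∣ B ∧ B.totalDegree ≤ W.totalDegree + 1 := by
  classical
  have hex : ∀ s ∈ W.support, ∃ u : V, ((s 0 + 1 : ℕ) : V) * u = (p : V) ^ v := fun s hs => by
    refine exists_natCast_mul_eq_pow p (by omega) (lt_of_le_of_lt ?_ h)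
    have := MvPolynomial.le_totalDegree hs
    rw [Finsupp.sum_fintype _ _ (fun _ => rfl), Fin.sum_univ_two] at this
    omega
  choose! u hu using hex
  have e : ∀ s a, MvPolynomial.monomial (s + Finsupp.single 0 1) a =
      MvPolynomial.X (0 : Fin 2) * MvPolynomial.monomial s (a : V) := fun s a => by
    rw [MvPolynomial.X, MvPolynomial.monomial_mul, one_mul, add_comm]
  refine ⟨∑ s ∈ W.support, MvPolynomial.monomial (s + Finsupp.single 0 1) (u s * W.coeff s),
    ?_, ?_, ?_⟩
  · conv_rhs => rw [W.as_sum, Finset.mul_sum]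
    rw [map_sum]
    refine Finset.sum_congr rfl fun s hs => ?_
    rw [MvPolynomial.pderiv_monomial, add_tsub_cancel_right, ← map_natCast MvPolynomial.C,
      ← map_pow, MvPolynomial.C_mul_monomial, ← hu s hs]
    congr 1
    simp
    ring
  · refine Finset.dvd_sum fun s _ => ?_
    rw [e]
    exact dvd_mul_right _ _
  · refine (MvPolynomial.totalDegree_finsetSum _ _).trans (Finset.sup_le fun s hs => ?_)
    refine (MvPolynomial.totalDegree_monomial_le _ _).trans ?_
    have := MvPolynomial.le_totalDegree hs
    rw [Finsupp.sum_fintype _ _ (fun _ => rfl), Fin.sum_univ_two] at this ⊢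
    simp
    omega

/-! ### Partial sums of the logarithm -/

/-- The partial sum `∑_{n < N} (p ^ n / (n + 1)) Y ^ (n + 1)` of `- p⁻¹ log (1 - p Y)`. -/
def logSum {B : Type u} [CommRing B] [Algebra V B] (N : ℕ) (Y : B) : B :=
  ∑ n ∈ Finset.range N, logCoeff p V n • Y ^ (n + 1)

section

variable {B : Type u} [CommRing B] [Algebra V B]

variable (V) in
theorem sub_dvd_logSum_sub (N : ℕ) (Y Z : B) :
    Y - Z ∣ logSum p (V := V) N Y - logSum p (V := V) N Z := by
  rw [logSum, logSum, ← Finset.sum_sub_distrib]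
  refine Finset.dvd_sum fun n _ => ?_
  rw [← smul_sub, Algebra.smul_def]
  exact (sub_dvd_pow_sub_pow _ _ _).mul_left _

variable (V) in
theorem dvd_logSum (N : ℕ) (Y : B) : Y ∣ logSum p (V := V) N Y := by
  refine Finset.dvd_sum fun n _ => ?_
  rw [Algebra.smul_def]
  exact (dvd_pow_self _ (Nat.succ_ne_zero n)).mul_left _

theorem map_logSum {B' : Type u} [CommRing B'] [Algebra V B'] (f : B →ₐ[V] B') (N : ℕ) (Y : B) :
    f (logSum p (V := V) N Y) = logSum p (V := V) N (f Y) := by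
  rw [logSum, logSum, map_sum]
  refine Finset.sum_congr rfl fun n _ => ?_
  rw [map_smul, map_pow]

/-- The derivative of the partial sum is a finite geometric series: up to the factor `1 - (p Y) ^ N`
it is the derivative `dY / (1 - p Y)` of the full logarithm. -/
theorem derivation_logSum (D : Derivation V B B) (N : ℕ) (Y : B) :
    (1 - (p : B) * Y) * D (logSum p (V := V) N Y) = (1 - ((p : B) * Y) ^ N) * D Y := by
  have hterm : ∀ n, D (logCoeff p V n • Y ^ (n + 1)) = ((p : B) * Y) ^ n * D Y := fun n => by
    have h1 : (((n + 1 : ℕ) : B)) * algebraMap V B (logCoeff p V n) = (p : B) ^ n := by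
      rw [← map_natCast (algebraMap V B), ← map_mul, logCoeff_spec, map_pow, map_natCast]
    rw [Derivation.map_smul, Derivation.leibniz_pow, Nat.add_sub_cancel, Algebra.smul_def,
      smul_eq_mul, nsmul_eq_mul, mul_pow, ← h1]
    ring
  rw [logSum, map_sum, Finset.sum_congr rfl fun n _ => hterm n, ← Finset.sum_mul, ← mul_assoc,
    mul_neg_geom_sum]

end

theorem totalDegree_logSum_le (N : ℕ) (Y : MvPolynomial (Fin 2) V) :
    (logSum p (V := V) N Y).totalDegree ≤ Y.totalDegree * (N + 1) := by
  refine (MvPolynomial.totalDegree_finsetSum _ _).trans (Finset.sup_le fun n hn => ?_)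
  refine (MvPolynomial.totalDegree_smul_le _ _).trans ((MvPolynomial.totalDegree_pow _ _).trans ?_)
  rw [mul_comm]
  exact Nat.mul_le_mul_left _ (by have := Finset.mem_range.1 hn; omega)

theorem pow_dvd_logSeries_sub_logSum (Y : overconvergentSeries p V m) (k : ℕ) :
    (p : overconvergentSeries p V m) ^ k ∣ logSeries p Y - logSum p (V := V) (2 * k) Y :=
  pow_dvd_logSeries_sub p Y k

theorem one_sub_mul_ne_zero (Y : MvPolynomial (Fin 2) V) :
    1 - (p : MvPolynomial (Fin 2) V) * Y ≠ 0 := fun h => by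
  have h1 := congrArg (MvPolynomial.aeval (0 : Fin 2 → V)) h
  rw [map_sub, map_one, map_mul, map_natCast, map_zero, sub_eq_zero] at h1
  have hm := natCast_mem_maximalIdeal p V
  exact (IsLocalRing.mem_maximalIdeal _).1 hm (IsUnit.of_mul_eq_one _ h1.symm)

/-! ### The functional equation -/

/-- The third argument `z` satisfies `1 - p z = (1 - p x)(1 - p y)`. The defect of additivity
vanishes at `x = 0`, and its derivative in `x` is divisible by `p ^ N`, being made of the tails of
geometric series. Integrating back costs at most `r + N / 4` powers of `p`. -/
theorem exists_pow_dvd_logSum_add : ∃ r : ℕ, ∀ N : ℕ,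
    (p : MvPolynomial (Fin 2) V) ^ (N - (r + N / 4)) ∣
      logSum p (V := V) N (MvPolynomial.X 0 : MvPolynomial (Fin 2) V) +
      logSum p (V := V) N (MvPolynomial.X 1) - logSum p (V := V) N
        (MvPolynomial.X 0 + MvPolynomial.X 1 -
          (p : MvPolynomial (Fin 2) V) * (MvPolynomial.X 0 * MvPolynomial.X 1)) := by
  set x : MvPolynomial (Fin 2) V := MvPolynomial.X 0
  set y : MvPolynomial (Fin 2) V := MvPolynomial.X 1
  set z := x + y - (p : MvPolynomial (Fin 2) V) * (x * y) with hz
  obtain ⟨r, hr⟩ := exists_linear_lt_pow p (max (max x.totalDegree y.totalDegree) z.totalDegree)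
  refine ⟨r, fun N => ?_⟩
  rcases le_or_gt N (r + N / 4) with hN | hN
  · rw [Nat.sub_eq_zero_of_le hN, pow_zero]; exact one_dvd _
  refine pow_dvd_of_X_mul_pderiv p (v := r + N / 4) ?_ ?_ ?_
  · have h1 : x ∣ y - z := ⟨-(1 - (p : MvPolynomial (Fin 2) V) * y), by rw [hz]; ring⟩
    rw [add_sub_assoc]
    exact dvd_add (dvd_logSum p V N x) (h1.trans (sub_dvd_logSum_sub p V N y z))
  · refine lt_of_le_of_lt ?_ (hr N)
    refine (MvPolynomial.totalDegree_sub _ _).trans (max_le ((MvPolynomial.totalDegree_add _ _).trans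
      (max_le ?_ ?_)) ?_)
    all_goals
      refine (totalDegree_logSum_le p N _).trans (Nat.mul_le_mul_right _ ?_)
      simp
  · rw [Nat.sub_add_cancel hN.le]
    refine Dvd.dvd.mul_left ?_ _
    set D := MvPolynomial.pderiv (R := V) (0 : Fin 2)
    have hx : D x = 1 := MvPolynomial.pderiv_X_self _
    have hy : D y = 0 := MvPolynomial.pderiv_X_of_ne (by decide)
    have hDz : D z = 1 - (p : MvPolynomial (Fin 2) V) * y := by
      rw [hz]; simp [hx, hy]
    have hpz : 1 - (p : MvPolynomial (Fin 2) V) * z =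
        (1 - (p : MvPolynomial (Fin 2) V) * x) * (1 - (p : MvPolynomial (Fin 2) V) * y) := by
      rw [hz]; ring
    have e1 := derivation_logSum p D N x
    have e2 := derivation_logSum p D N y
    have e3 := derivation_logSum p D N z
    rw [hx, mul_one] at e1
    rw [hy, mul_zero] at e2
    have e2' := (mul_eq_zero.1 e2).resolve_left (one_sub_mul_ne_zero p y)
    rw [hDz, hpz] at e3
    have e3' : (1 - (p : MvPolynomial (Fin 2) V) * x) * D (logSum p (V := V) N z) =
        1 - ((p : MvPolynomial (Fin 2) V) * z) ^ N := by
      refine mul_right_cancel₀ (one_sub_mul_ne_zero p y) ?_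
      linear_combination e3
    obtain ⟨h, hh⟩ := sub_dvd_pow_sub_pow z x N
    refine ⟨y * h, mul_left_cancel₀ (one_sub_mul_ne_zero p x) ?_⟩
    rw [map_sub, map_add, e2', add_zero]
    have hzx : z - x = y * (1 - (p : MvPolynomial (Fin 2) V) * x) := by rw [hz]; ring
    rw [hzx] at hh
    rw [mul_pow] at e1 e3'
    linear_combination e1 - e3' + (p : MvPolynomial (Fin 2) V) ^ N * hh

/-- The functional equation of the logarithm. It is the limit of the universal congruence for
polynomials, evaluated at `Y` and `Z`. -/
theorem logSeries_add (Y Z : overconvergentSeries p V m) : logSeries p Y + logSeries p Z =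
    logSeries p (Y + Z - (p : overconvergentSeries p V m) * (Y * Z)) := by
  obtain ⟨r, hr⟩ := exists_pow_dvd_logSum_add p (V := V)
  refine eq_of_forall_pow_dvd_sub p fun k => ?_
  set W := Y + Z - (p : overconvergentSeries p V m) * (Y * Z)
  -- With `2 * (k + r)` terms, the loss `r + (k + r) / 2` leaves at least `k` powers of `p`.
  have h1 := aeval_pow_dvd p (hr (2 * (k + r))) ![Y, Z]
  rw [map_sub, map_add, map_logSum, map_logSum, map_logSum, map_sub, map_add, map_mul, map_mul,
    map_natCast, MvPolynomial.aeval_X, MvPolynomial.aeval_X] at h1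
  change _ ∣ logSum p (V := V) (2 * (k + r)) Y + logSum p (V := V) (2 * (k + r)) Z -
    logSum p (V := V) (2 * (k + r)) W at h1
  have h2 := (pow_dvd_pow (p : overconvergentSeries p V m) (by omega :
    k ≤ 2 * (k + r) - (r + 2 * (k + r) / 4))).trans h1
  have h3 := fun X : overconvergentSeries p V m =>
    (pow_dvd_pow (p : overconvergentSeries p V m) (Nat.le_add_right k r)).trans
      (pow_dvd_logSeries_sub_logSum p X (k + r))
  have h4 := dvd_sub (dvd_add (dvd_add (h3 Y) (h3 Z)) h2) (h3 W)
  refine h4.trans (dvd_of_eq ?_)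
  ring

/-- The quotients of `Y ^ (n + 1) - Z ^ (n + 1)` by `Y - Z`, weighted with the coefficients of the
logarithm, sum to an overconvergent series. Consequently the logarithm is compatible with
congruences modulo the ideal of relations. -/
theorem sub_dvd_logSeries_sub (Y Z : overconvergentSeries p V m) :
    Y - Z ∣ logSeries p Y - logSeries p Z := by
  let h : ℕ → MvPolynomial (Fin 2) V := fun n =>
    ∑ i ∈ Finset.range (n + 1), MvPolynomial.X 0 ^ i * MvPolynomial.X 1 ^ (n - i)
  obtain ⟨B, hB⟩ := exists_padicSum p (fun n => logCoeff p V n • h n) 2 (fun n => by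
    refine (MvPolynomial.totalDegree_smul_le _ _).trans
      ((MvPolynomial.totalDegree_finsetSum _ _).trans (Finset.sup_le fun i hi => ?_))
    refine (MvPolynomial.totalDegree_mul _ _).trans ?_
    rw [MvPolynomial.totalDegree_X_pow, MvPolynomial.totalDegree_X_pow]
    have := Finset.mem_range.1 hi
    omega) (fun n => by
    obtain ⟨c, hc⟩ := (pow_dvd_pow (p : V) (by omega : n / 4 ≤ n / 2)).trans (dvd_logCoeff p V n)
    rw [hc, MvPolynomial.smul_eq_C_mul, map_mul, map_pow, map_natCast, mul_assoc]
    exact dvd_mul_right _ _) ![Y, Z]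
  refine ⟨B, eq_of_forall_pow_dvd_sub p fun k => ?_⟩
  have e : (Y - Z) * ∑ n ∈ Finset.range (4 * k), MvPolynomial.aeval ![Y, Z] (logCoeff p V n • h n) =
      logSum p (V := V) (4 * k) Y - logSum p (V := V) (4 * k) Z := by
    rw [logSum, logSum, ← Finset.sum_sub_distrib, Finset.mul_sum]
    refine Finset.sum_congr rfl fun n _ => ?_
    rw [map_smul, mul_smul_comm, ← smul_sub]
    congr 1
    have := geom_sum₂_mul Y Z (n + 1)
    rw [← this, mul_comm]
    congr 1
    rw [map_sum]
    refine Finset.sum_congr rfl fun i _ => ?_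
    simp
  have h1 := (hB k).mul_left (Y - Z)
  rw [mul_sub, e] at h1
  have h3 := fun X : overconvergentSeries p V m => 
    (pow_dvd_pow (p : overconvergentSeries p V m) (by omega : k ≤ 2 * k)).trans
      (pow_dvd_logSeries_sub_logSum p X (2 * k))
  simp only [← mul_assoc, show 2 * 2 = 4 from rfl] at h3
  have h4 := dvd_sub (dvd_sub (h3 Y) (h3 Z)) h1
  refine h4.trans (dvd_of_eq ?_)
  ring

end logSum

section steinberg

set_option linter.unusedSectionVars false

variable (p : ℕ) [hp : Fact p.Prime] {V : Type u} [CommRing V] [IsDomain V]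
  [IsDiscreteValuationRing V] [IsAdicComplete (IsLocalRing.maximalIdeal V) V] [CharZero V]
  [CharP (IsLocalRing.ResidueField V) p] {m : ℕ}

/-! ### A primitive for the Steinberg relation -/

/-- The polynomial `Q(t, s)` for which `1 - p Q` is the Frobenius quotient of `1 - f`, if `t` is
`- f / (1 - f)` and `1 - p s` is the Frobenius quotient of `f`. -/
theorem exists_steinbergPoly {B : Type u} [CommRing B] (t s : B) : ∃ Q : B,
    1 - (p : B) * Q = (1 - t) ^ p * (1 - (p : B) * s) - (-t) ^ p ∧ t ∣ Q - s ∧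
    (1 - t) ∣ 2 * Q - (p : B) * (Q * Q) := by
  obtain ⟨r, hr⟩ := exists_add_pow_prime_eq hp.out (1 - t) t
  rw [sub_add_cancel, one_pow] at hr
  -- The sum `t ^ p + (-t) ^ p` vanishes for odd `p` and is `2 t ^ 2` for `p = 2`, whence `e = 0` or
  -- `e = 1`. Modulo `1 - t` the polynomial `Q` is `e`. For `p = 2` it does not vanish there, but `2
  -- Q - p Q ^ 2`, which corresponds to the square of `1 - p Q`, does.
  obtain ⟨e, he, he'⟩ : ∃ e : B, (p : B) * e * t ^ p = t ^ p + (-t) ^ p ∧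
      2 * e - (p : B) * (e * e) = 0 := by
    rcases hp.out.eq_two_or_odd' with h2 | ho
    · refine ⟨1, ?_, ?_⟩
      · rw [h2]; push_cast; ring
      · rw [h2]; push_cast; ring
    · exact ⟨0, by rw [ho.neg_pow]; ring, by ring⟩
  obtain ⟨w, hw⟩ := sub_dvd_pow_sub_pow (1 - t) 1 p
  obtain ⟨w', hw'⟩ := sub_dvd_pow_sub_pow t 1 p
  obtain ⟨n, hn⟩ : ∃ n, p = n + 1 := Nat.exists_eq_succ_of_ne_zero hp.out.ne_zero
  have hpow : ∀ x : B, x ^ p = x * x ^ n := fun x => by rw [hn, pow_succ']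
  rw [one_pow] at hw hw'
  refine ⟨e * t ^ p + t * (1 - t) * r + s * (1 - t) ^ p, ?_, ?_, ?_⟩
  · linear_combination hr - he
  · refine ⟨e * t ^ n + (1 - t) * r - s * w, ?_⟩
    linear_combination e * hpow t + s * hw
  · obtain ⟨h, hh⟩ : ∃ h, e * t ^ p + t * (1 - t) * r + s * (1 - t) ^ p = e + (1 - t) * h := by
      refine ⟨-(e * w') + t * r + s * (1 - t) ^ n, ?_⟩
      linear_combination e * hw' + s * hpow (1 - t)
    rw [hh]
    refine ⟨2 * h - 2 * (p : B) * e * h - (p : B) * (1 - t) * h ^ 2, ?_⟩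
    linear_combination he'

theorem pderiv_comm' (i j : Fin 2) (F : MvPolynomial (Fin 2) V) :
    MvPolynomial.pderiv i (MvPolynomial.pderiv j F) =
      MvPolynomial.pderiv j (MvPolynomial.pderiv i F) := by
  have h : ⁅MvPolynomial.pderiv (R := V) i, MvPolynomial.pderiv (R := V) j⁆ = 0 := by
    refine MvPolynomial.derivation_ext fun k => ?_
    rw [Derivation.commutator_apply, MvPolynomial.pderiv_X, MvPolynomial.pderiv_X]
    simp [Pi.single_apply, apply_ite]
  have := congrArg (fun D => D F) h
  exact sub_eq_zero.1 this

theorem totalDegree_pderiv_le' (i : Fin 2) (F : MvPolynomial (Fin 2) V) :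
    (MvPolynomial.pderiv i F).totalDegree ≤ F.totalDegree := by
  classical
  conv_lhs => rw [F.as_sum, map_sum]
  refine (MvPolynomial.totalDegree_finsetSum _ _).trans (Finset.sup_le fun s hs => ?_)
  rw [MvPolynomial.pderiv_monomial]
  refine (MvPolynomial.totalDegree_monomial_le _ _).trans ?_
  have := MvPolynomial.le_totalDegree hs
  rw [Finsupp.sum_fintype _ _ (fun _ => rfl), Fin.sum_univ_two] at this ⊢
  rw [Finsupp.tsub_apply, Finsupp.tsub_apply]
  simp only [id]
  omega

/-- The poles of the form are removable in each term: at `t = 0` because `s'` and `Q'` agree there,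
at `t = 1` because `Q'` vanishes there. The two factors are coprime. -/
theorem exists_steinbergTerm {t s' Q' : MvPolynomial (Fin 2) V} (ht : t = MvPolynomial.X 0)
    (h0 : t ∣ s' - Q') (h1 : (1 - t) ∣ Q') (n : ℕ) : ∃ W : MvPolynomial (Fin 2) V,
    t * (1 - t) * W = (1 - t) * s' ^ (n + 1) - Q' ^ (n + 1) ∧
    W.totalDegree ≤ (1 + s'.totalDegree + Q'.totalDegree) * (n + 1) := by
  obtain ⟨W, hW⟩ : t * (1 - t) ∣ (1 - t) * s' ^ (n + 1) - Q' ^ (n + 1) := by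
    refine IsCoprime.mul_dvd ⟨1, 1, by ring⟩ ?_ ?_
    · have e : (1 - t) * s' ^ (n + 1) - Q' ^ (n + 1) =
          (s' ^ (n + 1) - Q' ^ (n + 1)) - t * s' ^ (n + 1) := by ring
      rw [e]
      exact dvd_sub (h0.trans (sub_dvd_pow_sub_pow _ _ _)) (dvd_mul_right _ _)
    · exact dvd_sub (dvd_mul_right _ _) (h1.trans (dvd_pow_self _ (Nat.succ_ne_zero n)))
  refine ⟨W, hW.symm, ?_⟩
  by_cases hW0 : W = 0
  · rw [hW0, MvPolynomial.totalDegree_zero]; exact Nat.zero_le _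
  have ht1 : (1 - t).totalDegree ≤ 1 := by
    refine (MvPolynomial.totalDegree_sub _ _).trans ?_
    rw [ht, MvPolynomial.totalDegree_one, MvPolynomial.totalDegree_X]
    exact le_rfl
  have hne : t * (1 - t) ≠ 0 := fun h => by
    have h2 := congrArg (MvPolynomial.aeval ![(2 : V), 0]) h
    rw [ht] at h2
    simp only [map_mul, map_sub, map_one, MvPolynomial.aeval_X, map_zero] at h2
    norm_num at h2
  have h2 := congrArg MvPolynomial.totalDegree hW
  rw [MvPolynomial.totalDegree_mul_of_isDomain hne hW0] at h2
  have h3 : W.totalDegree ≤ ((1 - t) * s' ^ (n + 1) - Q' ^ (n + 1)).totalDegree := by omega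
  refine h3.trans ((MvPolynomial.totalDegree_sub _ _).trans (max_le
    ((MvPolynomial.totalDegree_mul _ _).trans ?_) ((MvPolynomial.totalDegree_pow _ _).trans ?_)))
  · have := MvPolynomial.totalDegree_pow s' (n + 1)
    nlinarith [Nat.zero_le (Q'.totalDegree * (n + 1))]
  · rw [mul_comm]
    exact Nat.mul_le_mul_right _ (by omega)

/-- This is closedness of the form in `t` and `s` described at the beginning, with denominators
cleared. It results from differentiating the definition of `Q` and cancelling `p`. -/
theorem steinbergPoly_pderiv {t s Q : MvPolynomial (Fin 2) V}
    (t0 : MvPolynomial.pderiv (R := V) 0 t = 1) (t1 : MvPolynomial.pderiv (R := V) 1 t = 0)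
    (s0 : MvPolynomial.pderiv (R := V) 0 s = 0) (s1 : MvPolynomial.pderiv (R := V) 1 s = 1)
    (hQ : 1 - (p : MvPolynomial (Fin 2) V) * Q =
      (1 - t) ^ p * (1 - (p : MvPolynomial (Fin 2) V) * s) - (-t) ^ p) :
    (1 - t) * (1 - (p : MvPolynomial (Fin 2) V) * Q) -
      (1 - (p : MvPolynomial (Fin 2) V) * s) * MvPolynomial.pderiv 1 Q +
      t * (1 - t) * MvPolynomial.pderiv 0 Q = 0 := by
  set π : MvPolynomial (Fin 2) V := (p : MvPolynomial (Fin 2) V) with hπ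
  have hπ0 : π ≠ 0 := Nat.cast_ne_zero.2 hp.out.ne_zero
  obtain ⟨n, hn⟩ : ∃ n, p = n + 1 := Nat.exists_eq_succ_of_ne_zero hp.out.ne_zero
  have key : ∀ D : Derivation V (MvPolynomial (Fin 2) V) (MvPolynomial (Fin 2) V),
      π * D Q = π * ((1 - t) ^ n * (1 - π * s) * D t + (1 - t) ^ p * D s -
        (-t) ^ n * D t) := fun D => by
    have h1 : D π = 0 := D.map_natCast p
    have h2 := congrArg D hQ
    have hpn : p - 1 = n := by omega
    simp only [map_sub, map_neg, Derivation.leibniz, Derivation.leibniz_pow,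
      D.map_one_eq_zero, h1, smul_eq_mul, nsmul_eq_mul, hpn, ← hπ] at h2
    linear_combination -h2
  have k0 := mul_left_cancel₀ hπ0 (key (MvPolynomial.pderiv 0))
  have k1 := mul_left_cancel₀ hπ0 (key (MvPolynomial.pderiv 1))
  rw [t0, s0] at k0
  rw [t1, s1] at k1
  have hpow : ∀ x : MvPolynomial (Fin 2) V, x ^ p = x * x ^ n := fun x => by rw [hn, pow_succ']
  rw [k0, k1, hQ]
  linear_combination (- (1 - t)) * hpow (-t) + (1 - π * s) * (-t) * (hpow (1 - t))

/-- The polynomials whose sum is, up to a constant factor, the primitive of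
`(L(s) / t - L(Q) / (t (1 - t))) dt` that enters the Steinberg relation. -/
theorem exists_steinbergPrimitive {t s Q : MvPolynomial (Fin 2) V} (ht : t = MvPolynomial.X 0)
    (hs : s = MvPolynomial.X 1)
    (hQ : 1 - (p : MvPolynomial (Fin 2) V) * Q =
      (1 - t) ^ p * (1 - (p : MvPolynomial (Fin 2) V) * s) - (-t) ^ p)
    (hQ0 : t ∣ Q - s) (hQ1 : (1 - t) ∣ 2 * Q - (p : MvPolynomial (Fin 2) V) * (Q * Q))
    {s' Q' : MvPolynomial (Fin 2) V} (hs' : s' = 2 * s - (p : MvPolynomial (Fin 2) V) * (s * s))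
    (hQ' : Q' = 2 * Q - (p : MvPolynomial (Fin 2) V) * (Q * Q)) :
    ∃ (r d : ℕ) (B : ℕ → MvPolynomial (Fin 2) V), (∀ n, (B n).totalDegree ≤ d * (n + 1)) ∧
      (∀ n, (p : MvPolynomial (Fin 2) V) ^ (n / 4) ∣ B n) ∧
      (∀ N, t * (1 - t) * MvPolynomial.pderiv 0 (∑ n ∈ Finset.range N, B n) =
        (p : MvPolynomial (Fin 2) V) ^ r *
          ((1 - t) * logSum p (V := V) N s' - logSum p (V := V) N Q')) ∧
      ∃ r', ∀ N, (p : MvPolynomial (Fin 2) V) ^ (N - (r' + N / 4)) ∣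
        (1 - (p : MvPolynomial (Fin 2) V) * s) *
          MvPolynomial.pderiv 1 (∑ n ∈ Finset.range N, B n) +
        (p : MvPolynomial (Fin 2) V) ^ r *
          (logSum p (V := V) N Q' - logSum p (V := V) N s') := by
  set π : MvPolynomial (Fin 2) V := (p : MvPolynomial (Fin 2) V) with hπ
  have hdvd : t ∣ s' - Q' := by
    obtain ⟨h, hh⟩ := hQ0
    refine ⟨-(h * (2 - π * (s + Q))), ?_⟩
    rw [hs', hQ']
    linear_combination (-(2 - π * (s + Q))) * hh
  choose W hW hWd using fun n => exists_steinbergTerm ht hdvd (hQ' ▸ hQ1) n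
  set d0 := 1 + s'.totalDegree + Q'.totalDegree
  obtain ⟨r, hr⟩ := exists_linear_lt_pow p (d0 + 1)
  choose B hB hBX hBd using fun n => exists_integral p (W n) (v := r + n / 4) (by
    refine lt_of_le_of_lt ?_ (hr n)
    have := hWd n
    nlinarith)
  choose c hc using fun n => dvd_logCoeff p V n
  -- Of the `n / 2` powers of `p` in `logCoeff`, `n / 4` pay for the denominators of the integral `B
  -- n`; the others stay as a factor and give convergence. The bounded part `p ^ r` of the
  -- denominators is left as a common factor of the primitive.
  let A : ℕ → MvPolynomial (Fin 2) V := fun n =>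
    c n • (π ^ (n / 2 - n / 4) * B n)
  have hAd : ∀ n, (A n).totalDegree ≤ (d0 + 1) * (n + 1) := fun n => by
    refine (MvPolynomial.totalDegree_smul_le _ _).trans ((MvPolynomial.totalDegree_mul _ _).trans ?_)
    have h1 : (π ^ (n / 2 - n / 4)).totalDegree = 0 := by
      rw [hπ, ← map_natCast MvPolynomial.C, ← map_pow, MvPolynomial.totalDegree_C]
    have h2 := hBd n
    have h3 := hWd n
    rw [h1, zero_add]
    nlinarith
  have hAX : ∀ n, t ∣ A n := fun n => by
    rw [ht]
    change _ ∣ c n • _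
    rw [MvPolynomial.smul_eq_C_mul]
    exact ((hBX n).mul_left _).mul_left _
  have hA : ∀ n, t * (1 - t) * MvPolynomial.pderiv 0 (A n) =
      π ^ r * ((1 - t) * logCoeff p V n • s' ^ (n + 1) - logCoeff p V n • Q' ^ (n + 1)) := fun n => by
    have e1 : MvPolynomial.pderiv 0 (A n) = c n • (π ^ (n / 2 - n / 4) * (π ^ (r + n / 4) * W n)) := by
      change MvPolynomial.pderiv 0 (c n • _) = _
      rw [Derivation.map_smul, Derivation.leibniz, hB, hπ, ← Nat.cast_pow, Derivation.map_natCast,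
        smul_zero, add_zero, smul_eq_mul]
    have e2 : π ^ (n / 2 - n / 4) * π ^ (r + n / 4) = π ^ r * π ^ (n / 2) := by
      rw [← pow_add, ← pow_add]
      congr 1
      omega
    have e3 : (MvPolynomial.C (logCoeff p V n) : MvPolynomial (Fin 2) V) =
        π ^ (n / 2) * MvPolynomial.C (c n) := by
      conv_lhs => rw [hc n]
      rw [map_mul, map_pow, map_natCast]
    rw [e1, MvPolynomial.smul_eq_C_mul, MvPolynomial.smul_eq_C_mul, MvPolynomial.smul_eq_C_mul, e3]
    linear_combination t * (1 - t) * MvPolynomial.C (c n) * W n * e2 +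
      (MvPolynomial.C (c n) * π ^ r * π ^ (n / 2)) * hW n
  have hF : ∀ N, t * (1 - t) * MvPolynomial.pderiv 0 (∑ n ∈ Finset.range N, A n) =
      π ^ r * ((1 - t) * logSum p (V := V) N s' - logSum p (V := V) N Q') := fun N => by
    rw [map_sum, Finset.mul_sum, logSum, logSum, Finset.mul_sum, ← Finset.sum_sub_distrib,
      Finset.mul_sum]
    exact Finset.sum_congr rfl fun n _ => hA n
  refine ⟨r, d0 + 1, A, hAd, fun n => ?_, hF, ?_⟩
  · change _ ∣ c n • _
    rw [MvPolynomial.smul_eq_C_mul]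
    exact ((pow_dvd_pow _ (by omega)).mul_right _).mul_left _
  set D1 := (1 - π * s).totalDegree
  obtain ⟨r', hr'⟩ := exists_linear_lt_pow p (D1 + (d0 + 1) + s'.totalDegree + Q'.totalDegree)
  refine ⟨r', fun N => ?_⟩
  rcases le_or_gt N (r' + N / 4) with hN | hN
  · rw [Nat.sub_eq_zero_of_le hN, pow_zero]; exact one_dvd _
  have hFN := hF N
  set F := ∑ n ∈ Finset.range N, A n with hFdef
  have hFX : t ∣ F := Finset.dvd_sum fun n _ => hAX n
  have hFd : F.totalDegree ≤ (d0 + 1) * (N + 1) :=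
    (MvPolynomial.totalDegree_finsetSum _ _).trans (Finset.sup_le fun n hn =>
      (hAd n).trans (Nat.mul_le_mul_left _ (by have := Finset.mem_range.1 hn; omega)))
  have t0 : MvPolynomial.pderiv (R := V) 0 t = 1 := by rw [ht]; exact MvPolynomial.pderiv_X_self _
  have t1 : MvPolynomial.pderiv (R := V) 1 t = 0 := by
    rw [ht]; exact MvPolynomial.pderiv_X_of_ne (by decide)
  have s0 : MvPolynomial.pderiv (R := V) 0 s = 0 := by
    rw [hs]; exact MvPolynomial.pderiv_X_of_ne (by decide)
  have s1 : MvPolynomial.pderiv (R := V) 1 s = 1 := by rw [hs]; exact MvPolynomial.pderiv_X_self _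
  -- The derivative of the primitive in `s` is found without computing it: the expression vanishes
  -- at `t = 0`, and its derivative in `t` is small because the form is closed.
  refine pow_dvd_of_X_mul_pderiv p (v := r' + N / 4) ?_ ?_ ?_
  · rw [← ht]
    refine dvd_add (Dvd.dvd.mul_left ?_ _) (Dvd.dvd.mul_left ?_ _)
    · obtain ⟨G, hG⟩ := hFX
      rw [hG, Derivation.leibniz, t1, smul_zero, add_zero]
      exact dvd_mul_right _ _
    · rw [← dvd_neg, neg_sub]
      exact hdvd.trans (sub_dvd_logSum_sub p V N _ _)
  · refine lt_of_le_of_lt ?_ (hr' N)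
    have hπr : (π ^ r).totalDegree = 0 := by
      rw [hπ, ← map_natCast MvPolynomial.C, ← map_pow, MvPolynomial.totalDegree_C]
    have b1 := totalDegree_logSum_le p N s'
    have b2 := totalDegree_logSum_le p N Q'
    have b3 := totalDegree_pderiv_le' (V := V) 1 F
    refine (MvPolynomial.totalDegree_add _ _).trans (max_le
      ((MvPolynomial.totalDegree_mul _ _).trans ?_) ((MvPolynomial.totalDegree_mul _ _).trans ?_))
    · change D1 + _ ≤ _
      nlinarith [Nat.zero_le (D1 * N), Nat.zero_le (s'.totalDegree * (N + 1)),
        Nat.zero_le (Q'.totalDegree * (N + 1))]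
    · rw [hπr, zero_add]
      refine (MvPolynomial.totalDegree_sub _ _).trans (max_le ?_ ?_)
      · refine b2.trans (Nat.mul_le_mul_right _ (by omega))
      · refine b1.trans (Nat.mul_le_mul_right _ (by omega))
  · rw [Nat.sub_add_cancel hN.le, ← ht]
    have hQ₁ := steinbergPoly_pderiv p t0 t1 s0 s1 hQ
    rw [← hπ] at hQ₁
    set D0 := MvPolynomial.pderiv (R := V) (0 : Fin 2)
    set D1' := MvPolynomial.pderiv (R := V) (1 : Fin 2)
    have hD0π : D0 π = 0 := D0.map_natCast p
    have hD1π : D1' π = 0 := D1'.map_natCast p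
    have hπr : ∀ D : Derivation V (MvPolynomial (Fin 2) V) (MvPolynomial (Fin 2) V),
        D (π ^ r) = 0 := fun D => by rw [hπ, ← Nat.cast_pow, Derivation.map_natCast]
    have hquad : ∀ (D : Derivation V (MvPolynomial (Fin 2) V) (MvPolynomial (Fin 2) V))
        (x : MvPolynomial (Fin 2) V), D (2 * x - π * (x * x)) = 2 * (1 - π * x) * D x := fun D x => by
      have h1 : D π = 0 := D.map_natCast p
      have h2 : D 2 = 0 := D.map_natCast 2
      rw [map_sub, Derivation.leibniz, Derivation.leibniz, Derivation.leibniz, h1, h2]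
      simp only [smul_eq_mul]
      ring
    -- Since `1 - p (2 x - p x²)` is the square of `1 - p x`, one of the two factors cancels.
    have hls : ∀ (D : Derivation V (MvPolynomial (Fin 2) V) (MvPolynomial (Fin 2) V))
        (x : MvPolynomial (Fin 2) V), (1 - π * x) *
          D (logSum p (V := V) N (2 * x - π * (x * x))) =
        2 * (1 - (π * (2 * x - π * (x * x))) ^ N) * D x := fun D x => by
      have h1 := derivation_logSum p D N (2 * x - π * (x * x))
      rw [hquad, ← hπ] at h1
      refine mul_left_cancel₀ (one_sub_mul_ne_zero p x) ?_
      rw [← hπ]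
      linear_combination h1
    have g1 := hls D1' s
    have g2 := hls D0 s
    have g3 := hls D1' Q
    have g4 := hls D0 Q
    rw [← hs', s1, mul_one] at g1
    rw [← hs', s0, mul_zero] at g2
    rw [← hQ'] at g3 g4
    have g2' := (mul_eq_zero.1 g2).resolve_left (one_sub_mul_ne_zero p s)
    have hcomm : D0 (D1' F) = D1' (D0 F) := pderiv_comm' 0 1 F
    have g5 : t * (1 - t) * D1' (D0 F) =
        π ^ r * ((1 - t) * D1' (logSum p (V := V) N s') - D1' (logSum p (V := V) N Q')) := by
      have h1 := congrArg D1' hFN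
      simp only [Derivation.leibniz, map_sub, t1, D1'.map_one_eq_zero, hπr, smul_eq_mul] at h1
      linear_combination h1
    have g6 : D0 ((1 - π * s) * D1' F +
        π ^ r * (logSum p (V := V) N Q' - logSum p (V := V) N s')) =
        (1 - π * s) * D1' (D0 F) + π ^ r * D0 (logSum p (V := V) N Q') := by
      rw [map_add, Derivation.leibniz, Derivation.leibniz, map_sub, map_sub, D0.map_one_eq_zero,
        Derivation.leibniz, hD0π, s0, hπr, g2', hcomm]
      simp only [smul_eq_mul]
      ring
    rw [g6]
    have hne : (1 - t) * (1 - π * Q) ≠ 0 := by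
      refine mul_ne_zero (fun h => ?_) (one_sub_mul_ne_zero p Q)
      have h2 := congrArg (MvPolynomial.aeval ![(0 : V), 0]) h
      rw [ht] at h2
      simp at h2
    -- The witness collects the tails `(p Q') ^ N` and `(p s') ^ N` of the two geometric series,
    -- divided by `p ^ N`.
    refine ⟨2 * π ^ r * (Q' ^ N - s' ^ N), mul_left_cancel₀ hne ?_⟩
    rw [mul_pow] at g1 g3 g4
    linear_combination (1 - π * Q) * (1 - π * s) * g5 + π ^ r * (1 - t) * (1 - π * Q) * g1 -
      π ^ r * (1 - π * s) * g3 + t * (1 - t) * π ^ r * g4 +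
      2 * (1 - π ^ N * Q' ^ N) * π ^ r * hQ₁

end steinberg

section steinbergForm

set_option linter.unusedSectionVars false

variable (p : ℕ) [hp : Fact p.Prime] {V : Type u} [CommRing V] [IsDomain V]
  [IsDiscreteValuationRing V] [IsAdicComplete (IsLocalRing.maximalIdeal V) V] [CharZero V]
  [CharP (IsLocalRing.ResidueField V) p] (K : Type u) [Field K] [Algebra V K] [IsFractionRing V K]
  {A : Type u} [CommRing A] [Algebra V A] (P : AffinePresentation V A) {FV : V →+* V}
  (σ : FrobeniusLift p P FV)

/-! ### Relations between Frobenius logarithms -/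

/-- The map `V[T]^† → A^†_K`. -/
def seriesToK : overconvergentSeries p V P.m →+* DaggerK p K P :=
  (daggerToK p K P).comp (Dagger.mk p P).toRingHom

theorem seriesToK_algebraMap (v : V) : seriesToK p K P (algebraMap V _ v) =
    algebraMap K _ (algebraMap V K v) := by
  change daggerToK p K P (Dagger.mk p P (algebraMap V _ v)) = _
  rw [AlgHom.commutes, daggerToK_algebraMap]

theorem smul_mem_integralForms (a : overconvergentSeries p V P.m) {ω : Ω[DaggerK p K P⁄K]}
    (h : ω ∈ integralForms p K P) : seriesToK p K P a • ω ∈ integralForms p K P := by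
  refine AddSubgroup.closure_induction (p := fun ω _ => seriesToK p K P a • ω ∈ integralForms p K P)
    ?_ ?_ ?_ ?_ h
  · rintro _ ⟨b, c, rfl⟩
    refine AddSubgroup.subset_closure ⟨Dagger.mk p P a * b, c, ?_⟩
    rw [map_mul, mul_smul]
    rfl
  · rw [smul_zero]; exact zero_mem _
  · intro x y _ _ hx hy
    rw [smul_add]; exact add_mem hx hy
  · intro x _ hx
    rw [smul_neg]; exact neg_mem hx

theorem D_mem_integralForms (b : overconvergentSeries p V P.m) :
    KaehlerDifferential.D K (DaggerK p K P) (seriesToK p K P b) ∈ integralForms p K P :=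
  AddSubgroup.subset_closure ⟨1, Dagger.mk p P b, by rw [map_one, one_smul]; rfl⟩

theorem D_aeval (x : Fin 2 → overconvergentSeries p V P.m) (F : MvPolynomial (Fin 2) V) :
    KaehlerDifferential.D K (DaggerK p K P) (seriesToK p K P (MvPolynomial.aeval x F)) =
      seriesToK p K P (MvPolynomial.aeval x (MvPolynomial.pderiv 0 F)) •
        KaehlerDifferential.D K (DaggerK p K P) (seriesToK p K P (x 0)) +
      seriesToK p K P (MvPolynomial.aeval x (MvPolynomial.pderiv 1 F)) •
        KaehlerDifferential.D K (DaggerK p K P) (seriesToK p K P (x 1)) := by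
  induction F using MvPolynomial.induction_on with
  | C a =>
    simp [seriesToK_algebraMap]
  | add F G hF hG =>
    simp only [map_add, hF, hG, add_smul]
    abel
  | mul_X F i hF =>
    simp only [map_mul, Derivation.leibniz, hF, MvPolynomial.aeval_X, MvPolynomial.pderiv_X, map_add,
      smul_eq_mul, add_smul, smul_add, smul_smul, mul_comm (seriesToK p K P (x i))]
    fin_cases i
    · simp
      abel
    · simp
      abel

/-- Identities between continuous differentials may be checked modulo every power of `p` times
integral forms. -/
theorem eq_of_forall_integralForms {ω : Ω[DaggerK p K P⁄K]} (h : ∀ k : ℕ,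
    ∃ η ∈ integralForms p K P, ω = (p : DaggerK p K P) ^ k • η) :
    (σ.calculus p K).N.mkQ ω = 0 := by
  rw [Submodule.mkQ_apply, Submodule.Quotient.mk_eq_zero]
  exact Submodule.subset_span h

/-- `B` is the image of the convergent sum of the universal polynomials at `T` and `S`. Denominators
are cleared; the factor `2 p ^ r` comes from the passage to squares and from the integration. -/
theorem exists_steinbergForm (T S : overconvergentSeries p V P.m) {t s Q : MvPolynomial (Fin 2) V}
    (ht : t = MvPolynomial.X 0) (hs : s = MvPolynomial.X 1)
    (hQ : 1 - (p : MvPolynomial (Fin 2) V) * Q =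
      (1 - t) ^ p * (1 - (p : MvPolynomial (Fin 2) V) * s) - (-t) ^ p)
    (hQ0 : t ∣ Q - s) (hQ1 : (1 - t) ∣ 2 * Q - (p : MvPolynomial (Fin 2) V) * (Q * Q)) :
    ∃ (r : ℕ) (B : DaggerK p K P),
      (seriesToK p K P T * (1 - seriesToK p K P T) *
          (1 - (p : DaggerK p K P) * seriesToK p K P S)) • (σ.calculus p K).d B =
        (2 * (p : DaggerK p K P) ^ r * (1 - (p : DaggerK p K P) * seriesToK p K P S) *
          ((1 - seriesToK p K P T) * seriesToK p K P (logSeries p S) -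
            seriesToK p K P (logSeries p (MvPolynomial.aeval ![T, S] Q)))) •
              (σ.calculus p K).d (seriesToK p K P T) -
        (2 * (p : DaggerK p K P) ^ r * (seriesToK p K P T * (1 - seriesToK p K P T)) *
          (seriesToK p K P (logSeries p (MvPolynomial.aeval ![T, S] Q)) -
            seriesToK p K P (logSeries p S))) • (σ.calculus p K).d (seriesToK p K P S) := by
  obtain ⟨r, d, B, hBd, hBp, hB0, r', hB1⟩ := exists_steinbergPrimitive p ht hs hQ hQ0 hQ1 rfl rfl
  obtain ⟨b, hb⟩ := exists_padicSum p B d hBd hBp ![T, S]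
  refine ⟨r, seriesToK p K P b, ?_⟩
  set Q' := MvPolynomial.aeval ![T, S] Q with hQ'
  -- The primitive was built from the logarithms of squares; the functional equation brings back the
  -- logarithms of `S` and `Q'` themselves.
  have hdouble : ∀ Y : overconvergentSeries p V P.m, 2 * seriesToK p K P (logSeries p Y) =
      seriesToK p K P (logSeries p (2 * Y - (p : overconvergentSeries p V P.m) * (Y * Y))) :=
    fun Y => by rw [two_mul Y, ← logSeries_add, map_add, two_mul]
  set q := seriesToK p K P
  set D := KaehlerDifferential.D K (DaggerK p K P)
  have key : (σ.calculus p K).N.mkQ ((q T * (1 - q T) * (1 - (p : DaggerK p K P) * q S)) • D (q b) -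
      (2 * (p : DaggerK p K P) ^ r * (1 - (p : DaggerK p K P) * q S) * ((1 - q T) * q (logSeries p S) - q (logSeries p Q'))) • D (q T) +
      (2 * (p : DaggerK p K P) ^ r * (q T * (1 - q T)) * (q (logSeries p Q') - q (logSeries p S))) • D (q S)) = 0 := by
    refine eq_of_forall_integralForms p K P σ fun k => ?_
    -- The additional `r'` makes up for the loss in `hB1`, so that `4 * k0` terms give precision `p
    -- ^ k` everywhere.
    obtain ⟨k0, hk0⟩ : ∃ k0, k0 = k + r' := ⟨_, rfl⟩
    obtain ⟨E1, hE1⟩ := (pow_dvd_pow (p : overconvergentSeries p V P.m) (by omega : k ≤ k0)).trans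
      (hb k0)
    have hlog := fun Y : overconvergentSeries p V P.m =>
      (pow_dvd_pow (p : overconvergentSeries p V P.m) (by omega : k ≤ 2 * k0)).trans
        (pow_dvd_logSeries_sub_logSum p Y (2 * k0))
    simp only [← mul_assoc, show 2 * 2 = 4 from rfl] at hlog
    obtain ⟨E2, hE2⟩ := hlog (2 * S - (p : overconvergentSeries p V P.m) * (S * S))
    obtain ⟨E3, hE3⟩ := hlog (2 * Q' - (p : overconvergentSeries p V P.m) * (Q' * Q'))
    obtain ⟨E4, hE4⟩ := aeval_pow_dvd p ((pow_dvd_pow (p : MvPolynomial (Fin 2) V)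
      (by omega : k ≤ 4 * k0 - (r' + 4 * k0 / 4))).trans (hB1 (4 * k0))) ![T, S]
    have hE5 := congrArg (MvPolynomial.aeval ![T, S]) (hB0 (4 * k0))
    rw [← map_sum] at hE1
    set F := ∑ n ∈ Finset.range (4 * k0), B n
    have hev : ∀ x : MvPolynomial (Fin 2) V, MvPolynomial.aeval ![T, S] (2 * x -
        (p : MvPolynomial (Fin 2) V) * (x * x)) = 2 * MvPolynomial.aeval ![T, S] x -
          (p : overconvergentSeries p V P.m) *
            (MvPolynomial.aeval ![T, S] x * MvPolynomial.aeval ![T, S] x) := fun x => by simp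
    have hevt : MvPolynomial.aeval ![T, S] t = T := by rw [ht, MvPolynomial.aeval_X]; rfl
    have hevs : MvPolynomial.aeval ![T, S] s = S := by rw [hs, MvPolynomial.aeval_X]; rfl
    simp only [map_mul, map_add, map_sub, map_pow, map_natCast, map_one, map_logSum, hevt, hevs,
      map_ofNat] at hE4 hE5
    rw [← hQ'] at hE4 hE5
    have q1 := congrArg q hE1
    have q2 := congrArg q hE2
    have q3 := congrArg q hE3
    have q4 := congrArg q hE4
    have q5 := congrArg q hE5
    simp only [map_sub q, map_mul q, map_add q, map_pow q, map_natCast q, map_one q] at q1 q2 q3 q4 q5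
    have hd1 := hdouble S
    have hd2 := hdouble Q'
    simp only [← mul_assoc] at q1 q2 q3 q4 q5 hd1 hd2
    have hDb : D (q b) = q (MvPolynomial.aeval ![T, S] (MvPolynomial.pderiv 0 F)) • D (q T) +
        q (MvPolynomial.aeval ![T, S] (MvPolynomial.pderiv 1 F)) • D (q S) + (p : DaggerK p K P) ^ k • D (q E1) := by
      have h1 : q b = q (MvPolynomial.aeval ![T, S] F) + (p : K) ^ k • q E1 := by
        rw [Algebra.smul_def, map_pow, map_natCast]
        linear_combination q1
      rw [h1, map_add, Derivation.map_smul, D_aeval, ← algebraMap_smul (DaggerK p K P) ((p : K) ^ k),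
        map_pow, map_natCast]
      rfl
    set u0 := q (MvPolynomial.aeval ![T, S] (MvPolynomial.pderiv 0 F))
    set u1 := q (MvPolynomial.aeval ![T, S] (MvPolynomial.pderiv 1 F))
    refine ⟨q ((1 - (p : overconvergentSeries p V P.m) * S) * (p : overconvergentSeries p V P.m) ^ r *
        (E3 - (1 - T) * E2)) • D (q T) +
      q (T * (1 - T) * (E4 + (p : overconvergentSeries p V P.m) ^ r * (E3 - E2))) • D (q S) +
      q (T * (1 - T) * (1 - (p : overconvergentSeries p V P.m) * S)) • D (q E1),
      add_mem (add_mem (smul_mem_integralForms p K P _ (D_mem_integralForms p K P _))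
        (smul_mem_integralForms p K P _ (D_mem_integralForms p K P _)))
        (smul_mem_integralForms p K P _ (D_mem_integralForms p K P _)), ?_⟩
    simp only [map_sub q, map_mul q, map_add q, map_pow q, map_natCast q, map_one q]
    rw [hDb]
    have c0 : q T * (1 - q T) * (1 - (p : DaggerK p K P) * q S) * u0 -
        2 * (p : DaggerK p K P) ^ r * (1 - (p : DaggerK p K P) * q S) * ((1 - q T) * q (logSeries p S) - q (logSeries p Q')) =
        (p : DaggerK p K P) ^ k * ((1 - (p : DaggerK p K P) * q S) * (p : DaggerK p K P) ^ r * (q E3 - (1 - q T) * q E2)) := by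
      linear_combination (1 - (p : DaggerK p K P) * q S) * q5 +
        (1 - (p : DaggerK p K P) * q S) * (p : DaggerK p K P) ^ r *
          (q3 - (1 - q T) * q2 + hd2 - (1 - q T) * hd1)
    have c1 : q T * (1 - q T) * (1 - (p : DaggerK p K P) * q S) * u1 +
        2 * (p : DaggerK p K P) ^ r * (q T * (1 - q T)) * (q (logSeries p Q') - q (logSeries p S)) =
        (p : DaggerK p K P) ^ k * (q T * (1 - q T) * (q E4 + (p : DaggerK p K P) ^ r * (q E3 - q E2))) := by
      linear_combination q T * (1 - q T) * q4 +
        q T * (1 - q T) * (p : DaggerK p K P) ^ r * (q3 - q2 + hd2 - hd1)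
    linear_combination (norm := module) c0 • D (q T) + c1 • D (q S)
  rw [map_add, map_sub, map_smul, map_smul, map_smul] at key
  change _ • (σ.calculus p K).d _ - _ • (σ.calculus p K).d _ + _ • (σ.calculus p K).d _ = 0 at key
  rw [sub_add, sub_eq_zero] at key
  exact key

end steinbergForm

/-! ### Additivity of the Frobenius logarithm, and orthogonality of `f` and `1 - f`. -/

section frobeniusLog

set_option linter.unusedSectionVars false

variable (p : ℕ) [hp : Fact p.Prime] {V : Type u} [CommRing V] [IsDomain V]
  [IsDiscreteValuationRing V] [IsAdicComplete (IsLocalRing.maximalIdeal V) V] [CharZero V]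
  [CharP (IsLocalRing.ResidueField V) p] (K : Type u) [Field K] [Algebra V K] [IsFractionRing V K]
  {A : Type u} [CommRing A] [Algebra V A] {P : AffinePresentation V A} {FV : V →+* V}
  (σ : FrobeniusLift p P FV)

variable (P) in
-- Frobenius quotients are chosen lifts to overconvergent series, and their relations hold only in
-- `A^†_K`. This makes the logarithm depend only on the image there.
theorem seriesToK_logSeries_congr {Y Z : overconvergentSeries p V P.m}
    (h : seriesToK p K P Y = seriesToK p K P Z) :
    seriesToK p K P (logSeries p Y) = seriesToK p K P (logSeries p Z) := by
  obtain ⟨B, hB⟩ := sub_dvd_logSeries_sub p Y Z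
  have := congrArg (seriesToK p K P) hB
  rwa [map_sub, map_mul, map_sub, h, sub_self, zero_mul, sub_eq_zero] at this

variable (P) in
theorem natCast_mul_cancel {x y : DaggerK p K P} (h : (p : DaggerK p K P) * x = p * y) : x = y := by
  have hp0 : (p : K) ≠ 0 := natCast_ne_zero_of_isFractionRing p V K
  have hq : algebraMap K (DaggerK p K P) ((p : K)⁻¹) * (p : DaggerK p K P) = 1 := by
    rw [← map_natCast (algebraMap K (DaggerK p K P)), ← map_mul, inv_mul_cancel₀ hp0, map_one]
  linear_combination (algebraMap K (DaggerK p K P) ((p : K)⁻¹)) * h + (y - x) * hq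

/-- The image of a function in `A^†_K`. -/
def fnToK : A →+* DaggerK p K P := (daggerToK p K P).comp (toDagger p P).toRingHom

theorem algebraMap_unitK' (f : Aˣ) : algebraMap (K ⊗[V] A) (DaggerK p K P)
    ((unitK K f : (K ⊗[V] A)ˣ) : K ⊗[V] A) = fnToK p K (f : A) := algebraMap_unitK p K f

theorem algebraMap_unitK_inv (f : Aˣ) : algebraMap (K ⊗[V] A) (DaggerK p K P)
    (((unitK K f)⁻¹ : (K ⊗[V] A)ˣ) : K ⊗[V] A) = fnToK p K ((f⁻¹ : Aˣ) : A) := by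
  rw [← algebraMap_unitK']
  rfl

theorem fnToK_mul_inv (f : Aˣ) :
    fnToK p K (P := P) (f : A) * fnToK p K ((f⁻¹ : Aˣ) : A) = 1 := by
  rw [← map_mul, Units.mul_inv, map_one]

theorem frobenius_mul_inv (f : Aˣ) : σ.σK p K (fnToK p K (f : A)) *
    σ.σK p K (fnToK p K ((f⁻¹ : Aˣ) : A)) = 1 := by
  rw [← map_mul, fnToK_mul_inv, map_one]

theorem frobeniusQuotient_spec' (f : Aˣ) : σ.σK p K (fnToK p K (f : A)) *
    (1 - (p : DaggerK p K P) * seriesToK p K P (frobeniusQuotient p σ f)) = fnToK p K (f : A) ^ p := by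
  have := congrArg (daggerToK p K P) (frobeniusQuotient_spec p σ f)
  rw [map_mul, map_sub, map_one, map_mul, map_natCast, map_pow, ← σ.σK_daggerToK p K] at this
  exact this

theorem frobeniusLog_eq (f : Aˣ) : frobeniusLog p K σ f =
    - seriesToK p K P (logSeries p (frobeniusQuotient p σ f)) := rfl

/-- The quotient `f ^ p / σ(f)` is multiplicative in `A^†_K`, and the functional equation turns this
into additivity. -/
theorem frobeniusLog_mul (f g : Aˣ) :
    frobeniusLog p K σ (f * g) = frobeniusLog p K σ f + frobeniusLog p K σ g := by
  have h : seriesToK p K P (frobeniusQuotient p σ (f * g)) =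
      seriesToK p K P (frobeniusQuotient p σ f + frobeniusQuotient p σ g -
        (p : overconvergentSeries p V P.m) *
          (frobeniusQuotient p σ f * frobeniusQuotient p σ g)) := by
    apply natCast_mul_cancel p K P
    have h1 := frobeniusQuotient_spec' p K σ f
    have h2 := frobeniusQuotient_spec' p K σ g
    have h3 := frobeniusQuotient_spec' p K σ (f * g)
    have h4 := frobenius_mul_inv p K σ f
    have h5 := frobenius_mul_inv p K σ g
    rw [Units.val_mul, map_mul, map_mul, mul_pow, ← h1, ← h2] at h3
    simp only [map_sub, map_add, map_mul, map_natCast]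
    set a := σ.σK p K (fnToK p K (f : A))
    set b := σ.σK p K (fnToK p K (g : A))
    set a' := σ.σK p K (fnToK p K ((f⁻¹ : Aˣ) : A))
    set b' := σ.σK p K (fnToK p K ((g⁻¹ : Aˣ) : A))
    have hab : a * b * (a' * b') = 1 := by linear_combination b * b' * h4 + h5
    have h6 := congrArg (· * (a' * b')) h3
    linear_combination (-1 : DaggerK p K P) * h6 +
      (-(p : DaggerK p K P) * seriesToK p K P (frobeniusQuotient p σ (f * g)) +
        (p : DaggerK p K P) * (seriesToK p K P (frobeniusQuotient p σ f) +
          seriesToK p K P (frobeniusQuotient p σ g) - (p : DaggerK p K P) *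
          (seriesToK p K P (frobeniusQuotient p σ f) *
            seriesToK p K P (frobeniusQuotient p σ g)))) * hab
  rw [frobeniusLog_eq, frobeniusLog_eq, frobeniusLog_eq, seriesToK_logSeries_congr p K P h,
    ← logSeries_add, map_add, neg_add]

/-- Twice this logarithm is the logarithm of 1, and 2 is invertible in `K`. -/
theorem frobeniusLog_neg_one : frobeniusLog p K σ (-1) = 0 := by
  have h1 : frobeniusLog p K σ 1 = 0 := by
    have := frobeniusLog_mul p K σ 1 1
    rwa [mul_one, left_eq_add] at this
  have h2 := frobeniusLog_mul p K σ (-1) (-1)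
  have : CharZero K := charZero_of_injective_algebraMap (IsFractionRing.injective V K)
  have hq : algebraMap K (DaggerK p K P) ((2 : K)⁻¹) * 2 = 1 := by
    rw [← map_ofNat (algebraMap K (DaggerK p K P)), ← map_mul, inv_mul_cancel₀ two_ne_zero, map_one]
  rw [neg_mul_neg, one_mul, h1] at h2
  linear_combination -(algebraMap K (DaggerK p K P) ((2 : K)⁻¹)) * h2 -
    frobeniusLog p K σ (-1) * hq

/-- The logarithmic datum of a unit. -/
def logDatum (f : Aˣ) : FilFMIC.LogDatum (K ⊗[V] A) (σ.calculus p K) p where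
  unit := unitK K f
  log := frobeniusLog p K σ f
  d_log := d_frobeniusLog p K σ f

theorem logDatum_mul (f g : Aˣ) : logDatum p K σ (f * g) = logDatum p K σ f * logDatum p K σ g :=
  FilFMIC.LogDatum.ext (map_mul _ f g) (frobeniusLog_mul p K σ f g)

theorem logDatum_orthogonal_self (f : Aˣ) :
    (logDatum p K σ f).Orthogonal (logDatum p K σ f) := by
  have : CharZero K := charZero_of_injective_algebraMap (IsFractionRing.injective V K)
  exact FilFMIC.LogDatum.orthogonal_of_eq two_ne_zero rfl rfl

/-- With `t = -f / g` one has `1 - t = 1 / g`, dlog g = dt / (1 - t) and dlog f = dt / (t (1 - t)).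
The prescribed form then becomes the universal form in `t` and `s`, and `θ` is its primitive. -/
theorem logDatum_orthogonal_one_sub (f g : Aˣ) (hfg : (g : A) = 1 - (f : A)) :
    (logDatum p K σ f).Orthogonal (logDatum p K σ g) := by
  have : CharZero K := charZero_of_injective_algebraMap (IsFractionRing.injective V K)
  constructor
  · intro X Y
    have h1 : ((unitK K g : (K ⊗[V] A)ˣ) : K ⊗[V] A) = 1 - ((unitK K f : (K ⊗[V] A)ˣ) : K ⊗[V] A) := by
      change (Algebra.TensorProduct.includeRight : A →ₐ[V] K ⊗[V] A) (g : A) =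
        1 - (Algebra.TensorProduct.includeRight : A →ₐ[V] K ⊗[V] A) (f : A)
      rw [hfg, map_sub, map_one]
    change X ((unitK K f : (K ⊗[V] A)ˣ) : K ⊗[V] A) * Y ((unitK K g : (K ⊗[V] A)ˣ) : K ⊗[V] A) =
      Y ((unitK K f : (K ⊗[V] A)ˣ) : K ⊗[V] A) * X ((unitK K g : (K ⊗[V] A)ˣ) : K ⊗[V] A)
    rw [h1, map_sub, map_sub, Derivation.map_one_eq_zero, Derivation.map_one_eq_zero]
    ring
  obtain ⟨T, hT⟩ := Dagger.mk_surjective p P (toDagger p P (-((f : A) * ((g⁻¹ : Aˣ) : A))))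
  obtain ⟨Q, hQ, hQ0, hQ1⟩ := exists_steinbergPoly p (MvPolynomial.X 0 : MvPolynomial (Fin 2) V)
    (MvPolynomial.X 1)
  set S := frobeniusQuotient p σ f with hS
  obtain ⟨r, B, hB⟩ := exists_steinbergForm p K P σ T S rfl rfl hQ hQ0 hQ1
  have hQT := congrArg (fun x => seriesToK p K P (MvPolynomial.aeval ![T, S] x)) hQ
  simp only [map_mul, map_sub, map_pow, map_neg, map_natCast, map_one, MvPolynomial.aeval_X] at hQT
  change 1 - (p : DaggerK p K P) * _ = (1 - seriesToK p K P T) ^ p *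
    (1 - (p : DaggerK p K P) * seriesToK p K P S) - (-seriesToK p K P T) ^ p at hQT
  set Q' := MvPolynomial.aeval ![T, S] Q with hQ'
  have hτ : seriesToK p K P T = -(fnToK p K (f : A) * fnToK p K ((g⁻¹ : Aˣ) : A)) := by
    rw [← map_mul, ← map_neg]
    exact congrArg (daggerToK p K P) hT
  have hdL := d_logSeries p K σ S
  change (1 - (p : DaggerK p K P) * seriesToK p K P S) •
    (σ.calculus p K).d (seriesToK p K P (logSeries p S)) =
      (σ.calculus p K).d (seriesToK p K P S) at hdL
  have hsf := frobeniusQuotient_spec' p K σ f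
  have hsg := frobeniusQuotient_spec' p K σ g
  have hsgi := frobenius_mul_inv p K σ g
  have hfi := fnToK_mul_inv p K (P := P) f
  have hgi := fnToK_mul_inv p K (P := P) g
  have hg : fnToK p K (P := P) (g : A) = 1 - fnToK p K (f : A) := by rw [hfg, map_sub, map_one]
  have hdf := d_frobeniusLog p K σ f
  rw [algebraMap_unitK', algebraMap_unitK_inv, frobeniusLog_eq] at hdf
  -- Here `1 - p Q'` is the Frobenius quotient of `f / g`; its product with the quotient of `g` is
  -- that of `f`. The identity rests on `σ(g) = 1 - σ(f)`.
  have hYg : seriesToK p K P (frobeniusQuotient p σ g + Q' - (p : overconvergentSeries p V P.m) *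
      (frobeniusQuotient p σ g * Q')) = seriesToK p K P S := by
    apply natCast_mul_cancel p K P
    simp only [map_sub, map_add, map_mul, map_natCast]
    have hσ : σ.σK p K (fnToK p K (g : A)) = 1 - σ.σK p K (fnToK p K (f : A)) := by
      rw [hg, map_sub, map_one]
    set a := fnToK p K (P := P) (f : A)
    set b := fnToK p K (P := P) (g : A)
    set b' := fnToK p K (P := P) ((g⁻¹ : Aˣ) : A)
    have hpow : b ^ p * b' ^ p = 1 := by rw [← mul_pow, hgi, one_pow]
    have h1 : 1 - seriesToK p K P T = b' := by
      rw [hτ]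
      linear_combination b' * hg - hgi
    rw [h1, hτ, neg_neg, mul_pow] at hQT
    have h2 : σ.σK p K b * ((1 - (p : DaggerK p K P) * seriesToK p K P (frobeniusQuotient p σ g)) *
        (1 - (p : DaggerK p K P) * seriesToK p K P Q')) =
        σ.σK p K b * (1 - (p : DaggerK p K P) * seriesToK p K P S) := by
      linear_combination (1 - (p : DaggerK p K P) * seriesToK p K P Q') * hsg + b ^ p * hQT +
        ((1 - (p : DaggerK p K P) * seriesToK p K P S) - a ^ p) * hpow + hsf -
        (1 - (p : DaggerK p K P) * seriesToK p K P S) * hσ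
    have h3 := congrArg (fun x => σ.σK p K b' * x) h2
    have h4 : ∀ x, σ.σK p K b' * (σ.σK p K b * x) = x := fun x => by
      linear_combination x * hsgi
    simp only [h4] at h3
    linear_combination -h3
  have hlg : frobeniusLog p K σ g = seriesToK p K P (logSeries p Q') -
      seriesToK p K P (logSeries p S) := by
    have := seriesToK_logSeries_congr p K P hYg
    rw [← logSeries_add, map_add] at this
    rw [frobeniusLog_eq]
    linear_combination -this
  set C := σ.calculus p K
  refine ⟨algebraMap K (DaggerK p K P) ((2 * (p : K) ^ r)⁻¹) * B, ?_⟩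
  change C.d (algebraMap K (DaggerK p K P) ((2 * (p : K) ^ r)⁻¹) * B) =
    frobeniusLog p K σ f • algebraMap (K ⊗[V] A) (DaggerK p K P)
      (((unitK K g)⁻¹ : (K ⊗[V] A)ˣ) : K ⊗[V] A) • C.d (algebraMap (K ⊗[V] A) (DaggerK p K P)
        ((unitK K g : (K ⊗[V] A)ˣ) : K ⊗[V] A)) -
    (algebraMap K (DaggerK p K P) ((p : K)⁻¹) * frobeniusLog p K σ g) •
      C.σ (algebraMap (K ⊗[V] A) (DaggerK p K P) (((unitK K f)⁻¹ : (K ⊗[V] A)ˣ) : K ⊗[V] A)) •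
        C.d (C.σ (algebraMap (K ⊗[V] A) (DaggerK p K P) ((unitK K f : (K ⊗[V] A)ˣ) : K ⊗[V] A)))
  rw [algebraMap_unitK', algebraMap_unitK_inv, algebraMap_unitK', algebraMap_unitK_inv, hlg,
    frobeniusLog_eq, ← hS]
  set a := fnToK p K (P := P) (f : A)
  set b := fnToK p K (P := P) (g : A)
  set a' := fnToK p K (P := P) ((f⁻¹ : Aˣ) : A)
  set b' := fnToK p K (P := P) ((g⁻¹ : Aˣ) : A)
  set τ := seriesToK p K P T
  set w := 1 - (p : DaggerK p K P) * seriesToK p K P S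
  set LS := seriesToK p K P (logSeries p S)
  set LQ := seriesToK p K P (logSeries p Q')
  have hdg : C.d b = - C.d a := by
    rw [hg]
    simp [FrobeniusCalculus.d]
  have h1 : 1 - τ = b' := by
    rw [hτ]
    linear_combination b' * hg - hgi
  have hdτ : C.d τ = (-(b' * b')) • C.d a := by
    have h2 : C.d b' = (b' * b') • C.d a := by
      have h3 := congrArg (fun x => b' • C.d x) hgi
      simp only [C.d_mul, C.d_one, smul_zero, hdg, smul_add, smul_smul, smul_neg] at h3
      rw [mul_comm b' b, hgi, one_smul, add_neg_eq_zero] at h3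
      exact h3
    have h4 : C.d τ + C.d (a * b') = 0 := by
      rw [← C.d_add, hτ, neg_add_cancel, C.d_zero]
    rw [eq_neg_of_add_eq_zero_left h4, C.d_mul, h2, smul_smul, ← add_smul, ← neg_smul]
    congr 1
    linear_combination b' * hgi - b' * b' * hg
  have hdneg : C.d (-LS) = - C.d LS := by simp [FrobeniusCalculus.d]
  rw [hdneg] at hdf
  -- The term with σ(f) is eliminated: p⁻¹ dlog σ(f) is dlog f minus the differential of log^(σ)(f),
  -- and log^(σ)(f) is `-LS`.
  have hdσ : algebraMap K (DaggerK p K P) ((p : K)⁻¹) • C.σ a' • C.d (C.σ a) =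
      a' • C.d a + C.d LS := by
    rw [← sub_eq_iff_eq_add', ← neg_inj, neg_sub, hdf]
  set c := algebraMap K (DaggerK p K P) ((2 * (p : K) ^ r)⁻¹) with hc
  have hc1 : c * (2 * (p : DaggerK p K P) ^ r) = 1 := by
    have hp0 : (2 * (p : K) ^ r) ≠ 0 := mul_ne_zero two_ne_zero
      (pow_ne_zero r (natCast_ne_zero_of_isFractionRing p V K))
    have : algebraMap K (DaggerK p K P) (2 * (p : K) ^ r) = 2 * (p : DaggerK p K P) ^ r := by
      rw [map_mul, map_ofNat, map_pow, map_natCast]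
    rw [hc, ← this, ← map_mul, inv_mul_cancel₀ hp0, map_one]
  have hw : w * (σ.σK p K a * a' ^ p) = 1 := by
    have : a ^ p * a' ^ p = 1 := by rw [← mul_pow, hfi, one_pow]
    linear_combination a' ^ p * hsf + this
  have hab : a' * b' = a' + b' := by
    linear_combination (-(a' * b')) * hg + a' * hgi + b' * hfi
  have hdc : C.d (c * B) = c • C.d B := by
    rw [C.d_mul, C.d_algebraMap, smul_zero, add_zero]
  rw [hdτ, ← hdL, h1, hτ] at hB
  -- The multiplier undoes the cleared denominators: `-(b * a') * b` is the inverse of `t (1 - t) =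
  -- -f / g²`, `σ(f) f ^ (-p)` is the inverse of `w`, and `c` is that of `2 p ^ r`.
  have hB' := congrArg (fun x => (c * (-(b * a')) * b * (σ.σK p K a * a' ^ p)) • x) hB
  simp only [smul_sub, smul_smul] at hB'
  have k0 : c * (-(b * a')) * b * (σ.σK p K a * a' ^ p) * (-(a * b') * b' * w) = c := by
    linear_combination (c * (b * a') * b * (a * b') * b') * hw + c * (a * a') * (b * b') * hgi +
      c * (a * a') * hgi + c * hfi
  have k1 : c * (-(b * a')) * b * (σ.σK p K a * a' ^ p) *
      (2 * (p : DaggerK p K P) ^ r * w * (b' * LS - LQ) * (-(b' * b'))) =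
      (b' * LS) - (LQ - LS) * a' := by
    linear_combination (c * (b * a') * b * (2 * (p : DaggerK p K P) ^ r) * (b' * LS - LQ) *
        (b' * b')) * hw + ((b * a') * b * (b' * LS - LQ) * (b' * b')) * hc1 +
      (a' * (b' * LS - LQ)) * (b * b' + 1) * hgi + LS * hab
  have k2 : c * (-(b * a')) * b * (σ.σK p K a * a' ^ p) *
      (2 * (p : DaggerK p K P) ^ r * (-(a * b') * b') * (LQ - LS) * w) = LQ - LS := by
    linear_combination (c * (b * a') * b * (a * b') * b' * (2 * (p : DaggerK p K P) ^ r) *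
        (LQ - LS)) * hw + ((b * a') * b * (a * b') * b' * (LQ - LS)) * hc1 +
      (LQ - LS) * ((a * a') * (b * b' + 1) * hgi + hfi)
  rw [k0, k1, k2] at hB'
  rw [hdc, hB', mul_comm (algebraMap K (DaggerK p K P) _), mul_smul, hdσ, hdg]
  module

end frobeniusLog

/-! ### Alternating multilinear maps and Milnor symbols -/

section alternating

variable {M G : Type*} [AddCommGroup M] [AddCommGroup G] {n : ℕ}
  (μ : MultilinearMap ℤ (fun _ : Fin (n + 1) => M) G)

/-- A multilinear map which vanishes if two adjacent arguments agree changes its sign if two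
adjacent arguments are exchanged. -/
theorem map_swap_of_adjacent
    (h : ∀ (v : Fin (n + 1) → M) (i : Fin n), v i.castSucc = v i.succ → μ v = 0)
    (v : Fin (n + 1) → M) (i : Fin n) :
    μ (v ∘ Equiv.swap i.castSucc i.succ) = - μ v := by
  have hne : i.castSucc ≠ i.succ := (Fin.castSucc_lt_succ).ne
  have key : ∀ x y : M, μ (Function.update (Function.update v i.castSucc x) i.succ y) +
      μ (Function.update (Function.update v i.castSucc y) i.succ x) = 0 := fun x y => by
    have h0 : ∀ z : M, μ (Function.update (Function.update v i.castSucc z) i.succ z) = 0 :=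
      fun z => h _ i (by rw [Function.update_self, Function.update_of_ne hne, Function.update_self])
    have h1 := h0 (x + y)
    rw [MultilinearMap.map_update_add, Function.update_comm hne, MultilinearMap.map_update_add,
      Function.update_comm hne, MultilinearMap.map_update_add,
      Function.update_comm hne.symm, h0, Function.update_comm hne.symm, zero_add,
      Function.update_comm hne.symm, Function.update_comm hne.symm, h0, add_zero] at h1
    rw [add_comm]
    exact h1
  have h2 := key (v i.castSucc) (v i.succ)
  rw [Function.update_eq_self, Function.update_eq_self] at h2
  rw [eq_neg_iff_add_eq_zero, add_comm]
  convert h2 using 3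
  funext k
  rcases eq_or_ne k i.succ with rfl | hk
  · simp
  rcases eq_or_ne k i.castSucc with rfl | hk'
  · simp [hne]
  · simp [hk, hk', Equiv.swap_apply_of_ne_of_ne]

/-- Vanishing for adjacent related arguments implies vanishing for related arguments. -/
theorem map_eq_zero_of_adjacent
    (h : ∀ (v : Fin (n + 1) → M) (i : Fin n), v i.castSucc = v i.succ → μ v = 0)
    {r : M → M → Prop}
    (hr : ∀ (v : Fin (n + 1) → M) (i : Fin n), r (v i.castSucc) (v i.succ) → μ v = 0) :
    ∀ (e : ℕ) (v : Fin (n + 1) → M) (i j : Fin (n + 1)), (j : ℕ) = i + e + 1 → r (v i) (v j) →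
      μ v = 0 := by
  intro e
  induction e with
  | zero =>
    intro v i j hij hv
    have hi : (i : ℕ) < n := by omega
    have e1 : i = (⟨i, hi⟩ : Fin n).castSucc := rfl
    have e2 : j = (⟨i, hi⟩ : Fin n).succ := Fin.ext (by simpa using hij)
    rw [e1, e2] at hv
    exact hr v _ hv
  | succ e ih =>
    intro v i j hij hv
    have hj : (i : ℕ) + e + 1 < n := by omega
    let k : Fin n := ⟨i + e + 1, hj⟩
    have e2 : j = k.succ := Fin.ext (by simp [k]; omega)
    -- Exchanging the argument at `j` with its predecessor brings it one place closer to `i` and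
    -- only changes the sign.
    rw [← neg_eq_zero, ← map_swap_of_adjacent μ h v k]
    refine ih _ i k.castSucc rfl ?_
    have h1 : i ≠ k.castSucc := fun hh => by
      have := congrArg Fin.val hh
      simp [k] at this
      omega
    have h2 : i ≠ k.succ := fun hh => by
      have := congrArg Fin.val hh
      simp [k] at this
      omega
    rw [Function.comp_apply, Function.comp_apply, Equiv.swap_apply_of_ne_of_ne h1 h2,
      Equiv.swap_apply_left, ← e2]
    exact hv

/-- A map which is additive in each argument, as a multilinear map over the integers. -/
def multilinearMapOfUpdateAdd {n : ℕ} (F : (Fin n → M) → G)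
    (hF : ∀ v i x y, F (Function.update v i (x + y)) =
      F (Function.update v i x) + F (Function.update v i y)) :
    MultilinearMap ℤ (fun _ : Fin n => M) G where
  toFun := F
  map_update_add' := fun {dec} v i x y => by
    obtain rfl : dec = instDecidableEqFin n := Subsingleton.elim _ _
    exact hF v i x y
  map_update_smul' := fun {dec} v i c x => by
    obtain rfl : dec = instDecidableEqFin n := Subsingleton.elim _ _
    exact map_zsmul (AddMonoidHom.mk' (fun x => F (Function.update v i x)) (hF v i)) c x

end alternating

/-! ### Factorization through Milnor K-theory. -/

section lift

variable {R G : Type*} [CommRing R] [AddCommGroup G] {n : ℕ} (F : (Fin (n + 1) → Rˣ) → G)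
  (hF : ∀ v i x y, F (Function.update v i (x * y)) =
    F (Function.update v i x) + F (Function.update v i y))
  {r : Rˣ → Rˣ → Prop} (h1 : ∀ x, r x x)
  (h2 : ∀ x y : Rˣ, (y : R) = -(x : R) ∨ (y : R) = 1 - (x : R) → r x y)
  (h3 : ∀ (v : Fin (n + 1) → Rˣ) (i : Fin n), r (v i.castSucc) (v i.succ) → F v = 0)

/-- A map which is multiplicative in each argument and vanishes if two adjacent arguments are
related factors through Milnor `K`-theory if the relation contains the equality and the
relations of Milnor `K`-theory. -/
def MilnorK.lift : MilnorK R (n + 1) →+ G :=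
  ((Submodule.span ℤ (milnorRelations R (n + 1))).liftQ
    (PiTensorProduct.lift (multilinearMapOfUpdateAdd
      (fun v : Fin (n + 1) → Additive Rˣ => F fun k => (v k).toMul) hF)) (by
      rw [Submodule.span_le]
      rintro _ ⟨a, ⟨i, j, hij, h⟩, rfl⟩
      rw [SetLike.mem_coe, LinearMap.mem_ker, PiTensorProduct.lift.tprod]
      refine map_eq_zero_of_adjacent _ (fun v i hv => h3 _ i ?_)
        (r := fun x y => r x.toMul y.toMul) (fun v i hv => h3 _ i hv) (j - i - 1) _ i j ?_
        (h2 _ _ h)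
      · rw [hv]
        exact h1 _
      · have : (i : ℕ) < j := hij
        omega)).toAddMonoidHom

theorem MilnorK.lift_symbol (h : Fin (n + 1) → Rˣ) :
    MilnorK.lift F hF h1 h2 h3 (MilnorK.symbol h) = F h :=
  PiTensorProduct.lift.tprod (φ := multilinearMapOfUpdateAdd
    (fun v : Fin (n + 1) → Additive Rˣ => F fun k => (v k).toMul) hF)
    (fun k => Additive.ofMul (h k))

end lift

/-! ### Cup products of classes of units, and the homomorphism on symbols. -/

section symbols

set_option linter.unusedSectionVars false

variable (p : ℕ) [hp : Fact p.Prime] {V : Type u} [CommRing V] [IsDomain V]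
  [IsDiscreteValuationRing V] [IsAdicComplete (IsLocalRing.maximalIdeal V) V] [CharZero V]
  [CharP (IsLocalRing.ResidueField V) p] (K : Type u) [Field K] [Algebra V K] [IsFractionRing V K]
  {A : Type u} [CommRing A] [Algebra V A] {P : AffinePresentation V A} {FV : V →+* V}
  (σ : FrobeniusLift p P FV)

/-- The units `f` and `-f` have the same logarithmic differential and, because log^(σ)(-1) = 0, the
same logarithm. So the primitive for the pair `(f, f)` serves for `(f, -f)`. -/
theorem logDatum_orthogonal_neg (f g : Aˣ) (hfg : (g : A) = -(f : A)) :
    (logDatum p K σ f).Orthogonal (logDatum p K σ g) := by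
  obtain rfl : g = -1 * f := Units.ext (by rw [hfg]; simp)
  obtain ⟨h1, θ, hθ⟩ := logDatum_orthogonal_self p K σ f
  have hl : frobeniusLog p K σ (-1 * f) = frobeniusLog p K σ f := by
    rw [frobeniusLog_mul, frobeniusLog_neg_one, zero_add]
  have hu : unitK K (-1 * f) = - unitK (V := V) K f := Units.ext (by
    change (Algebra.TensorProduct.includeRight : A →ₐ[V] K ⊗[V] A) ((-1 * f : Aˣ) : A) =
      -(Algebra.TensorProduct.includeRight : A →ₐ[V] K ⊗[V] A) (f : A)
    rw [hfg, map_neg])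
  refine ⟨fun X Y => ?_, θ, ?_⟩
  · have := h1 X Y
    change X ((unitK K f : (K ⊗[V] A)ˣ) : K ⊗[V] A) * Y ((unitK K (-1 * f) : (K ⊗[V] A)ˣ) : K ⊗[V] A) =
      Y ((unitK K f : (K ⊗[V] A)ˣ) : K ⊗[V] A) * X ((unitK K (-1 * f) : (K ⊗[V] A)ˣ) : K ⊗[V] A)
    rw [hu, Units.val_neg, map_neg, map_neg, mul_neg, mul_neg]
    exact congrArg _ this
  · have hneg : ∀ x, (σ.calculus p K).d (-x) = - (σ.calculus p K).d x := fun x => by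
      simp [FrobeniusCalculus.d]
    refine hθ.trans ?_
    change frobeniusLog p K σ f • algebraMap (K ⊗[V] A) (DaggerK p K P)
        (((unitK K f)⁻¹ : (K ⊗[V] A)ˣ) : K ⊗[V] A) • (σ.calculus p K).d
          (algebraMap (K ⊗[V] A) (DaggerK p K P) ((unitK K f : (K ⊗[V] A)ˣ) : K ⊗[V] A)) -
      (algebraMap K (DaggerK p K P) ((p : K)⁻¹) * frobeniusLog p K σ f) • _ =
      frobeniusLog p K σ f • algebraMap (K ⊗[V] A) (DaggerK p K P)
        (((unitK K (-1 * f))⁻¹ : (K ⊗[V] A)ˣ) : K ⊗[V] A) • (σ.calculus p K).d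
          (algebraMap (K ⊗[V] A) (DaggerK p K P) ((unitK K (-1 * f) : (K ⊗[V] A)ˣ) : K ⊗[V] A)) -
      (algebraMap K (DaggerK p K P) ((p : K)⁻¹) * frobeniusLog p K σ (-1 * f)) • _
    rw [hl, hu, inv_neg, Units.val_neg, Units.val_neg, map_neg, map_neg, hneg, neg_smul_neg]

theorem equiv_cup {n : ℕ} (h : Fin (n + 1) → Aˣ) : FilFMIC.Ext.equiv _ _ n (cup p K σ h) =
    FilFMIC.cupClass (natCast_ne_zero_of_isFractionRing p V K) n 0 0 (n + 1) (by omega) rfl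
      (fun i => logDatum p K σ (h i)) :=
  FilFMIC.equiv_cupExtension (natCast_ne_zero_of_isFractionRing p V K) n
    (fun i => logDatum p K σ (h i))

theorem cup_update_mul {n : ℕ} (h : Fin (n + 1) → Aˣ) (i : Fin (n + 1)) (x y : Aˣ) :
    cup p K σ (Function.update h i (x * y)) =
      cup p K σ (Function.update h i x) + cup p K σ (Function.update h i y) := by
  apply (FilFMIC.Ext.equiv _ _ n).injective
  rw [FilFMIC.Ext.equiv_add, equiv_cup, equiv_cup, equiv_cup]
  have e : ∀ z, (fun j => logDatum p K σ (Function.update h i z j)) =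
      Function.update (fun j => logDatum p K σ (h j)) i (logDatum p K σ z) := fun z =>
    Function.comp_update (logDatum p K σ) h i z
  rw [e, e, e, logDatum_mul, FilFMIC.cupClass_update_mul]

theorem cup_eq_zero {n : ℕ} (h : Fin (n + 1) → Aˣ) (i : Fin n)
    (ho : (logDatum p K σ (h i.castSucc)).Orthogonal (logDatum p K σ (h i.succ))) :
    cup p K σ h = 0 := by
  apply (FilFMIC.Ext.equiv _ _ n).injective
  rw [FilFMIC.Ext.equiv_zero, equiv_cup]
  obtain ⟨n, rfl⟩ : ∃ m, n = m + 1 := ⟨n - 1, by have := i.2; omega⟩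
  exact FilFMIC.cupClass_eq_zero _ n 0 0 _ _ rfl _ i ho

/-- The homomorphism from Milnor `K`-theory to extension groups. -/
def milnorHom (n : ℕ) : MilnorK A (n + 1) →+
    FilFMIC.Ext (tateObject p K σ 0) (tateObject p K σ ((n : ℤ) + 1)) n :=
  MilnorK.lift (cup p K σ) (cup_update_mul p K σ)
    -- Orthogonality contains equality of units; this gives the alternating property which moves
    -- distant arguments of a Milnor relation next to each other.
    (r := fun x y => (logDatum p K σ x).Orthogonal (logDatum p K σ y))
    (logDatum_orthogonal_self p K σ) (fun x y h => h.elim (logDatum_orthogonal_neg p K σ x y)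
      (logDatum_orthogonal_one_sub p K σ x y)) (cup_eq_zero p K σ)

theorem milnorHom_symbol (n : ℕ) (h : Fin (n + 1) → Aˣ) :
    milnorHom p K σ n (MilnorK.symbol h) = cup p K σ h :=
  MilnorK.lift_symbol _ _ _ _ _ h

end symbols

end FilteredFIsocrystal

end

open FilteredFIsocrystal

theorem proposition2p7 (p : ℕ) [Fact p.Prime]
    (V : Type u) [CommRing V] [IsDomain V] [IsDiscreteValuationRing V]
    [IsAdicComplete (IsLocalRing.maximalIdeal V) V] [CharZero V]
    [CharP (IsLocalRing.ResidueField V) p] [PerfectField (IsLocalRing.ResidueField V)]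
    (K : Type u) [Field K] [Algebra V K] [IsFractionRing V K]
    (FV : V →+* V) (hFV : ∀ x, (p : V) ∣ FV x - x ^ p)
    (A : Type u) [CommRing A] [Algebra V A] [Algebra.Smooth V A]
    (P : AffinePresentation V A) (σ : FrobeniusLift p P FV) :
    ∃ _ : ∀ n : ℕ, AddCommGroup
        (FilFMIC.Ext (tateObject p K σ 0) (tateObject p K σ ((n : ℤ) + 1)) n),
      (∀ (n : ℕ)
        (x y z : FilFMIC.Ext (tateObject p K σ 0) (tateObject p K σ ((n : ℤ) + 1)) n),
          FilFMIC.Ext.IsBaerSum x y z ↔ x + y = z) ∧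
      FilFMIC.Ext.mk (FilFMIC.trivialExtension (tateObject p K σ 0)
          (tateObject p K σ (((1 : ℕ) : ℤ) + 1))) = 0 ∧
      (∀ f : Aˣ, cup p K σ ![f, f] = 0) ∧
      (∀ f g : Aˣ, (g : A) = 1 - (f : A) → cup p K σ ![f, g] = 0) ∧
      ∀ n : ℕ, ∃ φ : MilnorK A (n + 1) →+
          FilFMIC.Ext (tateObject p K σ 0) (tateObject p K σ ((n : ℤ) + 1)) n,
        ∀ h : Fin (n + 1) → Aˣ, φ (MilnorK.symbol h) = cup p K σ h :=
  ⟨fun _ => inferInstance, fun _ => FilFMIC.Ext.isBaerSum_iff, FilFMIC.Ext.mk_trivialExtension,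
    fun f => cup_eq_zero p K σ ![f, f] 0 (logDatum_orthogonal_self p K σ f),
    fun f g hfg => cup_eq_zero p K σ ![f, g] 0 (logDatum_orthogonal_one_sub p K σ f g hfg),
    fun n => ⟨milnorHom p K σ n, milnorHom_symbol p K σ n⟩⟩
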